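/- **The game.** Let $n\ge 6$ be even. Consider the linear binary constraint system over $\{\pm1\}$ with variables $a_v$ ($v\in\{1,\dots,n\}$), $x_e,y_e,z_e$ for each edge $e=\{u,v\}$ of the complete graph on $\{1,\dots,n\}$, $b_{uv|st}=b_{st|uv}$ for each unordered pair and $c_{uv|st}$ for each ordered pair of disjoint edges, and auxiliary variables $h_2,\dots,h_{n-2}$; its constraints are, for all distinct $u,v,s,t$, $$a_ua_vy_{uv}=1,\quad x_{uv}y_{uv}z_{uv}=1,\quad x_{uv}x_{st}b_{uv|st}=1,\quad x_{uv}z_{st}c_{uv|st}=1,$$ $$b_{uv|st}b_{vs|ut}b_{su|vt}=1,\quad c_{uv|st}c_{vs|ut}c_{su|vt}=1,$$ and the chain $a_1a_2h_2=1$, $h_{i-1}a_ih_i=1$ ($3\le i\le n-2$), $h_{n-2}a_{n-1}a_n=-1$, which is equivalent to $\prod_va_v=-1$. Let $\mathcal Q^A$ be the set of constraints (each one counted once), $\mathcal Q^B$ the set of variables, and $\mathcal Q$ the set of pairs $(\alpha,\beta)$ with $\alpha\in\mathcal Q^A$ and $\beta$ one of the three variables of $\alpha$, so $|\mathcal Q|=3|\mathcal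 Q^A|$. In the associated nonlocal game, Alice receives $\alpha$ and answers values for its three variables, Bob receives $\beta$ and answers a value; they win if Alice's values satisfy $\alpha$ and her value for $\beta$ equals Bob's. Let $p_{\mathrm{Clif}}$ be the supremum of the winning probabilities, for uniformly random $(\alpha,\beta)\in\mathcal Q$, of Clifford strategies: (with shared randomness) the players share a stabilizer state of finitely many qubits, Alice measures three commuting Pauli-string observables on her qubits, one for each variable of $\alpha$, and Bob measures one Pauli-string observable on his qubits. **The relation problem $R^n_N$** (with a parameter $w$, $N\ge2$ sites for Alice and $N$ for Bob). An instance is $(j,k,\alpha,\beta)$ with $1\le j<k\le N$ and $(\alpha,\beta)\in\mathcal Q$. In round 1, Alice's site $j$ and Bob's site $k$ receive $\top$ and all other sites receive $\bot$; each site returns $w$ signs, $r^{(1)A}_i(l)$ and $r^{(1)B}_i(l)$, $1\le l\le w$, without any requirement. In round 2, Alice's site $j$ receives $\alpha$ and $p^A(l)=\prod_{i=j+1}^{k}r^{(1)A}_i(l)$, $p^B(l)=\prod_{i=j}^{k-1}r^{(1)B}_i(l)$; Bob's site $k$ receives $\beta$; every other site of Alice receives $\bot$ and trivial signs, and every other site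 of Bob receives $\bot$. Each site returns three signs; the answer is correct if the three signs of Alice's site $j$ and the first sign of Bob's site $k$ win the game for $(\alpha,\beta)$. Elements of $\mathcal Q^A\cup\{\bot\}$ and $\mathcal Q^B\cup\{\bot\}$ are given as bit strings of lengths $\ell_A$, $\ell_B$ by fixed injective encodings. **Circuits.** A device consists of finitely many bits (input, output and ancilla bits) and qubits initialized to $|0\rangle$, and of one circuit for each round, fixed in advance; bits and qubits are kept between the rounds. Each layer of a circuit consists of gates on disjoint sets of wires; depth is the number of layers, and fan-in is the number of bits plus qubits of a gate. A gate is any composition, on its own wires, of classical functions, classically controlled unitaries and computational-basis measurements. A circuit is magic-free (Clifford) if, within each round, all bits that do not depend on measurement outcomes of that round are processed arbitrarily and may control arbitrary Clifford gates, while measurement outcomes are processed only by parity and negation (with coefficients that may depend on the former bits) and control only Pauli operators. A probabilistic device is a finite probability distribution on devices. **Theorem.** Let $n\ge6$ be even. Then $$p_{\mathrm{Clif}}\le 1-\frac1{2|\mathcal Q|}=1-\frac{1}{6|\mathcal Q^A|}<1,$$ and there is $w$ (with $w=3$ if $n=8$) such that for all encodings as above the problem $R_N^n$ has the following properties. 1.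 There is $K_{\mathrm{th}}$ independent of $N$, with $K_{\mathrm{th}}\le14$ if $n=8$ and $\ell_A,\ell_B\le11$, such that for every $K\ge K_{\mathrm{th}}$ there are $D,s$ such that for every $N\ge2$ some device with gates of fan-in at most $K$, with both circuits of depth at most $D$, and using some non-Clifford gate, answers every instance correctly with probability $1$; moreover its wires can be placed on a line of $2N$ positions (Alice's site $i$ at position $2i-1$, Bob's at $2i$, together with their inputs and outputs), at most $s$ wires on each, such that every gate acts within two neighbouring positions. 2. For all $K\ge1$, $D\ge0$, $N\ge2$, every probabilistic magic-free device with gates of fan-in at most $K$ and second-round depth at most $D$ answers a uniformly random instance correctly with probability at most $$p_{\mathrm{Clif}}+\frac{48K^D}{N}.$$ 3. For every $K\ge1$ there are $c>0$ and $N_0$ such that for all $N\ge N_0$, every probabilistic magic-free device with gates of fan-in at most $K$ and success probability larger than $(1+p_{\mathrm{Clif}})/2$ for a uniformly random instance has (in some device of the mixture) second-round depth at least $c\log N$. 4. The logarithm is optimal: for every $K\ge K_{\mathrm{th}}$ there is $c$ such that for every $N\ge2$ a magic-free device with gates of fan-in at most $K$ and both circuits of depth at most $c\log N$ answers every instance correctly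 with probability $1$. -/

import Mathlib

open scoped BigOperators Matrix

namespace MagicBCS

noncomputable section

/-- Classical bits.  The bit `b` also stands for the sign `(-1)^b`, so that `0` is `+1`, `1` is `-1`,
and a product of signs is a sum of bits. -/
abbrev Bit : Type := ZMod 2

/-! ### The binary constraint system and its nonlocal game -/

/-- The symbols of the constraint system on `n` vertices: `a v` for a vertex, `h k` for the auxiliary
variable that stands for `a 0 * a 1 * ... * a k`, `x e`, `y e`, `z e` for an edge,
`b {e, f}` for an unordered and `c e f` for an ordered pair of edges.
Only the symbols that occur in a constraint are variables of the system, see `Variable`. -/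
inductive Symbol (n : ℕ) : Type
  | a (v : Fin n)
  | h (k : Fin n)
  | x (e : Sym2 (Fin n))
  | y (e : Sym2 (Fin n))
  | z (e : Sym2 (Fin n))
  | b (p : Sym2 (Sym2 (Fin n)))
  | c (e f : Sym2 (Fin n))
  deriving DecidableEq

/-- Names of constraints; the valid ones, each listed once, form `Constraint`. -/
inductive RawCon (n : ℕ) : Type
  | aay (u v : Fin n)
  | xyz (u v : Fin n)
  | xxb (u v s t : Fin n)
  | xzc (u v s t : Fin n)
  | bbb (u v s t : Fin n)
  | ccc (u v s t : Fin n)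
  | chain (i : Fin n)
  deriving DecidableEq, Fintype

/-- Order conventions that select every constraint exactly once: edges are `u < v`; `xxb` is indexed by
an unordered pair of disjoint edges, `xzc` by an ordered one, `bbb` by a set of four vertices, `ccc` by
a set `{u, v, s}` of three vertices and a further vertex `t`; the chain has `n - 2` members. -/
def RawCon.Valid {n : ℕ} : RawCon n → Prop
  | .aay u v => u < v
  | .xyz u v => u < v
  | .xxb u v s t => u < v ∧ s < t ∧ u < s ∧ v ≠ s ∧ v ≠ t
  | .xzc u v s t => u < v ∧ s < t ∧ u ≠ s ∧ u ≠ t ∧ v ≠ s ∧ v ≠ t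
  | .bbb u v s t => u < v ∧ v < s ∧ s < t
  | .ccc u v s t => u < v ∧ v < s ∧ t ≠ u ∧ t ≠ v ∧ t ≠ s
  | .chain i => 1 ≤ i.1 ∧ i.1 + 2 ≤ n

instance {n : ℕ} : DecidablePred (RawCon.Valid (n := n)) := fun r => by
  cases r <;> unfold RawCon.Valid <;> infer_instance

/-- The three variables of a constraint.  The chain replaces the constraint that the product of all
`a v` is `-1`: it reads `a₀ a₁ h₁ = 1`, `h₁ a₂ h₂ = 1`, ..., `hₙ₋₃ aₙ₋₂ aₙ₋₁ = -1`. -/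
def RawCon.var {n : ℕ} : RawCon n → Fin 3 → Symbol n
  | .aay u v => ![.a u, .a v, .y s(u, v)]
  | .xyz u v => ![.x s(u, v), .y s(u, v), .z s(u, v)]
  | .xxb u v s t => ![.x s(u, v), .x s(s, t), .b s(s(u, v), s(s, t))]
  | .xzc u v s t => ![.x s(u, v), .z s(s, t), .c s(u, v) s(s, t)]
  | .bbb u v s t =>
      ![.b s(s(u, v), s(s, t)), .b s(s(v, s), s(u, t)), .b s(s(s, u), s(v, t))]
  | .ccc u v s t => ![.c s(u, v) s(s, t), .c s(v, s) s(u, t), .c s(s, u) s(v, t)]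
  | .chain i =>
      ![if i.1 = 1 then .a ⟨0, i.pos⟩ else .h ⟨i.1 - 1, by omega⟩,
        .a i,
        if i.1 + 2 = n then .a ⟨n - 1, by have := i.2; omega⟩ else .h i]

/-- The right-hand side of a constraint: `-1` for the last one of the chain, `+1` otherwise. -/
def RawCon.rhs {n : ℕ} : RawCon n → Bit
  | .chain i => if i.1 + 2 = n then 1 else 0
  | _ => 0

/-- The constraints of the system, which are the questions to Alice. -/
abbrev Constraint (n : ℕ) : Type := {r : RawCon n // r.Valid}

/-- The variables of the system, which are the questions to Bob. -/
abbrev Variable (n : ℕ) : Type := {v : Symbol n // ∃ (α : Constraint n) (s : Fin 3), α.1.var s = v}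

/-- The questions of the game: a constraint `α` together with one of its three variables `β`, given by
its position in the constraint. -/
abbrev Question (n : ℕ) : Type := Constraint n × Fin 3

/-- The variable that Bob is asked for. -/
def Question.bob {n : ℕ} (q : Question n) : Variable n := ⟨q.1.1.var q.2, q.1, q.2, rfl⟩

/-- The winning condition: Alice's assignment `a` satisfies the constraint, and it agrees with Bob's
answer `b` on the variable that Bob was asked for. -/
def Question.Wins {n : ℕ} (q : Question n) (a : Fin 3 → Bit) (b : Bit) : Prop :=
  ∑ l, a l = q.1.1.rhs ∧ a q.2 = b

instance {n : ℕ} (q : Question n) (a : Fin 3 → Bit) (b : Bit) : Decidable (q.Wins a b) := by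
  unfold Question.Wins; infer_instance

/-! ### Pauli and Clifford operators -/

/-- Operators on the qubits indexed by `Q`; basis states are the bit strings `Q → Bit`. -/
abbrev Operator (Q : Type) : Type := Matrix (Q → Bit) (Q → Bit) ℂ

section Operators

variable {Q : Type} [Fintype Q] [DecidableEq Q]

/-- The tensor product over the qubits `q` of `X ^ x q * Z ^ z q`,
i.e. `|j⟩ ↦ (-1)^(z·j) |j + x⟩`. -/
def pauliXZ (x z : Q → Bit) : Operator Q :=
  Matrix.of fun i j => if i = j + x then (-1 : ℂ) ^ (∑ q, z q * j q).val else 0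

/-- Elements of the Pauli group that act trivially outside `S`; the phases are powers of `i`,
and `Y = i X Z`. -/
def IsPauliOn (S : Finset Q) (M : Operator Q) : Prop :=
  ∃ (k : ℕ) (x z : Q → Bit), (∀ q, q ∉ S → x q = 0 ∧ z q = 0) ∧ M = Complex.I ^ k • pauliXZ x z

/-- The Pauli group `{±1, ±i} × {1, X, Y, Z}^{⊗ Q}`. -/
def IsPauli (M : Operator Q) : Prop := IsPauliOn Finset.univ M

/-- The Clifford group: unitaries that conjugate Pauli operators to Pauli operators. -/
def IsClifford (U : Operator Q) : Prop :=
  U ∈ Matrix.unitaryGroup (Q → Bit) ℂ ∧ ∀ P : Operator Q, IsPauli P → IsPauli (U * P * Uᴴ)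

/-- For an observable `O` with `O² = 1`, the projector on the eigenvalue `(-1)^b`. -/
def eigenprojector (O : Operator Q) (b : Bit) : Operator Q :=
  (1 / 2 : ℂ) • (1 + (-1 : ℂ) ^ b.val • O)

/-- The operator `M` on the qubits in `S`, extended by the identity. -/
def liftOperator (S : Finset Q) (M : Operator S) : Operator Q :=
  Matrix.of fun i j =>
    if ∀ q, q ∉ S → i q = j q then M (fun q => i q.1) (fun q => j q.1) else 0

/-- The projector on the basis states whose qubit `q` has the value `b`. -/
def basisProjector (q : Q) (b : Bit) : Operator Q :=
  Matrix.diagonal fun i => if i q = b then 1 else 0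

end Operators

/-! ### Clifford strategies for the game -/

/-- A Clifford strategy.  Alice and Bob share a stabilizer state of `m` qubits, of which Alice holds
those in `alice` and Bob holds the others.  On the question `α`, Alice measures one Pauli-string
observable for each variable of `α`, and these commute; on the question `β`, Bob measures one
Pauli-string observable. -/
structure CliffordStrategy (n : ℕ) where
  m : ℕ
  prep : Operator (Fin m)
  prep_clifford : IsClifford prep
  alice : Finset (Fin m)
  obsA : Constraint n → Fin 3 → Operator (Fin m)
  obsA_pauli : ∀ α s, IsPauliOn alice (obsA α s)
  obsA_hermitian : ∀ α s, (obsA α s).IsHermitian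
  obsA_commute : ∀ α s s', Commute (obsA α s) (obsA α s')
  obsB : Variable n → Operator (Fin m)
  obsB_pauli : ∀ β, IsPauliOn aliceᶜ (obsB β)
  obsB_hermitian : ∀ β, (obsB β).IsHermitian

namespace CliffordStrategy

variable {n : ℕ} (S : CliffordStrategy n)

/-- The shared state `prep |0...0⟩`. -/
def state : (Fin S.m → Bit) → ℂ := S.prep *ᵥ Pi.single 0 1

/-- The probability that Alice answers `a` and Bob answers `b`. -/
def prob (q : Question n) (a : Fin 3 → Bit) (b : Bit) : ℝ :=
  (star S.state ⬝ᵥ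
    ((eigenprojector (S.obsA q.1 0) (a 0) * eigenprojector (S.obsA q.1 1) (a 1) *
      eigenprojector (S.obsA q.1 2) (a 2) * eigenprojector (S.obsB q.bob) b) *ᵥ S.state)).re

/-- The winning probability for a uniformly random question. -/
def winProb : ℝ :=
  (∑ q : Question n, ∑ a : Fin 3 → Bit, ∑ b : Bit, if q.Wins a b then S.prob q a b else 0) /
    Fintype.card (Question n)

end CliffordStrategy

/-- `p_Clif`, the optimal winning probability of Clifford strategies for uniformly random questions;
the convex hull accounts for shared randomness. -/
def pClif (n : ℕ) : ℝ := sSup (convexHull ℝ (Set.range (CliffordStrategy.winProb (n := n))))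

/-! ### Circuits on bits and qubits -/

/-- States of bits `C` and qubits `Q`: to each bit string belongs the unnormalized density operator of
the qubits, whose trace is the probability of the bit string. -/
abbrev Hybrid (C Q : Type) : Type := (C → Bit) → Operator Q

section Circuits

variable {C Q : Type} [Fintype C] [DecidableEq C] [Fintype Q] [DecidableEq Q]

/-- A deterministic change of the bits. -/
def Hybrid.map (f : (C → Bit) → (C → Bit)) (ρ : Hybrid C Q) : Hybrid C Q :=
  fun c' => ∑ c, if f c = c' then ρ c else 0

/-- Bits in the state `c₀`, all qubits in the state `|0⟩`. -/
def Hybrid.init (c₀ : C → Bit) : Hybrid C Q :=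
  fun c => if c = c₀ then Matrix.single 0 0 1 else 0

/-- A function on the bits in `S`, extended by the identity. -/
def liftBits (S : Finset C) (f : (S → Bit) → (S → Bit)) (c : C → Bit) : C → Bit :=
  fun i => if h : i ∈ S then f (fun s => c s.1) ⟨i, h⟩ else c i

/-- Elementary operations on bits `C` and qubits `Q`: a classical function, a classically controlled
unitary, and the computational-basis measurement of the qubit `q`, with the outcome stored in the
bit `t`. -/
inductive Op (C Q : Type) [Fintype Q] [DecidableEq Q] : Type
  | classical (f : (C → Bit) → (C → Bit))
  | unitary (U : (C → Bit) → Matrix.unitaryGroup (Q → Bit) ℂ)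
  | measure (q : Q) (t : C)

/-- The action on the whole system of an elementary operation on the bits in `S` and the qubits
in `T`. -/
def Op.apply (S : Finset C) (T : Finset Q) : Op S T → Hybrid C Q → Hybrid C Q
  | .classical f, ρ => ρ.map (liftBits S f)
  | .unitary U, ρ => fun c =>
      liftOperator T (U fun s => c s.1).1 * ρ c * (liftOperator T (U fun s => c s.1).1)ᴴ
  | .measure q t, ρ => fun c =>
      ∑ b : Bit, basisProjector q.1 (c t.1) * ρ (Function.update c t.1 b) *
        basisProjector q.1 (c t.1)

/-- A gate: any composition of elementary operations on its own bits and qubits. -/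
structure Gate (C Q : Type) [Fintype C] [DecidableEq C] [Fintype Q] [DecidableEq Q] where
  bits : Finset C
  qubits : Finset Q
  ops : List (Op bits qubits)

/-- The number of bits and qubits that a gate acts on. -/
def Gate.fanIn (g : Gate C Q) : ℕ := g.bits.card + g.qubits.card

def Gate.apply (g : Gate C Q) (ρ : Hybrid C Q) : Hybrid C Q :=
  g.ops.foldl (fun σ o => o.apply g.bits g.qubits σ) ρ

/-- One step of a circuit: gates on disjoint sets of bits and qubits. -/
structure Layer (C Q : Type) [Fintype C] [DecidableEq C] [Fintype Q] [DecidableEq Q] where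
  gates : List (Gate C Q)
  disjoint : gates.Pairwise fun g g' => Disjoint g.bits g'.bits ∧ Disjoint g.qubits g'.qubits

/-- A circuit is a list of layers; its depth is the length of the list. -/
abbrev Circuit (C Q : Type) [Fintype C] [DecidableEq C] [Fintype Q] [DecidableEq Q] : Type :=
  List (Layer C Q)

/-- The gates of a circuit, in the order of their execution. -/
def Circuit.gates (K : Circuit C Q) : List (Gate C Q) := K.flatMap Layer.gates

def Circuit.apply (K : Circuit C Q) (ρ : Hybrid C Q) : Hybrid C Q :=
  (Circuit.gates K).foldl (fun σ g => g.apply σ) ρ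

/-! ### Magic-free circuits

At every moment each bit is either free or a record.  Records carry measurement outcomes; free bits do
not depend on any outcome of the running circuit.  Free bits are processed arbitrarily and may control
arbitrary Clifford gates.  Records are only processed by parity and negation, and may only control
Pauli operators. -/

/-- The bit strings `c` and `c'` agree on all free bits, where `R` is the set of records. -/
def AgreeOff (R : Set C) (c c' : C → Bit) : Prop := ∀ s, s ∉ R → c s = c' s

/-- The operation is magic-free if the records are `R` before it, and `R'` are the records after it. -/
def Op.MagicFree {C Q : Type} [Fintype Q] [DecidableEq Q] (R R' : Set C) : Op C Q → Prop
  | .classical f =>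
      -- a free output bit is a function of the free bits
      (∀ t, t ∉ R' → ∀ c c', AgreeOff R c c' → f c t = f c' t) ∧
      -- a record is an affine function, over the field with two elements, of the records,
      -- with coefficients that may depend on the free bits
      (∀ t, t ∈ R' → ∀ c₁ c₂ c₃, AgreeOff R c₁ c₂ → AgreeOff R c₁ c₃ →
        f (c₁ + c₂ + c₃) t = f c₁ t + f c₂ t + f c₃ t)
  | .unitary U =>
      R' = R ∧
      -- a Clifford gate selected by the free bits
      (((∀ c, IsClifford (U c).1) ∧ ∀ c c', AgreeOff R c c' → U c = U c') ∨
      -- a Pauli operator controlled by one bit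
        ∃ (t : C) (P : Operator Q), IsPauli P ∧ ∀ c, (U c).1 = if c t = 0 then 1 else P)
  | .measure _ t => R' = insert t R

/-- A list of operations, executed one after the other, is magic-free. -/
def opsMagicFree {C Q : Type} [Fintype Q] [DecidableEq Q] :
    Set C → List (Op C Q) → Set C → Prop
  | R, [], R' => R' = R
  | R, o :: os, R' => ∃ R₁, o.MagicFree R R₁ ∧ opsMagicFree R₁ os R'

/-- The gate is magic-free if the records are `R` before it and `R'` after it. -/
def Gate.MagicFree (R R' : Set C) (g : Gate C Q) : Prop :=
  opsMagicFree {s | s.1 ∈ R} g.ops {s | s.1 ∈ R'} ∧ ∀ s, s ∉ g.bits → (s ∈ R' ↔ s ∈ R)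

def gatesMagicFree : Set C → List (Gate C Q) → Prop
  | _, [] => True
  | R, g :: gs => ∃ R₁, g.MagicFree R R₁ ∧ gatesMagicFree R₁ gs

/-- Magic-free circuits; at the beginning all bits are free. -/
def Circuit.MagicFree (K : Circuit C Q) : Prop := gatesMagicFree ∅ (Circuit.gates K)

end Circuits

/-! ### The two-round relation problem -/

/-- A device for the two-round problem with `N` sites for Alice and for Bob.  In the first round each
site receives one bit, and answers `w` bits.  In the second round each site of Alice receives
`w + w + lA` bits and each site of Bob receives `lB` bits, and each site answers three bits.  The bits
that are not used by the input have the initial values `anc`, all qubits are initially `|0⟩`.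
All bits and qubits are kept between the rounds. -/
structure Protocol (N w lA lB : ℕ) where
  Bits : Type
  Qubits : Type
  [fintypeBits : Fintype Bits]
  [decEqBits : DecidableEq Bits]
  [fintypeQubits : Fintype Qubits]
  [decEqQubits : DecidableEq Qubits]
  anc : Bits → Bit
  in₁ : Fin N ⊕ Fin N ↪ Bits
  in₂ : (Fin N × ((Fin w ⊕ Fin w) ⊕ Fin lA)) ⊕ (Fin N × Fin lB) ↪ Bits
  out₁A : Fin N → Fin w → Bits
  out₁B : Fin N → Fin w → Bits
  out₂A : Fin N → Fin 3 → Bits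
  out₂B : Fin N → Fin 3 → Bits
  circ₁ : Circuit Bits Qubits
  circ₂ : Circuit Bits Qubits

attribute [instance] Protocol.fintypeBits Protocol.decEqBits Protocol.fintypeQubits
  Protocol.decEqQubits

/-- The instances `(j, k, α, β)` of the relation problem: `j < k`, and a question of the game. -/
abbrev Instance (n N : ℕ) : Type := {p : Fin N × Fin N // p.1 < p.2} × Question n

/-- The input of the first round: Alice's site `j` and Bob's site `k` receive `⊤ = 1`, all other sites
receive `⊥ = 0`. -/
def input₁ {N : ℕ} (j k : Fin N) : Fin N ⊕ Fin N → Bit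
  | .inl i => if i = j then 1 else 0
  | .inr i => if i = k then 1 else 0

/-- The input of the second round, where `r₁A` and `r₁B` are the answers of the first round: Alice's
site `j` receives the two syndromes and the constraint, Bob's site `k` receives the variable.
All other syndromes are trivial, all other questions are `⊥ = none`.  Questions are given in the binary
encodings `encA` and `encB`. -/
def input₂ {n N w lA lB : ℕ} (encA : Option (Constraint n) ↪ (Fin lA → Bit))
    (encB : Option (Variable n) ↪ (Fin lB → Bit)) (j k : Fin N) (q : Question n)
    (r₁A r₁B : Fin N → Fin w → Bit) :
    (Fin N × ((Fin w ⊕ Fin w) ⊕ Fin lA)) ⊕ (Fin N × Fin lB) → Bit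
  | .inl (i, .inl (.inl l)) => if i = j then ∑ m ∈ Finset.Ioc j k, r₁A m l else 0
  | .inl (i, .inl (.inr l)) => if i = j then ∑ m ∈ Finset.Ico j k, r₁B m l else 0
  | .inl (i, .inr l) => encA (if i = j then some q.1 else none) l
  | .inr (i, l) => encB (if i = k then some q.bob else none) l

namespace Protocol

variable {n N w lA lB : ℕ} (P : Protocol N w lA lB)

/-- The state at the end of the first round. -/
def state₁ (j k : Fin N) : Hybrid P.Bits P.Qubits :=
  P.circ₁.apply (Hybrid.init (Function.extend P.in₁ (input₁ j k) P.anc))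

/-- The state at the end of the second round. -/
def state₂ (encA : Option (Constraint n) ↪ (Fin lA → Bit))
    (encB : Option (Variable n) ↪ (Fin lB → Bit))
    (I : Instance n N) : Hybrid P.Bits P.Qubits :=
  P.circ₂.apply ((P.state₁ I.1.1.1 I.1.1.2).map fun c =>
    Function.extend P.in₂
      (input₂ encA encB I.1.1.1 I.1.1.2 I.2 (fun i l => c (P.out₁A i l))
        (fun i l => c (P.out₁B i l))) c)

/-- The probability that the answers of the second round are correct: those of Alice's site `j` and
Bob's site `k` win the game.  Bob's answer is the first of his three bits. -/
def success (encA : Option (Constraint n) ↪ (Fin lA → Bit))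
    (encB : Option (Variable n) ↪ (Fin lB → Bit))
    (I : Instance n N) : ℝ :=
  ∑ c : P.Bits → Bit,
    if I.2.Wins (fun l => c (P.out₂A I.1.1.1 l)) (c (P.out₂B I.1.1.2 0)) then
      (P.state₂ encA encB I c).trace.re else 0

/-- The success probability for a uniformly random instance. -/
def avgSuccess (encA : Option (Constraint n) ↪ (Fin lA → Bit))
    (encB : Option (Variable n) ↪ (Fin lB → Bit)) : ℝ :=
  (∑ I : Instance n N, P.success encA encB I) / Fintype.card (Instance n N)

/-- The gates of both rounds. -/
def gates : List (Gate P.Bits P.Qubits) := Circuit.gates P.circ₁ ++ Circuit.gates P.circ₂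

/-- All gates have fan-in at most `K`. -/
def FanInLE (K : ℕ) : Prop := ∀ g ∈ P.gates, g.fanIn ≤ K

/-- The circuits of both rounds are magic-free. -/
def MagicFree : Prop := Circuit.MagicFree P.circ₁ ∧ Circuit.MagicFree P.circ₂

/-- Some gate contains a (classically controlled) unitary that is not Clifford. -/
def UsesNonClifford : Prop :=
  ∃ g ∈ P.gates, ∃ U, Op.unitary U ∈ g.ops ∧ ∃ c, ¬ IsClifford (U c).1

/-- One-dimensional geometric locality: the bits and qubits can be placed on a line of `2 * N` sites,
at most `s` of them on each, such that the inputs and outputs of Alice's site `i` are at the position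
`2 * i`, those of Bob's site `i` are at the position `2 * i + 1`, and each gate acts within two
neighbouring positions. -/
def IsLocal1D (s : ℕ) : Prop :=
  ∃ pos : P.Bits ⊕ P.Qubits → ℕ,
    (∀ x, pos x < 2 * N) ∧
    (∀ m, Set.ncard {x | pos x = m} ≤ s) ∧
    (∀ i : Fin N,
      pos (.inl (P.in₁ (.inl i))) = 2 * i ∧ pos (.inl (P.in₁ (.inr i))) = 2 * i + 1 ∧
      (∀ l, pos (.inl (P.in₂ (.inl (i, l)))) = 2 * i) ∧
      (∀ l, pos (.inl (P.in₂ (.inr (i, l)))) = 2 * i + 1) ∧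
      (∀ l, pos (.inl (P.out₁A i l)) = 2 * i ∧ pos (.inl (P.out₁B i l)) = 2 * i + 1) ∧
      (∀ l, pos (.inl (P.out₂A i l)) = 2 * i ∧ pos (.inl (P.out₂B i l)) = 2 * i + 1)) ∧
    (∀ g ∈ P.gates, ∃ m : ℕ,
      (∀ b ∈ g.bits, pos (.inl b) = m ∨ pos (.inl b) = m + 1) ∧
      (∀ q ∈ g.qubits, pos (.inr q) = m ∨ pos (.inr q) = m + 1))

end Protocol

/-- A probabilistic device: a device chosen at random, independently of the input. -/
structure RandomProtocol (N w lA lB : ℕ) where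
  Seed : Type
  [fintypeSeed : Fintype Seed]
  weight : Seed → ℝ
  weight_nonneg : ∀ ω, 0 ≤ weight ω
  weight_sum : ∑ ω, weight ω = 1
  device : Seed → Protocol N w lA lB

attribute [instance] RandomProtocol.fintypeSeed

/-- The success probability for a uniformly random instance. -/
def RandomProtocol.avgSuccess {n N w lA lB : ℕ} (P : RandomProtocol N w lA lB)
    (encA : Option (Constraint n) ↪ (Fin lA → Bit))
    (encB : Option (Variable n) ↪ (Fin lB → Bit)) : ℝ :=
  ∑ ω, P.weight ω * (P.device ω).avgSuccess encA encB

end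

end MagicBCS

open MagicBCS

namespace MagicBCS
noncomputable section
set_option linter.unusedSectionVars false
set_option linter.unusedSimpArgs false

/-! ### Signs and Pauli operators -/

/-! The proof has three independent parts: an algebraic obstruction for Pauli observables, a
reduction of shallow magic-free devices to such observables, and two explicit devices.

Obstruction. In a stabilizer state every Hermitian Pauli operator has expectation 1, 0 or -1, so a
strategy with Pauli observables wins a question with certainty or with probability at most 1/2
(`questionValue_cases`). It therefore suffices to exclude perfect strategies. If a strategy is
perfect, Bob's observables, restricted to the space that they generate from the shared state,
satisfy all constraints as operator identities, and any two of them commute or anticommute. In such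
a solution `a_quad` expresses the product of four of the `a v` as the sign with which some `y`
passes some `b`. Hence the `a v` agree up to sign, so every `y` is a sign and commutes with
everything, so the `a v` are all equal; for even `n` the chain then says 1 = -1
(`RingSolution.one_eq_neg_one`, `exists_not_perfect`).

Reduction. In the Heisenberg picture the sign of an output bit of the second round is pulled back
through the circuit. Each measurement is deferred to a fresh auxiliary qubit, which makes the
pull-back an algebra homomorphism, so the images of different output signs commute. Magic-freeness
keeps each image a Pauli operator selected by the free bits, with a sign that is affine in the
records, and it involves only the past light cone of the output (`exists_gatesPull`), which has at
most `K ^ D` wires. If the cones of Alice's answers avoid Bob's question and conversely, then for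
each bit string left by the first round the images form a strategy with commuting Pauli observables
on a mixture of stabilizer states (`sum_success_le`). These observables may share qubits. To
separate the players, the correlations are reproduced on two copies of the qubits by the projector
on a stabilizer code, which is itself a nonnegative combination of stabilizer states
(`codeProjector_mem`, `trace_codeProjector_mul`); so the value is at most `pClif`
(`value_le_pClif`). All but `4 * N * K ^ D` of the pairs of sites are separated, and averaging gives
the bound and the logarithmic depth.

Devices. The system has a solution by real symmetric operators: signed permutation matrices on
0/1-vectors of odd weight, on which the constant sign vector acts as -1
(`Solution.exists_operators`). For such operators, measurements of the two halves of maximally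
entangled pairs win every question (`exists_bases`). The first round distributes the pairs by
entanglement swapping along the line; the two syndromes of the relation problem are exactly the
Pauli corrections (`circuit₁_step`, `circuit₂_step`). In logarithmic depth a classical device wins,
because Bob lacks only one bit, the right-hand side of Alice's constraint, which can be broadcast
over a hypercube (`LogDepth.device_success`). -/

/-- The sign `(-1)^b` of a bit. -/
def sgn (b : Bit) : ℂ := (-1 : ℂ) ^ b.val

@[simp] lemma sgn_zero : sgn 0 = 1 := by simp [sgn]
@[simp] lemma sgn_one : sgn 1 = -1 := by simp [sgn, ZMod.val_one]

lemma bit_cases (b : Bit) : b = 0 ∨ b = 1 := by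
  revert b; decide

lemma sgn_add (a b : Bit) : sgn (a + b) = sgn a * sgn b := by
  rcases bit_cases a with rfl | rfl <;> rcases bit_cases b with rfl | rfl <;> simp
  rw [show (1 + 1 : Bit) = 0 by decide]; simp

lemma sgn_mul_self (a : Bit) : sgn a * sgn a = 1 := by
  rcases bit_cases a with rfl | rfl <;> simp

lemma sgn_ne_zero (a : Bit) : sgn a ≠ 0 := by
  rcases bit_cases a with rfl | rfl <;> simp

@[simp] lemma star_sgn (a : Bit) : star (sgn a) = sgn a := by
  rcases bit_cases a with rfl | rfl <;> simp

lemma bit_add_self (b : Bit) : b + b = 0 := CharTwo.add_self_eq_zero b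

lemma bits_add_self {ι : Type*} (x : ι → Bit) : x + x = 0 := by
  ext i; exact bit_add_self _

lemma bits_add_cancel {ι : Type*} (x y : ι → Bit) : x + y + y = x := by
  rw [add_assoc, bits_add_self, add_zero]

lemma bits_eq_add_iff {ι : Type*} {x y z : ι → Bit} : x = y + z ↔ y = x + z := by
  constructor <;> rintro rfl <;> rw [bits_add_cancel]

lemma sgn_eq_I_pow (b : Bit) : sgn b = Complex.I ^ (2 * b.val) := by
  rw [pow_mul, Complex.I_sq]; rfl

section
variable {Q : Type} [Fintype Q] [DecidableEq Q]

lemma pauliXZ_apply (x z i j : Q → Bit) :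
    pauliXZ x z i j = if i = j + x then sgn (z ⬝ᵥ j) else 0 := rfl

lemma pauliXZ_mul (x z x' z' : Q → Bit) :
    pauliXZ x z * pauliXZ x' z' = sgn (z ⬝ᵥ x') • pauliXZ (x + x') (z + z') := by
  ext i j
  simp only [Matrix.mul_apply, Matrix.smul_apply, pauliXZ_apply, smul_eq_mul]
  rw [Finset.sum_eq_single (j + x')]
  · simp only [if_true, ite_mul, zero_mul, mul_ite, mul_zero]
    have : j + x' + x = j + (x + x') := by abel
    rw [this]
    split_ifs
    · rw [dotProduct_add, add_dotProduct, sgn_add, sgn_add]; ring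
    · rfl
  · intro b _ hb; simp [hb]
  · simp

@[simp] lemma pauliXZ_zero : pauliXZ (0 : Q → Bit) 0 = 1 := by
  ext i j; simp [pauliXZ_apply, Matrix.one_apply]

lemma pauliXZ_conjTranspose (x z : Q → Bit) :
    (pauliXZ x z)ᴴ = sgn (z ⬝ᵥ x) • pauliXZ x z := by
  ext i j
  simp only [Matrix.conjTranspose_apply, Matrix.smul_apply, pauliXZ_apply, smul_eq_mul]
  by_cases h : i = j + x
  · subst h
    rw [if_pos (bits_add_cancel _ _).symm, if_pos rfl, star_sgn, dotProduct_add, sgn_add, mul_comm]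
  · rw [if_neg (fun h' => h (bits_eq_add_iff.1 h')), if_neg h]; simp

lemma pauliXZ_trace {x z : Q → Bit} (h : x ≠ 0 ∨ z ≠ 0) : (pauliXZ x z).trace = 0 := by
  simp only [Matrix.trace, Matrix.diag, pauliXZ_apply]
  by_cases hx : x = 0
  · subst hx
    have hz : z ≠ 0 := by simpa using h
    obtain ⟨q, hq⟩ := Function.ne_iff.1 hz
    have hq1 : z q = 1 := by
      rcases bit_cases (z q) with h | h
      · exact absurd h hq
      · exact h
    simp only [add_zero, if_true]
    have key : ∑ i : Q → Bit, sgn (z ⬝ᵥ i) = ∑ i : Q → Bit, -sgn (z ⬝ᵥ i) := by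
      refine Fintype.sum_equiv (Equiv.addRight (Pi.single q 1)) _ _ fun i => ?_
      simp [dotProduct_add, sgn_add, hq1]
    rw [Finset.sum_neg_distrib] at key
    linear_combination key / 2
  · apply Finset.sum_eq_zero
    intro i _
    rw [if_neg]
    intro h'
    exact hx (by simpa using h')

lemma pauliXZ_mulVec_single (x z : Q → Bit) :
    pauliXZ x z *ᵥ Pi.single (0 : Q → Bit) (1 : ℂ) = Pi.single x 1 := by
  ext i
  simp [pauliXZ_apply, Pi.single_apply]

lemma IsPauliOn.intro {S : Finset Q} (k : ℕ) {x z : Q → Bit}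
    (h : ∀ q, q ∉ S → x q = 0 ∧ z q = 0) : IsPauliOn S (Complex.I ^ k • pauliXZ x z) :=
  ⟨k, x, z, h, rfl⟩

lemma IsPauli.intro (k : ℕ) (x z : Q → Bit) : IsPauli (Complex.I ^ k • pauliXZ x z) :=
  ⟨k, x, z, by simp, rfl⟩

lemma IsPauli.exists {M : Operator Q} (h : IsPauli M) :
    ∃ (k : ℕ) (x z : Q → Bit), M = Complex.I ^ k • pauliXZ x z := by
  obtain ⟨k, x, z, -, h⟩ := h; exact ⟨k, x, z, h⟩

lemma isPauli_pauliXZ (x z : Q → Bit) : IsPauli (pauliXZ x z) :=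
  ⟨0, x, z, by simp, by simp⟩

lemma IsPauliOn.mono {S T : Finset Q} (h : S ⊆ T) {M : Operator Q} (hM : IsPauliOn S M) :
    IsPauliOn T M := by
  obtain ⟨k, x, z, h', rfl⟩ := hM
  exact ⟨k, x, z, fun q hq => h' q fun h'' => hq (h h''), rfl⟩

lemma IsPauliOn.isPauli {S : Finset Q} {M : Operator Q} (hM : IsPauliOn S M) : IsPauli M :=
  hM.mono (Finset.subset_univ _)

lemma isPauliOn_one (S : Finset Q) : IsPauliOn S (1 : Operator Q) :=
  ⟨0, 0, 0, by simp, by simp⟩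

lemma isPauli_one : IsPauli (1 : Operator Q) := isPauliOn_one _

lemma IsPauliOn.mul {S : Finset Q} {M N : Operator Q} (hM : IsPauliOn S M) (hN : IsPauliOn S N) :
    IsPauliOn S (M * N) := by
  obtain ⟨k, x, z, h, rfl⟩ := hM
  obtain ⟨k', x', z', h', rfl⟩ := hN
  refine ⟨k + k' + 2 * (z ⬝ᵥ x').val, x + x', z + z', fun q hq => ?_, ?_⟩
  · simp [h q hq, h' q hq]
  · rw [Matrix.smul_mul, Matrix.mul_smul, pauliXZ_mul, sgn_eq_I_pow, smul_smul, smul_smul]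
    congr 1; ring

lemma IsPauli.mul {M N : Operator Q} (hM : IsPauli M) (hN : IsPauli N) : IsPauli (M * N) :=
  IsPauliOn.mul hM hN

lemma IsPauliOn.I_smul {S : Finset Q} {M : Operator Q} (hM : IsPauliOn S M) (k : ℕ) :
    IsPauliOn S (Complex.I ^ k • M) := by
  obtain ⟨k', x, z, h, rfl⟩ := hM
  exact ⟨k + k', x, z, h, by rw [smul_smul, pow_add]⟩

lemma IsPauliOn.sgn_smul {S : Finset Q} {M : Operator Q} (hM : IsPauliOn S M) (b : Bit) :
    IsPauliOn S (sgn b • M) := by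
  rw [sgn_eq_I_pow]; exact hM.I_smul _

lemma IsPauliOn.neg {S : Finset Q} {M : Operator Q} (hM : IsPauliOn S M) : IsPauliOn S (-M) := by
  simpa using hM.sgn_smul 1

lemma I_pow_star (k : ℕ) : star (Complex.I ^ k) = Complex.I ^ (3 * k) := by
  rw [star_pow, pow_mul, Complex.I_pow_three]; simp

lemma IsPauliOn.conjTranspose {S : Finset Q} {M : Operator Q} (hM : IsPauliOn S M) :
    IsPauliOn S Mᴴ := by
  obtain ⟨k, x, z, h, rfl⟩ := hM
  rw [Matrix.conjTranspose_smul, pauliXZ_conjTranspose, I_pow_star]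
  exact ((IsPauliOn.intro 0 h |> fun h => by simpa using h : IsPauliOn S (pauliXZ x z)).sgn_smul
    _).I_smul _

lemma IsPauli.conjTranspose {M : Operator Q} (hM : IsPauli M) : IsPauli Mᴴ :=
  IsPauliOn.conjTranspose hM

lemma I_pow_mul_star (k : ℕ) : Complex.I ^ k * star (Complex.I ^ k) = 1 := by
  rw [star_pow, ← mul_pow]; simp

lemma IsPauli.mul_conjTranspose {M : Operator Q} (hM : IsPauli M) : M * Mᴴ = 1 := by
  obtain ⟨k, x, z, rfl⟩ := hM.exists
  rw [Matrix.conjTranspose_smul, pauliXZ_conjTranspose, Matrix.smul_mul, Matrix.mul_smul,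
    Matrix.mul_smul, pauliXZ_mul, smul_smul, smul_smul, smul_smul, bits_add_self, bits_add_self,
    pauliXZ_zero, I_pow_mul_star, one_mul, sgn_mul_self, one_smul]

lemma IsPauli.conjTranspose_mul {M : Operator Q} (hM : IsPauli M) : Mᴴ * M = 1 :=
  mul_eq_one_comm.1 hM.mul_conjTranspose

lemma IsPauli.mem_unitary {M : Operator Q} (hM : IsPauli M) :
    M ∈ Matrix.unitaryGroup (Q → Bit) ℂ :=
  Matrix.mem_unitaryGroup_iff.2 hM.mul_conjTranspose

lemma IsPauli.mul_self {M : Operator Q} (hM : IsPauli M) (h : M.IsHermitian) : M * M = 1 := by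
  have := hM.mul_conjTranspose
  rwa [h.eq] at this

lemma IsPauli.isHermitian {M : Operator Q} (hM : IsPauli M) (h : M * M = 1) : M.IsHermitian := by
  have h1 := hM.mul_conjTranspose
  calc Mᴴ = M * M * Mᴴ := by rw [h, one_mul]
    _ = M := by rw [mul_assoc, h1, mul_one]

lemma IsPauli.mul_self_eq {M : Operator Q} (hM : IsPauli M) : M * M = 1 ∨ M * M = -1 := by
  obtain ⟨k, x, z, rfl⟩ := hM.exists
  rw [Matrix.smul_mul, Matrix.mul_smul, pauliXZ_mul, bits_add_self, bits_add_self, pauliXZ_zero,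
    smul_smul, smul_smul, ← mul_pow, Complex.I_mul_I]
  rcases neg_one_pow_eq_or ℂ k with h | h <;> rcases bit_cases (z ⬝ᵥ x) with h' | h' <;>
    simp [h, h']

lemma IsPauli.commute_or {M N : Operator Q} (hM : IsPauli M) (hN : IsPauli N) :
    M * N = N * M ∨ M * N = -(N * M) := by
  obtain ⟨k, x, z, rfl⟩ := hM.exists
  obtain ⟨k', x', z', rfl⟩ := hN.exists
  simp only [Matrix.smul_mul, Matrix.mul_smul, pauliXZ_mul, smul_smul, add_comm x' x,
    add_comm z' z, ← neg_smul]
  rcases bit_cases (z ⬝ᵥ x') with h | h <;> rcases bit_cases (z' ⬝ᵥ x) with h' | h' <;>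
    simp [h, h', mul_comm]

lemma dotProduct_eq_zero_of_disjoint {S T : Finset Q} (h : Disjoint S T) {x z : Q → Bit}
    (hz : ∀ q, q ∉ S → z q = 0) (hx : ∀ q, q ∉ T → x q = 0) : z ⬝ᵥ x = 0 := by
  apply Finset.sum_eq_zero
  intro q _
  by_cases hq : q ∈ S
  · rw [hx q (Finset.disjoint_left.1 h hq), mul_zero]
  · rw [hz q hq, zero_mul]

lemma IsPauliOn.commute_of_disjoint {S T : Finset Q} (h : Disjoint S T) {M N : Operator Q}
    (hM : IsPauliOn S M) (hN : IsPauliOn T N) : Commute M N := by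
  obtain ⟨k, x, z, h1, rfl⟩ := hM
  obtain ⟨k', x', z', h2, rfl⟩ := hN
  have e1 : z ⬝ᵥ x' = 0 :=
    dotProduct_eq_zero_of_disjoint h (fun q hq => (h1 q hq).2) (fun q hq => (h2 q hq).1)
  have e2 : z' ⬝ᵥ x = 0 :=
    dotProduct_eq_zero_of_disjoint h.symm (fun q hq => (h2 q hq).2) (fun q hq => (h1 q hq).1)
  simp only [Commute, SemiconjBy, Matrix.smul_mul, Matrix.mul_smul, pauliXZ_mul, smul_smul, e1, e2,
    add_comm x' x, add_comm z' z]
  congr 1; ring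

lemma IsPauli.trace_or {M : Operator Q} (hM : IsPauli M) :
    M.trace = 0 ∨ ∃ k : ℕ, M = Complex.I ^ k • (1 : Operator Q) := by
  obtain ⟨k, x, z, rfl⟩ := hM.exists
  by_cases h : x ≠ 0 ∨ z ≠ 0
  · left; rw [Matrix.trace_smul, pauliXZ_trace h, smul_zero]
  · right
    push Not at h
    obtain ⟨rfl, rfl⟩ := h
    exact ⟨k, by simp⟩

lemma isPauli_finite : {M : Operator Q | IsPauli M}.Finite := by
  apply (Set.finite_range (fun p : Fin 4 × (Q → Bit) × (Q → Bit) =>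
    Complex.I ^ p.1.1 • pauliXZ p.2.1 p.2.2)).subset
  intro M hM
  obtain ⟨k, x, z, rfl⟩ := IsPauli.exists hM
  refine ⟨(⟨k % 4, Nat.mod_lt _ (by norm_num)⟩, x, z), ?_⟩
  simp only
  congr 1
  rw [← Complex.I_pow_eq_pow_mod]

/-! ### Clifford operators -/

lemma IsClifford.mul_conjTranspose {U : Operator Q} (h : IsClifford U) : U * Uᴴ = 1 :=
  Matrix.mem_unitaryGroup_iff.1 h.1

lemma IsClifford.conjTranspose_mul {U : Operator Q} (h : IsClifford U) : Uᴴ * U = 1 :=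
  Matrix.mem_unitaryGroup_iff'.1 h.1

lemma IsPauli.isClifford {U : Operator Q} (h : IsPauli U) : IsClifford U :=
  ⟨h.mem_unitary, fun _ hP => (h.mul hP).mul h.conjTranspose⟩

lemma isClifford_one : IsClifford (1 : Operator Q) := isPauli_one.isClifford

lemma IsClifford.mul {U V : Operator Q} (hU : IsClifford U) (hV : IsClifford V) :
    IsClifford (U * V) := by
  refine ⟨mul_mem hU.1 hV.1, fun P hP => ?_⟩
  have := hU.2 _ (hV.2 P hP)
  rw [Matrix.conjTranspose_mul]
  simpa only [mul_assoc] using this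

/-- Conjugation by `U` is an injective self-map of the finite set of Pauli operators, hence
surjective; so the inverse conjugation preserves this set as well. -/
lemma IsClifford.conj_isPauli {U : Operator Q} (hU : IsClifford U) {P : Operator Q}
    (hP : IsPauli P) : IsPauli (Uᴴ * P * U) := by
  have inj : Set.InjOn (fun P => U * P * Uᴴ) {M : Operator Q | IsPauli M} := by
    intro A _ B _ h
    have := congrArg (fun M => Uᴴ * M * U) h
    simp only at this
    rw [show Uᴴ * (U * A * Uᴴ) * U = (Uᴴ * U) * A * (Uᴴ * U) by simp only [mul_assoc],
      show Uᴴ * (U * B * Uᴴ) * U = (Uᴴ * U) * B * (Uᴴ * U) by simp only [mul_assoc],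
      hU.conjTranspose_mul] at this
    simpa using this
  have maps : Set.MapsTo (fun P => U * P * Uᴴ) {M : Operator Q | IsPauli M} {M | IsPauli M} :=
    fun P hP => hU.2 P hP
  have surj : (fun P => U * P * Uᴴ) '' {M : Operator Q | IsPauli M} = {M | IsPauli M} :=
    Set.eq_of_subset_of_ncard_le maps.image_subset inj.ncard_image.ge
      isPauli_finite
  obtain ⟨P', hP', rfl⟩ : P ∈ (fun P => U * P * Uᴴ) '' {M : Operator Q | IsPauli M} :=
    by rw [surj]; exact hP
  simp only
  rw [show Uᴴ * (U * P' * Uᴴ) * U = (Uᴴ * U) * P' * (Uᴴ * U) by simp only [mul_assoc],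
      hU.conjTranspose_mul]
  simpa using hP'

lemma IsClifford.conjTranspose {U : Operator Q} (hU : IsClifford U) : IsClifford Uᴴ := by
  refine ⟨?_, fun P hP => ?_⟩
  · rw [Matrix.mem_unitaryGroup_iff]
    simpa [Matrix.star_eq_conjTranspose] using hU.conjTranspose_mul
  · rw [Matrix.conjTranspose_conjTranspose]; exact hU.conj_isPauli hP

/-- For anticommuting Hermitian Pauli operators `P`, `R`, the operator `(P + R) / √2` is Clifford. -/
lemma isClifford_of_anticommute {P R : Operator Q} (hP : IsPauli P) (hR : IsPauli R)
    (hP' : P.IsHermitian) (hR' : R.IsHermitian) (h : P * R = -(R * P)) :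
    IsClifford (((Real.sqrt 2 : ℝ) : ℂ)⁻¹ • (P + R)) := by
  have hP2 := hP.mul_self hP'
  have hR2 := hR.mul_self hR'
  set r : ℂ := ((Real.sqrt 2 : ℝ) : ℂ)⁻¹ with hr
  have hrr : r * r = 1 / 2 := by
    rw [hr, ← mul_inv, ← Complex.ofReal_mul, Real.mul_self_sqrt (by norm_num)]; norm_num
  have hstar : (r • (P + R))ᴴ = r • (P + R) := by
    rw [Matrix.conjTranspose_smul, Matrix.conjTranspose_add, hP'.eq, hR'.eq]
    congr 1
    simp [hr]
  have conj : ∀ M : Operator Q, r • (P + R) * M * (r • (P + R)) =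
      (1 / 2 : ℂ) • ((P + R) * M * (P + R)) := by
    intro M
    rw [Matrix.smul_mul, Matrix.smul_mul, Matrix.mul_smul, smul_smul, hrr]
  have half : ∀ M : Operator Q, (1 / 2 : ℂ) • (M + M) = M := by
    intro M; rw [← two_smul ℂ, smul_smul]; norm_num
  refine ⟨?_, fun S hS => ?_⟩
  · rw [Matrix.mem_unitaryGroup_iff, Matrix.star_eq_conjTranspose, hstar]
    have := conj 1
    rw [mul_one, mul_one] at this
    rw [this]
    have e : (P + R) * (P + R) = 1 + 1 := by
      rw [mul_add, add_mul, add_mul, hP2, hR2, h]; abel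
    rw [e, half]
  · rw [hstar, conj]
    -- Pull `S` to the left through the first factor, which turns `P + R` into `P + R` or `P - R` up
    -- to sign. The half-sum of the remaining products is `S`, `S * (P * R)`, `S * (R * P)` or `-S`.
    rcases hP.commute_or hS with hPS | hPS <;> rcases hR.commute_or hS with hRS | hRS
    · have e : (P + R) * S * (P + R) = S + S := by
        have : (P + R) * S = S * (P + R) := by rw [add_mul, mul_add, hPS, hRS]
        rw [this, mul_assoc, mul_add, add_mul, add_mul, hP2, hR2, h]
        simp only [mul_add, mul_one, mul_neg]; abel
      rw [e, half]; exact hS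
    · have e : (P + R) * S * (P + R) = S * (P * R) + S * (P * R) := by
        have : (P + R) * S = S * (P - R) := by rw [add_mul, mul_sub, hPS, hRS]; abel
        rw [this, mul_assoc, mul_add, sub_mul, sub_mul, hP2, hR2]
        rw [show R * P = -(P * R) by rw [h, neg_neg]]
        simp only [mul_add, mul_sub, mul_one, mul_neg]; abel
      rw [e, half]; exact hS.mul (hP.mul hR)
    · have e : (P + R) * S * (P + R) = S * (R * P) + S * (R * P) := by
        have : (P + R) * S = S * (R - P) := by rw [add_mul, mul_sub, hPS, hRS]; abel
        rw [this, mul_assoc, mul_add, sub_mul, sub_mul, hP2, hR2, h]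
        simp only [mul_add, mul_sub, mul_one, mul_neg]; abel
      rw [e, half]; exact hS.mul (hR.mul hP)
    · have e : (P + R) * S * (P + R) = -S + -S := by
        have : (P + R) * S = -(S * (P + R)) := by rw [add_mul, mul_add, hPS, hRS]; abel
        rw [this, neg_mul, mul_assoc, mul_add, add_mul, add_mul, hP2, hR2, h]
        simp only [mul_add, mul_one, mul_neg]; abel
      rw [e, half]; exact IsPauliOn.neg hS

end
end
end MagicBCS

namespace MagicBCS
noncomputable section
set_option linter.unusedSectionVars false
set_option linter.unusedSimpArgs false

/-! ### Stabilizer states and expectation values -/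

section
variable {Q : Type} [Fintype Q] [DecidableEq Q]

/-- The basis vector `|0...0⟩`. -/
def ket0 : (Q → Bit) → ℂ := Pi.single 0 1

/-- The vector is a stabilizer state. -/
def IsStab (ψ : (Q → Bit) → ℂ) : Prop := ∃ U : Operator Q, IsClifford U ∧ ψ = U *ᵥ ket0

/-- The quadratic form of an operator at a vector. -/
def expect (ψ : (Q → Bit) → ℂ) (M : Operator Q) : ℂ := star ψ ⬝ᵥ (M *ᵥ ψ)

lemma expect_add (ψ : (Q → Bit) → ℂ) (M N : Operator Q) :
    expect ψ (M + N) = expect ψ M + expect ψ N := by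
  simp [expect, Matrix.add_mulVec, dotProduct_add]

lemma expect_smul (ψ : (Q → Bit) → ℂ) (c : ℂ) (M : Operator Q) :
    expect ψ (c • M) = c * expect ψ M := by
  simp [expect, Matrix.smul_mulVec, dotProduct_smul]

lemma expect_sum (ψ : (Q → Bit) → ℂ) {ι : Type*} (s : Finset ι) (M : ι → Operator Q) :
    expect ψ (∑ i ∈ s, M i) = ∑ i ∈ s, expect ψ (M i) := by
  simp [expect, Matrix.sum_mulVec, dotProduct_sum]

lemma expect_zero (ψ : (Q → Bit) → ℂ) : expect ψ 0 = 0 := by simp [expect]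

lemma star_mulVec_dotProduct (U : Operator Q) (v w : (Q → Bit) → ℂ) :
    star (U *ᵥ v) ⬝ᵥ w = star v ⬝ᵥ (Uᴴ *ᵥ w) := by
  rw [Matrix.star_mulVec, Matrix.dotProduct_mulVec]

lemma expect_mulVec (U : Operator Q) (v : (Q → Bit) → ℂ) (M : Operator Q) :
    expect (U *ᵥ v) M = expect v (Uᴴ * M * U) := by
  simp only [expect, star_mulVec_dotProduct, Matrix.mulVec_mulVec, mul_assoc]

lemma star_ket0_dotProduct (v : (Q → Bit) → ℂ) : star ket0 ⬝ᵥ v = v 0 := by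
  have : star (ket0 : (Q → Bit) → ℂ) = ket0 := by
    ext i; simp only [ket0, Pi.star_apply, Pi.single_apply]; split_ifs <;> simp
  rw [this, ket0, single_dotProduct, one_mul]

lemma IsStab.expect_one {ψ : (Q → Bit) → ℂ} (h : IsStab ψ) : expect ψ 1 = 1 := by
  obtain ⟨U, hU, rfl⟩ := h
  rw [expect_mulVec, mul_one, hU.conjTranspose_mul, expect, Matrix.one_mulVec,
    star_ket0_dotProduct]
  simp [ket0]

lemma IsStab.ne_zero {ψ : (Q → Bit) → ℂ} (h : IsStab ψ) : ψ ≠ 0 := by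
  rintro rfl
  simpa [expect] using h.expect_one

/-- A Pauli operator either fixes a stabilizer state up to a phase or has zero expectation. -/
lemma IsStab.pauli_cases {ψ : (Q → Bit) → ℂ} (h : IsStab ψ) {P : Operator Q} (hP : IsPauli P) :
    (∃ k : ℕ, P *ᵥ ψ = Complex.I ^ k • ψ) ∨ expect ψ P = 0 := by
  obtain ⟨U, hU, rfl⟩ := h
  -- Conjugation by the preparing Clifford reduces the question to `|0...0⟩`: the `Z` part fixes it,
  -- and a nonzero `X` part moves it to an orthogonal basis state.
  obtain ⟨k, x, z, hM⟩ := (hU.conj_isPauli hP).exists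
  by_cases hx : x = 0
  · left
    refine ⟨k, ?_⟩
    have h1 : P * U = U * (Complex.I ^ k • pauliXZ x z) := by
      rw [← hM]; simp only [← mul_assoc, hU.mul_conjTranspose, one_mul]
    rw [Matrix.mulVec_mulVec, h1, ← Matrix.mulVec_mulVec, Matrix.smul_mulVec, ket0,
      pauliXZ_mulVec_single, hx, Matrix.mulVec_smul]
  · right
    rw [expect_mulVec, hM, expect_smul, expect, star_ket0_dotProduct, ket0, pauliXZ_mulVec_single,
      Pi.single_apply, if_neg (fun h => hx h.symm), mul_zero]

lemma I_pow_sq_eq_one {k : ℕ} (h : Complex.I ^ k * Complex.I ^ k = 1) :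
    Complex.I ^ k = 1 ∨ Complex.I ^ k = -1 := mul_self_eq_one_iff.1 h

lemma expect_of_eigen {ψ : (Q → Bit) → ℂ} (h : IsStab ψ) {M : Operator Q} {c : ℂ}
    (hM : M *ᵥ ψ = c • ψ) : expect ψ M = c := by
  have := h.expect_one
  rw [expect, Matrix.one_mulVec] at this
  rw [expect, hM, dotProduct_smul, this, smul_eq_mul, mul_one]

/-- The three cases for a Hermitian Pauli operator. -/
lemma IsStab.hermitian_cases {ψ : (Q → Bit) → ℂ} (h : IsStab ψ) {P : Operator Q} (hP : IsPauli P)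
    (hP2 : P * P = 1) :
    P *ᵥ ψ = ψ ∨ expect ψ P = -1 ∨ expect ψ P = 0 := by
  rcases h.pauli_cases hP with ⟨k, hk⟩ | h0
  · have h2 : (Complex.I ^ k * Complex.I ^ k) • ψ = (1 : ℂ) • ψ := by
      rw [← smul_smul, ← hk, ← Matrix.mulVec_smul, ← hk, Matrix.mulVec_mulVec, hP2,
        Matrix.one_mulVec, one_smul]
    have h3 := smul_left_injective ℂ h.ne_zero h2
    rcases I_pow_sq_eq_one h3 with h4 | h4
    · left; rw [hk, h4, one_smul]
    · right; left; rw [expect_of_eigen h hk, h4]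
  · exact Or.inr (Or.inr h0)

/-! ### The winning probability of commuting Pauli observables -/

lemma sum_fin_three {M : Type*} [AddCommMonoid M] (f : (Fin 3 → Bit) → M) :
    ∑ a, f a = ∑ a₀ : Bit, ∑ a₁ : Bit, ∑ a₂ : Bit, f ![a₀, a₁, a₂] := by
  let e : Bit × Bit × Bit ≃ (Fin 3 → Bit) :=
    { toFun := fun p => ![p.1, p.2.1, p.2.2]
      invFun := fun a => (a 0, a 1, a 2)
      left_inv := fun p => rfl
      right_inv := fun a => by ext i; fin_cases i <;> rfl }
  rw [← e.sum_comp, Fintype.sum_prod_type]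
  simp_rw [Fintype.sum_prod_type]
  rfl

lemma sum_bit {M : Type*} [AddCommMonoid M] (f : Bit → M) : ∑ b, f b = f 0 + f 1 :=
  Fin.sum_univ_two f

/-- The product of the eigenprojectors for given outcomes. -/
def outcomeOp (O : Fin 3 → Operator Q) (B : Operator Q) (a : Fin 3 → Bit) (b : Bit) : Operator Q :=
  eigenprojector (O 0) (a 0) * eigenprojector (O 1) (a 1) * eigenprojector (O 2) (a 2) *
    eigenprojector B b

/-- The operator whose expectation is the winning probability. -/
def winOp {n : ℕ} (q : Question n) (O : Fin 3 → Operator Q) (B : Operator Q) : Operator Q :=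
  ∑ a : Fin 3 → Bit, ∑ b : Bit, if q.Wins a b then outcomeOp O B a b else 0

lemma sum_wins {n : ℕ} {M : Type*} [AddCommMonoid M] (q : Question n) (f : (Fin 3 → Bit) → Bit → M) :
    (∑ a : Fin 3 → Bit, ∑ b : Bit, if q.Wins a b then f a b else 0) =
      ∑ a : Fin 3 → Bit, if ∑ l, a l = q.1.1.rhs then f a (a q.2) else 0 := by
  refine Finset.sum_congr rfl fun a _ => ?_
  rw [Finset.sum_eq_single (a q.2)]
  · simp [Question.Wins]
  · intro b _ hb
    rw [if_neg]
    rintro ⟨-, h⟩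
    exact hb h.symm
  · simp

lemma eigenprojector_eq (O : Operator Q) (b : Bit) :
    eigenprojector O b = (1 / 2 : ℂ) • (1 + sgn b • O) := rfl

/-- Winning is the conjunction of two sign conditions, parity and agreement, so the operator is the
product of `(1 + parity) / 2` and `(1 + agreement) / 2`. As `B` stands at the right of every
product, no commutation between `O` and `B` is required. -/
lemma winOp_eq {n : ℕ} (q : Question n) (O : Fin 3 → Operator Q) (B : Operator Q)
    (hO : ∀ s s', Commute (O s) (O s')) (hO2 : ∀ s, O s * O s = 1) :
    winOp q O B = (1 / 4 : ℂ) • (1 + sgn q.1.1.rhs • (O 0 * O 1 * O 2) + O q.2 * B +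
      sgn q.1.1.rhs • (O 0 * O 1 * O 2) * (O q.2 * B)) := by
  unfold winOp
  rw [sum_wins]
  obtain ⟨⟨r, hr⟩, s⟩ := q
  simp only
  generalize r.rhs = ρ
  have h10 : O 1 * O 0 = O 0 * O 1 := hO 1 0
  have h20 : O 2 * O 0 = O 0 * O 2 := hO 2 0
  have h21 : O 2 * O 1 = O 1 * O 2 := hO 2 1
  have h10' : ∀ X, O 1 * (O 0 * X) = O 0 * (O 1 * X) := fun X => by
    rw [← mul_assoc, h10, mul_assoc]
  have h20' : ∀ X, O 2 * (O 0 * X) = O 0 * (O 2 * X) := fun X => by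
    rw [← mul_assoc, h20, mul_assoc]
  have h21' : ∀ X, O 2 * (O 1 * X) = O 1 * (O 2 * X) := fun X => by
    rw [← mul_assoc, h21, mul_assoc]
  have h0 := hO2 0
  have h1 := hO2 1
  have h2 := hO2 2
  have h0' : ∀ X, O 0 * (O 0 * X) = X := fun X => by rw [← mul_assoc, h0, one_mul]
  have h1' : ∀ X, O 1 * (O 1 * X) = X := fun X => by rw [← mul_assoc, h1, one_mul]
  have h2' : ∀ X, O 2 * (O 2 * X) = X := fun X => by rw [← mul_assoc, h2, one_mul]
  simp only [sum_fin_three, sum_bit, Fin.sum_univ_three, outcomeOp]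
  have t : (1 + 1 : Bit) = 0 := by decide
  have d : (0 : Bit) ≠ 1 := by decide
  fin_cases s <;> rcases bit_cases ρ with rfl | rfl <;>
    simp [t, eigenprojector_eq] <;>
    simp only [mul_add, add_mul, mul_assoc, h10, h20, h21, h10', h20', h21', h0, h1, h2, h0', h1',
      h2', mul_one, one_mul, Matrix.smul_mul, Matrix.mul_smul, mul_neg, neg_mul, smul_smul,
      smul_add] <;> module

end
end
end MagicBCS

namespace MagicBCS
noncomputable section
set_option linter.unusedSectionVars false
set_option linter.unusedSimpArgs false

/-! ### The system has no solution in which all variables commute or anticommute -/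

section NoSolution

variable {E : Type*} [Ring E]

/-- Commutation within a constraint is not an assumption on a solution; it follows from the product
relation, since `b * a = c * c * b * a = c * a * b * b * a = c`. -/
lemma triple_comm {a b c : E} (ha : a * a = 1) (hb : b * b = 1) (hc : c * c = 1)
    (h : a * b * c = 1) : a * b = c ∧ b * a = c := by
  have h1 : a * b = c := by
    calc a * b = a * b * (c * c) := by rw [hc, mul_one]
      _ = (a * b * c) * c := by simp only [mul_assoc]
      _ = c := by rw [h, one_mul]
  refine ⟨h1, ?_⟩
  calc b * a = (c * c) * (b * a) := by rw [hc, one_mul]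
    _ = c * (a * b * (b * a)) := by rw [h1]; simp only [mul_assoc]
    _ = c * (a * (b * b) * a) := by simp only [mul_assoc]
    _ = c := by rw [hb, mul_one, ha, mul_one]

/-- A solution of the constraint system in a ring, where any two variables commute or
anticommute. -/
structure RingSolution (n : ℕ) (E : Type*) [Ring E] where
  G : Symbol n → E
  sq : ∀ v, G v * G v = 1
  comm : ∀ v w, G v * G w = G w * G v ∨ G v * G w = -(G w * G v)
  con : ∀ α : Constraint n,
    G (α.1.var 0) * G (α.1.var 1) * G (α.1.var 2) = if α.1.rhs = 0 then 1 else -1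

namespace RingSolution

variable {n : ℕ} (S : RingSolution n E)

lemma con' (α : RawCon n) (hα : α.Valid) (h : α.rhs = 0) :
    S.G (α.var 0) * S.G (α.var 1) = S.G (α.var 2) ∧
      S.G (α.var 1) * S.G (α.var 0) = S.G (α.var 2) :=
  triple_comm (S.sq _) (S.sq _) (S.sq _) (by simpa [h] using S.con ⟨α, hα⟩)

lemma y_eq {u v : Fin n} (h : u ≠ v) : S.G (.a u) * S.G (.a v) = S.G (.y s(u, v)) := by
  rcases lt_or_gt_of_ne h with h | h
  · exact (S.con' (.aay u v) h rfl).1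
  · rw [Sym2.eq_swap]; exact (S.con' (.aay v u) h rfl).2

lemma a_comm (u v : Fin n) : S.G (.a u) * S.G (.a v) = S.G (.a v) * S.G (.a u) := by
  by_cases h : u = v
  · rw [h]
  · rw [S.y_eq h, S.y_eq (Ne.symm h), Sym2.eq_swap]

lemma z_eq {u v : Fin n} (h : u ≠ v) :
    S.G (.x s(u, v)) * S.G (.y s(u, v)) = S.G (.z s(u, v)) ∧
      S.G (.y s(u, v)) * S.G (.x s(u, v)) = S.G (.z s(u, v)) := by
  rcases lt_or_gt_of_ne h with h | h
  · exact S.con' (.xyz u v) h rfl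
  · rw [Sym2.eq_swap]; exact S.con' (.xyz v u) h rfl

lemma c_eq {u v s t : Fin n} (huv : u ≠ v) (hst : s ≠ t) (hus : u ≠ s) (hut : u ≠ t) (hvs : v ≠ s)
    (hvt : v ≠ t) :
    S.G (.x s(u, v)) * S.G (.z s(s, t)) = S.G (.c s(u, v) s(s, t)) ∧
      S.G (.z s(s, t)) * S.G (.x s(u, v)) = S.G (.c s(u, v) s(s, t)) := by
  wlog h : u < v generalizing u v
  · rw [Sym2.eq_swap (a := u)]
    exact this huv.symm hvs hvt hus hut (lt_of_le_of_ne (not_lt.1 h) huv.symm)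
  wlog h' : s < t generalizing s t
  · rw [Sym2.eq_swap (a := s)]
    exact this hst.symm hut hus hvt hvs (lt_of_le_of_ne (not_lt.1 h') hst.symm)
  exact S.con' (.xzc u v s t) ⟨h, h', hus, hut, hvs, hvt⟩ rfl

lemma b_eq {u v s t : Fin n} (huv : u ≠ v) (hst : s ≠ t) (hus : u ≠ s) (hut : u ≠ t) (hvs : v ≠ s)
    (hvt : v ≠ t) :
    S.G (.x s(u, v)) * S.G (.x s(s, t)) = S.G (.b s(s(u, v), s(s, t))) ∧
      S.G (.x s(s, t)) * S.G (.x s(u, v)) = S.G (.b s(s(u, v), s(s, t))) := by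
  wlog h : u < v generalizing u v
  · rw [Sym2.eq_swap (a := u)]
    exact this huv.symm hvs hvt hus hut (lt_of_le_of_ne (not_lt.1 h) huv.symm)
  wlog h' : s < t generalizing s t
  · rw [Sym2.eq_swap (a := s)]
    exact this hst.symm hut hus hvt hvs (lt_of_le_of_ne (not_lt.1 h') hst.symm)
  rcases lt_or_gt_of_ne hus with h'' | h''
  · exact S.con' (.xxb u v s t) ⟨h, h', h'', hvs, hvt⟩ rfl
  · have := S.con' (.xxb s t u v) ⟨h', h, h'', hut.symm, hvt.symm⟩ rfl
    rw [Sym2.eq_swap (a := s(u, v))]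
    exact this.symm

/-- The system lists one `bbb` constraint for each set of four vertices, in increasing order. Its
three involutions commute and each is the product of the other two, so the relation survives any
position of `t` relative to `u < v < s`. -/
lemma bbb_eq {u v s t : Fin n} (huv : u < v) (hvs : v < s) (htu : t ≠ u) (htv : t ≠ v)
    (hts : t ≠ s) :
    S.G (.b s(s(u, v), s(s, t))) * S.G (.b s(s(v, s), s(u, t))) =
      S.G (.b s(s(s, u), s(v, t))) := by
  have key : ∀ {a b c : E}, a * a = 1 → b * b = 1 → c * c = 1 → a * b = c → a * c = b ∧ b * c = a := by
    intro a b c ha hb hc h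
    have h2 : b * a = c :=
      (triple_comm ha hb hc (by rw [h, hc])).2
    constructor
    · rw [← h, ← mul_assoc, ha, one_mul]
    · rw [← h2, ← mul_assoc, hb, one_mul]
  rcases lt_or_gt_of_ne hts with h3 | h3
  · rcases lt_or_gt_of_ne htv with h2 | h2
    · rcases lt_or_gt_of_ne htu with h1 | h1
      · have := S.con' (.bbb t u v s) ⟨h1, huv, hvs⟩ rfl
        simp only [RawCon.var, Matrix.cons_val] at this
        rw [Sym2.eq_swap (a := s(u, v)), Sym2.eq_swap (a := s), Sym2.eq_swap (a := s(v, s)),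
          Sym2.eq_swap (a := u) (b := t), Sym2.eq_swap (a := s(s, u)), Sym2.eq_swap (a := s) (b := u),
          Sym2.eq_swap (a := s(t, s))]
        exact this.2
      · have := S.con' (.bbb u t v s) ⟨h1, h2, hvs⟩ rfl
        simp only [RawCon.var, Matrix.cons_val] at this
        have := (key (S.sq _) (S.sq _) (S.sq _) this.2).2
        have h' := (triple_comm (S.sq _) (S.sq _) (S.sq _) (by rw [this, S.sq])).2
        rw [Sym2.eq_swap (a := u) (b := v), Sym2.eq_swap (a := s) (b := t),
          Sym2.eq_swap (a := s(v, s)), Sym2.eq_swap (a := s(s, u)), Sym2.eq_swap (a := s) (b := u),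
          Sym2.eq_swap (a := v) (b := t)]
        exact h'
    · have := S.con' (.bbb u v t s) ⟨huv, h2, h3⟩ rfl
      simp only [RawCon.var, Matrix.cons_val] at this
      have := (key (S.sq _) (S.sq _) (S.sq _) this.1).1
      rw [Sym2.eq_swap (a := s) (b := t), Sym2.eq_swap (a := s(v, s)), 
        Sym2.eq_swap (a := s(s, u)), Sym2.eq_swap (a := s) (b := u), Sym2.eq_swap (a := u) (b := t)]
      exact this
  · exact (S.con' (.bbb u v s t) ⟨huv, hvs, h3⟩ rfl).1

/-- Since `z = x y`, each `c` equals the corresponding `b` times a `y`, and the `ccc` constraint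
becomes `b₁ y_st b₂ y_ut = b₃ y_vt`. Moving `y_st` past `b₂` costs `ε`, and `b₁ b₂ = b₃` cancels,
which leaves `ε y_st y_ut = y_vt`. Written in the commuting involutions `a`, this is the claim. -/
lemma a_quad {u v s t : Fin n} (huv : u < v) (hvs : v < s) (htu : t ≠ u) (htv : t ≠ v)
    (hts : t ≠ s) {ε : E} (hε : ∀ w, w * ε = ε * w) (hε2 : ε * ε = 1)
    (h : S.G (.y s(s, t)) * S.G (.b s(s(v, s), s(u, t))) =
      ε * (S.G (.b s(s(v, s), s(u, t))) * S.G (.y s(s, t)))) :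
    S.G (.a t) * (S.G (.a s) * S.G (.a u) * S.G (.a v)) = ε := by
  have hus := huv.trans hvs
  have c_eq' : ∀ {p q r w : Fin n}, p ≠ q → r ≠ w → p ≠ r → p ≠ w → q ≠ r → q ≠ w →
      S.G (.c s(p, q) s(r, w)) = S.G (.b s(s(p, q), s(r, w))) * S.G (.y s(r, w)) := by
    intro p q r w h1 h2 h3 h4 h5 h6
    rw [← (S.c_eq h1 h2 h3 h4 h5 h6).1, ← (S.z_eq h2).1, ← mul_assoc,
      (S.b_eq h1 h2 h3 h4 h5 h6).1]
  have hc := (S.con' (.ccc u v s t) ⟨huv, hvs, htu, htv, hts⟩ rfl).1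
  simp only [RawCon.var, Matrix.cons_val] at hc
  rw [c_eq' huv.ne hts.symm hus.ne htu.symm hvs.ne htv.symm,
    c_eq' hvs.ne htu.symm huv.ne' htv.symm hus.ne' hts.symm,
    c_eq' hus.ne' htv.symm hvs.ne' hts.symm huv.ne htu.symm] at hc
  have hb := S.bbb_eq huv hvs htu htv hts
  set b₁ := S.G (.b s(s(u, v), s(s, t)))
  set b₂ := S.G (.b s(s(v, s), s(u, t)))
  set b₃ := S.G (.b s(s(s, u), s(v, t)))
  have hb3 : b₃ * b₃ = 1 := S.sq _
  have hy : ε * (S.G (.y s(s, t)) * S.G (.y s(u, t))) = S.G (.y s(v, t)) := by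
    have h1 : b₃ * (ε * (S.G (.y s(s, t)) * S.G (.y s(u, t)))) = b₃ * S.G (.y s(v, t)) := by
      rw [← hc, ← mul_assoc, hε, ← hb]
      calc ε * (b₁ * b₂) * (S.G (.y s(s, t)) * S.G (.y s(u, t)))
          = (b₁ * ε) * (b₂ * S.G (.y s(s, t))) * S.G (.y s(u, t)) := by
            rw [hε b₁]; simp only [mul_assoc]
        _ = b₁ * (ε * (b₂ * S.G (.y s(s, t)))) * S.G (.y s(u, t)) := by
            simp only [mul_assoc]
        _ = _ := by rw [← h]; simp only [mul_assoc]
    calc _ = b₃ * b₃ * (ε * (S.G (.y s(s, t)) * S.G (.y s(u, t)))) := by rw [hb3, one_mul]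
      _ = b₃ * b₃ * S.G (.y s(v, t)) := by rw [mul_assoc, h1, mul_assoc]
      _ = _ := by rw [hb3, one_mul]
  rw [← S.y_eq hts.symm, ← S.y_eq htu.symm, ← S.y_eq htv.symm, S.a_comm u t] at hy
  have h2 : S.G (.a s) * S.G (.a t) * (S.G (.a t) * S.G (.a u)) = S.G (.a s) * S.G (.a u) := by
    calc _ = S.G (.a s) * (S.G (.a t) * S.G (.a t)) * S.G (.a u) := by simp only [mul_assoc]
      _ = _ := by rw [S.sq, mul_one]
  rw [h2] at hy
  have h3 : S.G (.a s) * S.G (.a u) = ε * (S.G (.a v) * S.G (.a t)) := by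
    rw [← hy, ← mul_assoc, hε2, one_mul]
  rw [h3, ← mul_assoc, ← mul_assoc, hε]
  calc _ = ε * (S.G (.a t) * (S.G (.a v) * S.G (.a t)) * S.G (.a v)) := by simp only [mul_assoc]
    _ = ε * ((S.G (.a t) * S.G (.a v)) * (S.G (.a t) * S.G (.a v))) := by simp only [mul_assoc]
    _ = ε := by
      rw [S.a_comm t v]
      have : S.G (.a v) * S.G (.a t) * (S.G (.a v) * S.G (.a t)) = 1 := by
        rw [S.a_comm v t]
        calc _ = S.G (.a t) * (S.G (.a v) * S.G (.a t)) * S.G (.a v) := by simp only [mul_assoc]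
          _ = S.G (.a t) * (S.G (.a t) * S.G (.a v)) * S.G (.a v) := by rw [S.a_comm v t]
          _ = (S.G (.a t) * S.G (.a t)) * (S.G (.a v) * S.G (.a v)) := by simp only [mul_assoc]
          _ = 1 := by rw [S.sq, S.sq, one_mul]
      rw [this, mul_one]

/-- The only use of the dichotomy between commuting and anticommuting: it makes the `ε` of `a_quad`
a sign. The operator solution used for the device must violate the dichotomy. -/
lemma a_quad_sign {u v s t : Fin n} (huv : u < v) (hvs : v < s) (htu : t ≠ u) (htv : t ≠ v)
    (hts : t ≠ s) :
    S.G (.a t) * (S.G (.a s) * S.G (.a u) * S.G (.a v)) = 1 ∨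
      S.G (.a t) * (S.G (.a s) * S.G (.a u) * S.G (.a v)) = -1 := by
  rcases S.comm (.y s(s, t)) (.b s(s(v, s), s(u, t))) with h | h
  · exact Or.inl (S.a_quad huv hvs htu htv hts (by simp) (by simp) (by simpa using h))
  · exact Or.inr (S.a_quad huv hvs htu htv hts (by simp) (by simp) (by simpa using h))

lemma exists_three (hn : 6 ≤ n) (t t' : Fin n) : ∃ u v s : Fin n, u < v ∧ v < s ∧
    (t ≠ u ∧ t ≠ v ∧ t ≠ s) ∧ (t' ≠ u ∧ t' ≠ v ∧ t' ≠ s) := by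
  have hc : 3 ≤ (Finset.univ \ {t, t'} : Finset (Fin n)).card := by
    have := Finset.le_card_sdiff {t, t'} (Finset.univ : Finset (Fin n))
    have h2 := Finset.card_le_two (a := t) (b := t')
    rw [Finset.card_univ, Fintype.card_fin] at this
    omega
  obtain ⟨T, hT, hT3⟩ := Finset.exists_subset_card_eq hc
  have mem : ∀ i, t ≠ T.orderEmbOfFin hT3 i ∧ t' ≠ T.orderEmbOfFin hT3 i := by
    intro i
    have := hT (T.orderEmbOfFin_mem hT3 i)
    simp only [Finset.mem_sdiff, Finset.mem_insert, Finset.mem_singleton, not_or] at this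
    exact ⟨fun h => this.2.1 h.symm, fun h => this.2.2 h.symm⟩
  exact ⟨_, _, _, (T.orderEmbOfFin hT3).strictMono (show (0 : Fin 3) < 1 by decide),
    (T.orderEmbOfFin hT3).strictMono (show (1 : Fin 3) < 2 by decide),
    ⟨(mem 0).1, (mem 1).1, (mem 2).1⟩, ⟨(mem 0).2, (mem 1).2, (mem 2).2⟩⟩

lemma mul_right_cancel_of_quad {u v s : Fin n} {p q : E}
    (h : p * (S.G (.a s) * S.G (.a u) * S.G (.a v)) = q * (S.G (.a s) * S.G (.a u) * S.G (.a v))) :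
    p = q := by
  have inv : S.G (.a s) * S.G (.a u) * S.G (.a v) * (S.G (.a v) * S.G (.a u) * S.G (.a s)) = 1 := by
    calc _ = S.G (.a s) * (S.G (.a u) * (S.G (.a v) * S.G (.a v)) * S.G (.a u)) * S.G (.a s) := by
          simp only [mul_assoc]
      _ = 1 := by rw [S.sq, mul_one, S.sq, mul_one, S.sq]
  calc p = p * (S.G (.a s) * S.G (.a u) * S.G (.a v) * (S.G (.a v) * S.G (.a u) * S.G (.a s))) := by
        rw [inv, mul_one]
    _ = q * (S.G (.a s) * S.G (.a u) * S.G (.a v) * (S.G (.a v) * S.G (.a u) * S.G (.a s))) := by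
        rw [← mul_assoc, h, mul_assoc]
    _ = q := by rw [inv, mul_one]

/-- Compare two quadruples that share the three vertices `u`, `v`, `s` and differ in the fourth. -/
lemma a_eq_or (hn : 6 ≤ n) (t t' : Fin n) :
    S.G (.a t) = S.G (.a t') ∨ S.G (.a t) = -S.G (.a t') := by
  obtain ⟨u, v, s, huv, hvs, ⟨h1, h2, h3⟩, ⟨h1', h2', h3'⟩⟩ := exists_three hn t t'
  rcases S.a_quad_sign huv hvs h1 h2 h3 with h | h <;>
    rcases S.a_quad_sign huv hvs h1' h2' h3' with h' | h'
  · exact Or.inl (S.mul_right_cancel_of_quad (h.trans h'.symm))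
  · refine Or.inr (S.mul_right_cancel_of_quad (u := u) (v := v) (s := s) ?_)
    rw [h, neg_mul, h', neg_neg]
  · refine Or.inr (S.mul_right_cancel_of_quad (u := u) (v := v) (s := s) ?_)
    rw [h, neg_mul, h']
  · exact Or.inl (S.mul_right_cancel_of_quad (h.trans h'.symm))

/-- By `a_eq_or` each `y_st = a_s a_t` is a sign and hence central. So `a_quad` applies with `ε =
1`, all products of four are 1, and the comparison of quadruples no longer leaves a sign. -/
lemma a_eq (hn : 6 ≤ n) (t t' : Fin n) : S.G (.a t) = S.G (.a t') := by
  have quad : ∀ {u v s t : Fin n}, u < v → v < s → t ≠ u → t ≠ v → t ≠ s →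
      S.G (.a t) * (S.G (.a s) * S.G (.a u) * S.G (.a v)) = 1 := by
    intro u v s t huv hvs htu htv hts
    refine S.a_quad huv hvs htu htv hts (by simp) (by simp) ?_
    rw [one_mul, ← S.y_eq hts.symm]
    rcases S.a_eq_or hn s t with h | h <;> rw [h] <;> simp [S.sq]
  obtain ⟨u, v, s, huv, hvs, ⟨h1, h2, h3⟩, ⟨h1', h2', h3'⟩⟩ := exists_three hn t t'
  exact S.mul_right_cancel_of_quad ((quad huv hvs h1 h2 h3).trans (quad huv hvs h1' h2' h3').symm)

/-- The variable with index `k + 1` is a product of `k + 2` equal involutions, so it alternates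
between 1 and their common value. -/
lemma h_eq (hn : 6 ≤ n) (k : ℕ) (hk : k + 4 ≤ n) :
    S.G (.h ⟨k + 1, by omega⟩) = if Even k then 1 else S.G (.a ⟨0, by omega⟩) := by
  induction k with
  | zero =>
    have := (S.con' (.chain ⟨1, by omega⟩) ⟨by simp, by simp; omega⟩
      (by simp [RawCon.rhs]; omega)).1
    have h1 : ¬ (1 + 2 = n) := by omega
    simp only [RawCon.var, Matrix.cons_val, if_true, if_neg h1] at this
    rw [S.a_eq hn ⟨1, by omega⟩ ⟨0, by omega⟩, S.sq] at this
    simp [← this]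
  | succ k ih =>
    have := (S.con' (.chain ⟨k + 1 + 1, by omega⟩) ⟨by simp, by simp; omega⟩
      (by simp [RawCon.rhs]; omega)).1
    have h1 : ¬ (k + 1 + 1 + 2 = n) := by omega
    simp only [RawCon.var, Matrix.cons_val, if_neg h1,
      if_neg (show ¬ (k + 1 + 1 = 1) by omega), Nat.add_sub_cancel] at this
    rw [← this, ih (by omega), S.a_eq hn ⟨k + 1 + 1, by omega⟩ ⟨0, by omega⟩]
    by_cases hk : Even k
    · simp [hk, Nat.even_add_one]
    · simp [hk, Nat.even_add_one, S.sq]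

/-- The last constraint of the chain multiplies `h` with index `n - 3`, which is a product of the
even number `n - 2` of equal involutions and hence 1, by two further equal involutions. The product
is therefore 1, while the constraint demands -1. -/
theorem one_eq_neg_one (S : RingSolution n E) (hn : 6 ≤ n) (heven : Even n) : (1 : E) = -1 := by
  have hlt : n - 2 < n := by omega
  have hnn : n - 2 + 2 = n := by omega
  have h := S.con ⟨.chain ⟨n - 2, hlt⟩, by simp; omega, by simp; omega⟩
  simp only [RawCon.var, RawCon.rhs, Matrix.cons_val, if_pos hnn, one_ne_zero, if_false,
    if_neg (show ¬ (n - 2 = 1) by omega)] at h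
  rw [mul_assoc, S.a_eq hn ⟨n - 1, by omega⟩ ⟨n - 2, hlt⟩, S.sq, mul_one] at h
  have h2 := S.h_eq hn (n - 4) (by omega)
  have he : Even (n - 4) := by
    rw [Nat.even_sub (by omega)]; simp [heven]; decide
  rw [if_pos he] at h2
  have : (⟨n - 4 + 1, by omega⟩ : Fin n) = ⟨n - 2 - 1, by omega⟩ := by
    ext; simp; omega
  rw [this] at h2
  exact h2.symm.trans h

end RingSolution

end NoSolution


/-! ### Commuting Pauli observables -/

section

variable {Q : Type} [Fintype Q] [DecidableEq Q]

/-- Pauli observables for both players of the game.  The observables of Alice commute with those of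
Bob, but the players need not act on different qubits. -/
structure PauliStrategy (n : ℕ) (Q : Type) [Fintype Q] [DecidableEq Q] where
  obsA : Constraint n → Fin 3 → Operator Q
  obsB : Variable n → Operator Q
  pauliA : ∀ α s, IsPauli (obsA α s)
  pauliB : ∀ β, IsPauli (obsB β)
  sqA : ∀ α s, obsA α s * obsA α s = 1
  sqB : ∀ β, obsB β * obsB β = 1
  commA : ∀ α s s', Commute (obsA α s) (obsA α s')
  commAB : ∀ α s β, Commute (obsA α s) (obsB β)

namespace PauliStrategy

variable {n : ℕ} (S : PauliStrategy n Q) (ψ : (Q → Bit) → ℂ)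

/-- The winning probability for one question. -/
def questionValue (q : Question n) : ℝ := (expect ψ (winOp q (S.obsA q.1) (S.obsB q.bob))).re

/-- The signed product of Alice's observables for a constraint. -/
def parityOp (α : Constraint n) : Operator Q :=
  sgn α.1.rhs • (S.obsA α 0 * S.obsA α 1 * S.obsA α 2)

/-- The correlation operator of a question. -/
def agreeOp (q : Question n) : Operator Q := S.obsA q.1 q.2 * S.obsB q.bob

lemma winOp_eq' (q : Question n) : winOp q (S.obsA q.1) (S.obsB q.bob) =
    (1 / 4 : ℂ) • (1 + S.parityOp q.1 + S.agreeOp q + S.parityOp q.1 * S.agreeOp q) :=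
  winOp_eq q _ _ (S.commA q.1) (S.sqA q.1)

lemma isPauli_parityOp (α : Constraint n) : IsPauli (S.parityOp α) :=
  IsPauliOn.sgn_smul (((S.pauliA _ _).mul (S.pauliA _ _)).mul (S.pauliA _ _)) _

lemma isPauli_agreeOp (q : Question n) : IsPauli (S.agreeOp q) :=
  (S.pauliA _ _).mul (S.pauliB _)

lemma _root_.Commute.mul_mul_self {M : Type*} [Monoid M] {a b : M} (h : Commute a b)
    (ha : a * a = 1) (hb : b * b = 1) : a * b * (a * b) = 1 := by
  rw [mul_assoc, ← mul_assoc b, ← h.eq, mul_assoc a, hb, mul_one, ha]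

lemma parityOp_sq (α : Constraint n) : S.parityOp α * S.parityOp α = 1 := by
  rw [parityOp, Matrix.smul_mul, Matrix.mul_smul, smul_smul, sgn_mul_self, one_smul]
  refine Commute.mul_mul_self ((S.commA α 0 2).mul_left (S.commA α 1 2)) ?_ (S.sqA _ _)
  exact Commute.mul_mul_self (S.commA α 0 1) (S.sqA _ _) (S.sqA _ _)

lemma agreeOp_sq (q : Question n) : S.agreeOp q * S.agreeOp q = 1 :=
  Commute.mul_mul_self (S.commAB _ _ _) (S.sqA _ _) (S.sqB _)

lemma commute_parityOp_agreeOp (q : Question n) : Commute (S.parityOp q.1) (S.agreeOp q) := by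
  refine Commute.smul_left ?_ _
  have h : ∀ s, Commute (S.obsA q.1 s) (S.agreeOp q) := fun s =>
    (S.commA q.1 s q.2).mul_right (S.commAB q.1 s q.bob)
  exact ((h 0).mul_left (h 1)).mul_left (h 2)

variable {ψ}

/-- Let `p`, `r`, `m` be the expectations of the parity operator, the agreement operator and their
product, so that the value is `(1 + p + r + m) / 4`. Each of them is 1, 0 or -1, and is 1 only if
the operator fixes the state. If one of the two operators fixes the state, `m` is the expectation of
the other, and the value is half of one plus that expectation. If neither does, then `p, r ≤ 0` and
`m ≤ 1`. -/
lemma questionValue_cases (hψ : IsStab ψ) (q : Question n) :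
    (S.parityOp q.1 *ᵥ ψ = ψ ∧ S.agreeOp q *ᵥ ψ = ψ) ∨ S.questionValue ψ q ≤ 1 / 2 := by
  have hv : S.questionValue ψ q = (1 / 4) * (1 + (expect ψ (S.parityOp q.1)).re +
      (expect ψ (S.agreeOp q)).re + (expect ψ (S.parityOp q.1 * S.agreeOp q)).re) := by
    rw [questionValue, winOp_eq', expect_smul, expect_add, expect_add, expect_add, hψ.expect_one]
    rw [show (1 / 4 : ℂ) = ((1 / 4 : ℝ) : ℂ) by push_cast; rfl, Complex.re_ofReal_mul]
    simp
  have c := S.commute_parityOp_agreeOp q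
  have one : ∀ {M : Operator Q}, M *ᵥ ψ = ψ → expect ψ M = 1 := fun h =>
    expect_of_eigen hψ (by rw [h, one_smul])
  have h12 : S.agreeOp q *ᵥ ψ = ψ →
      expect ψ (S.parityOp q.1 * S.agreeOp q) = expect ψ (S.parityOp q.1) := fun h => by
    rw [expect, ← Matrix.mulVec_mulVec, h]; rfl
  have h21 : S.parityOp q.1 *ᵥ ψ = ψ →
      expect ψ (S.parityOp q.1 * S.agreeOp q) = expect ψ (S.agreeOp q) := fun h => by
    rw [c.eq, expect, ← Matrix.mulVec_mulVec, h]; rfl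
  have le : ∀ {M : Operator Q}, (expect ψ M = -1 ∨ expect ψ M = 0) → (expect ψ M).re ≤ 0 := by
    rintro M (h | h) <;> rw [h] <;> simp
  rcases hψ.hermitian_cases (S.isPauli_parityOp q.1) (S.parityOp_sq q.1) with h1 | h1
  · rcases hψ.hermitian_cases (S.isPauli_agreeOp q) (S.agreeOp_sq q) with h2 | h2
    · exact Or.inl ⟨h1, h2⟩
    · right
      have := le h2
      rw [hv, h21 h1, one h1, Complex.one_re]
      linarith
  · right
    have l1 := le h1
    rcases hψ.hermitian_cases (S.isPauli_agreeOp q) (S.agreeOp_sq q) with h2 | h2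
    · rw [hv, h12 h2, one h2, Complex.one_re]
      linarith
    · have l2 := le h2
      have l3 : (expect ψ (S.parityOp q.1 * S.agreeOp q)).re ≤ 1 := by
        rcases hψ.hermitian_cases ((S.isPauli_parityOp q.1).mul (S.isPauli_agreeOp q))
          (c.mul_mul_self (S.parityOp_sq q.1) (S.agreeOp_sq q)) with h | h
        · rw [one h, Complex.one_re]
        · exact (le h).trans zero_le_one
      rw [hv]; linarith

lemma questionValue_le_one (hψ : IsStab ψ) (q : Question n) : S.questionValue ψ q ≤ 1 := by
  rcases S.questionValue_cases hψ q with ⟨h1, h2⟩ | h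
  · have one : ∀ {M : Operator Q}, M *ᵥ ψ = ψ → expect ψ M = 1 := fun h =>
      expect_of_eigen hψ (by rw [h, one_smul])
    rw [questionValue, winOp_eq', expect_smul, expect_add, expect_add, expect_add, hψ.expect_one,
      one h1, one h2, one (by rw [← Matrix.mulVec_mulVec, h2, h1])]
    norm_num
  · linarith

/-- The space generated from the state by Bob's observables. -/
def bobSpace (ψ : (Q → Bit) → ℂ) : Submodule ℂ ((Q → Bit) → ℂ) :=
  (Subalgebra.toSubmodule (Algebra.adjoin ℂ (Set.range S.obsB))).map
    ((LinearMap.applyₗ ψ).comp (Matrix.toLin' (n := Q → Bit) (m := Q → Bit) (R := ℂ)).toLinearMap)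

lemma mem_bobSpace {v : (Q → Bit) → ℂ} : v ∈ S.bobSpace ψ ↔
    ∃ T ∈ Algebra.adjoin ℂ (Set.range S.obsB), T *ᵥ ψ = v := by
  simp [bobSpace, Submodule.mem_map]

lemma obsB_mulVec_mem (β : Variable n) {v : (Q → Bit) → ℂ} (hv : v ∈ S.bobSpace ψ) :
    (Matrix.toLin' (S.obsB β)) v ∈ S.bobSpace ψ := by
  obtain ⟨T, hT, rfl⟩ := S.mem_bobSpace.1 hv
  rw [S.mem_bobSpace]
  exact ⟨S.obsB β * T, mul_mem (Algebra.subset_adjoin ⟨β, rfl⟩) hT, by simp⟩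

/-- Bob's observable on `bobSpace`. -/
def bobEnd (ψ : (Q → Bit) → ℂ) (β : Variable n) : Module.End ℂ (S.bobSpace ψ) :=
  (Matrix.toLin' (S.obsB β)).restrict fun _ hv => S.obsB_mulVec_mem β hv

/-- No strategy is perfect. -/
theorem exists_not_perfect (hn : 6 ≤ n) (heven : Even n) (hψ : IsStab ψ) :
    ∃ q : Question n, S.questionValue ψ q ≤ 1 / 2 := by
  by_contra hcon
  push Not at hcon
  have perfect : ∀ q : Question n, S.parityOp q.1 *ᵥ ψ = ψ ∧ S.agreeOp q *ᵥ ψ = ψ := fun q =>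
    (S.questionValue_cases hψ q).resolve_right (not_le.2 (hcon q))
  -- Perfect agreement allows exchanging Bob's observables and Alice's next to the state. Moving the
  -- three factors of `W α` over to Alice one after the other, past her commuting observables, shows
  -- below that `W α` acts on the state by the right-hand side of `α`.
  have hBA : ∀ q : Question n, S.obsB q.bob *ᵥ ψ = S.obsA q.1 q.2 *ᵥ ψ := by
    intro q
    conv_rhs => rw [← (perfect q).2]
    rw [agreeOp, Matrix.mulVec_mulVec, ← mul_assoc, S.sqA, one_mul]
  let W : Constraint n → Operator Q := fun α =>
    S.obsB (Question.bob (α, 0)) * S.obsB (Question.bob (α, 1)) * S.obsB (Question.bob (α, 2))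
  have hW : ∀ α, W α *ᵥ ψ = sgn α.1.rhs • ψ := by
    intro α
    have e : W α *ᵥ ψ = (S.obsA α 0 * S.obsA α 1 * S.obsA α 2) *ᵥ ψ := by
      have c := S.commA α
      have cAB := fun s β => (S.commAB α s β).eq
      have b0 := hBA (α, 0)
      have b1 := hBA (α, 1)
      have b2 := hBA (α, 2)
      simp only at b0 b1 b2
      simp only [W, mul_assoc, ← Matrix.mulVec_mulVec, b2]
      rw [Matrix.mulVec_mulVec _ (S.obsB _) (S.obsA α 2), ← cAB, ← Matrix.mulVec_mulVec, b1,
        Matrix.mulVec_mulVec, Matrix.mulVec_mulVec, mul_assoc,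
        ← ((S.commAB α 2 _).mul_left (S.commAB α 1 _)).eq, ← Matrix.mulVec_mulVec, b0]
      simp only [Matrix.mulVec_mulVec]
      congr 1
      rw [(c 2 1).eq, ((c 1 0).mul_left (c 2 0)).eq]
    have h := (perfect (α, 0)).1
    simp only [parityOp, Matrix.smul_mulVec] at h
    rw [e]
    conv_rhs => rw [← h]
    rw [smul_smul, sgn_mul_self, one_smul]
  have hWP : ∀ α, IsPauli (W α) := fun α =>
    ((S.pauliB _).mul (S.pauliB _)).mul (S.pauliB _)
  -- Every variable `β` occurs in some constraint, so its observable can be traded on the state for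
  -- one of Alice's, with which `W α` commutes. Thus `W α` has the same sign on `obsB β *ᵥ ψ` as on
  -- `ψ`, whereas anticommutation would give the opposite sign on this nonzero vector.
  have hWB : ∀ α β, Commute (W α) (S.obsB β) := by
    intro α β
    obtain ⟨α', s, hβ⟩ := β.2
    have hβ' : β = Question.bob (α', s) := Subtype.ext hβ.symm
    rcases (hWP α).commute_or (S.pauliB β) with h | h
    · exact h
    · exfalso
      have e1 : (W α * S.obsB β) *ᵥ ψ = sgn α.1.rhs • (S.obsB β *ᵥ ψ) := by
        have cWA : Commute (W α) (S.obsA α' s) :=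
          (((S.commAB α' s _).mul_right (S.commAB α' s _)).mul_right (S.commAB α' s _)).symm
        rw [← Matrix.mulVec_mulVec, hβ', hBA, Matrix.mulVec_mulVec, cWA.eq, ← Matrix.mulVec_mulVec,
          hW, Matrix.mulVec_smul]
      have e2 : (S.obsB β * W α) *ᵥ ψ = sgn α.1.rhs • (S.obsB β *ᵥ ψ) := by
        rw [← Matrix.mulVec_mulVec, hW, Matrix.mulVec_smul]
      rw [h, Matrix.neg_mulVec, e2] at e1
      have e3 : sgn α.1.rhs • (S.obsB β *ᵥ ψ) = 0 := self_eq_neg.1 e1.symm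
      rw [smul_eq_zero, or_iff_right (sgn_ne_zero _)] at e3
      apply hψ.ne_zero
      calc ψ = (S.obsB β * S.obsB β) *ᵥ ψ := by rw [S.sqB, Matrix.one_mulVec]
        _ = 0 := by rw [← Matrix.mulVec_mulVec, e3, Matrix.mulVec_zero]
  -- Commuting with the whole algebra, `W α` acts as its sign on all of `bobSpace` and not only on
  -- the state. This makes the constraints operator identities there.
  have hWT : ∀ α, ∀ T ∈ Algebra.adjoin ℂ (Set.range S.obsB), Commute (W α) T := by
    intro α T hT
    have : Algebra.adjoin ℂ (Set.range S.obsB) ≤ Subalgebra.centralizer ℂ {W α} := by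
      apply Algebra.adjoin_le
      rintro _ ⟨β, rfl⟩
      rw [SetLike.mem_coe, Subalgebra.mem_centralizer_iff]
      rintro _ rfl
      exact hWB α β
    exact (Subalgebra.mem_centralizer_iff ℂ).1 (this hT) _ rfl
  classical
  -- Symbols that occur in no constraint get the value 1, which satisfies the axioms of a ring
  -- solution trivially.
  let G : Symbol n → Module.End ℂ (S.bobSpace ψ) := fun v =>
    if h : ∃ (α : Constraint n) (s : Fin 3), α.1.var s = v then S.bobEnd ψ ⟨v, h⟩ else 1
  have hG : ∀ α s, G (α.1.var s) = S.bobEnd ψ (Question.bob (α, s)) := fun α s =>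
    dif_pos ⟨α, s, rfl⟩
  let R : RingSolution n (Module.End ℂ (S.bobSpace ψ)) :=
    { G := G
      sq := by
        intro v
        by_cases h : ∃ (α : Constraint n) (s : Fin 3), α.1.var s = v
        · simp only [G, dif_pos h]
          ext w
          simp only [bobEnd, Module.End.mul_apply, LinearMap.restrict_apply, Matrix.toLin'_apply,
            Matrix.mulVec_mulVec, S.sqB, Matrix.one_mulVec, Module.End.one_apply]
        · simp only [G, dif_neg h, mul_one]
      comm := by
        intro v w
        by_cases h : ∃ (α : Constraint n) (s : Fin 3), α.1.var s = v
        · by_cases h' : ∃ (α : Constraint n) (s : Fin 3), α.1.var s = w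
          · simp only [G, dif_pos h, dif_pos h']
            rcases (S.pauliB ⟨v, h⟩).commute_or (S.pauliB ⟨w, h'⟩) with c | c
            · left
              ext u
              simp only [bobEnd, Module.End.mul_apply, LinearMap.restrict_apply,
                Matrix.toLin'_apply, Matrix.mulVec_mulVec, c]
            · right
              ext u
              simp only [bobEnd, Module.End.mul_apply, LinearMap.restrict_apply,
                Matrix.toLin'_apply, Matrix.mulVec_mulVec, c, LinearMap.neg_apply,
                Matrix.neg_mulVec, Submodule.coe_neg]
          · left; simp only [G, dif_neg h', mul_one, one_mul]
        · left; simp only [G, dif_neg h, mul_one, one_mul]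
      con := by
        intro α
        simp only [hG]
        have : (if α.1.rhs = 0 then (1 : Module.End ℂ (S.bobSpace ψ)) else -1) =
            sgn α.1.rhs • 1 := by
          rcases bit_cases α.1.rhs with h | h
          · simp [h]
          · rw [h, if_neg one_ne_zero, sgn_one]
            ext u : 1
            rw [LinearMap.smul_apply, LinearMap.neg_apply, Module.End.one_apply, neg_one_smul]
        rw [this]
        ext ⟨u, hu⟩
        obtain ⟨T, hT, rfl⟩ := S.mem_bobSpace.1 hu
        simp only [bobEnd, Module.End.mul_apply, LinearMap.restrict_apply,
          Matrix.toLin'_apply, Matrix.mulVec_mulVec, LinearMap.smul_apply, Module.End.one_apply,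
          Submodule.coe_smul]
        have : S.obsB (Question.bob (α, 0)) * (S.obsB (Question.bob (α, 1)) *
            (S.obsB (Question.bob (α, 2)) * T)) = W α * T := by simp only [W, mul_assoc]
        simp only [mul_assoc, this]
        rw [(hWT α T hT).eq, ← Matrix.mulVec_mulVec, hW, Matrix.mulVec_smul] }
  have h1 := R.one_eq_neg_one hn heven
  have hψm : ψ ∈ S.bobSpace ψ := S.mem_bobSpace.2 ⟨1, one_mem _, Matrix.one_mulVec _⟩
  have h2 := congrArg (fun f : Module.End ℂ (S.bobSpace ψ) => ((f ⟨ψ, hψm⟩ : S.bobSpace ψ) :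
    (Q → Bit) → ℂ)) h1
  simp only [Module.End.one_apply, LinearMap.neg_apply, Submodule.coe_neg] at h2
  exact hψ.ne_zero (self_eq_neg.1 h2)

/-- The winning probability for a uniformly random question. -/
def value (ψ : (Q → Bit) → ℂ) : ℝ :=
  (∑ q : Question n, S.questionValue ψ q) / Fintype.card (Question n)

theorem value_le (hn : 6 ≤ n) (heven : Even n) (hψ : IsStab ψ) :
    S.value ψ ≤ 1 - 1 / (2 * (Fintype.card (Question n) : ℝ)) := by
  obtain ⟨q₀, hq₀⟩ := S.exists_not_perfect hn heven hψ
  have hpos : (0 : ℝ) < Fintype.card (Question n) := by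
    exact_mod_cast Fintype.card_pos_iff.2 ⟨q₀⟩
  have hsum : ∑ q : Question n, S.questionValue ψ q ≤
      ∑ q : Question n, (1 - if q = q₀ then (1 / 2 : ℝ) else 0) := by
    refine Finset.sum_le_sum fun q _ => ?_
    split_ifs with h
    · subst h; linarith
    · linarith [S.questionValue_le_one hψ q]
  rw [Finset.sum_sub_distrib] at hsum
  simp only [Finset.sum_const, Finset.card_univ, nsmul_eq_mul, mul_one, Finset.sum_ite_eq',
    Finset.mem_univ, if_true] at hsum
  rw [value, div_le_iff₀ hpos]
  have : (1 - 1 / (2 * (Fintype.card (Question n) : ℝ))) * Fintype.card (Question n) =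
      Fintype.card (Question n) - 1 / 2 := by field_simp
  rw [this]; exact hsum

end PauliStrategy

end
end
end MagicBCS

open scoped Kronecker
namespace MagicBCS
noncomputable section
set_option linter.unusedSectionVars false
set_option linter.unusedSimpArgs false

/-! ### Clifford strategies and relabelling of qubits -/

namespace CliffordStrategy

variable {n : ℕ} (S : CliffordStrategy n)

/-- The observables of a Clifford strategy. -/
def toPauli : PauliStrategy n (Fin S.m) where
  obsA := S.obsA
  obsB := S.obsB
  pauliA α s := (S.obsA_pauli α s).isPauli
  pauliB β := (S.obsB_pauli β).isPauli
  sqA α s := (S.obsA_pauli α s).isPauli.mul_self (S.obsA_hermitian α s)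
  sqB β := (S.obsB_pauli β).isPauli.mul_self (S.obsB_hermitian β)
  commA := S.obsA_commute
  commAB α s β := (S.obsA_pauli α s).commute_of_disjoint disjoint_compl_right (S.obsB_pauli β)

lemma isStab_state : IsStab S.state := ⟨S.prep, S.prep_clifford, rfl⟩

lemma winProb_eq : S.winProb = S.toPauli.value S.state := by
  rw [winProb, PauliStrategy.value]
  congr 1
  refine Finset.sum_congr rfl fun q _ => ?_
  rw [PauliStrategy.questionValue, winOp, expect_sum, Complex.re_sum]
  refine Finset.sum_congr rfl fun a _ => ?_
  rw [expect_sum, Complex.re_sum]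
  refine Finset.sum_congr rfl fun b _ => ?_
  split_ifs
  · rfl
  · rw [expect_zero, Complex.zero_re]

end CliffordStrategy

theorem pClif_le {n : ℕ} (hn : 6 ≤ n) (heven : Even n) :
    pClif n ≤ 1 - 1 / (2 * (Fintype.card (Question n) : ℝ)) := by
  refine Real.sSup_le (fun x hx => ?_) ?_
  · have : convexHull ℝ (Set.range (CliffordStrategy.winProb (n := n))) ⊆
        Set.Iic (1 - 1 / (2 * (Fintype.card (Question n) : ℝ))) := by
      apply convexHull_min _ (convex_Iic _)
      rintro _ ⟨S, rfl⟩
      rw [Set.mem_Iic, S.winProb_eq]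
      exact S.toPauli.value_le hn heven S.isStab_state
    exact this hx
  · rcases Nat.eq_zero_or_pos (Fintype.card (Question n)) with h | h
    · simp [h]
    · have h1 : (1 : ℝ) ≤ Fintype.card (Question n) := by exact_mod_cast h
      rw [sub_nonneg, div_le_one (by positivity)]
      linarith

lemma PauliStrategy.value_le_one {n : ℕ} {Q : Type} [Fintype Q] [DecidableEq Q]
    (S : PauliStrategy n Q) {ψ : (Q → Bit) → ℂ} (hψ : IsStab ψ) : S.value ψ ≤ 1 := by
  refine div_le_one_of_le₀ ?_ (by positivity)
  calc ∑ q : Question n, S.questionValue ψ q ≤ ∑ _q : Question n, (1 : ℝ) :=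
        Finset.sum_le_sum fun q _ => S.questionValue_le_one hψ q
    _ = _ := by simp

lemma CliffordStrategy.winProb_le_pClif {n : ℕ} (S : CliffordStrategy n) : S.winProb ≤ pClif n := by
  refine le_csSup ⟨1, ?_⟩ (subset_convexHull ℝ _ ⟨S, rfl⟩)
  have : convexHull ℝ (Set.range (CliffordStrategy.winProb (n := n))) ⊆ Set.Iic 1 := by
    apply convexHull_min _ (convex_Iic _)
    rintro _ ⟨S, rfl⟩
    rw [Set.mem_Iic, S.winProb_eq]
    exact S.toPauli.value_le_one S.isStab_state
  exact fun x hx => this hx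

section Reindex

variable {Q R : Type} [Fintype Q] [DecidableEq Q] [Fintype R] [DecidableEq R] (e : R ≃ Q)

/-- Relabelling of basis states. -/
def relabelEquiv : (R → Bit) ≃ (Q → Bit) := Equiv.arrowCongr e (Equiv.refl _)

lemma relabelEquiv_apply (i : R → Bit) : relabelEquiv e i = i ∘ e.symm := rfl

/-- Relabelling of the qubits of an operator. -/
def relabel (M : Operator Q) : Operator R := M.submatrix (relabelEquiv e) (relabelEquiv e)

lemma relabel_mul (M N : Operator Q) : relabel e (M * N) = relabel e M * relabel e N :=
  (Matrix.submatrix_mul_equiv M N _ _ _).symm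

lemma relabel_one : relabel e (1 : Operator Q) = 1 := Matrix.submatrix_one_equiv _

lemma relabel_smul (c : ℂ) (M : Operator Q) : relabel e (c • M) = c • relabel e M := rfl

lemma relabel_add (M N : Operator Q) : relabel e (M + N) = relabel e M + relabel e N := rfl

lemma relabel_conjTranspose (M : Operator Q) : relabel e Mᴴ = (relabel e M)ᴴ := rfl

lemma relabel_eigenprojector (M : Operator Q) (b : Bit) :
    relabel e (eigenprojector M b) = eigenprojector (relabel e M) b := by
  rw [eigenprojector_eq, eigenprojector_eq, relabel_smul, relabel_add, relabel_one, relabel_smul]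

lemma relabel_pauliXZ (x z : Q → Bit) : relabel e (pauliXZ x z) = pauliXZ (x ∘ e) (z ∘ e) := by
  ext i j
  simp only [relabel, Matrix.submatrix_apply, pauliXZ_apply, relabelEquiv_apply]
  have h1 : i ∘ e.symm = j ∘ e.symm + x ↔ i = j + x ∘ e := by
    constructor
    · intro h; ext q; simpa using congrFun h (e q)
    · rintro rfl; ext q; simp
  have h2 : z ⬝ᵥ (j ∘ e.symm) = (z ∘ e) ⬝ᵥ j := by
    simp only [dotProduct]
    refine Fintype.sum_equiv e.symm _ _ fun q => by simp
  simp only [h1, h2]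

lemma relabel_isPauliOn {S : Finset Q} {M : Operator Q} (h : IsPauliOn S M) :
    IsPauliOn (S.map e.symm.toEmbedding) (relabel e M) := by
  obtain ⟨k, x, z, h, rfl⟩ := h
  refine ⟨k, x ∘ e, z ∘ e, fun q hq => h _ fun h' => hq ?_, ?_⟩
  · rw [Finset.mem_map]; exact ⟨e q, h', by simp⟩
  · rw [relabel_smul, relabel_pauliXZ]

lemma relabel_isPauli {M : Operator Q} (h : IsPauli M) : IsPauli (relabel e M) :=
  (relabel_isPauliOn e h).isPauli

lemma relabel_isClifford {U : Operator Q} (h : IsClifford U) : IsClifford (relabel e U) := by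
  constructor
  · rw [Matrix.mem_unitaryGroup_iff, Matrix.star_eq_conjTranspose, ← relabel_conjTranspose,
      ← relabel_mul, h.mul_conjTranspose, relabel_one]
  · intro P hP
    obtain ⟨k, x, z, rfl⟩ := hP.exists
    have : Complex.I ^ k • pauliXZ x z =
        relabel e (Complex.I ^ k • pauliXZ (x ∘ e.symm) (z ∘ e.symm)) := by
      rw [relabel_smul, relabel_pauliXZ]
      congr 2 <;> ext q <;> simp
    rw [this, ← relabel_conjTranspose, ← relabel_mul, ← relabel_mul]
    exact relabel_isPauli e (h.2 _ (IsPauli.intro _ _ _))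

lemma relabel_mulVec (M : Operator Q) (v : (Q → Bit) → ℂ) :
    relabel e M *ᵥ (v ∘ relabelEquiv e) = (M *ᵥ v) ∘ relabelEquiv e := by
  rw [relabel, Matrix.submatrix_mulVec_equiv, Function.comp_assoc, Equiv.self_comp_symm,
    Function.comp_id]

lemma ket0_relabel : (ket0 : (Q → Bit) → ℂ) ∘ relabelEquiv e = ket0 := by
  ext i
  simp only [Function.comp_apply, ket0, Pi.single_apply, relabelEquiv_apply]
  congr 1
  apply propext
  constructor
  · intro h; ext q; simpa using congrFun h (e q)
  · rintro rfl; rfl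

lemma expect_relabel (v : (Q → Bit) → ℂ) (M : Operator Q) :
    expect (v ∘ relabelEquiv e) (relabel e M) = expect v M := by
  rw [expect, relabel_mulVec, expect]
  exact comp_equiv_dotProduct_comp_equiv (star v) (M *ᵥ v) (relabelEquiv e)

end Reindex

/-- Observables on separate qubits form a Clifford strategy. -/
theorem PauliStrategy.value_le_pClif_of_separate {n : ℕ} {Q : Type} [Fintype Q] [DecidableEq Q]
    (S : PauliStrategy n Q) {ψ : (Q → Bit) → ℂ} (hψ : IsStab ψ) (T : Finset Q)
    (hA : ∀ α s, IsPauliOn T (S.obsA α s)) (hB : ∀ β, IsPauliOn Tᶜ (S.obsB β)) :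
    S.value ψ ≤ pClif n := by
  obtain ⟨U, hU, rfl⟩ := hψ
  let e := (Fintype.equivFin Q).symm
  let C : CliffordStrategy n :=
    { m := Fintype.card Q
      prep := relabel e U
      prep_clifford := relabel_isClifford e hU
      alice := T.map e.symm.toEmbedding
      obsA := fun α s => relabel e (S.obsA α s)
      obsA_pauli := fun α s => relabel_isPauliOn e (hA α s)
      obsA_hermitian := fun α s => (relabel_isPauli e (S.pauliA α s)).isHermitian (by
        rw [← relabel_mul, S.sqA, relabel_one])
      obsA_commute := fun α s s' => by
        rw [Commute, SemiconjBy, ← relabel_mul, (S.commA α s s').eq, relabel_mul]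
      obsB := fun β => relabel e (S.obsB β)
      obsB_pauli := fun β => by
        convert relabel_isPauliOn e (hB β) using 1
        ext q; simp
      obsB_hermitian := fun β => (relabel_isPauli e (S.pauliB β)).isHermitian (by
        rw [← relabel_mul, S.sqB, relabel_one]) }
  refine le_of_eq_of_le ?_ C.winProb_le_pClif
  rw [C.winProb_eq, PauliStrategy.value, PauliStrategy.value]
  congr 1
  refine Finset.sum_congr rfl fun q _ => ?_
  rw [questionValue, questionValue, winOp, winOp]
  simp only [expect_sum]
  congr 1
  refine Finset.sum_congr rfl fun a _ => Finset.sum_congr rfl fun b _ => ?_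
  have hstate : C.state = (U *ᵥ ket0) ∘ relabelEquiv e := by
    rw [← relabel_mulVec, ket0_relabel]; rfl
  split_ifs
  · rw [hstate, ← expect_relabel e]
    simp only [outcomeOp, relabel_mul, relabel_eigenprojector]
    rfl
  · rw [expect_zero, expect_zero]

end
end MagicBCS

open scoped Kronecker
namespace MagicBCS
noncomputable section
set_option linter.unusedSectionVars false
set_option linter.unusedSimpArgs false

/-! ### The cone of stabilizer states -/

section
variable {Q : Type} [Fintype Q] [DecidableEq Q]

/-- The projector on a vector, up to normalization. -/
def ketbra {I : Type*} (ψ : I → ℂ) : Matrix I I ℂ := Matrix.vecMulVec ψ (star ψ)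

lemma ketbra_conj {I J : Type*} [Fintype I] (ψ : I → ℂ) (M : Matrix J I ℂ) :
    M * ketbra ψ * Mᴴ = ketbra (M *ᵥ ψ) := by
  rw [ketbra, ketbra, Matrix.mul_vecMulVec, Matrix.vecMulVec_mul, Matrix.star_mulVec]

lemma trace_ketbra_mul (ψ : (Q → Bit) → ℂ) (M : Operator Q) :
    (ketbra ψ * M).trace = expect ψ M := by
  rw [ketbra, Matrix.vecMulVec_mul, Matrix.trace_vecMulVec, expect, dotProduct_comm,
    Matrix.dotProduct_mulVec]

lemma ketbra_smul {I : Type*} (c : ℂ) (ψ : I → ℂ) :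
    ketbra (c • ψ) = (c * star c) • ketbra ψ := by
  rw [ketbra, ketbra, Matrix.smul_vecMulVec, star_smul, Matrix.vecMulVec_smul, smul_smul]

/-- Nonnegative combinations of projectors on stabilizer states. -/
def stabCone (Q : Type) [Fintype Q] [DecidableEq Q] : AddSubmonoid (Operator Q) :=
  AddSubmonoid.closure {M | ∃ (r : ℂ) (ψ : (Q → Bit) → ℂ), IsStab ψ ∧ M = ketbra (r • ψ)}

lemma IsStab.mem_stabCone {ψ : (Q → Bit) → ℂ} (h : IsStab ψ) (r : ℂ) :
    ketbra (r • ψ) ∈ stabCone Q :=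
  AddSubmonoid.subset_closure ⟨r, ψ, h, rfl⟩

lemma isStab_ket0 : IsStab (ket0 : (Q → Bit) → ℂ) :=
  ⟨1, isClifford_one, (Matrix.one_mulVec _).symm⟩

lemma IsStab.mulVec {ψ : (Q → Bit) → ℂ} (h : IsStab ψ) {U : Operator Q} (hU : IsClifford U) :
    IsStab (U *ᵥ ψ) := by
  obtain ⟨V, hV, rfl⟩ := h
  exact ⟨U * V, hU.mul hV, by rw [Matrix.mulVec_mulVec]⟩

/-- Measuring a Hermitian Pauli operator maps stabilizer states to stabilizer states. -/
lemma IsStab.eigenprojector_mulVec {ψ : (Q → Bit) → ℂ} (h : IsStab ψ) {P : Operator Q}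
    (hP : IsPauli P) (hP2 : P * P = 1) (b : Bit) :
    ∃ (r : ℂ) (φ : (Q → Bit) → ℂ), IsStab φ ∧ eigenprojector P b *ᵥ ψ = r • φ := by
  obtain ⟨U, hU, rfl⟩ := h
  set M := Uᴴ * (sgn b • P) * U with hM
  have hsP : IsPauli (sgn b • P) := IsPauliOn.sgn_smul hP b
  have hMP : IsPauli M := hU.conj_isPauli hsP
  have hs2 : (sgn b • P) * (sgn b • P) = 1 := by
    rw [Matrix.smul_mul, Matrix.mul_smul, hP2, smul_smul, sgn_mul_self, one_smul]
  have hM2 : M * M = 1 := by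
    calc M * M = Uᴴ * (sgn b • P) * (U * Uᴴ) * (sgn b • P) * U := by simp only [hM, mul_assoc]
      _ = 1 := by
        rw [hU.mul_conjTranspose, mul_one, mul_assoc Uᴴ, hs2, mul_one, hU.conjTranspose_mul]
  have hUM : (sgn b • P) * U = U * M := by
    simp only [hM, ← mul_assoc, hU.mul_conjTranspose, one_mul]
  have key : eigenprojector P b *ᵥ (U *ᵥ ket0) = (1 / 2 : ℂ) • U *ᵥ (ket0 + M *ᵥ ket0) := by
    rw [eigenprojector_eq, Matrix.smul_mulVec, Matrix.add_mulVec, Matrix.one_mulVec,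
      Matrix.mulVec_mulVec, hUM, Matrix.mulVec_add, Matrix.mulVec_mulVec]
  rw [key]
  obtain ⟨k, x, z, hkxz⟩ := hMP.exists
  by_cases hx : x = 0
  · refine ⟨(1 / 2 : ℂ) * (1 + Complex.I ^ k), U *ᵥ ket0, ⟨U, hU, rfl⟩, ?_⟩
    have : M *ᵥ ket0 = Complex.I ^ k • ket0 := by
      rw [hkxz, Matrix.smul_mulVec, ket0, pauliXZ_mulVec_single, hx]
    rw [this, Matrix.mulVec_add, Matrix.mulVec_smul]
    module
  · obtain ⟨q, hq⟩ := Function.ne_iff.1 hx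
    have hq1 : x q = 1 := (bit_cases (x q)).resolve_left hq
    -- `Z` on a qubit flipped by `M` anticommutes with `M` and fixes `|0...0⟩`. So `(1 + M)|0...0⟩ =
    -- (Z + M)|0...0⟩`, and `(Z + M) / √2` is Clifford.
    set Z := pauliXZ (0 : Q → Bit) (Pi.single q 1) with hZ
    have hZP : IsPauli Z := isPauli_pauliXZ _ _
    have hZ2 : Z * Z = 1 := by
      rw [hZ, pauliXZ_mul, bits_add_self, bits_add_self]; simp
    have hanti : Z * M = -(M * Z) := by
      rw [hkxz, hZ, Matrix.mul_smul, Matrix.smul_mul, pauliXZ_mul, pauliXZ_mul]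
      simp [hq1, add_comm]
    have hV := isClifford_of_anticommute hZP hMP (hZP.isHermitian hZ2) (hMP.isHermitian hM2) hanti
    refine ⟨(1 / 2 : ℂ) * ((Real.sqrt 2 : ℝ) : ℂ), U *ᵥ _, IsStab.mulVec ⟨_, hV, rfl⟩ hU, ?_⟩
    have hs : ((Real.sqrt 2 : ℝ) : ℂ) ≠ 0 := by
      simp
    have hZk : Z *ᵥ ket0 = ket0 := by rw [hZ, ket0, pauliXZ_mulVec_single]
    rw [Matrix.smul_mulVec, Matrix.mulVec_smul, smul_smul, mul_assoc, mul_inv_cancel₀ hs, mul_one,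
      Matrix.add_mulVec, hZk]

lemma eigenprojector_conjTranspose {P : Operator Q} (hP : P.IsHermitian) (b : Bit) :
    (eigenprojector P b)ᴴ = eigenprojector P b := by
  rw [eigenprojector_eq, Matrix.conjTranspose_smul, Matrix.conjTranspose_add,
    Matrix.conjTranspose_smul, hP.eq, star_sgn]
  simp

lemma stabCone_conj {M : Operator Q} (hM : M ∈ stabCone Q) (K : Operator Q)
    (hK : ∀ ψ, IsStab ψ → ∃ (r : ℂ) (φ : (Q → Bit) → ℂ), IsStab φ ∧ K *ᵥ ψ = r • φ) :
    K * M * Kᴴ ∈ stabCone Q := by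
  induction hM using AddSubmonoid.closure_induction with
  | mem x hx =>
    obtain ⟨r, ψ, hψ, rfl⟩ := hx
    obtain ⟨r', φ, hφ, h⟩ := hK ψ hψ
    rw [ketbra_conj, Matrix.mulVec_smul, h, smul_smul]
    exact hφ.mem_stabCone _
  | zero => simp
  | add x y _ _ hx hy => rw [mul_add, add_mul]; exact add_mem hx hy

lemma one_mem_stabCone : (1 : Operator Q) ∈ stabCone Q := by
  have : (1 : Operator Q) = ∑ x : Q → Bit, ketbra ((1 : ℂ) • (pauliXZ x 0 *ᵥ ket0)) := by
    ext i j
    simp only [Matrix.sum_apply, ket0, pauliXZ_mulVec_single, one_smul, ketbra,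
      Matrix.vecMulVec_apply, Pi.star_apply, Pi.single_apply, Matrix.one_apply]
    by_cases h : i = j
    · subst h; simp
    · rw [if_neg h, eq_comm]
      apply Finset.sum_eq_zero
      intro x _
      by_cases h1 : i = x
      · rw [if_neg (fun h2 : j = x => h (h1.trans h2.symm))]; simp
      · rw [if_neg h1]; simp
  rw [this]
  exact sum_mem fun x _ => (isStab_ket0.mulVec (isPauli_pauliXZ x 0).isClifford).mem_stabCone 1

end

/-! ### Tensor products -/

section
variable {Q A : Type} [Fintype Q] [DecidableEq Q] [Fintype A] [DecidableEq A]

/-- The tensor product of operators. -/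
def tensor (M : Operator Q) (N : Operator A) : Operator (Q ⊕ A) :=
  (M ⊗ₖ N).submatrix (Equiv.sumArrowEquivProdArrow Q A Bit) (Equiv.sumArrowEquivProdArrow Q A Bit)

lemma tensor_apply (M : Operator Q) (N : Operator A) (i j : Q ⊕ A → Bit) :
    tensor M N i j = M (i ∘ Sum.inl) (j ∘ Sum.inl) * N (i ∘ Sum.inr) (j ∘ Sum.inr) := rfl

lemma tensor_mul (M M' : Operator Q) (N N' : Operator A) :
    tensor M N * tensor M' N' = tensor (M * M') (N * N') := by
  rw [tensor, tensor, Matrix.submatrix_mul_equiv, ← Matrix.mul_kronecker_mul]; rfl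

lemma tensor_one : tensor (1 : Operator Q) (1 : Operator A) = 1 := by
  rw [tensor, Matrix.one_kronecker_one, Matrix.submatrix_one_equiv]

lemma tensor_smul_left (c : ℂ) (M : Operator Q) (N : Operator A) :
    tensor (c • M) N = c • tensor M N := by
  rw [tensor, Matrix.smul_kronecker]; rfl

lemma tensor_smul_right (c : ℂ) (M : Operator Q) (N : Operator A) :
    tensor M (c • N) = c • tensor M N := by
  rw [tensor, Matrix.kronecker_smul]; rfl

lemma tensor_add_left (M M' : Operator Q) (N : Operator A) :
    tensor (M + M') N = tensor M N + tensor M' N := by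
  rw [tensor, Matrix.add_kronecker]; rfl

lemma tensor_add_right (M : Operator Q) (N N' : Operator A) :
    tensor M (N + N') = tensor M N + tensor M N' := by
  rw [tensor, Matrix.kronecker_add]; rfl

lemma tensor_conjTranspose (M : Operator Q) (N : Operator A) :
    (tensor M N)ᴴ = tensor Mᴴ Nᴴ := by
  rw [tensor, Matrix.conjTranspose_submatrix, Matrix.conjTranspose_kronecker]; rfl

lemma trace_tensor (M : Operator Q) (N : Operator A) :
    (tensor M N).trace = M.trace * N.trace := by
  rw [← Matrix.trace_kronecker, Matrix.trace, Matrix.trace]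
  exact Fintype.sum_equiv (Equiv.sumArrowEquivProdArrow Q A Bit) _ _ fun _ => rfl

lemma tensor_pauliXZ (x z : Q → Bit) (x' z' : A → Bit) :
    tensor (pauliXZ x z) (pauliXZ x' z') = pauliXZ (Sum.elim x x') (Sum.elim z z') := by
  ext i j
  simp only [tensor_apply, pauliXZ_apply]
  have h1 : i = j + Sum.elim x x' ↔ i ∘ Sum.inl = j ∘ Sum.inl + x ∧ i ∘ Sum.inr = j ∘ Sum.inr + x' := by
    constructor
    · rintro rfl; exact ⟨rfl, rfl⟩
    · rintro ⟨h, h'⟩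
      ext q
      rcases q with q | q
      · exact congrFun h q
      · exact congrFun h' q
  have h2 : Sum.elim z z' ⬝ᵥ j = z ⬝ᵥ (j ∘ Sum.inl) + z' ⬝ᵥ (j ∘ Sum.inr) := by
    simp [dotProduct]
  rw [h2, sgn_add]
  simp only [h1, ite_and, ite_mul, mul_ite, zero_mul, mul_zero]
  split_ifs <;> rfl

lemma exists_tensor {P : Operator (Q ⊕ A)} (hP : IsPauli P) :
    ∃ (M : Operator Q) (N : Operator A), IsPauli M ∧ IsPauli N ∧ P = tensor M N := by
  obtain ⟨k, x, z, rfl⟩ := hP.exists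
  refine ⟨Complex.I ^ k • pauliXZ (x ∘ Sum.inl) (z ∘ Sum.inl), pauliXZ (x ∘ Sum.inr) (z ∘ Sum.inr),
    IsPauli.intro _ _ _, isPauli_pauliXZ _ _, ?_⟩
  rw [tensor_smul_left, tensor_pauliXZ, Sum.elim_comp_inl_inr, Sum.elim_comp_inl_inr]

lemma isPauli_tensor {M : Operator Q} {N : Operator A} (hM : IsPauli M) (hN : IsPauli N) :
    IsPauli (tensor M N) := by
  obtain ⟨k, x, z, rfl⟩ := hM.exists
  obtain ⟨k', x', z', rfl⟩ := hN.exists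
  rw [tensor_smul_left, tensor_smul_right, tensor_pauliXZ]
  exact IsPauliOn.I_smul (IsPauli.intro _ _ _) _

/-- The qubits of the first tensor factor. -/
def leftQubits (Q A : Type) [Fintype Q] [DecidableEq Q] [DecidableEq A] : Finset (Q ⊕ A) :=
  Finset.univ.map Function.Embedding.inl

lemma isPauliOn_tensor_one {M : Operator Q} (hM : IsPauli M) :
    IsPauliOn (leftQubits Q A) (tensor M (1 : Operator A)) := by
  obtain ⟨k, x, z, rfl⟩ := hM.exists
  refine ⟨k, Sum.elim x 0, Sum.elim z 0, ?_, ?_⟩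
  · rintro (q | q) hq
    · simp [leftQubits] at hq
    · simp
  · rw [tensor_smul_left, ← pauliXZ_zero, tensor_pauliXZ]

lemma isPauliOn_one_tensor {N : Operator A} (hN : IsPauli N) :
    IsPauliOn (leftQubits Q A)ᶜ (tensor (1 : Operator Q) N) := by
  obtain ⟨k, x, z, rfl⟩ := hN.exists
  refine ⟨k, Sum.elim 0 x, Sum.elim 0 z, ?_, ?_⟩
  · rintro (q | q) hq
    · simp
    · simp [leftQubits] at hq
  · rw [tensor_smul_right, ← pauliXZ_zero, tensor_pauliXZ]

lemma isClifford_tensor_one {U : Operator Q} (hU : IsClifford U) :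
    IsClifford (tensor U (1 : Operator A)) := by
  refine ⟨?_, fun P hP => ?_⟩
  · rw [Matrix.mem_unitaryGroup_iff, Matrix.star_eq_conjTranspose, tensor_conjTranspose, tensor_mul,
      hU.mul_conjTranspose, Matrix.conjTranspose_one, mul_one, tensor_one]
  · obtain ⟨M, N, hM, hN, rfl⟩ := exists_tensor hP
    rw [tensor_conjTranspose, tensor_mul, tensor_mul, Matrix.conjTranspose_one, mul_one, one_mul]
    exact isPauli_tensor (hU.2 M hM) hN

/-- The tensor product of vectors. -/
def tensorVec (ψ : (Q → Bit) → ℂ) (φ : (A → Bit) → ℂ) : (Q ⊕ A → Bit) → ℂ :=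
  fun i => ψ (i ∘ Sum.inl) * φ (i ∘ Sum.inr)

lemma tensor_mulVec (M : Operator Q) (N : Operator A) (ψ : (Q → Bit) → ℂ) (φ : (A → Bit) → ℂ) :
    tensor M N *ᵥ tensorVec ψ φ = tensorVec (M *ᵥ ψ) (N *ᵥ φ) := by
  ext i
  simp only [Matrix.mulVec, dotProduct, tensor_apply, tensorVec]
  rw [Fintype.sum_mul_sum, ← Fintype.sum_prod_type']
  refine Fintype.sum_equiv (Equiv.sumArrowEquivProdArrow Q A Bit) _ _ fun j => ?_
  simp only [Equiv.sumArrowEquivProdArrow, Equiv.coe_fn_mk]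
  ring

lemma tensorVec_ket0 : tensorVec (ket0 : (Q → Bit) → ℂ) (ket0 : (A → Bit) → ℂ) = ket0 := by
  ext i
  simp only [tensorVec, ket0, Pi.single_apply]
  have : i = 0 ↔ i ∘ Sum.inl = 0 ∧ i ∘ Sum.inr = 0 := by
    constructor
    · rintro rfl; exact ⟨rfl, rfl⟩
    · rintro ⟨h, h'⟩
      ext q
      rcases q with q | q
      · exact congrFun h q
      · exact congrFun h' q
  simp only [this, ite_and, mul_ite, mul_one, mul_zero]
  split_ifs <;> rfl

lemma IsStab.tensor_ket0 {ψ : (Q → Bit) → ℂ} (h : IsStab ψ) :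
    IsStab (tensorVec ψ (ket0 : (A → Bit) → ℂ)) := by
  obtain ⟨U, hU, rfl⟩ := h
  refine ⟨tensor U 1, isClifford_tensor_one hU, ?_⟩
  rw [← tensorVec_ket0, tensor_mulVec, Matrix.one_mulVec]

end
end
end MagicBCS

open scoped Kronecker
namespace MagicBCS
noncomputable section
set_option linter.unusedSectionVars false
set_option linter.unusedSimpArgs false

/-! ### Commuting Pauli observables can be separated -/

namespace PauliStrategy
variable {n : ℕ} {Q : Type} [Fintype Q] [DecidableEq Q] (S : PauliStrategy n Q)
  {ψ : (Q → Bit) → ℂ}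

/-- The Pauli operators that commute with Bob's observables. -/
def groupA : Submonoid (Operator Q) where
  carrier := {P | IsPauli P ∧ ∀ β, Commute P (S.obsB β)}
  one_mem' := ⟨isPauli_one, fun _ => Commute.one_left _⟩
  mul_mem' := fun h h' => ⟨h.1.mul h'.1, fun β => (h.2 β).mul_left (h'.2 β)⟩

/-- The Pauli operators that commute with `groupA`. -/
def groupB : Submonoid (Operator Q) where
  carrier := {R | IsPauli R ∧ ∀ P ∈ S.groupA, Commute P R}
  one_mem' := ⟨isPauli_one, fun _ _ => Commute.one_right _⟩
  mul_mem' := fun h h' => ⟨h.1.mul h'.1, fun P hP => (h.2 P hP).mul_right (h'.2 P hP)⟩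

/-- The stabilizer group on two copies of the qubits. -/
def stabilizers (ψ : (Q → Bit) → ℂ) : Set (Operator (Q ⊕ Q)) :=
  {s | ∃ P ∈ S.groupA, ∃ R ∈ S.groupB, (P * R) *ᵥ ψ = ψ ∧ s = tensor P R}

lemma stabilizers_isPauli {s : Operator (Q ⊕ Q)} (hs : s ∈ S.stabilizers ψ) : IsPauli s := by
  obtain ⟨P, hP, R, hR, -, rfl⟩ := hs
  exact isPauli_tensor hP.1 hR.1

lemma stabilizers_finite : (S.stabilizers ψ).Finite :=
  isPauli_finite.subset fun _ hs => S.stabilizers_isPauli hs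

lemma one_mem_stabilizers : (1 : Operator (Q ⊕ Q)) ∈ S.stabilizers ψ :=
  ⟨1, one_mem _, 1, one_mem _, by simp, tensor_one.symm⟩

lemma mul_mem_stabilizers {s t : Operator (Q ⊕ Q)} (hs : s ∈ S.stabilizers ψ)
    (ht : t ∈ S.stabilizers ψ) : s * t ∈ S.stabilizers ψ := by
  obtain ⟨P, hP, R, hR, h, rfl⟩ := hs
  obtain ⟨P', hP', R', hR', h', rfl⟩ := ht
  refine ⟨P * P', mul_mem hP hP', R * R', mul_mem hR hR', ?_, tensor_mul _ _ _ _⟩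
  rw [mul_assoc, ← mul_assoc P' R, (hR.2 P' hP').eq, mul_assoc, ← mul_assoc P,
    ← Matrix.mulVec_mulVec, h', h]

lemma neg_ne {v : (Q → Bit) → ℂ} (hv : v ≠ 0) : -v ≠ v := fun h => hv (neg_eq_self.1 h)

/-- `P * P` and `R * R` are signs, and their product fixes the nonzero vector `ψ`; so the signs
agree and cancel in the tensor product. -/
lemma stabilizers_sq (hψ : ψ ≠ 0) {s : Operator (Q ⊕ Q)} (hs : s ∈ S.stabilizers ψ) :
    s * s = 1 := by
  obtain ⟨P, hP, R, hR, h, rfl⟩ := hs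
  have h2 : (P * P * (R * R)) *ᵥ ψ = ψ := by
    rw [(hR.2 P hP).mul_mul_mul_comm, ← Matrix.mulVec_mulVec, h, h]
  rw [tensor_mul]
  rcases hP.1.mul_self_eq with h1 | h1 <;> rcases hR.1.mul_self_eq with h1' | h1' <;>
    rw [h1, h1'] at h2 ⊢
  · exact tensor_one
  · exact absurd (by simpa [Matrix.neg_mulVec] using h2) (neg_ne hψ)
  · exact absurd (by simpa [Matrix.neg_mulVec] using h2) (neg_ne hψ)
  · rw [← neg_one_smul ℂ (1 : Operator Q), tensor_smul_left, tensor_smul_right, smul_smul]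
    simp [tensor_one]

lemma stabilizers_commute (hψ : ψ ≠ 0) {s t : Operator (Q ⊕ Q)} (hs : s ∈ S.stabilizers ψ)
    (ht : t ∈ S.stabilizers ψ) : Commute s t := by
  have h1 := S.stabilizers_sq hψ hs
  have h2 := S.stabilizers_sq hψ ht
  have h3 := S.stabilizers_sq hψ (S.mul_mem_stabilizers hs ht)
  calc s * t = s * (s * t * (s * t)) * t := by rw [h3, mul_one]
    _ = (s * s) * t * s * (t * t) := by simp only [mul_assoc]
    _ = t * s := by rw [h1, h2, one_mul, mul_one]

/-- The normalized sum of the stabilizer group. -/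
def codeProjector (ψ : (Q → Bit) → ℂ) : Operator (Q ⊕ Q) :=
  ((S.stabilizers_finite (ψ := ψ)).toFinset.card : ℂ)⁻¹ •
    ∑ s ∈ (S.stabilizers_finite (ψ := ψ)).toFinset, s

lemma stabilizers_card_ne_zero :
    ((S.stabilizers_finite (ψ := ψ)).toFinset.card : ℂ) ≠ 0 := by
  rw [Nat.cast_ne_zero, Finset.card_ne_zero]
  exact ⟨1, (Set.Finite.mem_toFinset _).2 S.one_mem_stabilizers⟩

lemma mul_codeProjector (hψ : ψ ≠ 0) {s : Operator (Q ⊕ Q)} (hs : s ∈ S.stabilizers ψ) :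
    s * S.codeProjector ψ = S.codeProjector ψ := by
  rw [codeProjector, Matrix.mul_smul, Finset.mul_sum]
  congr 1
  refine Finset.sum_nbij' (s * ·) (s * ·) ?_ ?_ ?_ ?_ ?_
  · intro t ht
    rw [Set.Finite.mem_toFinset] at ht ⊢
    exact S.mul_mem_stabilizers hs ht
  · intro t ht
    rw [Set.Finite.mem_toFinset] at ht ⊢
    exact S.mul_mem_stabilizers hs ht
  · intro t _; rw [← mul_assoc, S.stabilizers_sq hψ hs, one_mul]
  · intro t _; rw [← mul_assoc, S.stabilizers_sq hψ hs, one_mul]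
  · intro t _; rfl

lemma commute_codeProjector (hψ : ψ ≠ 0) {s : Operator (Q ⊕ Q)} (hs : s ∈ S.stabilizers ψ) :
    Commute s (S.codeProjector ψ) :=
  (Commute.sum_right _ _ _ fun _ ht =>
    S.stabilizers_commute hψ hs ((Set.Finite.mem_toFinset _).1 ht)).smul_right _

/-- Start from the identity, a sum of basis projectors, and conjugate it successively with `(1 + t)
/ 2` for all `t` in the group. Each step preserves the cone, because measuring a Pauli operator
keeps stabilizer states. The result `M` is absorbed by every group element, whence `E * M = M`; each
step also keeps `E * M = E`. So `E = M`. -/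
lemma codeProjector_mem (hψ : ψ ≠ 0) : S.codeProjector ψ ∈ stabCone (Q ⊕ Q) := by
  set E := S.codeProjector ψ
  have main : ∀ l : List (Operator (Q ⊕ Q)), (∀ s ∈ l, s ∈ S.stabilizers ψ) →
      ∃ M ∈ stabCone (Q ⊕ Q), (∀ s ∈ l, s * M = M) ∧
        (∀ s ∈ S.stabilizers ψ, Commute s M) ∧ E * M = E := by
    intro l
    induction l with
    | nil => exact fun _ => ⟨1, one_mem_stabCone, by simp, fun s _ => Commute.one_right s, mul_one _⟩
    | cons t l ih =>
      intro hl
      obtain ⟨M, hM, h1, h2, h3⟩ := ih fun s hs => hl s (List.mem_cons_of_mem _ hs)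
      have ht := hl t List.mem_cons_self
      have htP := S.stabilizers_isPauli ht
      have ht2 := S.stabilizers_sq hψ ht
      set p := eigenprojector t 0 with hp
      have hpe : p = (1 / 2 : ℂ) • (1 + t) := by rw [hp, eigenprojector_eq]; simp
      have hph : pᴴ = p := eigenprojector_conjTranspose (htP.isHermitian ht2) 0
      have hcp : ∀ s ∈ S.stabilizers ψ, Commute s p := fun s hs => by
        rw [hpe]
        exact ((Commute.one_right s).add_right (S.stabilizers_commute hψ hs ht)).smul_right _
      have hEp : E * p = E := by
        rw [hpe, Matrix.mul_smul, mul_add, mul_one, ← (S.commute_codeProjector hψ ht).eq,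
          S.mul_codeProjector hψ ht, ← two_smul ℂ, smul_smul]
        norm_num
      refine ⟨p * M * p, ?_, ?_, ?_, ?_⟩
      · have := stabCone_conj hM p fun φ hφ => hφ.eigenprojector_mulVec htP ht2 0
        rwa [hph] at this
      · intro s hs
        rcases List.mem_cons.1 hs with rfl | hs'
        · have : s * p = p := by
            rw [hpe, Matrix.mul_smul, mul_add, mul_one, ht2, add_comm]
          rw [← mul_assoc, ← mul_assoc, this]
        · have hsS := hl s hs
          rw [← mul_assoc, ← mul_assoc, (hcp s hsS).eq, mul_assoc p, h1 s hs']
      · intro s hs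
        exact ((hcp s hs).mul_right (h2 s hs)).mul_right (hcp s hs)
      · rw [← mul_assoc, ← mul_assoc, hEp, h3, hEp]
  obtain ⟨M, hM, h1, -, h3⟩ := main (S.stabilizers_finite (ψ := ψ)).toFinset.toList
    fun s hs => by simpa using hs
  have : E * M = M := by
    simp only [E, codeProjector, Matrix.smul_mul, Finset.sum_mul]
    rw [Finset.sum_congr rfl fun s hs => h1 s (Finset.mem_toList.2 hs), Finset.sum_const,
      ← Nat.cast_smul_eq_nsmul ℂ, smul_smul, inv_mul_cancel₀ S.stabilizers_card_ne_zero, one_smul]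
  rw [← h3, this]
  exact hM

lemma isPauli_trace_ne_zero {P : Operator Q} (hP : IsPauli P) (h : P.trace ≠ 0) :
    ∃ k : ℕ, P = Complex.I ^ k • (1 : Operator Q) := hP.trace_or.resolve_left h

/-- Only the identity contributes: a tensor product of Pauli operators with nonzero trace has phases
as factors, and the product of the two phases is 1 because it fixes `ψ`. -/
lemma trace_codeProjector (hψ : IsStab ψ) : ∃ r : ℝ, 0 < r ∧ (S.codeProjector ψ).trace = r := by
  have key : ∀ s ∈ (S.stabilizers_finite (ψ := ψ)).toFinset,
      s.trace = if s = 1 then (1 : Operator (Q ⊕ Q)).trace else 0 := by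
    intro s hs
    split_ifs with h1
    · rw [h1]
    · by_contra h0
      obtain ⟨P, hP, R, hR, h, rfl⟩ := (Set.Finite.mem_toFinset _).1 hs
      rw [trace_tensor] at h0
      obtain ⟨k, rfl⟩ := isPauli_trace_ne_zero hP.1 (left_ne_zero_of_mul h0)
      obtain ⟨k', rfl⟩ := isPauli_trace_ne_zero hR.1 (right_ne_zero_of_mul h0)
      apply h1
      rw [Matrix.smul_mul, one_mul, smul_smul, Matrix.smul_mulVec, Matrix.one_mulVec] at h
      have h2 := smul_left_injective ℂ hψ.ne_zero (h.trans (one_smul ℂ ψ).symm)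
      rw [tensor_smul_left, tensor_smul_right, smul_smul, h2, one_smul, tensor_one]
  refine ⟨((S.stabilizers_finite (ψ := ψ)).toFinset.card : ℝ)⁻¹ *
    Fintype.card (Q ⊕ Q → Bit), ?_, ?_⟩
  · have : (S.stabilizers_finite (ψ := ψ)).toFinset.card ≠ 0 := by
      exact_mod_cast S.stabilizers_card_ne_zero (ψ := ψ)
    positivity
  · rw [codeProjector, Matrix.trace_smul, Matrix.trace_sum, Finset.sum_congr rfl key,
      Finset.sum_ite_eq', if_pos ((Set.Finite.mem_toFinset _).2 S.one_mem_stabilizers),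
      Matrix.trace_one]
    push_cast
    rfl

/-- The correlations of the code projector are those of the state. -/
lemma trace_codeProjector_mul (hψ : IsStab ψ) {P R : Operator Q} (hP : P ∈ S.groupA)
    (hR : R ∈ S.groupB) :
    (S.codeProjector ψ * tensor P R).trace = (S.codeProjector ψ).trace * expect ψ (P * R) := by
  rcases hψ.pauli_cases (hP.1.mul hR.1) with ⟨k, hk⟩ | h0
  -- The phase `i^(3k)` is inverse to the eigenvalue `i^k`. After this rescaling the tensor product
  -- is a stabilizer and is absorbed by the code projector.
  · have h4 : Complex.I ^ (3 * k) * Complex.I ^ k = 1 := by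
      rw [← pow_add, show 3 * k + k = 4 * k by ring, pow_mul, Complex.I_pow_four, one_pow]
    have hs : tensor (Complex.I ^ (3 * k) • P) R ∈ S.stabilizers ψ := by
      refine ⟨_, ⟨IsPauliOn.I_smul hP.1 _, fun β => (hP.2 β).smul_left _⟩, R, hR, ?_, rfl⟩
      rw [Matrix.smul_mul, Matrix.smul_mulVec, hk, smul_smul, h4, one_smul]
    have e : tensor P R = Complex.I ^ k • tensor (Complex.I ^ (3 * k) • P) R := by
      rw [tensor_smul_left, smul_smul, mul_comm, h4, one_smul]
    rw [e, Matrix.mul_smul, ← (S.commute_codeProjector hψ.ne_zero hs).eq,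
      S.mul_codeProjector hψ.ne_zero hs, Matrix.trace_smul, expect_of_eigen hψ hk, smul_eq_mul,
      mul_comm]
  -- A summand of nonzero trace would make `P` and `R` adjoint, up to phases, to the factors of a
  -- stabilizer. Then `P * R` would have `ψ` as an eigenvector with a phase as eigenvalue, against
  -- its vanishing expectation.
  · rw [h0, mul_zero, codeProjector, Matrix.smul_mul, Matrix.trace_smul, Finset.sum_mul,
      Matrix.trace_sum, Finset.sum_eq_zero, smul_zero]
    intro s hs
    obtain ⟨P', hP', R', hR', h, rfl⟩ := (Set.Finite.mem_toFinset _).1 hs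
    by_contra hne
    rw [tensor_mul, trace_tensor] at hne
    obtain ⟨k, hk⟩ := isPauli_trace_ne_zero (hP'.1.mul hP.1) (left_ne_zero_of_mul hne)
    obtain ⟨k', hk'⟩ := isPauli_trace_ne_zero (hR'.1.mul hR.1) (right_ne_zero_of_mul hne)
    have e1 : P = Complex.I ^ k • P'ᴴ := by
      rw [← mul_one P'ᴴ, ← Matrix.mul_smul, ← hk, ← mul_assoc, hP'.1.conjTranspose_mul, one_mul]
    have e2 : R = Complex.I ^ k' • R'ᴴ := by
      rw [← mul_one R'ᴴ, ← Matrix.mul_smul, ← hk', ← mul_assoc, hR'.1.conjTranspose_mul, one_mul]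
    have e3 : (P'ᴴ * R'ᴴ) *ᵥ ψ = ψ := by
      rw [← Matrix.conjTranspose_mul, ← (hR'.2 P' hP').eq]
      conv_lhs => rw [← h]
      rw [Matrix.mulVec_mulVec, (hP'.1.mul hR'.1).conjTranspose_mul, Matrix.one_mulVec]
    have e4 : (P * R) *ᵥ ψ = (Complex.I ^ k * Complex.I ^ k') • ψ := by
      rw [e1, e2, Matrix.smul_mul, Matrix.mul_smul, smul_smul, Matrix.smul_mulVec, e3]
    have e5 := expect_of_eigen hψ e4
    rw [h0] at e5
    simp at e5

lemma trace_codeProjector_mul_span (hψ : IsStab ψ) {M N : Operator Q}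
    (hM : M ∈ Submodule.span ℂ (S.groupA : Set (Operator Q)))
    (hN : N ∈ Submodule.span ℂ (S.groupB : Set (Operator Q))) :
    (S.codeProjector ψ * tensor M N).trace = (S.codeProjector ψ).trace * expect ψ (M * N) := by
  induction hM using Submodule.span_induction with
  | mem P hP =>
    induction hN using Submodule.span_induction with
    | mem R hR => exact S.trace_codeProjector_mul hψ hP hR
    | zero => 
      have : tensor P (0 : Operator Q) = 0 := by simpa using tensor_smul_right 0 P (0 : Operator Q)
      simp [this, expect_zero]
    | add x y _ _ hx hy =>
      rw [tensor_add_right, mul_add, Matrix.trace_add, hx, hy, mul_add P, expect_add]; ring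
    | smul c x _ hx =>
      rw [tensor_smul_right, Matrix.mul_smul, Matrix.trace_smul, hx, Matrix.mul_smul, expect_smul,
        smul_eq_mul]; ring
  | zero =>
    have : tensor (0 : Operator Q) N = 0 := by simpa using tensor_smul_left 0 (0 : Operator Q) N
    simp [this, expect_zero]
  | add x y _ _ hx hy =>
    rw [tensor_add_left, mul_add, Matrix.trace_add, hx, hy, add_mul, expect_add]; ring
  | smul c x _ hx =>
    rw [tensor_smul_left, Matrix.mul_smul, Matrix.trace_smul, hx, Matrix.smul_mul, expect_smul,
      smul_eq_mul]; ring

lemma eigenprojector_mem_span {G : Submonoid (Operator Q)} {P : Operator Q} (hP : P ∈ G) (b : Bit) :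
    eigenprojector P b ∈ Submodule.span ℂ (G : Set (Operator Q)) := by
  rw [eigenprojector_eq]
  exact Submodule.smul_mem _ _ (add_mem (Submodule.subset_span (one_mem G))
    (Submodule.smul_mem _ _ (Submodule.subset_span hP)))

lemma mul_mem_span {G : Submonoid (Operator Q)} {M N : Operator Q}
    (hM : M ∈ Submodule.span ℂ (G : Set (Operator Q)))
    (hN : N ∈ Submodule.span ℂ (G : Set (Operator Q))) :
    M * N ∈ Submodule.span ℂ (G : Set (Operator Q)) := by
  have := Submodule.mul_mem_mul hM hN
  rwa [Submodule.span_mul_span, Submonoid.coe_mul_self_eq] at this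

lemma obsA_mem (α : Constraint n) (s : Fin 3) : S.obsA α s ∈ S.groupA :=
  ⟨S.pauliA α s, S.commAB α s⟩

lemma obsB_mem (β : Variable n) : S.obsB β ∈ S.groupB :=
  ⟨S.pauliB β, fun _ hP => hP.2 β⟩

/-- The strategy on two copies of the qubits. -/
def separate : PauliStrategy n (Q ⊕ Q) where
  obsA α s := tensor (S.obsA α s) 1
  obsB β := tensor 1 (S.obsB β)
  pauliA α s := isPauli_tensor (S.pauliA α s) isPauli_one
  pauliB β := isPauli_tensor isPauli_one (S.pauliB β)
  sqA α s := by rw [tensor_mul, S.sqA, one_mul, tensor_one]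
  sqB β := by rw [tensor_mul, S.sqB, one_mul, tensor_one]
  commA α s s' := by rw [Commute, SemiconjBy, tensor_mul, tensor_mul, (S.commA α s s').eq]
  commAB α s β := by rw [Commute, SemiconjBy, tensor_mul, tensor_mul]; simp

lemma tensor_eigenprojector_left (P : Operator Q) (b : Bit) :
    eigenprojector (tensor P (1 : Operator Q)) b = tensor (eigenprojector P b) 1 := by
  rw [eigenprojector_eq, eigenprojector_eq, tensor_smul_left, tensor_add_left, tensor_smul_left,
    tensor_one]

lemma tensor_eigenprojector_right (P : Operator Q) (b : Bit) :
    eigenprojector (tensor (1 : Operator Q) P) b = tensor 1 (eigenprojector P b) := by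
  rw [eigenprojector_eq, eigenprojector_eq, tensor_smul_right, tensor_add_right, tensor_smul_right,
    tensor_one]

lemma trace_codeProjector_winOp (hψ : IsStab ψ) (q : Question n) :
    (S.codeProjector ψ * winOp q (S.separate.obsA q.1) (S.separate.obsB q.bob)).trace =
      (S.codeProjector ψ).trace * expect ψ (winOp q (S.obsA q.1) (S.obsB q.bob)) := by
  simp only [winOp, Finset.mul_sum, Matrix.trace_sum, expect_sum]
  refine Finset.sum_congr rfl fun a _ => Finset.sum_congr rfl fun b _ => ?_
  split_ifs
  · simp only [outcomeOp, separate, tensor_eigenprojector_left, tensor_eigenprojector_right,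
      tensor_mul, one_mul, mul_one]
    apply S.trace_codeProjector_mul_span hψ
    · exact mul_mem_span (mul_mem_span (eigenprojector_mem_span (S.obsA_mem _ _) _)
        (eigenprojector_mem_span (S.obsA_mem _ _) _)) (eigenprojector_mem_span (S.obsA_mem _ _) _)
    · exact eigenprojector_mem_span (S.obsB_mem _) _
  · simp [expect_zero]

/-- The bound on the value, stated homogeneously so that it extends by additivity to unnormalized
mixtures of stabilizer states. -/
lemma trace_winOp_le {R : Type} [Fintype R] [DecidableEq R] (S : PauliStrategy n R)
    (h : ∀ ψ, IsStab ψ → S.value ψ ≤ pClif n) {M : Operator R} (hM : M ∈ stabCone R) :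
    (∑ q : Question n, (M * winOp q (S.obsA q.1) (S.obsB q.bob)).trace.re) ≤
      Fintype.card (Question n) * pClif n * M.trace.re := by
  induction hM using AddSubmonoid.closure_induction with
  | mem x hx =>
    obtain ⟨r, φ, hφ, rfl⟩ := hx
    have hr : r * star r = ((Complex.normSq r : ℝ) : ℂ) := Complex.mul_conj r
    have h1 : ∀ K, (ketbra (r • φ) * K).trace.re = Complex.normSq r * (expect φ K).re := by
      intro K
      rw [ketbra_smul, Matrix.smul_mul, Matrix.trace_smul, trace_ketbra_mul, hr, smul_eq_mul,
        Complex.re_ofReal_mul]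
    have h2 : (ketbra (r • φ)).trace.re = Complex.normSq r := by
      have := h1 1
      rwa [mul_one, hφ.expect_one, Complex.one_re, mul_one] at this
    simp only [h1, h2, ← Finset.mul_sum]
    have hv := h φ hφ
    rw [value] at hv
    have hsum : ∑ q : Question n, S.questionValue φ q ≤ Fintype.card (Question n) * pClif n := by
      rcases Nat.eq_zero_or_pos (Fintype.card (Question n)) with h0 | h0
      · have : IsEmpty (Question n) := Fintype.card_eq_zero_iff.1 h0
        simp [h0]
      · rw [div_le_iff₀ (by exact_mod_cast h0)] at hv
        linarith
    have := mul_le_mul_of_nonneg_left hsum (Complex.normSq_nonneg r)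
    calc _ ≤ _ := this
      _ = _ := by ring
  | zero => simp
  | add x y _ _ hx hy =>
    simp only [add_mul, Matrix.trace_add, Complex.add_re, Finset.sum_add_distrib, mul_add]
    exact add_le_add hx hy

/-- Strategies with commuting Pauli observables do not beat Clifford strategies. -/
theorem value_le_pClif (hψ : IsStab ψ) : S.value ψ ≤ pClif n := by
  -- The code projector has the correlations of `ψ`, scaled by its trace `r`, but with the players
  -- on different copies of the qubits. There the bound is known for every stabilizer state, hence
  -- on the cone; dividing by `r` gives it for `ψ`.
  obtain ⟨r, hr, htr⟩ := S.trace_codeProjector hψ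
  have h := S.separate.trace_winOp_le (fun φ hφ => S.separate.value_le_pClif_of_separate hφ
    (leftQubits Q Q) (fun α s => isPauliOn_tensor_one (S.pauliA α s))
    (fun β => isPauliOn_one_tensor (S.pauliB β))) (S.codeProjector_mem hψ.ne_zero)
  simp only [S.trace_codeProjector_winOp hψ, htr, Complex.re_ofReal_mul, Complex.ofReal_re,
    ← Finset.mul_sum] at h
  have h' : ∑ q : Question n, S.questionValue ψ q ≤ Fintype.card (Question n) * pClif n := by
    refine le_of_mul_le_mul_left ?_ hr
    calc _ ≤ _ := h
      _ = _ := by ring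
  rw [value]
  rcases Nat.eq_zero_or_pos (Fintype.card (Question n)) with h0 | h0
  · rw [h0, Nat.cast_zero, div_zero]
    refine Real.sSup_nonneg fun x hx => ?_
    have : convexHull ℝ (Set.range (CliffordStrategy.winProb (n := n))) ⊆ {0} := by
      apply convexHull_min _ (convex_singleton _)
      rintro _ ⟨C, rfl⟩
      rw [CliffordStrategy.winProb, h0, Nat.cast_zero, div_zero]; rfl
    exact (this hx).ge
  · rw [div_le_iff₀ (by exact_mod_cast h0)]
    linarith

/-- The bound for mixtures of stabilizer states. -/
theorem trace_winOp_le_pClif {M : Operator Q} (hM : M ∈ stabCone Q) :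
    (∑ q : Question n, (M * winOp q (S.obsA q.1) (S.obsB q.bob)).trace.re) ≤
      Fintype.card (Question n) * pClif n * M.trace.re :=
  S.trace_winOp_le (fun _ hψ => S.value_le_pClif hψ) hM

end PauliStrategy

end
end MagicBCS

open scoped Kronecker
namespace MagicBCS
noncomputable section
set_option linter.unusedSectionVars false
set_option linter.unusedSimpArgs false

/-! ### Operators on a subset of the qubits -/

section
variable {Q : Type} [Fintype Q] [DecidableEq Q]

lemma liftOperator_eq (T : Finset Q) (M : Operator T) :
    liftOperator T M = (M ⊗ₖ (1 : Matrix ({q // q ∉ T} → Bit) _ ℂ)).submatrix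
      (Equiv.piEquivPiSubtypeProd (· ∈ T) fun _ => Bit)
      (Equiv.piEquivPiSubtypeProd (· ∈ T) fun _ => Bit) := by
  ext i j
  simp only [liftOperator, Matrix.of_apply, Matrix.submatrix_apply, Matrix.kroneckerMap_apply,
    Equiv.piEquivPiSubtypeProd_apply, Matrix.one_apply, mul_ite, mul_one, mul_zero]
  congr 1
  apply propext
  rw [funext_iff]
  exact ⟨fun h q => h q.1 q.2, fun h q hq => h ⟨q, hq⟩⟩

lemma liftOperator_mul (T : Finset Q) (M N : Operator T) :
    liftOperator T (M * N) = liftOperator T M * liftOperator T N := by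
  rw [liftOperator_eq, liftOperator_eq, liftOperator_eq, Matrix.submatrix_mul_equiv,
    ← Matrix.mul_kronecker_mul, mul_one]

lemma liftOperator_one (T : Finset Q) : liftOperator T (1 : Operator T) = 1 := by
  rw [liftOperator_eq, Matrix.one_kronecker_one, Matrix.submatrix_one_equiv]

lemma liftOperator_smul (T : Finset Q) (c : ℂ) (M : Operator T) :
    liftOperator T (c • M) = c • liftOperator T M := by
  rw [liftOperator_eq, Matrix.smul_kronecker, liftOperator_eq]; rfl

lemma liftOperator_conjTranspose (T : Finset Q) (M : Operator T) :
    (liftOperator T M)ᴴ = liftOperator T Mᴴ := by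
  rw [liftOperator_eq, Matrix.conjTranspose_submatrix, Matrix.conjTranspose_kronecker,
    Matrix.conjTranspose_one, liftOperator_eq]

lemma liftOperator_mem_unitary {T : Finset Q} {M : Operator T}
    (h : M ∈ Matrix.unitaryGroup (T → Bit) ℂ) :
    (liftOperator T M)ᴴ * liftOperator T M = 1 := by
  rw [liftOperator_conjTranspose, ← liftOperator_mul, ← Matrix.star_eq_conjTranspose,
    Matrix.mem_unitaryGroup_iff'.1 h, liftOperator_one]

/-- A bit string on `T`, extended by zero. -/
def extendBits (T : Finset Q) (x : T → Bit) (q : Q) : Bit := if h : q ∈ T then x ⟨q, h⟩ else 0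

lemma liftOperator_pauliXZ (T : Finset Q) (x z : T → Bit) :
    liftOperator T (pauliXZ x z) = pauliXZ (extendBits T x) (extendBits T z) := by
  ext i j
  simp only [liftOperator, Matrix.of_apply, pauliXZ_apply]
  have h1 : i = j + extendBits T x ↔
      (∀ q, q ∉ T → i q = j q) ∧ (fun q : T => i q.1) = (fun q : T => j q.1) + x := by
    constructor
    · rintro rfl
      refine ⟨fun q hq => by simp [extendBits, hq], ?_⟩
      ext q; simp [extendBits, q.2]
    · rintro ⟨h, h'⟩
      ext q
      by_cases hq : q ∈ T
      · have := congrFun h' ⟨q, hq⟩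
        simpa [extendBits, hq] using this
      · simp [extendBits, hq, h q hq]
  have h2 : extendBits T z ⬝ᵥ j = z ⬝ᵥ fun q : T => j q.1 := by
    simp only [dotProduct, extendBits]
    rw [← Finset.sum_subset (Finset.subset_univ T), ← Finset.sum_coe_sort T]
    · exact Finset.sum_congr rfl fun q _ => by simp
    · intro q _ hq; simp [hq]
  rw [h2]
  simp only [h1, ite_and]

lemma liftOperator_isPauliOn {T : Finset Q} {P : Operator T} (hP : IsPauli P) :
    IsPauliOn T (liftOperator T P) := by
  obtain ⟨k, x, z, rfl⟩ := hP.exists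
  rw [liftOperator_smul, liftOperator_pauliXZ]
  exact IsPauliOn.intro k fun q hq => by simp [extendBits, hq]

/-- Replace the bits in `T`. -/
def glue (T : Finset Q) (a : T → Bit) (i : Q → Bit) (q : Q) : Bit :=
  if h : q ∈ T then a ⟨q, h⟩ else i q

lemma liftOperator_mulVec (T : Finset Q) (M : Operator T) (ψ : (Q → Bit) → ℂ) (i : Q → Bit) :
    (liftOperator T M *ᵥ ψ) i = ∑ a : T → Bit, M (fun q => i q.1) a * ψ (glue T a i) := by
  rw [Matrix.mulVec, dotProduct,
    ← (Equiv.piEquivPiSubtypeProd (· ∈ T) fun _ : Q => Bit).symm.sum_comp, Fintype.sum_prod_type]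
  refine Finset.sum_congr rfl fun a _ => ?_
  rw [Finset.sum_eq_single fun q => i q.1]
  · rw [liftOperator, Matrix.of_apply, if_pos]
    · congr 2
      ext q; simp [Equiv.piEquivPiSubtypeProd, q.2]
    · intro q hq; simp [Equiv.piEquivPiSubtypeProd, hq]
  · intro b _ hb
    rw [liftOperator, Matrix.of_apply, if_neg, zero_mul]
    intro h
    apply hb
    ext q
    rw [h q.1 q.2]
    simp [Equiv.piEquivPiSubtypeProd, q.2]
  · simp

lemma liftOperator_commute {S T : Finset Q} (h : Disjoint S T) {P : Operator Q}
    (hP : IsPauliOn S P) (M : Operator T) : Commute P (liftOperator T M) := by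
  obtain ⟨k, x, z, hxz, rfl⟩ := hP
  refine Commute.smul_left ?_ _
  ext i j
  have e1 : (pauliXZ x z * liftOperator T M) i j =
      sgn (z ⬝ᵥ (i + x)) * liftOperator T M (i + x) j := by
    rw [Matrix.mul_apply, Finset.sum_eq_single (i + x)]
    · rw [pauliXZ_apply, if_pos (bits_add_cancel i x).symm]
    · intro b _ hb
      rw [pauliXZ_apply, if_neg, zero_mul]
      intro h; exact hb (bits_eq_add_iff.1 h)
    · simp
  have e2 : (liftOperator T M * pauliXZ x z) i j =
      liftOperator T M i (j + x) * sgn (z ⬝ᵥ j) := by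
    rw [Matrix.mul_apply, Finset.sum_eq_single (j + x)]
    · rw [pauliXZ_apply, if_pos rfl]
    · intro b _ hb
      rw [pauliXZ_apply, if_neg hb, mul_zero]
    · simp
  rw [e1, e2]
  have hx : ∀ q ∈ T, x q = 0 := fun q hq => (hxz q (Finset.disjoint_right.1 h hq)).1
  have hz : ∀ q ∈ T, z q = 0 := fun q hq => (hxz q (Finset.disjoint_right.1 h hq)).2
  simp only [liftOperator, Matrix.of_apply]
  have c1 : (∀ q, q ∉ T → (i + x) q = j q) ↔ (∀ q, q ∉ T → i q = (j + x) q) := by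
    refine forall_congr' fun q => imp_congr_right fun _ => ?_
    simp only [Pi.add_apply]
    constructor
    · intro h; rw [← h, add_assoc, bit_add_self, add_zero]
    · intro h; rw [h, add_assoc, bit_add_self, add_zero]
  by_cases hc : ∀ q, q ∉ T → (i + x) q = j q
  · rw [if_pos hc, if_pos (c1.1 hc), mul_comm]
    congr 1
    · congr 1
      · ext q; simp [hx q.1 q.2]
      · ext q; simp [hx q.1 q.2]
    · congr 1
      apply Finset.sum_congr rfl
      intro q _
      by_cases hq : q ∈ T
      · rw [hz q hq, zero_mul, zero_mul]
      · rw [hc q hq]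
  · rw [if_neg hc, if_neg (fun h => hc (c1.2 h))]; simp

/-- A Pauli operator splits into a part on `T` and a part outside `T`. -/
lemma IsPauliOn.split {L : Finset Q} {P : Operator Q} (hP : IsPauliOn L P) (T : Finset Q) :
    ∃ (P₁ : Operator T) (P₂ : Operator Q), IsPauli P₁ ∧ IsPauliOn (L \ T) P₂ ∧
      P = liftOperator T P₁ * P₂ := by
  obtain ⟨k, x, z, h, rfl⟩ := hP
  refine ⟨Complex.I ^ k • pauliXZ (fun q => x q.1) (fun q => z q.1),
    pauliXZ (fun q => if q ∈ T then 0 else x q) (fun q => if q ∈ T then 0 else z q),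
    IsPauli.intro _ _ _, ?_, ?_⟩
  · have := IsPauliOn.intro (S := L \ T) 0 (x := fun q => if q ∈ T then 0 else x q)
      (z := fun q => if q ∈ T then 0 else z q) (by
      intro q hq
      by_cases hT : q ∈ T
      · simp [hT]
      · have hL : q ∉ L := fun hL => hq (Finset.mem_sdiff.2 ⟨hL, hT⟩)
        simp [hT, h q hL])
    simpa using this
  · rw [liftOperator_smul, liftOperator_pauliXZ, Matrix.smul_mul, pauliXZ_mul]
    have h0 : extendBits T (fun q => z q.1) ⬝ᵥ (fun q => if q ∈ T then 0 else x q) = 0 := by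
      apply Finset.sum_eq_zero
      intro q _
      by_cases hT : q ∈ T <;> simp [extendBits, hT]
    rw [h0, sgn_zero, one_smul]
    congr 2 <;> · ext q; by_cases hT : q ∈ T <;> simp [extendBits, hT]

/-- Split the Pauli operator into a factor on `T` and a factor off `T`. The latter commutes with the
gate, so the support grows at most by `T`: this is the elementary step of light-cone growth. -/
lemma liftOperator_conj_isPauliOn {L T : Finset Q} {U : Operator T} (hU : IsClifford U)
    {P : Operator Q} (hP : IsPauliOn L P) :
    IsPauliOn (L ∪ T) (liftOperator T U * P * (liftOperator T U)ᴴ) := by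
  obtain ⟨P₁, P₂, h1, h2, rfl⟩ := hP.split T
  have hc : Commute P₂ (liftOperator T U)ᴴ := by
    rw [liftOperator_conjTranspose]
    exact liftOperator_commute Finset.sdiff_disjoint h2 _
  have : liftOperator T U * (liftOperator T P₁ * P₂) * (liftOperator T U)ᴴ =
      liftOperator T (U * P₁ * Uᴴ) * P₂ := by
    rw [mul_assoc, mul_assoc, hc.eq, liftOperator_conjTranspose, liftOperator_mul, liftOperator_mul]
    simp only [mul_assoc]
  rw [this]
  exact ((liftOperator_isPauliOn (hU.2 _ h1)).mono Finset.subset_union_right).mul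
    (h2.mono (Finset.sdiff_subset.trans Finset.subset_union_left))

lemma liftOperator_isClifford {T : Finset Q} {U : Operator T} (hU : IsClifford U) :
    IsClifford (liftOperator T U) := by
  refine ⟨?_, fun P hP => (liftOperator_conj_isPauliOn hU hP).isPauli⟩
  rw [Matrix.mem_unitaryGroup_iff, Matrix.star_eq_conjTranspose, liftOperator_conjTranspose,
    ← liftOperator_mul, hU.mul_conjTranspose, liftOperator_one]

lemma basisProjector_eq (q : Q) (b : Bit) :
    basisProjector q b = eigenprojector (pauliXZ 0 (Pi.single q 1)) b := by
  ext i j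
  rw [basisProjector, eigenprojector_eq, Matrix.diagonal_apply]
  simp only [Matrix.smul_apply, Matrix.add_apply, Matrix.one_apply, pauliXZ_apply, add_zero,
    single_dotProduct, one_mul, smul_eq_mul]
  by_cases h : i = j
  · subst h
    rw [if_pos rfl, if_pos rfl, if_pos rfl]
    rcases bit_cases (i q) with h1 | h1 <;> rcases bit_cases b with h2 | h2 <;> simp [h1, h2] <;>
      norm_num
  · simp [h]

lemma basisProjector_conjTranspose (q : Q) (b : Bit) :
    (basisProjector q b)ᴴ = basisProjector q b := by
  rw [basisProjector, Matrix.diagonal_conjTranspose]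
  congr 1
  ext i
  simp only [Pi.star_apply]
  split_ifs <;> simp

lemma basisProjector_mul_self (q : Q) (b : Bit) :
    basisProjector q b * basisProjector q b = basisProjector q b := by
  rw [basisProjector, Matrix.diagonal_mul_diagonal]
  congr 1
  ext i
  split_ifs <;> simp

lemma basisProjector_sum (q : Q) : ∑ b, basisProjector q b = 1 := by
  rw [sum_bit]
  ext i j
  simp only [basisProjector, Matrix.add_apply, Matrix.diagonal_apply, Matrix.one_apply]
  by_cases h : i = j
  · subst h
    rcases bit_cases (i q) with h1 | h1 <;> simp [h1]
  · simp [h]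

lemma basisProjector_mulVec (q : Q) (b : Bit) (ψ : (Q → Bit) → ℂ) (i : Q → Bit) :
    (basisProjector q b *ᵥ ψ) i = if i q = b then ψ i else 0 := by
  rw [basisProjector, Matrix.mulVec_diagonal]; simp

end

/-! ### Trajectories -/

section
variable {C Q : Type} [Fintype C] [DecidableEq C] [Fintype Q] [DecidableEq Q]

/-- A pure branch `(c', ψ')` of the result of an operation that is applied to `(c, ψ)`. -/
def Op.Step (S : Finset C) (T : Finset Q) : Op S T → (C → Bit) → ((Q → Bit) → ℂ) →
    (C → Bit) → ((Q → Bit) → ℂ) → Prop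
  | .classical f, c, ψ, c', ψ' => c' = liftBits S f c ∧ ψ' = ψ
  | .unitary U, c, ψ, c', ψ' => c' = c ∧ ψ' = liftOperator T (U fun s => c s.1).1 *ᵥ ψ
  | .measure q t, c, ψ, c', ψ' =>
      ∃ b : Bit, c' = Function.update c t.1 b ∧ ψ' = basisProjector q.1 b *ᵥ ψ

/-- Branches of a list of operations. -/
def opsStep (S : Finset C) (T : Finset Q) : List (Op S T) → (C → Bit) → ((Q → Bit) → ℂ) →
    (C → Bit) → ((Q → Bit) → ℂ) → Prop
  | [], c, ψ, c', ψ' => c' = c ∧ ψ' = ψ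
  | o :: os, c, ψ, c', ψ' => ∃ c₁ ψ₁, o.Step S T c ψ c₁ ψ₁ ∧ opsStep S T os c₁ ψ₁ c' ψ'

/-- Branches of a list of gates. -/
def gatesStep : List (Gate C Q) → (C → Bit) → ((Q → Bit) → ℂ) →
    (C → Bit) → ((Q → Bit) → ℂ) → Prop
  | [], c, ψ, c', ψ' => c' = c ∧ ψ' = ψ
  | g :: gs, c, ψ, c', ψ' => ∃ c₁ ψ₁, opsStep g.bits g.qubits g.ops c ψ c₁ ψ₁ ∧
      gatesStep gs c₁ ψ₁ c' ψ'

lemma gatesStep_append {gs hs : List (Gate C Q)} {c : C → Bit} {ψ : (Q → Bit) → ℂ} {c' : C → Bit}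
    {ψ' : (Q → Bit) → ℂ} (h : gatesStep (gs ++ hs) c ψ c' ψ') :
    ∃ c₁ ψ₁, gatesStep gs c ψ c₁ ψ₁ ∧ gatesStep hs c₁ ψ₁ c' ψ' := by
  induction gs generalizing c ψ with
  | nil => exact ⟨c, ψ, ⟨rfl, rfl⟩, h⟩
  | cons g gs ih =>
    obtain ⟨c₁, ψ₁, h1, h2⟩ := h
    obtain ⟨c₂, ψ₂, h3, h4⟩ := ih h2
    exact ⟨c₂, ψ₂, ⟨c₁, ψ₁, h1, h3⟩, h4⟩

/-- The state is a mixture of pure branches with a given property. -/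
def Branches (I : (C → Bit) → ((Q → Bit) → ℂ) → Prop) (ρ : Hybrid C Q) : Prop :=
  ∀ c, ρ c ∈ AddSubmonoid.closure {M | ∃ ψ, I c ψ ∧ M = ketbra ψ}

variable {I I' : (C → Bit) → ((Q → Bit) → ℂ) → Prop} {ρ : Hybrid C Q}

lemma Branches.mono (h : Branches I ρ) (hI : ∀ c ψ, I c ψ → I' c ψ) : Branches I' ρ := fun c =>
  AddSubmonoid.closure_mono (by rintro _ ⟨ψ, hψ, e⟩; exact ⟨ψ, hI c ψ hψ, e⟩) (h c)

lemma Branches.map (h : Branches I ρ) (f : (C → Bit) → (C → Bit))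
    (hI : ∀ c ψ, I c ψ → I' (f c) ψ) : Branches I' (ρ.map f) := by
  intro c'
  refine sum_mem fun c _ => ?_
  split_ifs with hc
  · subst hc
    exact AddSubmonoid.closure_mono (by rintro _ ⟨ψ, hψ, e⟩; exact ⟨ψ, hI c ψ hψ, e⟩) (h c)
  · exact zero_mem _

lemma conj_mem_closure {A B : ((Q → Bit) → ℂ) → Prop} {M : Operator Q}
    (hM : M ∈ AddSubmonoid.closure {M | ∃ ψ, A ψ ∧ M = ketbra ψ}) (K : Operator Q)
    (h : ∀ ψ, A ψ → B (K *ᵥ ψ)) :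
    K * M * Kᴴ ∈ AddSubmonoid.closure {M | ∃ ψ, B ψ ∧ M = ketbra ψ} := by
  induction hM using AddSubmonoid.closure_induction with
  | mem x hx =>
    obtain ⟨ψ, hψ, rfl⟩ := hx
    rw [ketbra_conj]
    exact AddSubmonoid.subset_closure ⟨_, h ψ hψ, rfl⟩
  | zero => simp
  | add x y _ _ hx hy => rw [mul_add, add_mul]; exact add_mem hx hy

/-- Every operation acts as a sum of conjugations, possibly after moving weight between bit strings.
An invariant of the mixture may therefore be checked along pure branches, where an operation has the
simple description `Op.Step`. -/
lemma Branches.op (h : Branches I ρ) {S : Finset C} {T : Finset Q} (o : Op S T)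
    (hI : ∀ c ψ c' ψ', I c ψ → o.Step S T c ψ c' ψ' → I' c' ψ') : Branches I' (o.apply S T ρ) := by
  cases o with
  | classical f => exact h.map _ fun c ψ hψ => hI c ψ _ _ hψ ⟨rfl, rfl⟩
  | unitary U => exact fun c => conj_mem_closure (h c) _ fun ψ hψ => hI c ψ _ _ hψ ⟨rfl, rfl⟩
  | measure q t =>
    intro c
    refine sum_mem fun b _ => ?_
    have := conj_mem_closure (h (Function.update c t.1 b)) (basisProjector q.1 (c t.1))
      (B := I' c) fun ψ hψ => hI _ ψ _ _ hψ ⟨c t.1, by simp, rfl⟩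
    rwa [basisProjector_conjTranspose] at this

lemma Branches.ops (h : Branches I ρ) {S : Finset C} {T : Finset Q} (os : List (Op S T))
    (hI : ∀ c ψ c' ψ', I c ψ → opsStep S T os c ψ c' ψ' → I' c' ψ') :
    Branches I' (os.foldl (fun σ o => o.apply S T σ) ρ) := by
  induction os generalizing ρ I with
  | nil => exact h.mono fun c ψ hψ => hI c ψ c ψ hψ ⟨rfl, rfl⟩
  | cons o os ih =>
    exact ih (I := fun c₁ ψ₁ => ∃ c ψ, I c ψ ∧ o.Step S T c ψ c₁ ψ₁)
      (h.op o fun c ψ c' ψ' hψ hs => ⟨c, ψ, hψ, hs⟩)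
      fun c₁ ψ₁ c' ψ' ⟨c, ψ, hψ, hs⟩ h' => hI c ψ c' ψ' hψ ⟨c₁, ψ₁, hs, h'⟩

lemma Branches.gates (h : Branches I ρ) (gs : List (Gate C Q))
    (hI : ∀ c ψ c' ψ', I c ψ → gatesStep gs c ψ c' ψ' → I' c' ψ') :
    Branches I' (gs.foldl (fun σ g => g.apply σ) ρ) := by
  induction gs generalizing ρ I with
  | nil => exact h.mono fun c ψ hψ => hI c ψ c ψ hψ ⟨rfl, rfl⟩
  | cons g gs ih =>
    exact ih (I := fun c₁ ψ₁ => ∃ c ψ, I c ψ ∧ opsStep g.bits g.qubits g.ops c ψ c₁ ψ₁)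
      (h.ops g.ops fun c ψ c' ψ' hψ hs => ⟨c, ψ, hψ, hs⟩)
      fun c₁ ψ₁ c' ψ' ⟨c, ψ, hψ, hs⟩ h' => hI c ψ c' ψ' hψ ⟨c₁, ψ₁, hs, h'⟩

lemma Branches.circuit (h : Branches I ρ) (K : Circuit C Q)
    (hI : ∀ c ψ c' ψ', I c ψ → gatesStep (Circuit.gates K) c ψ c' ψ' → I' c' ψ') :
    Branches I' (K.apply ρ) := h.gates _ hI

lemma ketbra_ket0 : ketbra (ket0 : (Q → Bit) → ℂ) = Matrix.single 0 0 1 := by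
  ext i j
  simp only [ketbra, ket0, Matrix.vecMulVec_apply, Pi.star_apply, Pi.single_apply,
    Matrix.single_apply]
  by_cases h : i = 0 <;> by_cases h' : j = 0 <;> simp [h, h', eq_comm]

lemma Branches.init (c₀ : C → Bit) :
    Branches (fun c ψ => c = c₀ ∧ ψ = ket0) (Hybrid.init c₀ : Hybrid C Q) := by
  intro c
  simp only [Hybrid.init]
  split_ifs with h
  · exact AddSubmonoid.subset_closure ⟨ket0, ⟨h, rfl⟩, ketbra_ket0.symm⟩
  · exact zero_mem _

lemma trace_ketbra (ψ : (Q → Bit) → ℂ) : 0 ≤ (ketbra ψ).trace.re := by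
  rw [ketbra, Matrix.trace_vecMulVec, dotProduct, Complex.re_sum]
  refine Finset.sum_nonneg fun i _ => ?_
  rw [Pi.star_apply, Complex.star_def, Complex.mul_conj, Complex.ofReal_re]
  exact Complex.normSq_nonneg _

lemma Branches.trace_nonneg (h : Branches I ρ) (c : C → Bit) : 0 ≤ (ρ c).trace.re := by
  have := h c
  generalize ρ c = M at this
  induction this using AddSubmonoid.closure_induction with
  | mem x hx => obtain ⟨ψ, -, rfl⟩ := hx; exact trace_ketbra ψ
  | zero => simp
  | add x y _ _ hx hy => rw [Matrix.trace_add, Complex.add_re]; exact add_nonneg hx hy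

lemma Branches.eq_zero (h : Branches I ρ) (c : C → Bit) (h0 : ∀ ψ, I c ψ → ψ = 0) : ρ c = 0 := by
  have := h c
  generalize ρ c = M at this
  induction this using AddSubmonoid.closure_induction with
  | mem x hx =>
    obtain ⟨ψ, hψ, rfl⟩ := hx
    rw [h0 ψ hψ, ketbra]; simp
  | zero => rfl
  | add x y _ _ hx hy => rw [hx, hy, add_zero]

/-! ### The total trace -/

/-- The total probability. -/
def Hybrid.total (ρ : Hybrid C Q) : ℂ := ∑ c, (ρ c).trace

/-- Exchanging `c t` with `b` is an involution of the pairs `(c, b)`. It converts the sum over new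
outcomes and forgotten old values in a measurement into a sum over old bit strings and outcomes. -/
lemma sum_update {M : Type*} [AddCommMonoid M] (t : C) (f : (C → Bit) → Bit → M) :
    ∑ c : C → Bit, ∑ b : Bit, f (Function.update c t b) (c t) = ∑ c, ∑ b, f c b := by
  rw [← Fintype.sum_prod_type', ← Fintype.sum_prod_type']
  let e : (C → Bit) × Bit ≃ (C → Bit) × Bit :=
    { toFun := fun p => (Function.update p.1 t p.2, p.1 t)
      invFun := fun p => (Function.update p.1 t p.2, p.1 t)
      left_inv := fun p => by simp
      right_inv := fun p => by simp }
  exact Fintype.sum_equiv e _ _ fun p => rfl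

lemma Hybrid.sum_map {M : Type*} [AddCommMonoid M] (f : (C → Bit) → (C → Bit)) (ρ : Hybrid C Q)
    (F : (C → Bit) → Operator Q →+ M) :
    ∑ c, F c (ρ.map f c) = ∑ c, F (f c) (ρ c) := by
  simp only [Hybrid.map, map_sum]
  rw [Finset.sum_comm]
  refine Finset.sum_congr rfl fun c _ => ?_
  rw [Finset.sum_eq_single (f c)]
  · simp
  · intro b _ hb; rw [if_neg (Ne.symm hb), map_zero]
  · simp

lemma Hybrid.total_map (f : (C → Bit) → (C → Bit)) (ρ : Hybrid C Q) :
    (ρ.map f).total = ρ.total :=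
  Hybrid.sum_map f ρ fun _ => Matrix.traceAddMonoidHom _ _

lemma Op.total_apply {S : Finset C} {T : Finset Q} (o : Op S T) (ρ : Hybrid C Q) :
    (o.apply S T ρ).total = ρ.total := by
  cases o with
  | classical f => exact Hybrid.total_map _ _
  | unitary U =>
    refine Finset.sum_congr rfl fun c _ => ?_
    simp only [Op.apply]
    rw [Matrix.trace_mul_comm, ← mul_assoc, liftOperator_mem_unitary (U _).2, one_mul]
  | measure q t =>
    simp only [Hybrid.total, Op.apply, Matrix.trace_sum]
    rw [sum_update t.1 fun c b => (basisProjector q.1 b * ρ c * basisProjector q.1 b).trace]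
    refine Finset.sum_congr rfl fun c _ => ?_
    simp only [Matrix.trace_mul_comm _ (basisProjector q.1 _), ← mul_assoc,
      basisProjector_mul_self]
    rw [← Matrix.trace_sum, ← Finset.sum_mul, basisProjector_sum, one_mul]

lemma Gate.total_apply (g : Gate C Q) (ρ : Hybrid C Q) : (g.apply ρ).total = ρ.total := by
  unfold Gate.apply
  generalize g.ops = os
  induction os generalizing ρ with
  | nil => rfl
  | cons o os ih => rw [List.foldl_cons, ih, Op.total_apply]

lemma Circuit.total_apply (K : Circuit C Q) (ρ : Hybrid C Q) :
    (Circuit.apply K ρ).total = ρ.total := by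
  unfold Circuit.apply
  generalize Circuit.gates K = gs
  induction gs generalizing ρ with
  | nil => rfl
  | cons g gs ih => rw [List.foldl_cons, ih, Gate.total_apply]

lemma Hybrid.total_init (c₀ : C → Bit) : (Hybrid.init c₀ : Hybrid C Q).total = 1 := by
  simp only [Hybrid.total, Hybrid.init]
  rw [Finset.sum_eq_single c₀]
  · simp
  · intro c _ hc; simp [hc]
  · simp

end
end
end MagicBCS

open scoped Kronecker
namespace MagicBCS
noncomputable section
set_option linter.unusedSectionVars false
set_option linter.unusedSimpArgs false

/-! ### The Heisenberg picture with deferred measurements -/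

section
variable {C Q : Type} [Fintype C] [DecidableEq C] [Fintype Q] [DecidableEq Q]
variable {A : Type} [Fintype A] [DecidableEq A]

/-- Observables on the bits, the qubits, and auxiliary qubits `A`. -/
abbrev Observable (C Q A : Type) : Type := (C → Bit) → Operator (Q ⊕ A)

/-- The expectation of an observable, with the auxiliary qubits in the state `|0⟩`. -/
def pairing (ρ : Hybrid C Q) (F : Observable C Q A) : ℂ :=
  ∑ c, (F c * tensor (ρ c) (ketbra (ket0 : (A → Bit) → ℂ))).trace

lemma trace_mul_tensor (X : Operator (Q ⊕ A)) (M : Operator Q) :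
    (X * tensor M (ketbra (ket0 : (A → Bit) → ℂ))).trace =
      ∑ i : Q → Bit, ∑ j : Q → Bit, X (Sum.elim i 0) (Sum.elim j 0) * M j i := by
  rw [Matrix.trace]
  simp only [Matrix.diag, Matrix.mul_apply, tensor_apply, ketbra_ket0, Matrix.single_apply]
  have e := (Equiv.sumArrowEquivProdArrow Q A Bit).symm
  rw [← (Equiv.sumArrowEquivProdArrow Q A Bit).symm.sum_comp, Fintype.sum_prod_type]
  refine Finset.sum_congr rfl fun i _ => ?_
  rw [Finset.sum_eq_single 0]
  · rw [← (Equiv.sumArrowEquivProdArrow Q A Bit).symm.sum_comp, Fintype.sum_prod_type]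
    refine Finset.sum_congr rfl fun j _ => ?_
    rw [Finset.sum_eq_single 0]
    · simp [Equiv.sumArrowEquivProdArrow]
    · intro b _ hb; simp [Equiv.sumArrowEquivProdArrow, hb.symm]
    · simp
  · intro a _ ha
    apply Finset.sum_eq_zero
    intro j _
    simp [Equiv.sumArrowEquivProdArrow, ha.symm]
  · simp

/-- The pull-back along a change of the bits. -/
def classicalPull (f : (C → Bit) → (C → Bit)) : Observable C Q A →ₐ[ℂ] Observable C Q A :=
  AlgHom.ofLinearMap
    { toFun := fun F c => F (f c)
      map_add' := fun _ _ => rfl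
      map_smul' := fun _ _ => rfl } rfl fun _ _ => rfl

/-- The pull-back along a controlled unitary. -/
def unitaryPull (U : (C → Bit) → Operator Q) (hU : ∀ c, U c * (U c)ᴴ = 1) :
    Observable C Q A →ₐ[ℂ] Observable C Q A :=
  AlgHom.ofLinearMap
    { toFun := fun F c => tensor (U c)ᴴ 1 * F c * tensor (U c) 1
      map_add' := fun F G => by ext1 c; simp [mul_add, add_mul]
      map_smul' := fun r F => by ext1 c; simp }
    (by
      ext1 c
      simp only [LinearMap.coe_mk, AddHom.coe_mk, Pi.one_apply, mul_one, tensor_mul]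
      rw [mul_eq_one_comm.1 (hU c), tensor_one])
    (by
      intro F G
      ext1 c
      simp only [LinearMap.coe_mk, AddHom.coe_mk, Pi.mul_apply]
      have : tensor (U c) (1 : Operator A) * tensor (U c)ᴴ 1 = 1 := by
        rw [tensor_mul, hU, mul_one, tensor_one]
      calc _ = tensor (U c)ᴴ 1 * F c * (1 : Operator (Q ⊕ A)) * G c * tensor (U c) 1 := by
            simp only [mul_assoc, one_mul]
        _ = _ := by rw [← this]; simp only [mul_assoc])

/-- Forget the new auxiliary bit. -/
def dropBit (i : Q ⊕ Option A → Bit) : Q ⊕ A → Bit := fun x => i (x.map id some)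

/-- The outcome of a deferred measurement. -/
def recBit (q : Q) (i : Q ⊕ Option A → Bit) : Bit := i (.inr none) + i (.inl q)

/-- Bit strings with a new auxiliary bit, relative to the measured bit. -/
def recEquiv (q : Q) : (Q ⊕ Option A → Bit) ≃ (Q ⊕ A → Bit) × Bit where
  toFun i := (dropBit i, recBit q i)
  invFun p
    | .inl q' => p.1 (.inl q')
    | .inr none => p.2 + p.1 (.inl q)
    | .inr (some a) => p.1 (.inr a)
  left_inv i := by
    ext x
    rcases x with x | _ | x
    · rfl
    · simp [dropBit, recBit, add_assoc, bit_add_self]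
    · rfl
  right_inv p := by
    ext x
    · rcases x with x | x <;> rfl
    · simp [dropBit, recBit, add_assoc, bit_add_self]

/-- The operator that is block diagonal in the outcome of a deferred measurement. -/
def blockOp (q : Q) (X : Bit → Operator (Q ⊕ A)) : Operator (Q ⊕ Option A) :=
  (Matrix.blockDiagonal X).submatrix (recEquiv q) (recEquiv q)

lemma blockOp_apply (q : Q) (X : Bit → Operator (Q ⊕ A)) (i j : Q ⊕ Option A → Bit) :
    blockOp q X i j = if recBit q i = recBit q j then X (recBit q i) (dropBit i) (dropBit j)
      else 0 := rfl

/-- The pull-back along a measurement. -/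
def measurePull (q : Q) (t : C) : Observable C Q A →ₐ[ℂ] Observable C Q (Option A) :=
  AlgHom.ofLinearMap
    -- A controlled NOT copies the qubit `q` to the fresh auxiliary qubit, and block `b` is the
    -- observable for the stored outcome `b`. The dilation makes the pull-back multiplicative;
    -- without an auxiliary qubit it would only be a positive map, and products of output signs
    -- would not be preserved.
    { toFun := fun F c => blockOp q fun b => F (Function.update c t b)
      map_add' := fun F G => by
        ext c i j
        simp only [blockOp_apply, Pi.add_apply, Matrix.add_apply]
        split_ifs <;> simp
      map_smul' := fun r F => by
        ext c i j
        simp only [blockOp_apply, Pi.smul_apply, Matrix.smul_apply]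
        split_ifs <;> simp }
    (by
      ext1 c
      simp only [LinearMap.coe_mk, AddHom.coe_mk, Pi.one_apply, blockOp]
      rw [show (fun _ : Bit => (1 : Operator (Q ⊕ A))) = 1 from rfl, Matrix.blockDiagonal_one,
        Matrix.submatrix_one_equiv])
    (by
      intro F G
      ext1 c
      simp only [LinearMap.coe_mk, AddHom.coe_mk, Pi.mul_apply, blockOp]
      rw [Matrix.submatrix_mul_equiv, ← Matrix.blockDiagonal_mul])

lemma pairing_map (f : (C → Bit) → (C → Bit)) (ρ : Hybrid C Q) (F : Observable C Q A) :
    pairing (ρ.map f) F = pairing ρ (classicalPull f F) := by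
  refine Hybrid.sum_map f ρ fun c => 
    { toFun := fun M => (F c * tensor M (ketbra (ket0 : (A → Bit) → ℂ))).trace
      map_zero' := ?_
      map_add' := ?_ }
  · have : tensor (0 : Operator Q) (ketbra (ket0 : (A → Bit) → ℂ)) = 0 := by
      simpa using tensor_smul_left 0 (0 : Operator Q) (ketbra (ket0 : (A → Bit) → ℂ))
    rw [this, mul_zero, Matrix.trace_zero]
  · intro M N
    rw [tensor_add_left, mul_add, Matrix.trace_add]

lemma pairing_unitary (U : (C → Bit) → Operator Q) (hU : ∀ c, U c * (U c)ᴴ = 1) (ρ : Hybrid C Q)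
    (F : Observable C Q A) :
    pairing (fun c => U c * ρ c * (U c)ᴴ) F = pairing ρ (unitaryPull U hU F) := by
  refine Finset.sum_congr rfl fun c _ => ?_
  have : tensor (U c * ρ c * (U c)ᴴ) (ketbra (ket0 : (A → Bit) → ℂ)) =
      tensor (U c) 1 * tensor (ρ c) (ketbra ket0) * tensor (U c)ᴴ 1 := by
    rw [tensor_mul, tensor_mul, one_mul, mul_one]
  rw [this, ← mul_assoc, ← mul_assoc, Matrix.trace_mul_comm]
  simp only [unitaryPull, AlgHom.ofLinearMap_apply, LinearMap.coe_mk, AddHom.coe_mk, mul_assoc]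

/-- With the auxiliary qubit in `|0⟩` the recorded bit equals the measured qubit. So the block
structure deletes exactly the matrix entries between different values of that qubit, as the
measurement does. -/
lemma pairing_measure {S : Finset C} {T : Finset Q} (q : T) (t : S) (ρ : Hybrid C Q)
    (F : Observable C Q A) :
    pairing ((Op.measure q t).apply S T ρ) F = pairing ρ (measurePull q.1 t.1 F) := by
  have h1 : pairing ((Op.measure q t).apply S T ρ) F = ∑ c : C → Bit, ∑ b : Bit,
      (F c * tensor (basisProjector q.1 (c t.1) * ρ (Function.update c t.1 b) *
        basisProjector q.1 (c t.1)) (ketbra ket0)).trace := by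
    refine Finset.sum_congr rfl fun c _ => ?_
    simp only [Op.apply, trace_mul_tensor, Matrix.sum_apply, Finset.mul_sum]
    conv_rhs => rw [Finset.sum_comm]
    refine Finset.sum_congr rfl fun j _ => ?_
    rw [Finset.sum_comm]
  have h2 := sum_update t.1 fun c b => (F (Function.update c t.1 b) *
    tensor (basisProjector q.1 b * ρ c * basisProjector q.1 b)
      (ketbra (ket0 : (A → Bit) → ℂ))).trace
  simp only [Function.update_idem, Function.update_eq_self] at h2
  rw [h1, h2, pairing]
  refine Finset.sum_congr rfl fun c _ => ?_
  simp only [trace_mul_tensor, measurePull, AlgHom.ofLinearMap_apply, LinearMap.coe_mk,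
    AddHom.coe_mk, blockOp_apply]
  rw [Finset.sum_comm]
  refine Finset.sum_congr rfl fun i _ => ?_
  rw [Finset.sum_comm]
  refine Finset.sum_congr rfl fun j _ => ?_
  have hp : ∀ b, (basisProjector q.1 b * ρ c * basisProjector q.1 b) j i =
      if i q.1 = b then (if j q.1 = b then ρ c j i else 0) else 0 := by
    intro b
    simp only [basisProjector, Matrix.mul_diagonal, Matrix.diagonal_mul]
    split_ifs <;> simp
  simp only [hp]
  rw [Finset.sum_eq_single (i q.1)]
  · have hd : ∀ i : Q → Bit, dropBit (A := A) (Sum.elim i 0) = Sum.elim i 0 := by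
      intro i; ext x; rcases x with x | x <;> rfl
    simp only [recBit, Sum.elim_inl, Sum.elim_inr, Pi.zero_apply, zero_add, if_true, hd]
    by_cases h : j q.1 = i q.1
    · rw [if_pos h, if_pos h.symm]
    · rw [if_neg h, if_neg (Ne.symm h)]; simp
  · intro b _ hb
    rw [if_neg hb.symm, mul_zero]
  · simp

end
end
end MagicBCS

open scoped Kronecker
namespace MagicBCS
noncomputable section
set_option linter.unusedSectionVars false
set_option linter.unusedSimpArgs false

/-! ### Light cones of magic-free circuits -/

section
variable {C Q : Type} [Fintype C] [DecidableEq C] [Fintype Q] [DecidableEq Q]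
variable {A : Type} [Fintype A] [DecidableEq A]

open Classical in
/-- The qubits in the set of wires `W`, and all auxiliary qubits. -/
def coneQubits (A : Type) [Fintype A] (W : Finset (C ⊕ Q)) : Finset (Q ⊕ A) :=
  Finset.univ.filter fun x => ∀ q, x = Sum.inl q → Sum.inr q ∈ W

/-- The qubits in the set of wires `W`. -/
def wireQubits (W : Finset (C ⊕ Q)) : Finset Q := Finset.univ.filter fun q => Sum.inr q ∈ W

lemma exists_tensor_cone {W : Finset (C ⊕ Q)} {X : Operator (Q ⊕ A)}
    (hX : IsPauliOn (coneQubits A W) X) :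
    ∃ (M : Operator Q) (N : Operator A), IsPauliOn (wireQubits W) M ∧ IsPauli N ∧
      X = tensor M N := by
  obtain ⟨k, x, z, h, rfl⟩ := hX
  refine ⟨Complex.I ^ k • pauliXZ (x ∘ Sum.inl) (z ∘ Sum.inl), pauliXZ (x ∘ Sum.inr) (z ∘ Sum.inr),
    IsPauliOn.intro k fun q hq => h _ ?_, isPauli_pauliXZ _ _, ?_⟩
  · simp only [coneQubits, wireQubits, Finset.mem_filter, Finset.mem_univ, true_and] at hq ⊢
    exact fun h' => hq (h' q rfl)
  · rw [tensor_smul_left, tensor_pauliXZ]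
    congr 2 <;> · ext x; rcases x with x | x <;> rfl

lemma isPauliOn_tensor_cone {W : Finset (C ⊕ Q)} {M : Operator Q} {N : Operator A}
    (hM : IsPauliOn (wireQubits W) M) (hN : IsPauli N) :
    IsPauliOn (coneQubits A W) (tensor M N) := by
  obtain ⟨k, x, z, h, rfl⟩ := hM
  obtain ⟨k', x', z', rfl⟩ := hN.exists
  rw [tensor_smul_left, tensor_smul_right, tensor_pauliXZ, smul_smul, ← pow_add]
  refine IsPauliOn.intro _ fun q hq => ?_
  simp only [coneQubits, Finset.mem_filter, Finset.mem_univ, true_and] at hq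
  push Not at hq
  obtain ⟨q, rfl, hq⟩ := hq
  exact h q (by simpa [wireQubits] using hq)

/-- Up to a sign, `F` is a Pauli operator that is selected by the free bits; the sign is an affine
function of the records.  Only the wires in `W` are involved. -/
def IsObs (R : Set C) (W : Finset (C ⊕ Q)) (F : Observable C Q A) : Prop :=
  ∃ (g : (C → Bit) → Bit) (X : Observable C Q A), (∀ c, F c = sgn (g c) • X c) ∧
    (∀ c, IsPauliOn (coneQubits A W) (X c)) ∧ (∀ c c', AgreeOff R c c' → X c = X c') ∧
    (∀ c₁ c₂ c₃, AgreeOff R c₁ c₂ → AgreeOff R c₁ c₃ →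
      g (c₁ + c₂ + c₃) = g c₁ + g c₂ + g c₃) ∧
    ∀ c c', (∀ s, Sum.inl s ∈ W → c s = c' s) → F c = F c'

lemma IsObs.isPauli {R : Set C} {W : Finset (C ⊕ Q)} {F : Observable C Q A} (h : IsObs R W F)
    (c : C → Bit) : IsPauli (F c) := by
  obtain ⟨g, X, h1, h2, -⟩ := h
  rw [h1]; exact ((h2 c).sgn_smul _).isPauli

lemma IsObs.congr_bits {R : Set C} {W : Finset (C ⊕ Q)} {F : Observable C Q A} (h : IsObs R W F)
    {c c' : C → Bit} (hc : ∀ s, Sum.inl s ∈ W → c s = c' s) : F c = F c' := by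
  obtain ⟨g, X, -, -, -, -, h⟩ := h
  exact h c c' hc

lemma IsObs.mono {R : Set C} {W W' : Finset (C ⊕ Q)} {F : Observable C Q A} (h : IsObs R W F)
    (hW : W ⊆ W') : IsObs R W' F := by
  obtain ⟨g, X, h1, h2, h3, h4, h5⟩ := h
  refine ⟨g, X, h1, fun c => (h2 c).mono ?_, h3, h4, fun c c' hc => h5 c c' fun s hs => hc s (hW hs)⟩
  intro x
  simp only [coneQubits, Finset.mem_filter, Finset.mem_univ, true_and]
  exact fun hx q hq => hW (hx q hq)

lemma isObs_sign (R : Set C) (t : C) :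
    IsObs R ({Sum.inl t} : Finset (C ⊕ Q)) (fun c => sgn (c t) • (1 : Operator (Q ⊕ A))) :=
  ⟨fun c => c t, fun _ => 1, fun _ => rfl, fun _ => isPauliOn_one _, fun _ _ _ => rfl,
    fun _ _ _ _ _ => rfl, fun c c' h => by
      show sgn (c t) • _ = sgn (c' t) • _
      rw [h t (by simp)]⟩

lemma bit_add_three (x : Bit) : x + x + x = x := by rw [bit_add_self, zero_add]

/-- Free bits after the operation depend only on free bits before it, and the records are affine in
the old records once the free bits are fixed. Both the selection of the Pauli operator and the
affine sign survive composition with such a map. -/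
lemma isObs_classicalPull {R₁ R₂ : Set C} {W : Finset (C ⊕ Q)} {F : Observable C Q A}
    (h : IsObs R₂ W F) {S : Finset C} {T : Finset Q} {f : (S → Bit) → (S → Bit)}
    (hf : (Op.classical f : Op S T).MagicFree {s | s.1 ∈ R₁} {s | s.1 ∈ R₂})
    (hR : ∀ s, s ∉ S → (s ∈ R₂ ↔ s ∈ R₁))
    (hW : S.disjSum T ⊆ W ∨ Disjoint W (S.disjSum T)) :
    IsObs R₁ W (classicalPull (liftBits S f) F) := by
  obtain ⟨g, X, h1, h2, h3, h4, h5⟩ := h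
  obtain ⟨hf1, hf2⟩ := hf
  have ag : ∀ c c', AgreeOff R₁ c c' →
      AgreeOff {s : S | s.1 ∈ R₁} (fun s => c s.1) (fun s => c' s.1) :=
    fun c c' h s hs => h s.1 hs
  have off : ∀ c c', AgreeOff R₁ c c' → AgreeOff R₂ (liftBits S f c) (liftBits S f c') := by
    intro c c' h s hs
    unfold liftBits
    split_ifs with hS
    · exact hf1 ⟨s, hS⟩ hs _ _ (ag _ _ h)
    · exact h s (fun h' => hs ((hR s hS).2 h'))
  have add : ∀ c₁ c₂ c₃, AgreeOff R₁ c₁ c₂ → AgreeOff R₁ c₁ c₃ →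
      liftBits S f (c₁ + c₂ + c₃) = liftBits S f c₁ + liftBits S f c₂ + liftBits S f c₃ := by
    intro c₁ c₂ c₃ h2 h3
    ext s
    by_cases hs : s ∈ R₂
    · simp only [liftBits, Pi.add_apply]
      split_ifs with hS
      · exact hf2 ⟨s, hS⟩ hs _ _ _ (ag _ _ h2) (ag _ _ h3)
      · rfl
    · have e : AgreeOff R₁ c₁ (c₁ + c₂ + c₃) := by
        intro s hs
        simp only [Pi.add_apply, ← h2 s hs, ← h3 s hs, bit_add_three]
      simp only [Pi.add_apply]
      rw [← off _ _ e s hs, ← off _ _ h2 s hs, ← off _ _ h3 s hs, bit_add_three]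
  refine ⟨fun c => g (liftBits S f c), fun c => X (liftBits S f c), fun c => h1 _, fun c => h2 _,
    fun c c' h => h3 _ _ (off _ _ h), ?_, ?_⟩
  · intro c₁ c₂ c₃ e2 e3
    show g _ = _
    rw [add _ _ _ e2 e3]
    exact h4 _ _ _ (off _ _ e2) (off _ _ e3)
  · intro c c' h
    refine h5 _ _ fun s hs => ?_
    unfold liftBits
    split_ifs with hS
    · rcases hW with hW | hW
      · congr 1
        ext s'
        exact h _ (hW (by simp))
      · exact absurd (show Sum.inl s ∈ S.disjSum T by simpa using hS) (Finset.disjoint_left.1 hW hs)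
    · exact h s hs

/-- A Clifford gate selected by free bits conjugates the Pauli operator to another one selected by
free bits. A Pauli gate controlled by one bit, possibly a record, changes only the sign. A gate off
the cone cancels against its adjoint. -/
lemma isObs_unitaryPull {R : Set C} {W : Finset (C ⊕ Q)} {F : Observable C Q A}
    (h : IsObs R W F) {S : Finset C} {T : Finset Q} {U : (S → Bit) → Matrix.unitaryGroup (T → Bit) ℂ}
    {R' : Set S} (hU : (Op.unitary U : Op S T).MagicFree {s | s.1 ∈ R} R')
    (hW : S.disjSum T ⊆ W ∨ Disjoint W (S.disjSum T))
    (hU' : ∀ c : C → Bit, liftOperator T (U fun s => c s.1).1 *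
      (liftOperator T (U fun s => c s.1).1)ᴴ = 1) :
    IsObs R W (unitaryPull (A := A) (fun c => liftOperator T (U fun s => c s.1).1) hU' F) := by
  obtain ⟨g, X, h1, h2, h3, h4, h5⟩ := h
  have happ : ∀ c, unitaryPull (A := A) (fun c => liftOperator T (U fun s => c s.1).1) hU' F c =
    tensor (liftOperator T (U fun s => c s.1).1)ᴴ 1 * F c *
      tensor (liftOperator T (U fun s => c s.1).1) 1 := fun c => rfl
  have hU'' := fun c => mul_eq_one_comm.1 (hU' c)
  rcases hW with hW | hW
  · have hTW : T ⊆ wireQubits W := fun q hq => by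
      simp only [wireQubits, Finset.mem_filter, Finset.mem_univ, true_and]
      exact hW (by simpa using hq)
    have dep : ∀ c c', (∀ s, Sum.inl s ∈ W → c s = c' s) →
        unitaryPull (A := A) (fun c => liftOperator T (U fun s => c s.1).1) hU' F c =
        unitaryPull (A := A) (fun c => liftOperator T (U fun s => c s.1).1) hU' F c' := by
      intro c c' h
      rw [happ, happ, h5 c c' h,
        show (fun s : S => c s.1) = (fun s : S => c' s.1) from
          funext fun s => h _ (hW (by simp))]
    obtain ⟨-, ⟨hC, hag⟩ | ⟨t, P, hP, hUP⟩⟩ := hU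
    · refine ⟨g, fun c => tensor (liftOperator T (U fun s => c s.1).1)ᴴ 1 * X c *
        tensor (liftOperator T (U fun s => c s.1).1) 1, fun c => ?_, fun c => ?_, ?_, h4, dep⟩
      · rw [happ, h1, Matrix.mul_smul, Matrix.smul_mul]
      · obtain ⟨M, N, hM, hN, e⟩ := exists_tensor_cone (h2 c)
        simp only []
        rw [e, tensor_mul, tensor_mul, one_mul, mul_one]
        refine isPauliOn_tensor_cone ?_ hN
        have := liftOperator_conj_isPauliOn (T := T) (hC fun s => c s.1).conjTranspose hM
        rw [← liftOperator_conjTranspose, Matrix.conjTranspose_conjTranspose,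
          Finset.union_eq_left.2 hTW] at this
        exact this
      · intro c c' h
        simp only []
        rw [h3 c c' h, hag (fun s => c s.1) (fun s => c' s.1) fun s hs => h s.1 hs]
    · classical
      have hPu : IsPauli (tensor (liftOperator T P) (1 : Operator A)) :=
        isPauli_tensor (liftOperator_isPauliOn hP).isPauli isPauli_one
      set P' := tensor (liftOperator T P) (1 : Operator A) with hP'
      -- `ω` tells whether the gate anticommutes with the observable. It depends only on the free
      -- bits, so the additional sign `ω c * c t` is affine in the records.
      set ω : (C → Bit) → Bit := fun c => if X c * P' = P' * X c then 0 else 1 with hω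
      have hcm : ∀ c, X c * P' = sgn (ω c) • (P' * X c) := by
        intro c
        simp only [hω]
        split_ifs with h
        · simpa using h
        · simpa using ((h2 c).isPauli.commute_or hPu).resolve_left h
      refine ⟨fun c => g c + ω c * c t.1, X, fun c => ?_, h2, h3, ?_, dep⟩
      · rw [happ, h1, hUP]
        by_cases ht : c t.1 = 0
        · simp [ht, liftOperator_one, tensor_one]
        · have ht1 := (bit_cases (c t.1)).resolve_left ht
          have e : tensor (liftOperator T P)ᴴ (1 : Operator A) = P'ᴴ := by
            rw [hP', tensor_conjTranspose, Matrix.conjTranspose_one]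
          simp only [ht1]
          rw [if_neg one_ne_zero, e, ← hP', mul_one, sgn_add, Matrix.mul_smul, Matrix.smul_mul, mul_assoc,
            hcm, Matrix.mul_smul, ← mul_assoc, hPu.conjTranspose_mul, one_mul, smul_smul]
      · intro c₁ c₂ c₃ e2 e3
        have ω2 : ω c₂ = ω c₁ := by simp only [hω, h3 _ _ e2]
        have ω3 : ω c₃ = ω c₁ := by simp only [hω, h3 _ _ e3]
        have ω4 : ω (c₁ + c₂ + c₃) = ω c₁ := by
          have : AgreeOff R c₁ (c₁ + c₂ + c₃) := by
            intro s hs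
            simp only [Pi.add_apply, ← e2 s hs, ← e3 s hs, bit_add_three]
          simp only [hω, ← h3 _ _ this]
        simp only [h4 _ _ _ e2 e3, ω2, ω3, ω4, Pi.add_apply]
        ring
  · have : unitaryPull (A := A) (fun c => liftOperator T (U fun s => c s.1).1) hU' F = F := by
      ext1 c
      rw [happ, h1]
      obtain ⟨M, N, hM, hN, e⟩ := exists_tensor_cone (h2 c)
      have hd : Disjoint (wireQubits W) T := by
        rw [Finset.disjoint_left]
        intro q hq hT
        simp only [wireQubits, Finset.mem_filter, Finset.mem_univ, true_and] at hq
        exact Finset.disjoint_left.1 hW hq (by simpa using hT)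
      rw [e, Matrix.mul_smul, Matrix.smul_mul, tensor_mul, tensor_mul, one_mul, mul_one, mul_assoc,
        (liftOperator_commute hd hM _).eq, ← mul_assoc, hU'', one_mul]
    rw [this]
    exact ⟨g, X, h1, h2, h3, h4, h5⟩

/-- The sign `(-1)^(m b)` of the recorded outcome is `Z ^ m` on the auxiliary qubit and on `q`,
because `b` is the sum of these two bits. Since the outcome is the same for row and column, an `X`
on `q` is accompanied by an `X` on the auxiliary qubit. -/
lemma blockOp_pauliXZ (q : Q) (m : Bit) (x z : Q ⊕ A → Bit) :
    blockOp q (fun b => sgn (m * b) • pauliXZ x z) =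
      pauliXZ (fun y => match y with
          | .inl q' => x (.inl q')
          | .inr none => x (.inl q)
          | .inr (some a) => x (.inr a))
        (fun y => match y with
          | .inl q' => z (.inl q') + if q' = q then m else 0
          | .inr none => m
          | .inr (some a) => z (.inr a)) := by
  ext i j
  rw [blockOp_apply, pauliXZ_apply, Matrix.smul_apply, pauliXZ_apply, smul_eq_mul]
  have h1 : (i = j + (fun y => match y with
          | .inl q' => x (.inl q')
          | .inr none => x (.inl q)
          | .inr (some a) => x (.inr a))) ↔ recBit q i = recBit q j ∧ dropBit i = dropBit j + x := by
    constructor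
    · intro h
      refine ⟨?_, ?_⟩
      · have e1 := congrFun h (.inr none)
        have e2 := congrFun h (.inl q)
        simp only [Pi.add_apply] at e1 e2
        rw [recBit, recBit, e1, e2]
        linear_combination bit_add_self (x (.inl q))
      · ext y
        rw [h]
        rcases y with y | y <;> rfl
    · rintro ⟨hr, hd⟩
      have e2 := congrFun hd (.inl q)
      ext y
      rcases y with y | _ | y
      · exact congrFun hd (.inl y)
      · simp only [recBit] at hr
        simp only [dropBit, Pi.add_apply, Sum.map_inl, id] at e2
        simp only [Pi.add_apply]
        rw [e2] at hr
        linear_combination hr - bit_add_self (x (.inl q))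
      · exact congrFun hd (.inr y)
  by_cases h : recBit q i = recBit q j
  · rw [if_pos h]
    by_cases h' : dropBit i = dropBit j + x
    · rw [if_pos h', if_pos (h1.2 ⟨h, h'⟩), ← sgn_add, h]
      congr 1
      simp only [dotProduct, Fintype.sum_sum_type, Fintype.sum_option, recBit, dropBit, add_mul,
        Finset.sum_add_distrib, ite_mul, zero_mul, Finset.sum_ite_eq', Finset.mem_univ, if_true,
        Sum.map_inl, Sum.map_inr, id]
      ring
    · rw [if_neg h', if_neg (fun h2 => h' (h1.1 h2).2), mul_zero]
  · rw [if_neg h, if_neg (fun h2 => h (h1.1 h2).1)]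

/-- As a function of the newly recorded bit `b` the sign is `g₀ + m * b`, where the slope `m`
depends only on the free bits. The term `m * b` becomes a factor `Z ^ m` by `blockOp_pauliXZ`, and
the rest remains a sign. If the gate lies off the cone, the observable does not depend on the
overwritten bit and `m` vanishes, so `q` does not enter the cone. -/
lemma isObs_measurePull {R₁ R₂ : Set C} {W : Finset (C ⊕ Q)} {F : Observable C Q A}
    (h : IsObs R₂ W F) {S : Finset C} {T : Finset Q} {q : T} {t : S}
    (hR : R₂ = insert t.1 R₁)
    (hW : S.disjSum T ⊆ W ∨ Disjoint W (S.disjSum T)) :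
    IsObs R₁ W (measurePull q.1 t.1 F) := by
  obtain ⟨g, X, h1, h2, h3, h4, h5⟩ := h
  have up : ∀ c c' b b', AgreeOff R₁ c c' →
      AgreeOff R₂ (Function.update c t.1 b) (Function.update c' t.1 b') := by
    intro c c' b b' h s hs
    rw [hR, Set.mem_insert_iff, not_or] at hs
    rw [Function.update_of_ne hs.1, Function.update_of_ne hs.1, h s hs.2]
  set m : (C → Bit) → Bit := fun c =>
    g (Function.update c t.1 0) + g (Function.update c t.1 1) with hm
  have hm' : ∀ c c', AgreeOff R₁ c c' → m c = m c' := by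
    intro c c' h
    have e : Function.update c' t.1 1 = Function.update c t.1 1 + Function.update c t.1 0 +
        Function.update c' t.1 0 := by
      ext s
      by_cases hs : s = t.1
      · subst hs; simp
      · simp [Function.update_of_ne hs, bit_add_self]
    simp only [hm]
    rw [e, h4 _ _ _ (up c c 1 0 fun _ _ => rfl) (up c c' 1 0 h)]
    linear_combination - bit_add_self (g (Function.update c' t.1 0))
  have hX : ∀ c b, X (Function.update c t.1 b) = X c := by
    intro c b
    rw [← Function.update_eq_self t.1 c, Function.update_idem]
    exact h3 _ _ (up c c _ _ fun _ _ => rfl)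
  refine ⟨fun c => g (Function.update c t.1 0), fun c => blockOp q.1 fun b => sgn (m c * b) • X c,
    fun c => ?_, fun c => ?_, fun c c' h => ?_, ?_, ?_⟩
  · show blockOp q.1 (fun b => F (Function.update c t.1 b)) = _
    have : ∀ b, F (Function.update c t.1 b) =
        sgn (g (Function.update c t.1 0)) • sgn (m c * b) • X c := by
      intro b
      rw [h1, hX, smul_smul, ← sgn_add]
      congr 2
      rcases bit_cases b with hb | hb
      · simp [hb]
      · rw [hb, mul_one, hm]
        linear_combination - bit_add_self (g (Function.update c t.1 0))
    simp only [this]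
    ext i j
    simp only [blockOp_apply, Matrix.smul_apply]
    split_ifs <;> simp
  · have h2c := h2 c
    have hWc : q.1 ∈ wireQubits W ∨ m c = 0 := by
      rcases hW with hW | hW
      · left
        simp only [wireQubits, Finset.mem_filter, Finset.mem_univ, true_and]
        exact hW (by simp)
      · right
        have e := h5 (Function.update c t.1 0) (Function.update c t.1 1) fun s hs => by
          have : s ≠ t.1 := by
            rintro rfl
            exact Finset.disjoint_left.1 hW hs (by simp)
          rw [Function.update_of_ne this, Function.update_of_ne this]
        rw [h1, h1, hX, hX] at e
        have e' := congrArg (· * (X c)ᴴ) e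
        simp only [Matrix.smul_mul, h2c.isPauli.mul_conjTranspose] at e'
        have e2 := congrFun (congrFun e' 0) 0
        simp only [Matrix.smul_apply, Matrix.one_apply_eq, smul_eq_mul, mul_one] at e2
        simp only [hm]
        rcases bit_cases (g (Function.update c t.1 0)) with h0 | h0 <;>
          rcases bit_cases (g (Function.update c t.1 1)) with h1' | h1' <;>
          simp [h0, h1'] at e2 ⊢
        · norm_num at e2
        · norm_num at e2
        · exact bit_add_self 1
    obtain ⟨k, x, z, hxz, e⟩ := h2c
    have : (blockOp q.1 fun b => sgn (m c * b) • X c) =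
        Complex.I ^ k • blockOp q.1 fun b => sgn (m c * b) • pauliXZ x z := by
      ext i j
      simp only [blockOp_apply, Matrix.smul_apply, e]
      split_ifs
      · simp only [smul_eq_mul]; ring
      · simp
    simp only []
    rw [this, blockOp_pauliXZ]
    refine IsPauliOn.intro k fun y hy => ?_
    simp only [coneQubits, Finset.mem_filter, Finset.mem_univ, true_and] at hy
    push Not at hy
    obtain ⟨q', rfl, hq'⟩ := hy
    obtain ⟨e1, e2⟩ := hxz (.inl q') (by
      simp only [coneQubits, Finset.mem_filter, Finset.mem_univ, true_and]
      exact fun h => hq' (h q' rfl))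
    refine ⟨e1, ?_⟩
    simp only [e2, zero_add]
    split_ifs with hqq
    · subst hqq
      rcases hWc with h | h
      · simp only [wireQubits, Finset.mem_filter, Finset.mem_univ, true_and] at h
        exact absurd h hq'
      · exact h
    · rfl
  · simp only []
    rw [hm' c c' h, ← hX c 0, ← hX c' 0, h3 _ _ (up c c' 0 0 h)]
  · intro c₁ c₂ c₃ e2 e3
    simp only []
    rw [← h4 _ _ _ (up _ _ 0 0 e2) (up _ _ 0 0 e3)]
    congr 1
    ext s
    by_cases hs : s = t.1
    · subst hs; simp
    · simp [Function.update_of_ne hs]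
  · intro c c' h
    show blockOp q.1 (fun b => F (Function.update c t.1 b)) =
      blockOp q.1 (fun b => F (Function.update c' t.1 b))
    congr 1
    ext1 b
    refine h5 _ _ fun s hs => ?_
    by_cases hst : s = t.1
    · subst hst; simp
    · rw [Function.update_of_ne hst, Function.update_of_ne hst, h s hs]

end
end
end MagicBCS

open scoped Kronecker
namespace MagicBCS
noncomputable section
set_option linter.unusedSectionVars false
set_option linter.unusedSimpArgs false

/-! ### Pull-back of whole circuits and the growth of light cones -/

section
variable {C Q : Type} [Fintype C] [DecidableEq C] [Fintype Q] [DecidableEq Q]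

/-- The auxiliary type is existential because each measurement adds a qubit. The homomorphism is
chosen independently of the records, so one pull-back serves all output signs and all inputs. -/
lemma exists_opPull {A : Type} [Fintype A] [DecidableEq A] (S : Finset C) (T : Finset Q)
    (o : Op S T) :
    ∃ (A' : Type) (_ : Fintype A') (_ : DecidableEq A')
      (Ψ : Observable C Q A →ₐ[ℂ] Observable C Q A'),
      (∀ ρ F, pairing (o.apply S T ρ) F = pairing ρ (Ψ F)) ∧
      ∀ (R₁ R₂ : Set C), o.MagicFree {s | s.1 ∈ R₁} {s | s.1 ∈ R₂} →
        (∀ s, s ∉ S → (s ∈ R₂ ↔ s ∈ R₁)) → ∀ W, (S.disjSum T ⊆ W ∨ Disjoint W (S.disjSum T)) →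
        ∀ F, IsObs R₂ W F → IsObs R₁ W (Ψ F) := by
  cases o with
  | classical f =>
    exact ⟨A, inferInstance, inferInstance, classicalPull (liftBits S f), pairing_map _,
      fun R₁ R₂ h hR W hW F hF => isObs_classicalPull hF h hR hW⟩
  | unitary U =>
    have hU : ∀ c : C → Bit, liftOperator T (U fun s => c s.1).1 *
        (liftOperator T (U fun s => c s.1).1)ᴴ = 1 := fun c =>
      mul_eq_one_comm.1 (liftOperator_mem_unitary (U fun s => c s.1).2)
    refine ⟨A, inferInstance, inferInstance, unitaryPull _ hU, pairing_unitary _ hU,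
      fun R₁ R₂ h hR W hW F hF => isObs_unitaryPull ?_ h hW hU⟩
    have : R₂ = R₁ := by
      ext s
      by_cases hs : s ∈ S
      · have h1 : ({s : S | s.1 ∈ R₂} : Set S) = {s | s.1 ∈ R₁} := h.1
        exact Set.ext_iff.1 h1 ⟨s, hs⟩
      · exact hR s hs
    rwa [← this]
  | measure q t =>
    refine ⟨Option A, inferInstance, inferInstance, measurePull q.1 t.1, pairing_measure q t,
      fun R₁ R₂ h hR W hW F hF => isObs_measurePull hF ?_ hW⟩
    ext s
    by_cases hs : s ∈ S
    · have h1 : ({s : S | s.1 ∈ R₂} : Set S) = insert t {s | s.1 ∈ R₁} := h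
      have := Set.ext_iff.1 h1 ⟨s, hs⟩
      simpa [Subtype.ext_iff] using this
    · rw [hR s hs, Set.mem_insert_iff]
      exact ⟨Or.inr, fun h => h.resolve_left fun h' => hs (h' ▸ t.2)⟩

lemma exists_opsPull {A : Type} [Fintype A] [DecidableEq A] (S : Finset C) (T : Finset Q)
    (os : List (Op S T)) :
    ∃ (A' : Type) (_ : Fintype A') (_ : DecidableEq A')
      (Ψ : Observable C Q A →ₐ[ℂ] Observable C Q A'),
      (∀ ρ F, pairing (os.foldl (fun σ o => o.apply S T σ) ρ) F = pairing ρ (Ψ F)) ∧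
      ∀ (R₁ R₂ : Set C), opsMagicFree {s | s.1 ∈ R₁} os {s | s.1 ∈ R₂} →
        (∀ s, s ∉ S → (s ∈ R₂ ↔ s ∈ R₁)) → ∀ W, (S.disjSum T ⊆ W ∨ Disjoint W (S.disjSum T)) →
        ∀ F, IsObs R₂ W F → IsObs R₁ W (Ψ F) := by
  induction os with
  | nil =>
    refine ⟨A, inferInstance, inferInstance, AlgHom.id ℂ _, fun _ _ => rfl, ?_⟩
    intro R₁ R₂ h hR W hW F hF
    have : R₂ = R₁ := by
      ext s
      by_cases hs : s ∈ S
      · have h1 : ({s : S | s.1 ∈ R₂} : Set S) = {s | s.1 ∈ R₁} := h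
        exact Set.ext_iff.1 h1 ⟨s, hs⟩
      · exact hR s hs
    rw [← this]; exact hF
  | cons o os ih =>
    obtain ⟨A₁, _, _, Ψ₁, h1, h1'⟩ := ih
    obtain ⟨A₂, i1, i2, Ψ₂, h2, h2'⟩ := exists_opPull (A := A₁) S T o
    refine ⟨A₂, i1, i2, Ψ₂.comp Ψ₁, fun ρ F => by rw [List.foldl_cons, h1, h2]; rfl, ?_⟩
    rintro R₁ R₂ ⟨R', ho, hos⟩ hR W hW F hF
    -- The records between two operations of a gate are known only on its own bits; off the gate
    -- they are those before the gate.
    set G : Set C := {c | (∃ h, (⟨c, h⟩ : S) ∈ R') ∨ (c ∉ S ∧ c ∈ R₁)} with hG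
    have e : ({s : S | s.1 ∈ G} : Set S) = R' := by
      ext s
      simp [hG]
    have eo : ∀ s, s ∉ S → (s ∈ G ↔ s ∈ R₁) := by
      intro s hs
      simp [hG, hs]
    refine h2' R₁ G (by rwa [e]) eo W hW _ (h1' G R₂ (by rwa [e]) (fun s hs => ?_) W hW F hF)
    rw [hR s hs, eo s hs]

/-- The wires of a gate. -/
def Gate.wires (g : Gate C Q) : Finset (C ⊕ Q) := g.bits.disjSum g.qubits

lemma Gate.card_wires (g : Gate C Q) : g.wires.card = g.fanIn := Finset.card_disjSum _ _

/-- The past light cone of the wires `W`. -/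
def lightCone (gs : List (Gate C Q)) (W : Finset (C ⊕ Q)) : Finset (C ⊕ Q) :=
  gs.foldr (fun g W => if Disjoint W g.wires then W else W ∪ g.wires) W

/-- The evaluation of functions of the bits as observables. -/
def evalObservable : ((C → Bit) → ℂ) →ₐ[ℂ] Observable C Q Empty :=
  AlgHom.ofLinearMap
    { toFun := fun F c => F c • 1
      map_add' := fun F G => by ext1 c; simp [add_smul]
      map_smul' := fun r F => by ext1 c; simp [smul_smul] }
    (by ext1 c; simp)
    (by intro F G; ext1 c; simp [smul_smul, mul_comm])

/-- The heart of the reduction: a single homomorphism `Φ` on functions of the final bits, so that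
all images commute and squares are respected, under which the sign of each output bit becomes a
Pauli observable on its past light cone. -/
lemma exists_gatesPull (gs : List (Gate C Q)) :
    ∃ (A : Type) (_ : Fintype A) (_ : DecidableEq A)
      (Φ : ((C → Bit) → ℂ) →ₐ[ℂ] Observable C Q A),
      (∀ ρ F, ∑ c, F c * (gs.foldl (fun σ g => g.apply σ) ρ c).trace = pairing ρ (Φ F)) ∧
      ∀ R, gatesMagicFree R gs → ∀ t,
        IsObs R (lightCone gs {Sum.inl t}) (Φ fun c => sgn (c t)) := by
  induction gs with
  | nil =>
    refine ⟨Empty, inferInstance, inferInstance, evalObservable, fun ρ F => ?_,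
      fun R _ t => isObs_sign R t⟩
    refine Finset.sum_congr rfl fun c _ => ?_
    show _ = ((F c • (1 : Operator (Q ⊕ Empty))) * _).trace
    rw [Matrix.smul_mul, one_mul, Matrix.trace_smul, trace_tensor, ketbra_ket0]
    simp [Matrix.trace_single_eq_same]
  | cons g gs ih =>
    obtain ⟨A₁, _, _, Φ, h1, h1'⟩ := ih
    obtain ⟨A₂, i1, i2, Ψ, h2, h2'⟩ := exists_opsPull (A := A₁) g.bits g.qubits g.ops
    refine ⟨A₂, i1, i2, Ψ.comp Φ, fun ρ F => by rw [List.foldl_cons, h1]; exact h2 _ _, ?_⟩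
    rintro R ⟨R', ⟨hg, hR⟩, hgs⟩ t
    have hF := h1' R' hgs t
    refine h2' R R' hg hR _ ?_ _ (hF.mono ?_)
    · simp only [lightCone, List.foldr_cons]
      split_ifs with h
      · exact Or.inr h
      · exact Or.inl Finset.subset_union_right
    · simp only [lightCone, List.foldr_cons]
      split_ifs with h
      · exact subset_rfl
      · exact Finset.subset_union_left

/-- Although the gates of a layer are executed one after the other, their disjointness prevents a
cone from spreading through two of them: a wire that enters with one gate meets no other. -/
lemma mem_lightCone {gs : List (Gate C Q)}
    (hgs : gs.Pairwise fun g g' => Disjoint g.wires g'.wires) {W : Finset (C ⊕ Q)} {x : C ⊕ Q}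
    (hx : x ∈ lightCone gs W) : ∃ v ∈ W, v = x ∨ ∃ g ∈ gs, v ∈ g.wires ∧ x ∈ g.wires := by
  induction gs generalizing x with
  | nil => exact ⟨x, hx, Or.inl rfl⟩
  | cons g gs ih =>
    obtain ⟨hg, hgs⟩ := List.pairwise_cons.1 hgs
    have key : ∀ y ∈ lightCone gs W, ∃ v ∈ W, v = y ∨ ∃ g' ∈ g :: gs, v ∈ g'.wires ∧
        y ∈ g'.wires := by
      intro y hy
      obtain ⟨v, hv, h | ⟨g', h1, h2⟩⟩ := ih hgs hy
      · exact ⟨v, hv, Or.inl h⟩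
      · exact ⟨v, hv, Or.inr ⟨g', List.mem_cons_of_mem _ h1, h2⟩⟩
    rw [lightCone, List.foldr_cons] at hx
    change x ∈ (if Disjoint (lightCone gs W) g.wires then lightCone gs W
      else lightCone gs W ∪ g.wires) at hx
    split_ifs at hx with hd
    · exact key x hx
    · rcases Finset.mem_union.1 hx with hx | hx
      · exact key x hx
      · obtain ⟨y, hy, hy'⟩ := Finset.not_disjoint_iff.1 hd
        obtain ⟨v, hv, rfl | ⟨g', h1, h2, h3⟩⟩ := ih hgs hy
        · exact ⟨v, hv, Or.inr ⟨g, List.mem_cons_self, hy', hx⟩⟩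
        · exact absurd h3 (Finset.disjoint_left.1 (hg g' h1) hy')

lemma Layer.pairwise_wires (L : Layer C Q) :
    L.gates.Pairwise fun g g' => Disjoint g.wires g'.wires :=
  L.disjoint.imp fun {g g'} h => by
    rw [Finset.disjoint_left]
    rintro (x | x) h1 h2
    · simp only [Gate.wires, Finset.inl_mem_disjSum] at h1 h2
      exact Finset.disjoint_left.1 h.1 h1 h2
    · simp only [Gate.wires, Finset.inr_mem_disjSum] at h1 h2
      exact Finset.disjoint_left.1 h.2 h1 h2

/-- Each wire belongs to at most one gate of the layer, so it is replaced by at most `K` wires. -/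
lemma Layer.card_lightCone_le (L : Layer C Q) {K : ℕ} (hK : 1 ≤ K)
    (hL : ∀ g ∈ L.gates, g.fanIn ≤ K) (W : Finset (C ⊕ Q)) :
    (lightCone L.gates W).card ≤ W.card * K := by
  classical
  have hp := L.pairwise_wires
  let blk : C ⊕ Q → Finset (C ⊕ Q) := fun v =>
    if h : ∃ g ∈ L.gates, v ∈ g.wires then h.choose.wires else {v}
  have hsub : lightCone L.gates W ⊆ W.biUnion blk := by
    intro x hx
    obtain ⟨v, hv, h⟩ := mem_lightCone hp hx
    refine Finset.mem_biUnion.2 ⟨v, hv, ?_⟩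
    simp only [blk]
    split_ifs with h'
    · obtain ⟨h1, h2⟩ := h'.choose_spec
      rcases h with rfl | ⟨g, hg, hvg, hxg⟩
      · exact h2
      · by_cases e : h'.choose = g
        · rw [e]; exact hxg
        · have := List.Pairwise.forall (R := fun g g' : Gate C Q => Disjoint g.wires g'.wires)
            hp h1 hg e
          exact absurd hvg (Finset.disjoint_left.1 this h2)
    · rcases h with rfl | ⟨g, hg, hvg, hxg⟩
      · simp
      · exact absurd ⟨g, hg, hvg⟩ h'
  refine (Finset.card_le_card hsub).trans (Finset.card_biUnion_le_card_mul _ _ _ fun v _ => ?_)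
  simp only [blk]
  split_ifs with h
  · rw [Gate.card_wires]; exact hL _ h.choose_spec.1
  · simpa using hK

lemma Circuit.card_lightCone_le (Γ : Circuit C Q) {K : ℕ} (hK : 1 ≤ K)
    (hL : ∀ g ∈ Circuit.gates Γ, g.fanIn ≤ K) (W : Finset (C ⊕ Q)) :
    (lightCone (Circuit.gates Γ) W).card ≤ W.card * K ^ Γ.length := by
  induction Γ generalizing W with
  | nil => simp [Circuit.gates, lightCone]
  | cons L Γ ih =>
    have e : Circuit.gates (L :: Γ) = L.gates ++ Circuit.gates Γ := by simp [Circuit.gates]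
    rw [e] at hL ⊢
    have e2 : lightCone (L.gates ++ Circuit.gates Γ) W =
      lightCone L.gates (lightCone (Circuit.gates Γ) W) := by simp [lightCone, List.foldr_append]
    rw [e2]
    refine (L.card_lightCone_le hK (fun g hg => hL g (List.mem_append_left _ hg)) _).trans ?_
    have := ih (fun g hg => hL g (List.mem_append_right _ hg)) W
    calc _ ≤ W.card * K ^ Γ.length * K := Nat.mul_le_mul_right _ this
      _ = _ := by rw [List.length_cons, pow_succ, mul_assoc]

end
end
end MagicBCS

open scoped Kronecker
namespace MagicBCS
noncomputable section
set_option linter.unusedSectionVars false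
set_option linter.unusedSimpArgs false

/-! ### Magic-free devices -/

section
variable {C Q : Type} [Fintype C] [DecidableEq C] [Fintype Q] [DecidableEq Q]

/-- A multiple of a stabilizer state. -/
def IsStabRay (ψ : (Q → Bit) → ℂ) : Prop := ∃ (r : ℂ) (φ : (Q → Bit) → ℂ), IsStab φ ∧ ψ = r • φ

lemma IsStabRay.opStep {S : Finset C} {T : Finset Q} {o : Op S T} {R R' : Set S}
    (ho : o.MagicFree R R') {c c' : C → Bit} {ψ ψ' : (Q → Bit) → ℂ} (hψ : IsStabRay ψ)
    (h : o.Step S T c ψ c' ψ') : IsStabRay ψ' := by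
  obtain ⟨r, φ, hφ, rfl⟩ := hψ
  cases o with
  | classical f =>
    obtain ⟨-, rfl⟩ := h
    exact ⟨r, φ, hφ, rfl⟩
  | unitary U =>
    obtain ⟨-, rfl⟩ := h
    have hU : IsClifford (U fun s => c s.1).1 := by
      obtain ⟨-, ⟨hC, -⟩ | ⟨t, P, hP, h⟩⟩ := ho
      · exact hC _
      · rw [h]
        split_ifs
        · exact isClifford_one
        · exact hP.isClifford
    exact ⟨r, _, hφ.mulVec (liftOperator_isClifford hU), by rw [Matrix.mulVec_smul]⟩
  | measure q t =>
    obtain ⟨b, -, rfl⟩ := h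
    have hZ2 : pauliXZ (0 : Q → Bit) (Pi.single q.1 1) * pauliXZ 0 (Pi.single q.1 1) = 1 := by
      rw [pauliXZ_mul, bits_add_self, bits_add_self]; simp
    obtain ⟨r', φ', hφ', h⟩ := hφ.eigenprojector_mulVec (isPauli_pauliXZ 0 (Pi.single q.1 1)) hZ2 b
    exact ⟨r * r', φ', hφ', by rw [Matrix.mulVec_smul, basisProjector_eq, h, smul_smul]⟩

lemma IsStabRay.opsStep {S : Finset C} {T : Finset Q} {os : List (Op S T)} {R R' : Set S}
    (ho : opsMagicFree R os R') {c c' : C → Bit} {ψ ψ' : (Q → Bit) → ℂ} (hψ : IsStabRay ψ)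
    (h : MagicBCS.opsStep S T os c ψ c' ψ') : IsStabRay ψ' := by
  induction os generalizing R c ψ with
  | nil => obtain ⟨-, rfl⟩ := h; exact hψ
  | cons o os ih =>
    obtain ⟨R₁, h1, h2⟩ := ho
    obtain ⟨c₁, ψ₁, h3, h4⟩ := h
    exact ih h2 (hψ.opStep h1 h3) h4

lemma IsStabRay.gatesStep {gs : List (Gate C Q)} {R : Set C}
    (ho : gatesMagicFree R gs) {c c' : C → Bit} {ψ ψ' : (Q → Bit) → ℂ} (hψ : IsStabRay ψ)
    (h : MagicBCS.gatesStep gs c ψ c' ψ') : IsStabRay ψ' := by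
  induction gs generalizing R c ψ with
  | nil => obtain ⟨-, rfl⟩ := h; exact hψ
  | cons g gs ih =>
    obtain ⟨R₁, h1, h2⟩ := ho
    obtain ⟨c₁, ψ₁, h3, h4⟩ := h
    exact ih h2 (hψ.opsStep h1.1 h3) h4

/-- Along every pure branch the state stays a multiple of a stabilizer state. For the first round
nothing else is needed; its depth plays no role. -/
lemma mem_stabCone_of_magicFree {Γ : Circuit C Q} (h : Circuit.MagicFree Γ) (c₀ c : C → Bit) :
    Γ.apply (Hybrid.init c₀) c ∈ stabCone Q := by
  have := (Branches.init (Q := Q) c₀).circuit (I' := fun _ ψ => IsStabRay ψ) Γ (by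
    rintro c ψ c' ψ' ⟨-, rfl⟩ hs
    exact IsStabRay.gatesStep h ⟨1, ket0, isStab_ket0, (one_smul _ _).symm⟩ hs) c
  refine AddSubmonoid.closure_mono ?_ this
  rintro _ ⟨_, ⟨r, φ, hφ, rfl⟩, rfl⟩
  exact ⟨r, φ, hφ, rfl⟩

lemma tensor_ket0_mem_stabCone {A : Type} [Fintype A] [DecidableEq A] {M : Operator Q}
    (hM : M ∈ stabCone Q) : tensor M (ketbra (ket0 : (A → Bit) → ℂ)) ∈ stabCone (Q ⊕ A) := by
  induction hM using AddSubmonoid.closure_induction with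
  | mem x hx =>
    obtain ⟨r, ψ, hψ, rfl⟩ := hx
    have : tensor (ketbra (r • ψ)) (ketbra (ket0 : (A → Bit) → ℂ)) =
        ketbra (r • tensorVec ψ ket0) := by
      ext i j
      simp only [tensor_apply, ketbra, Matrix.vecMulVec_apply, tensorVec, Pi.smul_apply,
        Pi.star_apply, star_smul, star_mul', smul_eq_mul, Function.comp_def]
      ring
    rw [this]
    exact hψ.tensor_ket0.mem_stabCone r
  | zero =>
    have : tensor (0 : Operator Q) (ketbra (ket0 : (A → Bit) → ℂ)) = 0 := by
      simpa using tensor_smul_left 0 (0 : Operator Q) (ketbra (ket0 : (A → Bit) → ℂ))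
    rw [this]; exact zero_mem _
  | add x y _ _ hx hy => rw [tensor_add_left]; exact add_mem hx hy

/-- The indicator of winning is a polynomial in the signs of the four answer bits, and a
homomorphism evaluates the same polynomial at the images. This is why multiplicativity of the
pull-back is essential. -/
lemma map_winning_indicator {A : Type} [Fintype A] [DecidableEq A] {n : ℕ} (q : Question n)
    (oA : Fin 3 → C) (oB : C) (Φ : ((C → Bit) → ℂ) →ₐ[ℂ] Observable C Q A) (c : C → Bit) :
    Φ (fun c => if q.Wins (fun l => c (oA l)) (c oB) then 1 else 0) c =
      winOp q (fun l => Φ (fun c => sgn (c (oA l))) c) (Φ (fun c => sgn (c oB)) c) := by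
  have hind : ∀ x b : Bit, (1 / 2 : ℂ) * (1 + sgn b * sgn x) = if x = b then 1 else 0 := by
    intro x b
    rcases bit_cases x with h | h <;> rcases bit_cases b with h' | h' <;> subst h <;> subst h' <;>
      norm_num
  have e : (fun c : C → Bit => if q.Wins (fun l => c (oA l)) (c oB) then (1 : ℂ) else 0) =
      ∑ a : Fin 3 → Bit, ∑ b : Bit, if q.Wins a b then
        ((1 / 2 : ℂ) • (1 + sgn (a 0) • fun c : C → Bit => sgn (c (oA 0)))) *
        ((1 / 2 : ℂ) • (1 + sgn (a 1) • fun c : C → Bit => sgn (c (oA 1)))) *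
        ((1 / 2 : ℂ) • (1 + sgn (a 2) • fun c : C → Bit => sgn (c (oA 2)))) *
        ((1 / 2 : ℂ) • (1 + sgn b • fun c : C → Bit => sgn (c oB))) else 0 := by
    ext1 c
    simp only [Finset.sum_apply]
    rw [Finset.sum_eq_single fun l => c (oA l), Finset.sum_eq_single (c oB)]
    · split_ifs
      · simp only [Pi.mul_apply, Pi.smul_apply, Pi.add_apply, Pi.one_apply, smul_eq_mul, hind]
        simp
      · rfl
    · intro b _ hb
      split_ifs
      · simp only [Pi.mul_apply, Pi.smul_apply, Pi.add_apply, Pi.one_apply, smul_eq_mul, hind]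
        simp [hb.symm]
      · rfl
    · simp
    · intro a _ ha
      apply Finset.sum_eq_zero
      intro b _
      have : ¬ (c (oA 0) = a 0 ∧ c (oA 1) = a 1 ∧ c (oA 2) = a 2) := by
        rintro ⟨h0, h1, h2⟩
        apply ha
        ext l
        fin_cases l
        · exact h0.symm
        · exact h1.symm
        · exact h2.symm
      split_ifs
      · simp only [Pi.mul_apply, Pi.smul_apply, Pi.add_apply, Pi.one_apply, smul_eq_mul, hind]
        by_cases h0 : c (oA 0) = a 0 <;> by_cases h1 : c (oA 1) = a 1 <;>
          by_cases h2 : c (oA 2) = a 2 <;> simp_all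
      · rfl
    · simp
  rw [e]
  simp only [map_sum, Finset.sum_apply, winOp]
  refine Finset.sum_congr rfl fun a _ => Finset.sum_congr rfl fun b _ => ?_
  split_ifs
  · simp only [map_mul, map_smul, map_add, map_one, Pi.mul_apply, Pi.smul_apply, Pi.add_apply,
      Pi.one_apply, outcomeOp, eigenprojector_eq]
  · simp

end

/-! ### The success probability of magic-free devices -/

section
variable {n N w lA lB : ℕ}

lemma extend_of_range {α β γ : Type*} (f : α ↪ β) (g g' : α → γ) (e : β → γ) (b : β)
    (h : ∀ a, f a = b → g a = g' a) : Function.extend f g e b = Function.extend f g' e b := by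
  by_cases hb : ∃ a, f a = b
  · obtain ⟨a, rfl⟩ := hb
    rw [f.injective.extend_apply, f.injective.extend_apply, h a rfl]
  · rw [Function.extend_apply' _ _ _ hb, Function.extend_apply' _ _ _ hb]

namespace Protocol
variable (P : Protocol N w lA lB) (encA : Option (Constraint n) ↪ (Fin lA → Bit))
    (encB : Option (Variable n) ↪ (Fin lB → Bit))

/-- The answers of Alice's site `j` do not depend on the question to Bob's site `k`, and conversely. -/
def Separated (j k : Fin N) : Prop :=
  (∀ l m, Sum.inl (P.in₂ (.inr (k, m))) ∉
    lightCone (Circuit.gates P.circ₂) {Sum.inl (P.out₂A j l)}) ∧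
  ∀ m, Sum.inl (P.in₂ (.inl (j, .inr m))) ∉
    lightCone (Circuit.gates P.circ₂) {Sum.inl (P.out₂B k 0)}

lemma success_eq (I : Instance n N) : P.success encA encB I =
    (∑ c : P.Bits → Bit,
      (if I.2.Wins (fun l => c (P.out₂A I.1.1.1 l)) (c (P.out₂B I.1.1.2 0)) then 1 else 0) *
        (P.state₂ encA encB I c).trace).re := by
  rw [success, Complex.re_sum]
  refine Finset.sum_congr rfl fun c _ => ?_
  split_ifs <;> simp

lemma branches_state₂ (I : Instance n N) :
    Branches (fun _ _ => True) (P.state₂ encA encB I) := by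
  refine Branches.circuit (I := fun _ _ => True) (Branches.map (I := fun _ _ => True) ?_ _ ?_) _ ?_
  · exact (Branches.init _).circuit _ fun _ _ _ _ _ _ => trivial
  · exact fun _ _ _ => trivial
  · exact fun _ _ _ _ _ _ => trivial

lemma total_state₁ (j k : Fin N) : (P.state₁ j k).total = 1 := by
  rw [state₁, Circuit.total_apply, Hybrid.total_init]

lemma total_state₂ (I : Instance n N) : (P.state₂ encA encB I).total = 1 := by
  rw [state₂, Circuit.total_apply, Hybrid.total_map, total_state₁]

lemma success_le_one (I : Instance n N) : P.success encA encB I ≤ 1 := by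
  have h := congrArg Complex.re (P.total_state₂ encA encB I)
  rw [Hybrid.total, Complex.re_sum, Complex.one_re] at h
  rw [← h, success]
  refine Finset.sum_le_sum fun c _ => ?_
  split_ifs
  · rfl
  · exact (P.branches_state₂ encA encB I).trace_nonneg c

/-- Fix the bit string `c` left by the first round; the state given `c` lies in the stabilizer cone
and does not depend on the question. By separation the image of Alice's answer does not depend on
Bob's question and conversely, so for each `c` the images form one strategy with commuting Pauli
observables. Its bound is summed over `c`, and the weights of the `c` add up to 1. -/
theorem sum_success_le (hP : P.MagicFree) {j k : Fin N} (hjk : j < k) (hs : P.Separated j k) :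
    ∑ q : Question n, P.success encA encB (⟨(j, k), hjk⟩, q) ≤
      Fintype.card (Question n) * pClif n := by
  obtain ⟨hP1, hP2⟩ := hP
  obtain ⟨A, _, _, Φ, hΦ, hcone⟩ := exists_gatesPull (Circuit.gates P.circ₂)
  have hcone := hcone ∅ hP2
  -- The input of the second round with the two questions as independent arguments. The syndromes
  -- are functions of `c` alone.
  let inp (c : P.Bits → Bit) (α : Option (Constraint n)) (β : Option (Variable n)) :
      P.Bits → Bit :=
    Function.extend P.in₂ (fun x => match x with
      | .inl (i, .inl (.inl l)) => if i = j then ∑ m ∈ Finset.Ioc j k, c (P.out₁A m l) else 0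
      | .inl (i, .inl (.inr l)) => if i = j then ∑ m ∈ Finset.Ico j k, c (P.out₁B m l) else 0
      | .inl (i, .inr l) => encA (if i = j then α else none) l
      | .inr (i, l) => encB (if i = k then β else none) l) c
  let u (s : Fin 3) : (P.Bits → Bit) → ℂ := fun c => sgn (c (P.out₂A j s))
  let v : (P.Bits → Bit) → ℂ := fun c => sgn (c (P.out₂B k 0))
  have hu2 : ∀ s, u s * u s = 1 := fun s => funext fun c => sgn_mul_self _
  have hv2 : v * v = 1 := funext fun c => sgn_mul_self _
  have hA : ∀ c α β β' s, Φ (u s) (inp c α β) = Φ (u s) (inp c α β') := by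
    intro c α β β' s
    refine (hcone (P.out₂A j s)).congr_bits fun t ht => ?_
    refine extend_of_range _ _ _ _ _ fun x hx => ?_
    rcases x with ⟨i, (l | l) | l⟩ | ⟨i, l⟩
    · rfl
    · rfl
    · rfl
    · by_cases hi : i = k
      · subst hi; subst hx; exact absurd ht (hs.1 s l)
      · simp [hi]
  have hB : ∀ c α α' β, Φ v (inp c α β) = Φ v (inp c α' β) := by
    intro c α α' β
    refine (hcone (P.out₂B k 0)).congr_bits fun t ht => ?_
    refine extend_of_range _ _ _ _ _ fun x hx => ?_
    rcases x with ⟨i, (l | l) | l⟩ | ⟨i, l⟩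
    · rfl
    · rfl
    · by_cases hi : i = j
      · subst hi; subst hx; exact absurd ht (hs.2 l)
      · simp [hi]
    · rfl
  have hcomm : ∀ f g c, Commute (Φ f c) (Φ g c) := by
    intro f g c
    have : Φ f * Φ g = Φ g * Φ f := by rw [← map_mul, mul_comm, map_mul]
    exact congrFun this c
  have hsq : ∀ f c, f * f = 1 → Φ f c * Φ f c = 1 := by
    intro f c h
    have : Φ f * Φ f = 1 := by rw [← map_mul, h, map_one]
    exact congrFun this c
  let S (c : P.Bits → Bit) : PauliStrategy n (P.Qubits ⊕ A) :=
    { obsA := fun α s => Φ (u s) (inp c (some α) none)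
      obsB := fun β => Φ v (inp c none (some β))
      pauliA := fun α s => (hcone (P.out₂A j s)).isPauli _
      pauliB := fun β => (hcone (P.out₂B k 0)).isPauli _
      sqA := fun α s => hsq _ _ (hu2 s)
      sqB := fun β => hsq _ _ hv2
      commA := fun α s s' => hcomm _ _ _
      -- Inserting the irrelevant question on either side evaluates both observables at the same
      -- input, where images under `Φ` commute.
      commAB := fun α s β => by
        rw [hA c (some α) none (some β), hB c none (some α)]
        exact hcomm _ _ _ }
  have hsucc : ∀ q : Question n, P.success encA encB (⟨(j, k), hjk⟩, q) =
      ∑ c, (tensor (P.state₁ j k c) (ketbra (ket0 : (A → Bit) → ℂ)) *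
        winOp q ((S c).obsA q.1) ((S c).obsB q.bob)).trace.re := by
    intro q
    rw [success_eq]
    simp only [state₂]
    have h1 := hΦ ((P.state₁ j k).map fun c =>
      Function.extend P.in₂ (input₂ encA encB j k q (fun i l => c (P.out₁A i l))
        (fun i l => c (P.out₁B i l))) c)
      (fun c => if q.Wins (fun l => c (P.out₂A j l)) (c (P.out₂B k 0)) then 1 else 0)
    refine (congrArg Complex.re h1).trans ?_
    rw [pairing_map, pairing, Complex.re_sum]
    refine Finset.sum_congr rfl fun c _ => ?_
    rw [Matrix.trace_mul_comm]
    congr 3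
    have hin : Function.extend P.in₂ (input₂ encA encB j k q (fun i l => c (P.out₁A i l))
        (fun i l => c (P.out₁B i l))) c = inp c (some q.1) (some q.bob) := by
      simp only [inp]
      congr 1
    show Φ _ (Function.extend P.in₂ (input₂ encA encB j k q (fun i l => c (P.out₁A i l))
        (fun i l => c (P.out₁B i l))) c) = _
    rw [map_winning_indicator, hin]
    congr 1
    · ext1 s
      exact hA c _ _ _ s
    · exact hB c _ _ _
  calc _ = ∑ c, ∑ q : Question n, (tensor (P.state₁ j k c) (ketbra (ket0 : (A → Bit) → ℂ)) *
        winOp q ((S c).obsA q.1) ((S c).obsB q.bob)).trace.re := by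
        rw [Finset.sum_comm]; exact Finset.sum_congr rfl fun q _ => hsucc q
    _ ≤ ∑ c, Fintype.card (Question n) * pClif n *
        (tensor (P.state₁ j k c) (ketbra (ket0 : (A → Bit) → ℂ))).trace.re :=
        Finset.sum_le_sum fun c _ => (S c).trace_winOp_le_pClif
          (tensor_ket0_mem_stabCone (mem_stabCone_of_magicFree hP1 _ c))
    _ = Fintype.card (Question n) * pClif n * (P.state₁ j k).total.re := by
        rw [← Finset.mul_sum, Hybrid.total, Complex.re_sum]
        congr 1
        refine Finset.sum_congr rfl fun c _ => ?_
        rw [trace_tensor, ketbra_ket0, Matrix.trace_single_eq_same, mul_one]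
    _ = _ := by rw [total_state₁, Complex.one_re, mul_one]

end Protocol

/-- For the strategy without qubits, in which all observables are 1, every term of the cone bound is
visibly nonnegative. -/
lemma pClif_nonneg (n : ℕ) : 0 ≤ pClif n := by
  let S : PauliStrategy n Empty :=
    { obsA := fun _ _ => 1
      obsB := fun _ => 1
      pauliA := fun _ _ => isPauli_one
      pauliB := fun _ => isPauli_one
      sqA := fun _ _ => one_mul _
      sqB := fun _ => one_mul _
      commA := fun _ _ _ => Commute.one_left _
      commAB := fun _ _ _ => Commute.one_left _ }
  have h := S.trace_winOp_le_pClif one_mem_stabCone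
  have h0 : (0 : ℝ) ≤ ∑ q : Question n,
      (1 * winOp q (S.obsA q.1) (S.obsB q.bob)).trace.re := by
    refine Finset.sum_nonneg fun q _ => ?_
    rw [winOp_eq q _ _ (fun _ _ => Commute.one_left _) fun _ => one_mul _]
    rcases bit_cases q.1.1.rhs with h | h <;>
      simp only [S, h, sgn_zero, sgn_one, mul_one, one_smul, Matrix.trace_smul, Matrix.trace_add,
        Matrix.trace_one, neg_smul, Matrix.trace_neg, one_mul] <;> simp
    positivity
  have h1 : (1 : Operator Empty).trace.re = 1 := by simp
  rw [h1, mul_one] at h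
  by_contra hneg
  push Not at hneg
  rcases Nat.eq_zero_or_pos (Fintype.card (Question n)) with hc | hc
  · have : ∀ S : CliffordStrategy n, S.winProb = 0 := fun S => by
      simp [CliffordStrategy.winProb, hc]
    apply absurd hneg
    rw [not_lt, pClif]
    apply Real.sSup_nonneg
    intro x hx
    have : Set.range (CliffordStrategy.winProb (n := n)) ⊆ {0} := by
      rintro _ ⟨S, rfl⟩; exact this S
    have := convexHull_mono this hx
    rw [convexHull_singleton] at this
    exact this.ge
  · have : (0 : ℝ) < Fintype.card (Question n) := by exact_mod_cast hc
    nlinarith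

/-- There are `N (N - 1) / 2` pairs, and `N ≤ 2 (N - 1)`. -/
lemma sq_le_card_pairs (hN : 2 ≤ N) :
    N ^ 2 ≤ 4 * Fintype.card {p : Fin N × Fin N // p.1 < p.2} := by
  have h1 : Fintype.card {p : Fin N × Fin N // p.1 < p.2} = ∑ i ∈ Finset.range N, i := by
    rw [Fintype.card_subtype, Finset.card_filter, Fintype.sum_prod_type,
      ← Finset.sum_range_reflect, ← Fin.sum_univ_eq_sum_range (fun i => N - 1 - i)]
    refine Finset.sum_congr rfl fun j _ => ?_
    rw [← Finset.card_filter, ← Fin.card_Ioi]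
    congr 1
    ext x; simp
  have h2 := Finset.sum_range_id_mul_two N
  rw [h1]
  obtain ⟨m, rfl⟩ : ∃ m, N = m + 2 := ⟨N - 2, by omega⟩
  rw [show m + 2 - 1 = m + 1 by omega] at h2
  nlinarith

namespace Protocol
variable (P : Protocol N w lA lB)

/-- Charge a pair that is not separated to an answer wire together with an input wire in its cone.
The answer wire gives one site and the input wire the other, so the charge determines the pair.
There are three answer wires at each site of Alice and one at each site of Bob, with at most `K ^ D`
wires in each cone. -/
lemma card_not_separated_le {K D : ℕ} (hK : 1 ≤ K) (hfan : P.FanInLE K)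
    (hD : P.circ₂.length ≤ D) :
    {p : Fin N × Fin N | ¬ P.Separated p.1 p.2}.ncard ≤ 4 * N * K ^ D := by
  classical
  have hcone : ∀ x, (lightCone (Circuit.gates P.circ₂) {Sum.inl x}).card ≤ K ^ D := by
    intro x
    have := Circuit.card_lightCone_le P.circ₂ hK (fun g hg => hfan g (List.mem_append_right _ hg))
      {Sum.inl x}
    rw [Finset.card_singleton, one_mul] at this
    exact this.trans (Nat.pow_le_pow_right hK hD)
  let fA (x : (Fin N × Fin 3) × (P.Bits ⊕ P.Qubits)) : Set (Fin N × Fin N) :=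
    {p | p.1 = x.1.1 ∧ ∃ m, x.2 = Sum.inl (P.in₂ (.inr (p.2, m)))}
  let TA : Finset ((Fin N × Fin 3) × (P.Bits ⊕ P.Qubits)) :=
    Finset.univ.filter fun x => x.2 ∈ lightCone (Circuit.gates P.circ₂)
      {Sum.inl (P.out₂A x.1.1 x.1.2)}
  let TB : Finset (Fin N × (P.Bits ⊕ P.Qubits)) :=
    Finset.univ.filter fun x => x.2 ∈ lightCone (Circuit.gates P.circ₂)
      {Sum.inl (P.out₂B x.1 0)}
  have hTA : TA.card ≤ N * 3 * K ^ D := by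
    simp only [TA, Finset.card_filter]
    rw [Fintype.sum_prod_type]
    calc _ ≤ ∑ x : Fin N × Fin 3, K ^ D := Finset.sum_le_sum fun x _ => by
          rw [← Finset.card_filter]; simpa using hcone (P.out₂A x.1 x.2)
      _ = _ := by simp
  have hTB : TB.card ≤ N * K ^ D := by
    simp only [TB, Finset.card_filter]
    rw [Fintype.sum_prod_type]
    calc _ ≤ ∑ x : Fin N, K ^ D := Finset.sum_le_sum fun x _ => by
          rw [← Finset.card_filter]; simpa using hcone (P.out₂B x 0)
      _ = _ := by simp
  let gA : (Fin N × Fin 3) × (P.Bits ⊕ P.Qubits) → Option (Fin N × Fin N) := fun x =>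
    if h : ∃ p : Fin N × Fin N, p.1 = x.1.1 ∧ ∃ m, x.2 = Sum.inl (P.in₂ (.inr (p.2, m)))
      then some h.choose else none
  let gB : Fin N × (P.Bits ⊕ P.Qubits) → Option (Fin N × Fin N) := fun x =>
    if h : ∃ p : Fin N × Fin N, p.2 = x.1 ∧ ∃ m, x.2 = Sum.inl (P.in₂ (.inl (p.1, .inr m)))
      then some h.choose else none
  have hsub : (Finset.univ.filter fun p : Fin N × Fin N => ¬ P.Separated p.1 p.2).image some ⊆
      TA.image gA ∪ TB.image gB := by
    intro o ho
    obtain ⟨⟨j, k⟩, hp, rfl⟩ := Finset.mem_image.1 ho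
    have hp := (Finset.mem_filter.1 hp).2
    rw [Separated, not_and_or] at hp
    push Not at hp
    rw [Finset.mem_union]
    rcases hp with ⟨l, m, h⟩ | ⟨m, h⟩
    · left
      refine Finset.mem_image.2 ⟨((j, l), Sum.inl (P.in₂ (.inr (k, m)))), by simpa [TA] using h, ?_⟩
      have hex : ∃ p : Fin N × Fin N, p.1 = j ∧
        ∃ m', (Sum.inl (P.in₂ (.inr (k, m))) : P.Bits ⊕ P.Qubits) =
          Sum.inl (P.in₂ (.inr (p.2, m'))) := ⟨(j, k), rfl, m, rfl⟩
      simp only [gA]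
      rw [dif_pos hex]
      obtain ⟨h1, m', h2⟩ := hex.choose_spec
      have := P.in₂.injective (Sum.inl_injective h2)
      rw [Sum.inr.injEq, Prod.mk.injEq] at this
      exact congrArg some (Prod.ext h1 this.1.symm)
    · right
      refine Finset.mem_image.2 ⟨(k, Sum.inl (P.in₂ (.inl (j, .inr m)))), by simpa [TB] using h, ?_⟩
      have hex : ∃ p : Fin N × Fin N, p.2 = k ∧
        ∃ m', (Sum.inl (P.in₂ (.inl (j, .inr m))) : P.Bits ⊕ P.Qubits) =
          Sum.inl (P.in₂ (.inl (p.1, .inr m'))) := ⟨(j, k), rfl, m, rfl⟩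
      simp only [gB]
      rw [dif_pos hex]
      obtain ⟨h1, m', h2⟩ := hex.choose_spec
      have := P.in₂.injective (Sum.inl_injective h2)
      rw [Sum.inl.injEq, Prod.mk.injEq] at this
      exact congrArg some (Prod.ext this.1.symm h1)
  have := Finset.card_le_card hsub
  rw [Finset.card_image_of_injective _ (Option.some_injective _)] at this
  have hn : {p : Fin N × Fin N | ¬ P.Separated p.1 p.2}.ncard =
      (Finset.univ.filter fun p : Fin N × Fin N => ¬ P.Separated p.1 p.2).card := by
    rw [← Set.ncard_coe_finset]; congr 1; ext; simp
  rw [hn]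
  calc _ ≤ TA.card + TB.card := this.trans ((Finset.card_union_le _ _).trans
        (add_le_add Finset.card_image_le Finset.card_image_le))
    _ ≤ _ := by nlinarith

variable (encA : Option (Constraint n) ↪ (Fin lA → Bit))
    (encB : Option (Variable n) ↪ (Fin lB → Bit))

theorem avgSuccess_le {K D : ℕ} (hK : 1 ≤ K) (hN : 2 ≤ N) (hP : P.MagicFree) (hfan : P.FanInLE K)
    (hD : P.circ₂.length ≤ D) : P.avgSuccess encA encB ≤ pClif n + 48 * (K : ℝ) ^ D / N := by
  classical
  set q : ℝ := (Fintype.card (Question n) : ℝ) with hq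
  set M : ℝ := (Fintype.card {p : Fin N × Fin N // p.1 < p.2} : ℝ) with hM
  have hN0 : (0 : ℝ) < N := by exact_mod_cast (by omega : 0 < N)
  have hM2 : (N : ℝ) ^ 2 ≤ 4 * M := by
    rw [hM]; exact_mod_cast sq_le_card_pairs hN
  have hM0 : 0 < M := by nlinarith [sq_nonneg (N : ℝ)]
  have hp := pClif_nonneg n
  have hKD : (0 : ℝ) ≤ (K : ℝ) ^ D := by positivity
  have hpair : ∀ p : {p : Fin N × Fin N // p.1 < p.2},
      ∑ x : Question n, P.success encA encB (p, x) ≤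
        q * pClif n + if P.Separated p.1.1 p.1.2 then 0 else q := by
    rintro ⟨⟨j, k⟩, hjk⟩
    split_ifs with hs
    · rw [add_zero]; exact P.sum_success_le encA encB hP hjk hs
    · calc _ ≤ ∑ x : Question n, (1 : ℝ) :=
            Finset.sum_le_sum fun x _ => P.success_le_one encA encB _
        _ = q := by simp [hq]
        _ ≤ _ := le_add_of_nonneg_left (by positivity)
  have hbad : (∑ p : {p : Fin N × Fin N // p.1 < p.2},
      if P.Separated p.1.1 p.1.2 then 0 else q) ≤ q * (4 * N * K ^ D) := by
    have : (∑ p : {p : Fin N × Fin N // p.1 < p.2}, if P.Separated p.1.1 p.1.2 then 0 else q) =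
        q * (Finset.univ.filter fun p : {p : Fin N × Fin N // p.1 < p.2} =>
          ¬ P.Separated p.1.1 p.1.2).card := by
      simp only [← ite_not (p := P.Separated _ _)]
      rw [← Finset.sum_filter, Finset.sum_const, nsmul_eq_mul, mul_comm]
    rw [this]
    refine mul_le_mul_of_nonneg_left ?_ (by positivity)
    have h1 := P.card_not_separated_le hK hfan hD
    have h2 : (Finset.univ.filter fun p : {p : Fin N × Fin N // p.1 < p.2} =>
          ¬ P.Separated p.1.1 p.1.2).card ≤ {p : Fin N × Fin N | ¬ P.Separated p.1 p.2}.ncard := by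
      rw [← Finset.card_image_of_injective _ Subtype.val_injective, ← Set.ncard_coe_finset]
      refine Set.ncard_le_ncard ?_ (Set.toFinite _)
      intro p hp
      simp only [Finset.coe_image, Set.mem_image, Finset.mem_coe, Finset.mem_filter] at hp
      obtain ⟨p, ⟨-, h⟩, rfl⟩ := hp
      exact h
    exact_mod_cast h2.trans h1
  have hsum : ∑ I : Instance n N, P.success encA encB I ≤ M * (q * pClif n) +
      q * (4 * N * K ^ D) := by
    rw [Fintype.sum_prod_type]
    refine (Finset.sum_le_sum fun p _ => hpair p).trans ?_
    rw [Finset.sum_add_distrib, Finset.sum_const, Finset.card_univ, nsmul_eq_mul]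
    linarith
  have hcard : (Fintype.card (Instance n N) : ℝ) = M * q := by
    rw [Fintype.card_prod]; push_cast; rfl
  have hbound : 0 ≤ 48 * (K : ℝ) ^ D / N := by positivity
  rw [avgSuccess, hcard]
  rcases (show 0 ≤ q by positivity).eq_or_lt with h0 | h0
  · rw [← h0, mul_zero, div_zero]; positivity
  · rw [div_le_iff₀ (by positivity)]
    refine hsum.trans ?_
    -- From `N ^ 2 ≤ 4 * M` the fraction of pairs that are not separated is at most `16 * K ^ D /
    -- N`; the constant 48 leaves room.
    have : 4 * N * (K : ℝ) ^ D ≤ 48 * (K : ℝ) ^ D / N * M := by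
      rw [div_mul_eq_mul_div, le_div_iff₀ hN0]
      nlinarith
    nlinarith

end Protocol

theorem RandomProtocol.avgSuccess_le {K D : ℕ} (hK : 1 ≤ K) (hN : 2 ≤ N)
    (P : RandomProtocol N w lA lB) (encA : Option (Constraint n) ↪ (Fin lA → Bit))
    (encB : Option (Variable n) ↪ (Fin lB → Bit))
    (hP : ∀ ω, (P.device ω).MagicFree ∧ (P.device ω).FanInLE K ∧
      (P.device ω).circ₂.length ≤ D) :
    P.avgSuccess encA encB ≤ pClif n + 48 * (K : ℝ) ^ D / N := by
  calc _ ≤ ∑ ω, P.weight ω * (pClif n + 48 * (K : ℝ) ^ D / N) :=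
        Finset.sum_le_sum fun ω _ => mul_le_mul_of_nonneg_left
          ((P.device ω).avgSuccess_le encA encB hK hN (hP ω).1 (hP ω).2.1 (hP ω).2.2)
          (P.weight_nonneg ω)
    _ = _ := by rw [← Finset.sum_mul, P.weight_sum, one_mul]

end
end
end MagicBCS

open scoped Kronecker
namespace MagicBCS
noncomputable section
set_option linter.unusedSectionVars false
set_option linter.unusedSimpArgs false

/-! ### The logarithmic lower bound on the depth -/

lemma pClif_lt_one {n : ℕ} (hn : 6 ≤ n) (heven : Even n) : pClif n < 1 := by
  have h := pClif_le hn heven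
  have hq : 0 < Fintype.card (Question n) := Fintype.card_pos_iff.2
    ⟨⟨⟨.aay ⟨0, by omega⟩ ⟨1, by omega⟩, show (0 : ℕ) < 1 by omega⟩, 0⟩⟩
  have : (0 : ℝ) < Fintype.card (Question n) := by exact_mod_cast hq
  have : (0 : ℝ) < 1 / (2 * (Fintype.card (Question n) : ℝ)) := by positivity
  linarith

/-- Magic-free devices need logarithmic depth. -/
theorem exists_log_depth_lower_bound {n w lA lB : ℕ} (hn : 6 ≤ n) (heven : Even n)
    (encA : Option (Constraint n) ↪ (Fin lA → Bit))
    (encB : Option (Variable n) ↪ (Fin lB → Bit)) {K : ℕ} (hK : 1 ≤ K) :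
    ∃ c : ℝ, 0 < c ∧ ∃ N₀ : ℕ, ∀ N : ℕ, N₀ ≤ N → ∀ D : ℕ, ∀ P : RandomProtocol N w lA lB,
      (∀ ω, (P.device ω).MagicFree ∧ (P.device ω).FanInLE K ∧
        (P.device ω).circ₂.length ≤ D) →
      (1 + pClif n) / 2 < P.avgSuccess encA encB → c * Real.log N ≤ D := by
  have hp := pClif_lt_one hn heven
  have hKr : (1 : ℝ) < (K : ℝ) + 1 := by
    have : (1 : ℝ) ≤ K := by exact_mod_cast hK
    linarith
  have hlog : 0 < Real.log ((K : ℝ) + 1) := Real.log_pos hKr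
  -- For `√N ≥ 96 / (1 - pClif n)` the error term `48 / √N` is at most half of the gap `1 - pClif
  -- n`.
  obtain ⟨N₀, hN₀⟩ := exists_nat_ge ((96 / (1 - pClif n)) ^ 2)
  -- With this constant a smaller depth gives `K ^ D ≤ √N`. The shift to `K + 1` keeps the logarithm
  -- positive for `K = 1`.
  refine ⟨1 / (2 * Real.log (K + 1)), by positivity, max 2 N₀, fun N hN D P hP hsucc => ?_⟩
  by_contra hD
  push Not at hD
  have hN2 : 2 ≤ N := (le_max_left _ _).trans hN
  have hN0 : (0 : ℝ) < N := by exact_mod_cast (by omega : 0 < N)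
  have hs : 0 < Real.sqrt N := Real.sqrt_pos.2 hN0
  have hpow : (K : ℝ) ^ D ≤ Real.sqrt N := by
    have h1 : (K : ℝ) ^ D ≤ (K + 1) ^ D := pow_le_pow_left₀ (by positivity) (by linarith) _
    refine h1.trans ?_
    rw [← Real.log_le_log_iff (by positivity) hs, Real.log_pow, Real.log_sqrt hN0.le]
    have := mul_le_mul_of_nonneg_right hD.le hlog.le
    calc _ ≤ _ := this
      _ = _ := by field_simp
  have hsq : 96 / (1 - pClif n) ≤ Real.sqrt N := by
    refine Real.le_sqrt_of_sq_le (hN₀.trans ?_)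
    exact_mod_cast (le_max_right _ _).trans hN
  have hb := P.avgSuccess_le hK hN2 encA encB hP
  have : 48 * (K : ℝ) ^ D / N ≤ (1 - pClif n) / 2 := by
    rw [div_le_iff₀ (by linarith)] at hsq
    rw [div_le_iff₀ hN0]
    have := Real.mul_self_sqrt hN0.le
    nlinarith
  linarith

end
end MagicBCS

open scoped Kronecker
namespace MagicBCS
noncomputable section
set_option linter.unusedSectionVars false
set_option linter.unusedSimpArgs false

/-! ### Classical layers -/

section
variable {C Q : Type} [Fintype C] [DecidableEq C] [Fintype Q] [DecidableEq Q]

/-- The gate that applies the function `F` to the bits in `S`. -/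
def classicalGate (S : Finset C) (F : (C → Bit) → (C → Bit)) : Gate C Q :=
  ⟨S, ∅, [.classical fun x s => F (extendBits S x) s.1]⟩

/-- A step in which the bits in the disjoint sets `S i` are processed separately. -/
def classicalLayer {ι : Type} [Fintype ι] (S : ι → Finset C)
    (hS : Pairwise fun i j => Disjoint (S i) (S j)) (F : (C → Bit) → (C → Bit)) : Layer C Q where
  gates := (Finset.univ : Finset ι).toList.map fun i => classicalGate (S i) F
  disjoint := by
    rw [List.pairwise_map]
    exact (Finset.nodup_toList _).imp fun {i j} hij => ⟨hS hij, Finset.disjoint_empty_left _⟩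

/-- The gates run one after the other, but each reads and writes only its own block. So no gate sees
another's result, and together they apply the global function `F` at once. -/
lemma classicalLayer_step {ι : Type} [Fintype ι] {S : ι → Finset C}
    {hS : Pairwise fun i j => Disjoint (S i) (S j)} {F : (C → Bit) → (C → Bit)}
    (hF : ∀ i, ∀ s ∈ S i, ∀ c c', (∀ s' ∈ S i, c s' = c' s') → F c s = F c' s)
    (hF' : ∀ s, (∀ i, s ∉ S i) → ∀ c, F c s = c s)
    {c c' : C → Bit} {ψ ψ' : (Q → Bit) → ℂ}
    (h : gatesStep (classicalLayer (Q := Q) S hS F).gates c ψ c' ψ') : c' = F c ∧ ψ' = ψ := by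
  classical
  have key : ∀ (l : List ι), l.Nodup → ∀ (c : C → Bit) (ψ : (Q → Bit) → ℂ),
      gatesStep (l.map fun i => classicalGate (S i) F) c ψ c' ψ' →
      (∀ s, c' s = if ∃ i ∈ l, s ∈ S i then F c s else c s) ∧ ψ' = ψ := by
    intro l
    induction l with
    | nil =>
      rintro - c ψ ⟨rfl, rfl⟩
      simp
    | cons i l ih =>
      rintro hl c ψ ⟨c₁, ψ₁, ⟨c₂, ψ₂, ⟨rfl, rfl⟩, rfl, rfl⟩, h2⟩
      obtain ⟨hil, hl⟩ := List.nodup_cons.1 hl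
      obtain ⟨h3, rfl⟩ := ih hl _ _ h2
      refine ⟨fun s => ?_, rfl⟩
      rw [h3]
      have e : ∀ s, liftBits (S i) (fun x s => F (extendBits (S i) x) s.1) c s =
          if s ∈ S i then F c s else c s := by
        intro s
        unfold liftBits
        split_ifs with hs
        · refine hF i s hs _ _ fun s' hs' => ?_
          simp [extendBits, hs']
        · rfl
      change (if ∃ i ∈ l, s ∈ S i then
          F (liftBits (S i) (fun x s => F (extendBits (S i) x) s.1) c) s
        else liftBits (S i) (fun x s => F (extendBits (S i) x) s.1) c s) = _
      by_cases hs : ∃ i' ∈ l, s ∈ S i'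
      · rw [if_pos hs]
        obtain ⟨i', hi', hs'⟩ := hs
        rw [if_pos ⟨i', List.mem_cons_of_mem _ hi', hs'⟩]
        refine hF i' s hs' _ _ fun s' hs' => ?_
        rw [e, if_neg]
        have : i' ≠ i := fun h => hil (h ▸ hi')
        exact Finset.disjoint_left.1 (hS this) hs'
      · rw [if_neg hs, e]
        congr 1
        rw [eq_iff_iff]
        constructor
        · exact fun h => ⟨i, List.mem_cons_self, h⟩
        · rintro ⟨i', hi', h⟩
          rcases List.mem_cons.1 hi' with rfl | hi'
          · exact h
          · exact absurd ⟨i', hi', h⟩ hs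
  obtain ⟨h1, h2⟩ := key _ (Finset.nodup_toList _) c ψ h
  refine ⟨?_, h2⟩
  ext s
  rw [h1]
  split_ifs with hs
  · rfl
  · rw [hF']
    intro i hi
    exact hs ⟨i, by simp, hi⟩

lemma classicalGate_magicFree (S : Finset C) (F : (C → Bit) → (C → Bit)) :
    (classicalGate S F : Gate C Q).MagicFree ∅ ∅ := by
  refine ⟨⟨∅, ⟨?_, ?_⟩, ?_⟩, fun s _ => Iff.rfl⟩
  · intro t _ c c' h
    have : c = c' := funext fun s => h s (Set.notMem_empty _)
    rw [this]
  · intro t ht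
    exact absurd ht (Set.notMem_empty _)
  · ext s; simp

lemma gatesMagicFree_of_classical {gs : List (Gate C Q)}
    (h : ∀ g ∈ gs, ∃ S F, g = classicalGate S F) : gatesMagicFree ∅ gs := by
  induction gs with
  | nil => trivial
  | cons g gs ih =>
    obtain ⟨S, F, rfl⟩ := h g List.mem_cons_self
    exact ⟨∅, classicalGate_magicFree S F, ih fun g hg => h g (List.mem_cons_of_mem _ hg)⟩

end

/-- The total probability is 1, so perfect success follows once every losing bit string carries only
branches with vanishing state. -/
lemma Protocol.success_eq_one {n N w lA lB : ℕ} (P : Protocol N w lA lB)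
    (encA : Option (Constraint n) ↪ (Fin lA → Bit)) (encB : Option (Variable n) ↪ (Fin lB → Bit))
    (I : Instance n N) (J : (P.Bits → Bit) → ((P.Qubits → Bit) → ℂ) → Prop)
    (hJ : Branches J (P.state₂ encA encB I))
    (h : ∀ c ψ, J c ψ → ¬ I.2.Wins (fun l => c (P.out₂A I.1.1.1 l)) (c (P.out₂B I.1.1.2 0)) →
      ψ = 0) : P.success encA encB I = 1 := by
  have ht := congrArg Complex.re (P.total_state₂ encA encB I)
  rw [Hybrid.total, Complex.re_sum, Complex.one_re] at ht
  rw [← ht, success]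
  refine Finset.sum_congr rfl fun c _ => ?_
  split_ifs with hw
  · rfl
  · rw [hJ.eq_zero c fun ψ hψ => h c ψ hψ hw]; simp

/-! ### A magic-free device of logarithmic depth -/

namespace LogDepth

/-- The bits of the device: inputs of both rounds, the hypercube, a copy of Alice's answers, and a
constant. -/
abbrev Wire (N w lA lB m : ℕ) : Type :=
  (Fin N ⊕ Fin N) ⊕ (((Fin N × ((Fin w ⊕ Fin w) ⊕ Fin lA)) ⊕ (Fin N × Fin lB)) ⊕
    ((Fin m → Bit) ⊕ (Fin N ⊕ Unit)))

variable {n N w lA lB m : ℕ}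

set_option synthInstance.maxSize 1000 in
set_option synthInstance.maxHeartbeats 200000 in
instance : DecidableEq (Wire N w lA lB m) := inferInstance

set_option synthInstance.maxSize 1000 in
set_option synthInstance.maxHeartbeats 200000 in
instance : Fintype (Wire N w lA lB m) := inferInstance

/-- The input bits of the second round. -/
abbrev inp (x : (Fin N × ((Fin w ⊕ Fin w) ⊕ Fin lA)) ⊕ (Fin N × Fin lB)) : Wire N w lA lB m :=
  .inr (.inl x)

/-- The bit at a vertex of the hypercube. -/
abbrev vert (v : Fin m → Bit) : Wire N w lA lB m := .inr (.inr (.inl v))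

/-- Alice's answer. -/
abbrev ans (i : Fin N) : Wire N w lA lB m := .inr (.inr (.inr (.inl i)))

/-- A constant bit. -/
abbrev const : Wire N w lA lB m := .inr (.inr (.inr (.inr ())))

open Classical in
/-- The right-hand side of an encoded constraint. -/
def rhsBit (encA : Option (Constraint n) ↪ (Fin lA → Bit)) (x : Fin lA → Bit) : Bit :=
  if ∃ α : Constraint n, encA (some α) = x ∧ α.1.rhs = 1 then 1 else 0

lemma rhsBit_some (encA : Option (Constraint n) ↪ (Fin lA → Bit)) (α : Constraint n) :
    rhsBit encA (encA (some α)) = α.1.rhs := by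
  unfold rhsBit
  split_ifs with h
  · obtain ⟨α', h1, h2⟩ := h
    rw [EmbeddingLike.apply_eq_iff_eq, Option.some_inj] at h1
    rw [← h1, h2]
  · exact ((bit_cases α.1.rhs).resolve_right fun h' => h ⟨α, rfl, h'⟩).symm

lemma rhsBit_none (encA : Option (Constraint n) ↪ (Fin lA → Bit)) :
    rhsBit encA (encA none) = 0 := by
  unfold rhsBit
  rw [if_neg]
  rintro ⟨α, h, -⟩
  simp at h

open Classical in
/-- Whether an encoded variable is an auxiliary one. -/
def auxBit (encB : Option (Variable n) ↪ (Fin lB → Bit)) (x : Fin lB → Bit) : Bit :=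
  if ∃ β : Variable n, encB (some β) = x ∧ ∃ k, β.1 = .h k then 1 else 0

/-- Alice's sites compute the right-hand sides. -/
def writeFun (encA : Option (Constraint n) ↪ (Fin lA → Bit)) (emb : Fin N ↪ (Fin m → Bit))
    (c : Wire N w lA lB m → Bit) : Wire N w lA lB m → Bit
  | .inr (.inr (.inl v)) => Function.extend emb
      (fun i => rhsBit encA fun l => c (inp (.inl (i, .inr l)))) (fun v => c (vert v)) v
  | .inr (.inr (.inr (.inl i))) => rhsBit encA fun l => c (inp (.inl (i, .inr l)))
  | s => c s

/-- The wires of the first layer. -/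
def writeWires (emb : Fin N ↪ (Fin m → Bit)) (i : Fin N) : Finset (Wire N w lA lB m) :=
  (Finset.univ.image fun l : Fin lA => inp (.inl (i, .inr l))) ∪ {vert (emb i), ans i}

/-- Add up the bits along the coordinate `t` of the hypercube. -/
def addFun (t : Fin m) (c : Wire N w lA lB m → Bit) : Wire N w lA lB m → Bit
  | .inr (.inr (.inl v)) => c (vert (Function.update v t 0)) + c (vert (Function.update v t 1))
  | s => c s

/-- The edges of the hypercube in the direction `t`. -/
def addWires (t : Fin m) (v : {v : Fin m → Bit // v t = 0}) : Finset (Wire N w lA lB m) :=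
  {vert v.1, vert (Function.update v.1 t 1)}

/-- Bob's sites compute their answers. -/
def readFun (encB : Option (Variable n) ↪ (Fin lB → Bit)) (emb : Fin N ↪ (Fin m → Bit))
    (c : Wire N w lA lB m → Bit) : Wire N w lA lB m → Bit
  | .inr (.inr (.inl v)) => Function.extend emb
      (fun i => c (vert (emb i)) * auxBit encB fun l => c (inp (.inr (i, l))))
      (fun v => c (vert v)) v
  | s => c s

/-- The wires of the last layer. -/
def readWires (emb : Fin N ↪ (Fin m → Bit)) (i : Fin N) : Finset (Wire N w lA lB m) :=
  (Finset.univ.image fun l : Fin lB => inp (.inr (i, l))) ∪ {vert (emb i)}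

lemma writeWires_disjoint (emb : Fin N ↪ (Fin m → Bit)) :
    Pairwise fun i j => Disjoint (writeWires emb i) (writeWires (w := w) (lA := lA) (lB := lB) emb j) := by
  intro i j hij
  rw [Finset.disjoint_left]
  intro s h1 h2
  simp only [writeWires, Finset.mem_union, Finset.mem_image, Finset.mem_univ, true_and,
    Finset.mem_insert, Finset.mem_singleton] at h1 h2
  rcases h1 with ⟨l, rfl⟩ | rfl | rfl <;> rcases h2 with ⟨l', h⟩ | h | h <;>
    simp [hij, hij.symm] at h

lemma addWires_disjoint (t : Fin m) :
    Pairwise fun i j => Disjoint (addWires t i)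
      (addWires (N := N) (w := w) (lA := lA) (lB := lB) t j) := by
  rintro ⟨v, hv⟩ ⟨v', hv'⟩ hij
  have hne : v ≠ v' := fun h => hij (Subtype.ext h)
  rw [Finset.disjoint_left]
  intro s h1 h2
  simp only [addWires, Finset.mem_insert, Finset.mem_singleton] at h1 h2
  have key : ∀ b b', Function.update v t b = Function.update v' t b' → False := by
    intro b b' h
    apply hne
    have := congrArg (fun x => Function.update x t 0) h
    simp only [Function.update_idem] at this
    rw [← hv, Function.update_eq_self, hv, ← hv', Function.update_eq_self] at this
    exact this
  have e : v = Function.update v t 0 := by rw [← hv, Function.update_eq_self]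
  have e' : v' = Function.update v' t 0 := by rw [← hv', Function.update_eq_self]
  rcases h1 with rfl | rfl <;> rcases h2 with h | h <;>
    simp only [Sum.inr.injEq, Sum.inl.injEq] at h
  · exact hne h
  · rw [e] at h; exact key _ _ h
  · rw [e'] at h; exact key _ _ h
  · exact key _ _ h

lemma readWires_disjoint (emb : Fin N ↪ (Fin m → Bit)) :
    Pairwise fun i j => Disjoint (readWires emb i) (readWires (w := w) (lA := lA) (lB := lB) emb j) := by
  intro i j hij
  rw [Finset.disjoint_left]
  intro s h1 h2
  simp only [readWires, Finset.mem_union, Finset.mem_image, Finset.mem_univ, true_and,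
    Finset.mem_insert, Finset.mem_singleton] at h1 h2
  rcases h1 with ⟨l, rfl⟩ | rfl <;> rcases h2 with ⟨l', h⟩ | h <;>
    simp [hij, hij.symm] at h

/-- The circuit of the second round. -/
def circuit (encA : Option (Constraint n) ↪ (Fin lA → Bit))
    (encB : Option (Variable n) ↪ (Fin lB → Bit)) (emb : Fin N ↪ (Fin m → Bit)) :
    Circuit (Wire N w lA lB m) Empty :=
  classicalLayer (writeWires emb) (writeWires_disjoint emb) (writeFun encA emb) ::
    ((List.finRange m).map fun t => classicalLayer (addWires t) (addWires_disjoint t) (addFun t)) ++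
    [classicalLayer (readWires emb) (readWires_disjoint emb) (readFun encB emb)]

/-- The device. -/
def device (encA : Option (Constraint n) ↪ (Fin lA → Bit))
    (encB : Option (Variable n) ↪ (Fin lB → Bit)) (emb : Fin N ↪ (Fin m → Bit)) :
    Protocol N w lA lB where
  Bits := Wire N w lA lB m
  Qubits := Empty
  anc := 0
  in₁ := Function.Embedding.inl
  in₂ := Function.Embedding.inl.trans Function.Embedding.inr
  out₁A _ _ := const
  out₁B _ _ := const
  -- Alice answers the right-hand side at position 0 and zeros elsewhere, which satisfies every
  -- constraint without communication.
  out₂A i l := if l = 0 then ans i else const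
  out₂B i _ := vert (emb i)
  circ₁ := []
  circ₂ := circuit encA encB emb

variable (encA : Option (Constraint n) ↪ (Fin lA → Bit))
    (encB : Option (Variable n) ↪ (Fin lB → Bit)) (emb : Fin N ↪ (Fin m → Bit))

lemma write_step {c c' : Wire N w lA lB m → Bit} {ψ ψ' : (Empty → Bit) → ℂ}
    (h : gatesStep (classicalLayer (Q := Empty) (writeWires emb) (writeWires_disjoint emb)
      (writeFun encA emb)).gates c ψ c' ψ') : c' = writeFun encA emb c := by
  refine (classicalLayer_step ?_ ?_ h).1
  · intro i s hs c c' hc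
    simp only [writeWires, Finset.mem_union, Finset.mem_image, Finset.mem_univ, true_and,
      Finset.mem_insert, Finset.mem_singleton] at hs hc
    have e : (fun l => c (inp (.inl (i, .inr l)))) = fun l => c' (inp (.inl (i, .inr l))) :=
      funext fun l => hc _ (Or.inl ⟨l, rfl⟩)
    rcases hs with ⟨l, rfl⟩ | rfl | rfl
    · exact hc _ (Or.inl ⟨l, rfl⟩)
    · simp only [writeFun, emb.injective.extend_apply, e]
    · simp only [writeFun, e]
  · intro s hs c
    rcases s with s | s | v | i | s
    · rfl
    · rfl
    · simp only [writeFun]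
      rw [Function.extend_apply']
      rintro ⟨i, rfl⟩
      exact hs i (by simp [writeWires])
    · exact absurd (by simp [writeWires]) (hs i)
    · rfl

lemma add_step (t : Fin m) {c c' : Wire N w lA lB m → Bit} {ψ ψ' : (Empty → Bit) → ℂ}
    (h : gatesStep (classicalLayer (Q := Empty) (addWires t) (addWires_disjoint t)
      (addFun t)).gates c ψ c' ψ') : c' = addFun t c := by
  refine (classicalLayer_step ?_ ?_ h).1
  · rintro ⟨v, hv⟩ s hs c c' hc
    simp only [addWires, Finset.mem_insert, Finset.mem_singleton] at hs hc
    have e : v = Function.update v t 0 := by rw [← hv, Function.update_eq_self]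
    have e0 := hc _ (Or.inl rfl)
    have e1 := hc _ (Or.inr rfl)
    rw [e] at e0
    rcases hs with rfl | rfl <;> simp only [addFun, Function.update_idem, e0, e1]
  · intro s hs c
    rcases s with s | s | v | i | s
    · rfl
    · rfl
    · exfalso
      refine hs ⟨Function.update v t 0, by simp⟩ ?_
      simp only [addWires, Finset.mem_insert, Finset.mem_singleton, Sum.inr.injEq, Sum.inl.injEq,
        Function.update_idem]
      rcases bit_cases (v t) with h | h
      · left; rw [← h, Function.update_eq_self]
      · right; rw [← h, Function.update_eq_self]
    · rfl
    · rfl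

lemma read_step {c c' : Wire N w lA lB m → Bit} {ψ ψ' : (Empty → Bit) → ℂ}
    (h : gatesStep (classicalLayer (Q := Empty) (readWires emb) (readWires_disjoint emb)
      (readFun encB emb)).gates c ψ c' ψ') : c' = readFun encB emb c := by
  refine (classicalLayer_step ?_ ?_ h).1
  · intro i s hs c c' hc
    simp only [readWires, Finset.mem_union, Finset.mem_image, Finset.mem_univ, true_and,
      Finset.mem_insert, Finset.mem_singleton] at hs hc
    have e : (fun l => c (inp (.inr (i, l)))) = fun l => c' (inp (.inr (i, l))) :=
      funext fun l => hc _ (Or.inl ⟨l, rfl⟩)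
    rcases hs with ⟨l, rfl⟩ | rfl
    · exact hc _ (Or.inl ⟨l, rfl⟩)
    · simp only [readFun, emb.injective.extend_apply, e, hc _ (Or.inr rfl)]
  · intro s hs c
    rcases s with s | s | v | i | s
    · rfl
    · rfl
    · simp only [readFun]
      rw [Function.extend_apply']
      rintro ⟨i, rfl⟩
      exact hs i (by simp [readWires])
    · rfl
    · rfl

/-- Once the directions in `T` are summed over, the bit `a` placed at the vertex `x` is present
exactly at the vertices that agree with `x` off `T`. After all directions every vertex holds `a`: a
broadcast from an unknown source. -/
lemma add_steps (x : Fin m → Bit) (a : Bit) (l : List (Fin m)) (T : Finset (Fin m))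
    (hl : l.Nodup) (hT : ∀ t ∈ l, t ∉ T) {c c' : Wire N w lA lB m → Bit}
    {ψ ψ' : (Empty → Bit) → ℂ}
    (hc : ∀ v, c (vert v) = if ∀ s, s ∉ T → v s = x s then a else 0)
    (h : gatesStep (Circuit.gates (Q := Empty) (l.map fun t =>
      classicalLayer (addWires t) (addWires_disjoint t) (addFun t))) c ψ c' ψ') :
    (∀ v, c' (vert v) = if ∀ s, s ∉ T ∪ l.toFinset → v s = x s then a else 0) ∧
      (∀ y, c' (inp y) = c (inp y)) ∧ (∀ i, c' (ans i) = c (ans i)) ∧ c' const = c const := by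
  induction l generalizing T c ψ with
  | nil =>
    obtain ⟨rfl, rfl⟩ := h
    exact ⟨by simpa using hc, fun _ => rfl, fun _ => rfl, rfl⟩
  | cons t l ih =>
    have h : gatesStep ((classicalLayer (Q := Empty) (addWires t) (addWires_disjoint t)
        (addFun t)).gates ++ Circuit.gates (l.map fun t =>
      classicalLayer (addWires t) (addWires_disjoint t) (addFun t))) c ψ c' ψ' := h
    obtain ⟨c₁, ψ₁, h1, h2⟩ := gatesStep_append h
    have e := add_step t h1
    subst e
    obtain ⟨htl, hl⟩ := List.nodup_cons.1 hl
    have htT : t ∉ T := hT t List.mem_cons_self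
    obtain ⟨i1, i2⟩ := ih (insert t T) hl (fun s hs => by
      rw [Finset.mem_insert, not_or]
      exact ⟨fun h => htl (h ▸ hs), hT s (List.mem_cons_of_mem _ hs)⟩) (fun v => by
      simp only [addFun, hc]
      by_cases hv : ∀ s, s ∉ insert t T → v s = x s
      · rw [if_pos hv]
        have e : ∀ b, (∀ s, s ∉ T → Function.update v t b s = x s) ↔ b = x t := by
          intro b
          constructor
          · intro h; simpa using h t htT
          · intro h s hs
            by_cases hst : s = t
            · subst hst; simpa using h
            · rw [Function.update_of_ne hst]
              exact hv s (by simp [hst, hs])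
        simp only [e]
        rcases bit_cases (x t) with h | h <;> simp [h]
      · have e : ∀ b, ¬ (∀ s, s ∉ T → Function.update v t b s = x s) := by
          intro b h
          apply hv
          intro s hs
          rw [Finset.mem_insert, not_or] at hs
          have := h s hs.2
          rwa [Function.update_of_ne hs.1] at this
        rw [if_neg hv, if_neg (e 0), if_neg (e 1), add_zero]) h2
    refine ⟨fun v => ?_, i2⟩
    rw [i1]
    simp only [List.toFinset_cons, Finset.insert_union, Finset.union_insert]

/-- Only the last constraint of the chain has right-hand side 1; there Alice gives 1 to an auxiliary
variable and 0 to two vertex variables. So Bob's consistent answer is the right-hand side times the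
bit that tells whether his variable is auxiliary, and the right-hand side is the only thing that he
has to learn. -/
lemma device_success (hn : 6 ≤ n) (I : Instance n N) :
    (device (w := w) encA encB emb).success encA encB I = 1 := by
  obtain ⟨⟨⟨j, k⟩, hjk⟩, q⟩ := I
  let P := device (w := w) encA encB emb
  refine P.success_eq_one encA encB _
    (fun (c : Wire N w lA lB m → Bit) _ => c (ans j) = q.1.1.rhs ∧ c const = 0 ∧
      c (vert (emb k)) = q.1.1.rhs * auxBit encB (encB (some q.bob))) ?_ ?_
  · refine Branches.circuit (I := fun c _ => (∀ x, c (inp x) = input₂ encA encB j k q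
        (fun _ _ => 0) (fun _ _ => 0) x) ∧ (∀ v, c (vert v) = 0) ∧ c const = 0) ?_ _ ?_
    · refine ((Branches.init _).mono (I' := fun c _ => (∀ v, c (vert v) = 0) ∧ c const = 0) ?_).map
        _ ?_
      · rintro c ψ ⟨rfl, -⟩
        have e : ∀ s : Wire N w lA lB m, (∀ x, Sum.inl x ≠ s) →
            Function.extend P.in₁ (input₁ j k) P.anc s = 0 := by
          intro s hs
          exact (Function.extend_apply' (f := P.in₁) _ _ _ fun ⟨x, hx⟩ => hs x hx).trans rfl
        exact ⟨fun v => e _ (by simp), e _ (by simp)⟩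
      · rintro c ψ ⟨h1, h2⟩
        have e : ∀ (g : _ → Bit) (s : Wire N w lA lB m), (∀ x, inp x ≠ s) →
            Function.extend P.in₂ g c s = c s := by
          intro g s hs
          exact Function.extend_apply' (f := P.in₂) _ _ _ fun ⟨x, hx⟩ => hs x hx
        refine ⟨fun x => ?_, fun v => (e _ _ (by simp)).trans (h1 v), (e _ _ (by simp)).trans h2⟩
        refine (P.in₂.injective.extend_apply _ _ x).trans ?_
        congr 1 <;> · ext i l; exact h2
    · rintro c ψ c' ψ' ⟨h1, h2, h3⟩ hs
      have hs : gatesStep ((classicalLayer (writeWires emb) (writeWires_disjoint emb)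
        (writeFun encA emb)).gates ++ (Circuit.gates (Q := Empty) ((List.finRange m).map fun t =>
          classicalLayer (addWires t) (addWires_disjoint t) (addFun t)) ++
          (classicalLayer (readWires emb) (readWires_disjoint emb) (readFun encB emb)).gates))
          c ψ c' ψ' := by
        have e : Circuit.gates (circuit (w := w) encA encB emb) =
            ((classicalLayer (writeWires emb) (writeWires_disjoint emb)
        (writeFun encA emb)).gates ++ (Circuit.gates (Q := Empty) ((List.finRange m).map fun t =>
          classicalLayer (addWires t) (addWires_disjoint t) (addFun t)) ++
          (classicalLayer (readWires emb) (readWires_disjoint emb) (readFun encB emb)).gates)) := by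
          simp only [circuit, Circuit.gates, List.flatMap_append, List.flatMap_cons,
            List.flatMap_nil, List.append_nil, List.cons_append]
        exact e ▸ (show gatesStep (Circuit.gates (circuit (w := w) encA encB emb)) c ψ c' ψ' from hs)
      obtain ⟨c₁, ψ₁, hs1, hs⟩ := gatesStep_append hs
      obtain ⟨c₂, ψ₂, hs2, hs3⟩ := gatesStep_append hs
      have e1 := write_step encA emb hs1
      have e3 := read_step encB emb hs3
      have hα : ∀ i, (fun l => c (inp (.inl (i, .inr l)))) =
          encA (if i = j then some q.1 else none) := fun i => funext fun l => h1 _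
      have hβ : (fun l => c (inp (.inr (k, l)))) = encB (some q.bob) := by
        ext l; rw [h1]; simp [input₂]
      have hrhs : ∀ i, rhsBit encA (encA (if i = j then some q.1 else none)) =
          if i = j then q.1.1.rhs else 0 := by
        intro i
        split_ifs
        · exact rhsBit_some _ _
        · exact rhsBit_none _
      obtain ⟨a1, a2, a3, a4⟩ := add_steps (emb j) q.1.1.rhs (List.finRange m) ∅
        (List.nodup_finRange m) (by simp) (c := c₁) (by
          intro v
          rw [e1]
          simp only [writeFun, hα, hrhs]
          by_cases hv : ∃ i, emb i = v
          · obtain ⟨i, rfl⟩ := hv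
            rw [emb.injective.extend_apply]
            congr 1
            rw [eq_iff_iff]
            constructor
            · rintro rfl; simp
            · intro h; exact emb.injective (funext fun s => h s (by simp))
          · rw [Function.extend_apply' _ _ _ hv, h2, if_neg]
            intro h
            exact hv ⟨j, funext fun s => (h s (by simp)).symm⟩) hs2
      have e2 : ∀ v, c₂ (vert v) = q.1.1.rhs := by
        intro v; rw [a1, if_pos]; simp
      refine ⟨?_, ?_, ?_⟩
      · rw [e3]
        show c₂ (ans j) = _
        rw [a3, e1]
        show rhsBit encA (fun l => c (inp (.inl (j, .inr l)))) = _
        rw [hα, hrhs, if_pos rfl]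
      · rw [e3]
        show c₂ const = _
        rw [a4, e1]
        exact h3
      · rw [e3]
        simp only [readFun, emb.injective.extend_apply, e2, a2]
        rw [e1]
        show _ * auxBit encB (fun l => c (inp (.inr (k, l)))) = _
        rw [hβ]
  · rintro c ψ ⟨h1, h2, h3⟩ hw
    exfalso
    apply hw
    have o0 : c (P.out₂A j 0) = q.1.1.rhs := h1
    have o1 : c (P.out₂A j 1) = 0 := h2
    have o2 : c (P.out₂A j 2) = 0 := h2
    have ob : c (P.out₂B k 0) = q.1.1.rhs * auxBit encB (encB (some q.bob)) := h3
    refine ⟨?_, ?_⟩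
    · refine (Fin.sum_univ_three _).trans ?_
      exact (congrArg₂ _ (congrArg₂ _ o0 o1) o2).trans (by simp)
    · refine Eq.trans ?_ ob.symm
      have haux : auxBit encB (encB (some q.bob)) = 1 ↔ ∃ k, q.1.1.var q.2 = .h k := by
        unfold auxBit
        constructor
        · intro h
          split_ifs at h with h'
          · obtain ⟨β, hβ, h'⟩ := h'
            rw [EmbeddingLike.apply_eq_iff_eq, Option.some_inj] at hβ
            subst hβ
            exact h'
          · exact absurd h zero_ne_one
        · intro h
          rw [if_pos ⟨q.bob, rfl, h⟩]
      obtain ⟨⟨r, hr⟩, s⟩ := q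
      have hs : s = 0 ∨ s = 1 ∨ s = 2 := by fin_cases s <;> simp
      rcases bit_cases r.rhs with h0 | h0
      · simp only [h0, zero_mul] at o0 ⊢
        rcases hs with rfl | rfl | rfl
        · exact o0
        · exact o1
        · exact o2
      · simp only [h0, one_mul] at o0 ⊢
        cases r with
        | chain i =>
          have hi : i.1 + 2 = n := by
            by_contra hi
            simp [RawCon.rhs, hi] at h0
          -- As `n ≥ 6`, the last constraint of the chain is not the first one, so its position 0
          -- holds an auxiliary variable and not a vertex variable.
          have hi1 : i.1 ≠ 1 := by omega
          rcases hs with rfl | rfl | rfl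
          · refine o0.trans (Eq.symm (haux.2 ?_))
            simp [RawCon.var, hi1]
          · refine o1.trans (Eq.symm ((bit_cases _).resolve_right fun h => ?_))
            have := haux.1 h
            simp [RawCon.var] at this
          · refine o2.trans (Eq.symm ((bit_cases _).resolve_right fun h => ?_))
            have := haux.1 h
            simp [RawCon.var, hi] at this
        | _ => simp [RawCon.rhs] at h0

lemma device_gates {g : Gate (Wire N w lA lB m) Empty}
    (hg : g ∈ (device (w := w) encA encB emb).gates) :
    ∃ S F, g = classicalGate S F ∧ S.card ≤ max lA lB + 2 := by
  have hg : g ∈ Circuit.gates (circuit (w := w) encA encB emb) := by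
    rcases List.mem_append.1 hg with h | h
    · exact absurd h List.not_mem_nil
    · exact h
  simp only [Circuit.gates, List.mem_flatMap, circuit, List.cons_append, List.mem_cons,
    List.mem_append, List.mem_map, List.not_mem_nil, or_false] at hg
  obtain ⟨L, hL, hg⟩ := hg
  rcases hL with rfl | ⟨t, -, rfl⟩ | rfl
  · obtain ⟨i, -, rfl⟩ := List.mem_map.1 hg
    refine ⟨_, _, rfl, (Finset.card_union_le _ _).trans (add_le_add ?_ Finset.card_le_two)⟩
    refine Finset.card_image_le.trans ?_
    simp
  · obtain ⟨i, -, rfl⟩ := List.mem_map.1 hg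
    exact ⟨_, _, rfl, Finset.card_le_two.trans (by omega)⟩
  · obtain ⟨i, -, rfl⟩ := List.mem_map.1 hg
    refine ⟨_, _, rfl, (Finset.card_union_le _ _).trans (add_le_add ?_ ?_)⟩
    · refine Finset.card_image_le.trans ?_
      simp
    · simp

end LogDepth

theorem exists_log_depth_device {n w lA lB : ℕ} (hn : 6 ≤ n)
    (encA : Option (Constraint n) ↪ (Fin lA → Bit))
    (encB : Option (Variable n) ↪ (Fin lB → Bit)) {K : ℕ} (hK : max lA lB + 2 ≤ K) :
    ∃ c : ℝ, ∀ N : ℕ, 2 ≤ N → ∃ P : Protocol N w lA lB,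
      P.FanInLE K ∧ (P.circ₁.length : ℝ) ≤ c * Real.log N ∧
      (P.circ₂.length : ℝ) ≤ c * Real.log N ∧ P.MagicFree ∧
      ∀ I : Instance n N, P.success encA encB I = 1 := by
  have hl2 : 0 < Real.log 2 := Real.log_pos one_lt_two
  -- The depth is `m + 2` with `(m - 1) * log 2 ≤ log N`, and the three additional steps are paid by
  -- `log 2 ≤ log N`.
  refine ⟨4 / Real.log 2, fun N hN => ?_⟩
  have hlN : Real.log 2 ≤ Real.log N := Real.log_le_log two_pos (by exact_mod_cast hN)
  obtain ⟨m, hm⟩ : ∃ m, m = Nat.clog 2 N := ⟨_, rfl⟩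
  obtain ⟨emb⟩ : Nonempty (Fin N ↪ (Fin m → Bit)) := by
    refine Function.Embedding.nonempty_of_card_le ?_
    simp only [Fintype.card_fin, Fintype.card_fun, ZMod.card, hm]
    exact Nat.le_pow_clog one_lt_two N
  have hm1 : ((m : ℝ) - 1) * Real.log 2 ≤ Real.log N := by
    have h1 : 2 ^ (m - 1) < N := by
      rw [hm]; exact Nat.pow_pred_clog_lt_self one_lt_two (by omega)
    have hm0 : 1 ≤ m := by rw [hm]; exact Nat.clog_pos one_lt_two hN
    have h2 : ((2 : ℝ) ^ (m - 1)) ≤ N := by exact_mod_cast h1.le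
    have := Real.log_le_log (by positivity) h2
    rwa [Real.log_pow, Nat.cast_sub hm0, Nat.cast_one] at this
  refine ⟨LogDepth.device encA encB emb, ?_, ?_, ?_, ⟨show gatesMagicFree ∅ [] from trivial, ?_⟩,
    LogDepth.device_success encA encB emb hn⟩
  · intro g hg
    obtain ⟨S, F, rfl, h⟩ := LogDepth.device_gates encA encB emb hg
    show S.card + (∅ : Finset Empty).card ≤ K
    rw [Finset.card_empty]; omega
  · show ((([] : List (Layer _ _)).length : ℕ) : ℝ) ≤ _
    have : 0 < Real.log N := hl2.trans_le hlN
    simp only [List.length_nil, Nat.cast_zero]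
    positivity
  · show (((LogDepth.circuit encA encB emb).length : ℕ) : ℝ) ≤ _
    have : (LogDepth.circuit (w := w) encA encB emb).length = m + 2 := by
      simp [LogDepth.circuit]
    rw [this, div_mul_eq_mul_div, le_div_iff₀ hl2]
    push_cast
    nlinarith
  · refine gatesMagicFree_of_classical fun g hg => ?_
    obtain ⟨S, F, h, -⟩ := LogDepth.device_gates encA encB emb (g := g)
      (List.mem_append_right _ hg)
    exact ⟨S, F, h⟩

end
end MagicBCS

open scoped Kronecker
namespace MagicBCS
noncomputable section
set_option linter.unusedSectionVars false
set_option linter.unusedSimpArgs false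

/-! ### An operator solution of the constraint system -/

namespace Solution

variable {n : ℕ}

/-- The transposition of the end points of an edge. -/
def edgeSwap : Sym2 (Fin n) → Equiv.Perm (Fin n) :=
  Sym2.lift ⟨Equiv.swap, Equiv.swap_comm⟩

/-- The indicator function of an edge. -/
def edgeInd : Sym2 (Fin n) → Fin n → Bit :=
  Sym2.lift ⟨fun u v => Pi.single u 1 + Pi.single v 1, fun _ _ => add_comm _ _⟩

@[simp] lemma edgeSwap_mk (u v : Fin n) : edgeSwap s(u, v) = Equiv.swap u v := rfl

@[simp] lemma edgeInd_mk (u v : Fin n) : edgeInd s(u, v) = Pi.single u 1 + Pi.single v 1 := rfl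

lemma edgeSwap_mul_self (e : Sym2 (Fin n)) : edgeSwap e * edgeSwap e = 1 := by
  induction e with | _ u v => exact Equiv.swap_mul_self u v

lemma edgeInd_comp_edgeSwap (e : Sym2 (Fin n)) : edgeInd e ∘ edgeSwap e = edgeInd e := by
  induction e with | _ u v =>
  ext i
  simp only [edgeInd_mk, edgeSwap_mk, Function.comp_apply, Pi.add_apply, Pi.single_apply,
    Equiv.swap_apply_def]
  split_ifs <;> simp_all

open Classical in
/-- The permutation and the sign vector of a symbol. -/
def sol : Symbol n → Equiv.Perm (Fin n) × (Fin n → Bit)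
  | .a v => (1, Pi.single v 1)
  | .h k => (1, fun i => if i ≤ k then 1 else 0)
  | .x e => (edgeSwap e, 0)
  | .y e => (1, edgeInd e)
  | .z e => (edgeSwap e, edgeInd e)
  -- Trivial values for overlapping edges, here and for `c`, keep the image of every symbol an
  -- involution; the constraints involve disjoint edges only.
  | .b p => (Sym2.lift ⟨fun e f => if edgeSwap e * edgeSwap f = edgeSwap f * edgeSwap e then
      edgeSwap e * edgeSwap f else 1, fun e f => by
        by_cases h : edgeSwap e * edgeSwap f = edgeSwap f * edgeSwap e
        · dsimp only
          rw [if_pos h, if_pos h.symm, h]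
        · dsimp only
          rw [if_neg h, if_neg (Ne.symm h)]⟩ p, 0)
  | .c e f => if edgeSwap e * edgeSwap f = edgeSwap f * edgeSwap e ∧
      edgeInd f ∘ edgeSwap e = edgeInd f then (edgeSwap e * edgeSwap f, edgeInd f) else (1, 0)

lemma sol_involutive (s : Symbol n) :
    (sol s).1 * (sol s).1 = 1 ∧ (sol s).2 ∘ (sol s).1 = (sol s).2 := by
  cases s with
  | a v => exact ⟨one_mul _, rfl⟩
  | h k => exact ⟨one_mul _, rfl⟩
  | x e => exact ⟨edgeSwap_mul_self e, rfl⟩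
  | y e => exact ⟨one_mul _, rfl⟩
  | z e => exact ⟨edgeSwap_mul_self e, edgeInd_comp_edgeSwap e⟩
  | b p =>
    induction p with | _ e f =>
    refine ⟨?_, rfl⟩
    show (if _ then _ else _) * (if _ then _ else _) = (1 : Equiv.Perm (Fin n))
    split_ifs with h
    · rw [mul_assoc, ← mul_assoc (edgeSwap f), ← h, mul_assoc, edgeSwap_mul_self, mul_one,
        edgeSwap_mul_self]
    · exact one_mul _
  | c e f =>
    simp only [sol]
    split_ifs with h
    · refine ⟨?_, ?_⟩
      · show edgeSwap e * edgeSwap f * (edgeSwap e * edgeSwap f) = 1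
        rw [mul_assoc, ← mul_assoc (edgeSwap f), ← h.1, mul_assoc, edgeSwap_mul_self, mul_one,
          edgeSwap_mul_self]
      · show edgeInd f ∘ (edgeSwap e ∘ edgeSwap f) = edgeInd f
        rw [← Function.comp_assoc, h.2, edgeInd_comp_edgeSwap]
    · exact ⟨one_mul _, rfl⟩

lemma swap_disjoint_comm {u v s t : Fin n} (h1 : u ≠ s) (h2 : u ≠ t) (h3 : v ≠ s) (h4 : v ≠ t) :
    Equiv.swap u v * Equiv.swap s t = Equiv.swap s t * Equiv.swap u v := by
  ext i
  simp only [Equiv.Perm.mul_apply, Equiv.swap_apply_def]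
  split_ifs <;> simp_all

lemma ind_comp_swap {u v s t : Fin n} (h1 : u ≠ s) (h2 : u ≠ t) (h3 : v ≠ s) (h4 : v ≠ t) :
    (Pi.single s 1 + Pi.single t 1 : Fin n → Bit) ∘ Equiv.swap u v =
      Pi.single s 1 + Pi.single t 1 := by
  ext i
  simp only [Function.comp_apply, Pi.add_apply, Pi.single_apply, Equiv.swap_apply_def]
  split_ifs <;> simp_all

lemma sol_b {u v s t : Fin n} (h1 : u ≠ s) (h2 : u ≠ t) (h3 : v ≠ s) (h4 : v ≠ t) :
    sol (.b s(s(u, v), s(s, t))) = (Equiv.swap u v * Equiv.swap s t, 0) := by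
  show ((if _ then _ else _), _) = _
  rw [if_pos]
  · rfl
  · exact swap_disjoint_comm h1 h2 h3 h4

lemma sol_c {u v s t : Fin n} (h1 : u ≠ s) (h2 : u ≠ t) (h3 : v ≠ s) (h4 : v ≠ t) :
    sol (.c s(u, v) s(s, t)) = (Equiv.swap u v * Equiv.swap s t, Pi.single s 1 + Pi.single t 1) := by
  rw [sol, if_pos]
  · rfl
  · exact ⟨swap_disjoint_comm h1 h2 h3 h4, ind_comp_swap h1 h2 h3 h4⟩

/-- The product of signed permutations. -/
def comp (g g' : Equiv.Perm (Fin n) × (Fin n → Bit)) : Equiv.Perm (Fin n) × (Fin n → Bit) :=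
  (g'.1 * g.1, g'.2 + g.2 ∘ g'.1.symm)

lemma klein_mul {u v s t : Fin n} (h1 : u ≠ v) (h2 : u ≠ s) (h3 : u ≠ t) (h4 : v ≠ s) (h5 : v ≠ t)
    (h6 : s ≠ t) : (Equiv.swap v s * Equiv.swap u t) * (Equiv.swap u v * Equiv.swap s t) =
      Equiv.swap s u * Equiv.swap v t := by
  refine Equiv.ext fun i => ?_
  simp only [Equiv.Perm.mul_apply]
  by_cases hiu : i = u
  · subst hiu
    rw [Equiv.swap_apply_of_ne_of_ne h2 h3, Equiv.swap_apply_left,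
      Equiv.swap_apply_of_ne_of_ne h1.symm h5, Equiv.swap_apply_left,
      Equiv.swap_apply_of_ne_of_ne h1 h3, Equiv.swap_apply_right]
  by_cases hiv : i = v
  · subst hiv
    rw [Equiv.swap_apply_of_ne_of_ne h4 h5, Equiv.swap_apply_right,
      Equiv.swap_apply_left, Equiv.swap_apply_of_ne_of_ne h5.symm h6.symm,
      Equiv.swap_apply_left, Equiv.swap_apply_of_ne_of_ne h6.symm h3.symm]
  by_cases his : i = s
  · subst his
    rw [Equiv.swap_apply_left, Equiv.swap_apply_of_ne_of_ne h3.symm h5.symm,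
      Equiv.swap_apply_right, Equiv.swap_apply_of_ne_of_ne h1 h2,
      Equiv.swap_apply_of_ne_of_ne h4.symm h6, Equiv.swap_apply_left]
  by_cases hit : i = t
  · subst hit
    rw [Equiv.swap_apply_right, Equiv.swap_apply_of_ne_of_ne h2.symm h4.symm,
      Equiv.swap_apply_of_ne_of_ne h2.symm h6, Equiv.swap_apply_right,
      Equiv.swap_apply_right, Equiv.swap_apply_of_ne_of_ne h4 h1.symm]
  rw [Equiv.swap_apply_of_ne_of_ne his hit, Equiv.swap_apply_of_ne_of_ne hiu hiv,
    Equiv.swap_apply_of_ne_of_ne hiu hit, Equiv.swap_apply_of_ne_of_ne hiv his,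
    Equiv.swap_apply_of_ne_of_ne hiv hit, Equiv.swap_apply_of_ne_of_ne his hiu]

lemma klein_mul_self {u v s t : Fin n} (h2 : u ≠ s) (h3 : u ≠ t) (h4 : v ≠ s) (h5 : v ≠ t) :
    (Equiv.swap u v * Equiv.swap s t) * (Equiv.swap u v * Equiv.swap s t) = 1 := by
  rw [mul_assoc, ← mul_assoc (Equiv.swap s t), ← swap_disjoint_comm h2 h3 h4 h5, mul_assoc,
    Equiv.swap_mul_self, mul_one, Equiv.swap_mul_self]

/-- The relations hold with zero sign vector, except for the last constraint of the chain. There the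
sign vector is constant 1, which acts as the sign -1 on vectors of odd weight. That is where the
required -1 comes from, and why only such vectors are used. -/
lemma sol_mul (r : RawCon n) (hr : r.Valid) :
    (comp (comp (sol (r.var 0)) (sol (r.var 1))) (sol (r.var 2))).1 = 1 ∧
    ∀ v : Fin n → Bit, ∑ i, v i = 1 →
      (comp (comp (sol (r.var 0)) (sol (r.var 1))) (sol (r.var 2))).2 ⬝ᵥ v = r.rhs := by
  cases r with
  | aay u v =>
    refine ⟨rfl, fun x _ => ?_⟩
    have : (comp (comp (sol (.a u)) (sol (.a v))) (sol (.y s(u, v)))).2 = 0 := by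
      show (Pi.single u 1 + Pi.single v 1 : Fin n → Bit) + (Pi.single v 1 + Pi.single u 1) = 0
      rw [add_comm (Pi.single v 1)]
      exact bits_add_self _
    exact (congrArg (· ⬝ᵥ x) this).trans (zero_dotProduct _)
  | xyz u v =>
    refine ⟨?_, fun x _ => ?_⟩
    · exact Equiv.swap_mul_self u v
    · have : (comp (comp (sol (.x s(u, v))) (sol (.y s(u, v)))) (sol (.z s(u, v)))).2 = 0 := by
        show edgeInd s(u, v) + (edgeInd s(u, v) + 0) ∘ (edgeSwap s(u, v)).symm = 0
        rw [add_zero, edgeSwap_mk, Equiv.symm_swap, ← edgeSwap_mk, edgeInd_comp_edgeSwap]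
        exact bits_add_self _
      exact (congrArg (· ⬝ᵥ x) this).trans (zero_dotProduct _)
  | xxb u v s t =>
    obtain ⟨h1, h2, h3, h4, h5⟩ := hr
    have hus : u ≠ s := h3.ne
    have hut : u ≠ t := (h3.trans h2).ne
    have e := sol_b hus hut h4 h5
    refine ⟨?_, fun x _ => ?_⟩
    · show (sol (.b s(s(u, v), s(s, t)))).1 * (Equiv.swap s t * Equiv.swap u v) = 1
      rw [e, ← swap_disjoint_comm hus hut h4 h5]
      exact klein_mul_self hus hut h4 h5
    · have : (comp (comp (sol (.x s(u, v))) (sol (.x s(s, t))))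
          (sol (.b s(s(u, v), s(s, t))))).2 = 0 := by
        rw [e]
        show (0 : Fin n → Bit) + (0 + 0 : Fin n → Bit) ∘ _ = 0
        rfl
      exact (congrArg (· ⬝ᵥ x) this).trans (zero_dotProduct _)
  | xzc u v s t =>
    obtain ⟨h1, h2, hus, hut, hvs, hvt⟩ := hr
    have e := sol_c hus hut hvs hvt
    refine ⟨?_, fun x _ => ?_⟩
    · show (sol (.c s(u, v) s(s, t))).1 * (Equiv.swap s t * Equiv.swap u v) = 1
      rw [e, ← swap_disjoint_comm hus hut hvs hvt]
      exact klein_mul_self hus hut hvs hvt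
    · have : (comp (comp (sol (.x s(u, v))) (sol (.z s(s, t))))
          (sol (.c s(u, v) s(s, t)))).2 = 0 := by
        rw [e]
        show (Pi.single s 1 + Pi.single t 1 : Fin n → Bit) +
          (edgeInd s(s, t) + 0) ∘ (Equiv.swap u v * Equiv.swap s t).symm = 0
        have e2 : (edgeInd s(s, t) + 0) ∘ (Equiv.swap u v * Equiv.swap s t).symm =
            Pi.single s 1 + Pi.single t 1 := by
          rw [add_zero]
          show edgeInd s(s, t) ∘ ((Equiv.swap s t).symm ∘ (Equiv.swap u v).symm) = _
          rw [Equiv.symm_swap, Equiv.symm_swap, ← Function.comp_assoc, ← edgeSwap_mk s t,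
            edgeInd_comp_edgeSwap]
          exact ind_comp_swap hus hut hvs hvt
        rw [e2]
        exact bits_add_self _
      exact (congrArg (· ⬝ᵥ x) this).trans (zero_dotProduct _)
  | bbb u v s t =>
    obtain ⟨h1, h2, h3⟩ := hr
    have huv := h1.ne
    have hvs := h2.ne
    have hst := h3.ne
    have hus := (h1.trans h2).ne
    have hvt := (h2.trans h3).ne
    have hut := (h1.trans (h2.trans h3)).ne
    have e1 := sol_b hus hut hvs hvt
    have e2 := sol_b huv.symm hvt hus.symm hst
    have e3 := sol_b hvs.symm hst huv hut
    refine ⟨?_, fun x _ => ?_⟩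
    · show (sol (.b s(s(s, u), s(v, t)))).1 *
        ((sol (.b s(s(v, s), s(u, t)))).1 * (sol (.b s(s(u, v), s(s, t)))).1) = 1
      rw [e1, e2, e3, klein_mul huv hus hut hvs hvt hst]
      exact klein_mul_self hvs.symm hst huv hut
    · have : (comp (comp (sol (.b s(s(u, v), s(s, t)))) (sol (.b s(s(v, s), s(u, t)))))
          (sol (.b s(s(s, u), s(v, t))))).2 = 0 := by
        rw [e1, e2, e3]
        show (0 : Fin n → Bit) + (0 + (0 : Fin n → Bit) ∘ _) ∘ _ = 0
        ext i; simp
      exact (congrArg (· ⬝ᵥ x) this).trans (zero_dotProduct _)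
  | ccc u v s t =>
    obtain ⟨h1, h2, htu, htv, hts⟩ := hr
    have huv := h1.ne
    have hvs := h2.ne
    have hus := (h1.trans h2).ne
    have hst := hts.symm
    have hvt := htv.symm
    have hut := htu.symm
    have e1 := sol_c hus hut hvs hvt
    have e2 := sol_c huv.symm hvt hus.symm hst
    have e3 := sol_c hvs.symm hst huv hut
    refine ⟨?_, fun x _ => ?_⟩
    · show (sol (.c s(s, u) s(v, t))).1 *
        ((sol (.c s(v, s) s(u, t))).1 * (sol (.c s(u, v) s(s, t))).1) = 1
      rw [e1, e2, e3, klein_mul huv hus hut hvs hvt hst]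
      exact klein_mul_self hvs.symm hst huv hut
    · have : (comp (comp (sol (.c s(u, v) s(s, t))) (sol (.c s(v, s) s(u, t))))
          (sol (.c s(s, u) s(v, t)))).2 = 0 := by
        rw [e1, e2, e3]
        ext i
        show (Pi.single v 1 + Pi.single t 1 : Fin n → Bit) i +
          (((Pi.single u 1 + Pi.single t 1 : Fin n → Bit) +
            (Pi.single s 1 + Pi.single t 1 : Fin n → Bit) ∘
              ((Equiv.swap u t).symm ∘ (Equiv.swap v s).symm)) ∘
              ((Equiv.swap v t).symm ∘ (Equiv.swap s u).symm)) i = 0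
        simp only [Equiv.symm_swap, Function.comp_apply, Pi.add_apply, Pi.single_apply,
          Equiv.swap_apply_def]
        by_cases hiu : i = u
        · subst hiu; simp_all [bit_add_self, eq_comm]
        by_cases hiv : i = v
        · subst hiv; simp_all [bit_add_self, eq_comm]
        by_cases his : i = s
        · subst his; simp_all [bit_add_self, eq_comm]
        by_cases hit : i = t
        · subst hit; simp_all [bit_add_self, eq_comm]
        simp_all
      exact (congrArg (· ⬝ᵥ x) this).trans (zero_dotProduct _)
  | chain i =>
    obtain ⟨h1, h2⟩ := hr
    have hn : 0 < n := i.pos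
    set p : Symbol n := if i.1 = 1 then .a ⟨0, i.pos⟩ else .h ⟨i.1 - 1, by omega⟩ with hp
    set q : Symbol n := if i.1 + 2 = n then .a ⟨n - 1, by omega⟩ else .h i with hq
    have ep : sol p = (1, fun m : Fin n => if m.1 < i.1 then 1 else 0) := by
      rw [hp]
      split_ifs with h
      · refine Prod.ext rfl (funext fun m => ?_)
        simp only [sol, Pi.single_apply, Fin.ext_iff, h]
        congr 1
        rw [eq_iff_iff]; omega
      · refine Prod.ext rfl (funext fun m => ?_)
        simp only [sol, Fin.le_def]
        congr 1
        rw [eq_iff_iff]; omega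
    refine ⟨?_, fun x hx => ?_⟩
    · show (sol q).1 * ((sol (.a i)).1 * (sol p).1) = 1
      rw [ep, hq]
      split_ifs <;> rfl
    · have h2 : (comp (comp (sol p) (sol (.a i))) (sol q)).2 =
          if i.1 + 2 = n then (fun _ => 1 : Fin n → Bit) else (0 : Fin n → Bit) := by
        show (sol q).2 + ((sol (.a i)).2 + (sol p).2 ∘ _) ∘ (sol q).1.symm = _
        rw [ep]
        have e1 : (sol q).1 = 1 := by
          rw [hq]
          split_ifs <;> rfl
        rw [e1]
        ext m
        show (sol q).2 m + ((Pi.single i 1 : Fin n → Bit) m + if m.1 < i.1 then 1 else 0) = _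
        rw [hq, Pi.single_apply]
        by_cases h : i.1 + 2 = n
        · rw [if_pos h, if_pos h]
          simp only [sol, Pi.single_apply, Fin.ext_iff]
          rcases lt_trichotomy m.1 i.1 with h' | h' | h'
          · rw [if_neg (by omega), if_neg (by omega), if_pos h', zero_add, zero_add]
          · rw [if_neg (by omega), if_pos h', if_neg (by omega), zero_add, add_zero]
          · rw [if_pos (by omega), if_neg (by omega), if_neg (by omega), zero_add, add_zero]
        · rw [if_neg h, if_neg h]
          simp only [sol, Fin.ext_iff, Fin.le_def, Pi.zero_apply]
          rcases lt_trichotomy m.1 i.1 with h' | h' | h'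
          · rw [if_pos (by omega), if_neg (by omega), if_pos h', zero_add]; exact bit_add_self _
          · rw [if_pos (by omega), if_pos h', if_neg (by omega), add_zero]; exact bit_add_self _
          · rw [if_neg (by omega), if_neg (by omega), if_neg (by omega), zero_add, add_zero]
      refine (congrArg (· ⬝ᵥ x) h2).trans ?_
      simp only [RawCon.rhs]
      split_ifs
      · simpa [dotProduct] using hx
      · exact zero_dotProduct _

/-- A family of 0/1-vectors, invariant under permutations of the coordinates. -/
def family (n : ℕ) (v : Fin n → Bit) : Prop :=
  -- The vectors of odd weight always work, with `n - 1` qubits. For `n = 8` the unit vectors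
  -- already are a permutation-invariant family of `2 ^ 3` vectors, and three qubits suffice.
  if n = 8 then ∃ i, v = Pi.single i 1 else ∑ i, v i = 1

lemma family_sum {v : Fin n → Bit} (h : family n v) : ∑ i, v i = 1 := by
  unfold family at h
  split_ifs at h
  · obtain ⟨i, rfl⟩ := h; simp
  · exact h

lemma family_comp {v : Fin n → Bit} (h : family n v) (π : Equiv.Perm (Fin n)) :
    family n (v ∘ π) := by
  unfold family at h ⊢
  split_ifs at h ⊢
  · obtain ⟨i, rfl⟩ := h
    refine ⟨π.symm i, ?_⟩
    ext m
    simp only [Function.comp_apply, Pi.single_apply, Equiv.eq_symm_apply]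
  · rw [← h]; exact Equiv.sum_comp π v

/-- The vectors of the family. -/
abbrev Vec (n : ℕ) : Type := {v : Fin n → Bit // family n v}

/-- The number of qubits of each player. -/
def width (n : ℕ) : ℕ := if n = 8 then 3 else n - 1

/-- Either there are `8 = 2 ^ 3` unit vectors, or a vector of odd weight is determined by its tail;
so the family indexes the basis states of a register of qubits. -/
lemma exists_vecEquiv (hn : 1 ≤ n) : Nonempty (Vec n ≃ (Fin (width n) → Bit)) := by
  classical
  by_cases h8 : n = 8
  · subst h8
    rw [← Fintype.card_eq]
    have : Fintype.card (Vec 8) = Fintype.card (Fin 8) := by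
      refine (Fintype.card_congr (Equiv.ofBijective
        (fun i : Fin 8 => (⟨Pi.single i 1, ⟨i, rfl⟩⟩ : Vec 8)) ⟨?_, ?_⟩)).symm
      · intro i j h
        have := congrFun (Subtype.ext_iff.1 h) i
        simp only [Pi.single_eq_same, Pi.single_apply] at this
        by_contra hij
        rw [if_neg hij] at this
        exact one_ne_zero this
      · rintro ⟨_, ⟨i, rfl⟩⟩
        exact ⟨i, rfl⟩
    rw [this]
    simp [width]
  · obtain ⟨m, rfl⟩ : ∃ m, n = m + 1 := ⟨n - 1, by omega⟩
    have hw : width (m + 1) = m := by simp [width, h8]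
    rw [hw]
    refine ⟨⟨fun v => Fin.tail v.1, fun u => ⟨Fin.cons (1 + ∑ i, u i) u, ?_⟩, ?_, ?_⟩⟩
    · rw [family, if_neg h8, Fin.sum_univ_succ]
      simp only [Fin.cons_zero, Fin.cons_succ]
      rw [add_assoc, bit_add_self, add_zero]
    · rintro ⟨v, hv⟩
      refine Subtype.ext ?_
      have := family_sum hv
      rw [Fin.sum_univ_succ] at this
      show Fin.cons (1 + ∑ i, Fin.tail v i) (Fin.tail v) = v
      have e : 1 + ∑ i, Fin.tail v i = v 0 := by
        rw [← this, add_assoc]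
        simp only [Fin.tail]
        rw [bit_add_self, add_zero]
      rw [e, Fin.cons_self_tail]
    · intro u
      exact Fin.tail_cons _ _

/-- The signed permutation matrix of `(π, d)`: it maps `v` to `v ∘ π`, with the sign `d ⬝ᵥ v`. -/
def signedPerm (g : Equiv.Perm (Fin n) × (Fin n → Bit)) : Matrix (Vec n) (Vec n) ℂ :=
  Matrix.of fun v v' => if v.1 = v'.1 ∘ g.1 then sgn (g.2 ⬝ᵥ v'.1) else 0

lemma signedPerm_mul [Fintype (Vec n)] (g g' : Equiv.Perm (Fin n) × (Fin n → Bit)) :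
    signedPerm g * signedPerm g' = signedPerm (comp g g') := by
  ext v v'
  rw [Matrix.mul_apply, Finset.sum_eq_single ⟨v'.1 ∘ g'.1, family_comp v'.2 _⟩]
  · simp only [signedPerm, Matrix.of_apply, comp, if_true]
    have : g.2 ⬝ᵥ (v'.1 ∘ g'.1) = (g.2 ∘ g'.1.symm) ⬝ᵥ v'.1 := by
      simp only [dotProduct]
      rw [← Equiv.sum_comp g'.1 fun i => (g.2 ∘ g'.1.symm) i * v'.1 i]
      simp
    rw [add_dotProduct, sgn_add, ite_mul, zero_mul, this, mul_comm]
    rfl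
  · intro v'' _ hne
    simp only [signedPerm, Matrix.of_apply]
    rw [if_neg (fun h => hne (Subtype.ext h)), mul_zero]
  · simp

lemma signedPerm_one [DecidableEq (Vec n)] {g : Equiv.Perm (Fin n) × (Fin n → Bit)} {r : Bit}
    (h1 : g.1 = 1) (h2 : ∀ v : Fin n → Bit, ∑ i, v i = 1 → g.2 ⬝ᵥ v = r) :
    signedPerm g = sgn r • 1 := by
  ext v v'
  simp only [signedPerm, Matrix.of_apply, h1, h2 _ (family_sum v'.2), Matrix.smul_apply,
    Matrix.one_apply, Subtype.ext_iff, smul_eq_mul, mul_ite, mul_one, mul_zero]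
  rfl

/-- Symmetry matters because Bob's half of a maximally entangled state sees transposed operators. It
also gives commutation within a constraint. -/
lemma signedPerm_transpose {g : Equiv.Perm (Fin n) × (Fin n → Bit)} (h1 : g.1 * g.1 = 1)
    (h2 : g.2 ∘ g.1 = g.2) : (signedPerm g)ᵀ = signedPerm g := by
  have hinv : ∀ v : Fin n → Bit, (v ∘ g.1) ∘ g.1 = v := fun v => by
    ext i
    have := congrArg (fun π : Equiv.Perm (Fin n) => π i) h1
    simp only [Equiv.Perm.mul_apply, Equiv.Perm.one_apply] at this
    simp only [Function.comp_apply, this]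
  ext v v'
  simp only [signedPerm, Matrix.of_apply, Matrix.transpose_apply]
  by_cases h : v.1 = v'.1 ∘ g.1
  · rw [if_pos h, if_pos (by rw [h, hinv]), h]
    congr 1
    nth_rw 1 [← h2]
    simp only [dotProduct, Function.comp_apply]
    exact Equiv.sum_comp g.1 fun i => g.2 i * v'.1 i
  · rw [if_neg h, if_neg]
    intro h'
    exact h (by rw [h', hinv])

lemma signedPerm_star (g : Equiv.Perm (Fin n) × (Fin n → Bit)) :
    (signedPerm g)ᴴ = (signedPerm g)ᵀ := by
  ext v v'
  simp only [signedPerm, Matrix.of_apply, Matrix.transpose_apply, Matrix.conjTranspose_apply]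
  split_ifs
  · exact star_sgn _
  · simp

/-- The constraint system has a solution by real symmetric operators. -/
theorem exists_operators (hn : 1 ≤ n) : ∃ O : Symbol n → Operator (Fin (width n)),
    (∀ s, (O s)ᵀ = O s ∧ (O s)ᴴ = O s ∧ O s * O s = 1) ∧
    ∀ α : Constraint n, O (α.1.var 0) * O (α.1.var 1) * O (α.1.var 2) = sgn α.1.rhs • 1 := by
  classical
  obtain ⟨ξ⟩ := exists_vecEquiv hn
  refine ⟨fun s => (signedPerm (sol s)).submatrix ξ.symm ξ.symm, fun s => ?_, fun α => ?_⟩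
  · obtain ⟨h1, h2⟩ := sol_involutive s
    have ht := signedPerm_transpose h1 h2
    refine ⟨?_, ?_, ?_⟩
    · rw [Matrix.transpose_submatrix, ht]
    · rw [Matrix.conjTranspose_submatrix, signedPerm_star, ht]
    · rw [Matrix.submatrix_mul_equiv, signedPerm_mul, signedPerm_one (r := 0) h1, sgn_zero,
        one_smul, Matrix.submatrix_one_equiv]
      intro v _
      have hs : (sol s).1.symm = (sol s).1  := inv_eq_of_mul_eq_one_left h1
      show ((sol s).2 + (sol s).2 ∘ (sol s).1.symm) ⬝ᵥ v = 0
      rw [hs, h2, bits_add_self, zero_dotProduct]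
  · obtain ⟨h1, h2⟩ := sol_mul α.1 α.2
    rw [Matrix.submatrix_mul_equiv, Matrix.submatrix_mul_equiv, signedPerm_mul, signedPerm_mul,
      signedPerm_one h1 h2]
    ext i j
    simp [Matrix.one_apply]

end Solution

end
end MagicBCS

open scoped Kronecker
namespace MagicBCS
noncomputable section
set_option linter.unusedSectionVars false
set_option linter.unusedSimpArgs false

/-! ### Simultaneous diagonalization of commuting involutions -/

section
variable {m : Type} [Fintype m] [DecidableEq m]

/-- The four pairs of signs give the distinct values ±1 ± 2 of `M = O₀ + 2 O₁`, so both operators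
are polynomials in `M`; explicitly `M³ - 7 M = 6 O₀`. A single eigenbasis of the Hermitian `M`
therefore diagonalizes both, and the eigenvalues are signs since the operators are involutions. -/
lemma exists_diagonalize {O₀ O₁ : Matrix m m ℂ} (h0 : O₀ᴴ = O₀) (h1 : O₁ᴴ = O₁)
    (s0 : O₀ * O₀ = 1) (s1 : O₁ * O₁ = 1) (hc : O₀ * O₁ = O₁ * O₀) :
    ∃ (V : Matrix.unitaryGroup m ℂ) (a₀ a₁ : m → Bit),
      V.1 * O₀ = Matrix.diagonal (fun i => sgn (a₀ i)) * V.1 ∧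
      V.1 * O₁ = Matrix.diagonal (fun i => sgn (a₁ i)) * V.1 := by
  set M := O₀ + (2 : ℂ) • O₁ with hM
  have hMh : M.IsHermitian := by
    show (O₀ + (2 : ℂ) • O₁)ᴴ = _
    rw [Matrix.conjTranspose_add, Matrix.conjTranspose_smul, h0, h1]
    simp [hM]
  have hM3 : (1 / 6 : ℂ) • (M * M * M - (7 : ℂ) • M) = O₀ := by
    have e1 : O₀ * O₁ * O₀ = O₁ := by rw [hc, mul_assoc, s0, mul_one]
    have e2 : O₀ * O₁ * O₁ = O₀ := by rw [mul_assoc, s1, mul_one]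
    have e : M * M = (5 : ℂ) • 1 + (4 : ℂ) • (O₀ * O₁) := by
      rw [hM]
      simp only [add_mul, mul_add, Matrix.smul_mul, Matrix.mul_smul, s0, s1, ← hc, smul_smul]
      module
    rw [e, hM]
    simp only [add_mul, mul_add, Matrix.smul_mul, Matrix.mul_smul, e1, e2, one_mul, smul_smul]
    module
  have hspec := hMh.spectral_theorem
  set W := hMh.eigenvectorUnitary
  set d : m → ℂ := RCLike.ofReal ∘ hMh.eigenvalues
  have hV : (star W).1 * M = Matrix.diagonal d * (star W).1 := by
    rw [hspec, Unitary.conjStarAlgAut_apply, ← mul_assoc, ← mul_assoc]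
    rw [show (star W).1 * W.1 = 1 from Unitary.coe_star_mul_self W, one_mul]
    rfl
  set V := (star W).1 with hVdef
  have hVu : V * Vᴴ = 1 := Matrix.mem_unitaryGroup_iff.1 (star W).2
  have key : ∀ O : Matrix m m ℂ, O * O = 1 → ∀ f : m → ℂ, V * O = Matrix.diagonal f * V →
      ∃ a : m → Bit, V * O = Matrix.diagonal (fun i => sgn (a i)) * V := by
    intro O hO f hf
    have hf2 : Matrix.diagonal f * Matrix.diagonal f = 1 := by
      calc Matrix.diagonal f * Matrix.diagonal f
          = Matrix.diagonal f * (Matrix.diagonal f * V) * Vᴴ := by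
            rw [mul_assoc, mul_assoc, hVu, mul_one]
        _ = V * (O * O) * Vᴴ := by rw [← hf, ← mul_assoc, ← hf, mul_assoc V]
        _ = 1 := by rw [hO, mul_one, hVu]
    rw [Matrix.diagonal_mul_diagonal] at hf2
    have hf3 : ∀ i, f i = 1 ∨ f i = -1 := by
      intro i
      have := congrFun (congrFun hf2 i) i
      rw [Matrix.diagonal_apply_eq, Matrix.one_apply_eq] at this
      exact mul_self_eq_one_iff.1 this
    classical
    refine ⟨fun i => if f i = 1 then 0 else 1, ?_⟩
    rw [hf]
    congr 2
    ext i
    rcases hf3 i with h | h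
    · simp [h]
    · have hne : f i ≠ 1 := by rw [h]; norm_num
      simp only [if_neg hne]
      simp [h]
  have e0 : V * O₀ = Matrix.diagonal (fun i => (1 / 6 : ℂ) * (d i * d i * d i - 7 * d i)) * V := by
    have e3 : V * (M * M * M) = Matrix.diagonal (fun i => d i * d i * d i) * V := by
      rw [← mul_assoc, ← mul_assoc, hV, mul_assoc _ V, hV, mul_assoc, mul_assoc, hV, ← mul_assoc,
        ← mul_assoc, Matrix.diagonal_mul_diagonal, Matrix.diagonal_mul_diagonal]
    rw [← hM3, Matrix.mul_smul, Matrix.mul_sub, e3, Matrix.mul_smul, hV]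
    ext i j
    simp only [Matrix.smul_apply, Matrix.sub_apply, Matrix.diagonal_mul, smul_eq_mul]
    ring
  have e1 : V * O₁ = Matrix.diagonal (fun i => (1 / 2 : ℂ) *
      (d i - (1 / 6 : ℂ) * (d i * d i * d i - 7 * d i))) * V := by
    have : O₁ = (1 / 2 : ℂ) • (M - O₀) := by rw [hM]; module
    rw [this, Matrix.mul_smul, Matrix.mul_sub, hV, e0]
    ext i j
    simp only [Matrix.smul_apply, Matrix.sub_apply, Matrix.diagonal_mul, smul_eq_mul]
    ring
  obtain ⟨a₀, ha₀⟩ := key O₀ s0 _ e0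
  obtain ⟨a₁, ha₁⟩ := key O₁ s1 _ e1
  exact ⟨star W, a₀, a₁, ha₀, ha₁⟩

end

/-! ### Layers of controlled unitaries and of measurements -/

section
variable {C Q : Type} [Fintype C] [DecidableEq C] [Fintype Q] [DecidableEq Q]
variable {κ κ' : Type} [Fintype κ] [DecidableEq κ] [Fintype κ'] [DecidableEq κ']

/-- The action of an operator on the qubits `e k`. -/
def actOn (e : κ → Q) (M : Operator κ) (ψ : (Q → Bit) → ℂ) : (Q → Bit) → ℂ :=
  fun i => ∑ a : κ → Bit, M (i ∘ e) a * ψ (Function.extend e a i)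

lemma actOn_one (e : κ ↪ Q) (ψ : (Q → Bit) → ℂ) : actOn e 1 ψ = ψ := by
  ext i
  rw [actOn, Finset.sum_eq_single (i ∘ e)]
  · rw [Matrix.one_apply_eq, one_mul]
    congr 1
    ext q
    by_cases h : ∃ k, e k = q
    · obtain ⟨k, rfl⟩ := h; rw [e.injective.extend_apply]; rfl
    · rw [Function.extend_apply' _ _ _ h]
  · intro a _ ha; rw [Matrix.one_apply_ne ha.symm, zero_mul]
  · simp

/-- The wires as a finite set. -/
def wireEquiv (e : κ ↪ Q) : κ ≃ {q // q ∈ Finset.univ.map e} :=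
  Equiv.ofBijective (fun k => ⟨e k, Finset.mem_map_of_mem _ (Finset.mem_univ k)⟩)
    ⟨fun _ _ h => e.injective (Subtype.ext_iff.1 h), fun ⟨q, hq⟩ => by
      obtain ⟨k, -, rfl⟩ := Finset.mem_map.1 hq
      exact ⟨k, rfl⟩⟩

/-- A unitary on renamed qubits. -/
def renameUnitary {κ₂ : Type} [Fintype κ₂] [DecidableEq κ₂] (f : κ ≃ κ₂)
    (U : Matrix.unitaryGroup (κ → Bit) ℂ) : Matrix.unitaryGroup (κ₂ → Bit) ℂ :=
  ⟨U.1.submatrix (Equiv.arrowCongr f.symm (Equiv.refl Bit)) (Equiv.arrowCongr f.symm (Equiv.refl Bit)),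
    by
      rw [Matrix.mem_unitaryGroup_iff, Matrix.star_eq_conjTranspose, Matrix.conjTranspose_submatrix,
        Matrix.submatrix_mul_equiv, ← Matrix.star_eq_conjTranspose,
        Matrix.mem_unitaryGroup_iff.1 U.2, Matrix.submatrix_one_equiv]⟩

lemma liftOperator_rename (e : κ ↪ Q) (U : Matrix.unitaryGroup (κ → Bit) ℂ) (ψ : (Q → Bit) → ℂ) :
    liftOperator (Finset.univ.map e) (renameUnitary (wireEquiv e) U).1 *ᵥ ψ = actOn e U.1 ψ := by
  ext i
  rw [liftOperator_mulVec, actOn]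
  refine Fintype.sum_equiv (Equiv.arrowCongr (wireEquiv e).symm (Equiv.refl Bit)) _ _ fun a => ?_
  congr 2
  ext q
  by_cases h : ∃ k, e k = q
  · obtain ⟨k, rfl⟩ := h
    rw [e.injective.extend_apply, glue, dif_pos (Finset.mem_map_of_mem _ (Finset.mem_univ k))]
    rfl
  · rw [Function.extend_apply' _ _ _ h, glue, dif_neg]
    intro h'
    obtain ⟨k, -, hk⟩ := Finset.mem_map.1 h'
    exact h ⟨k, hk⟩

/-- The gate that applies to the qubits `e k` a unitary that is controlled by the bits `d k`. -/
def unitaryGate (d : κ' ↪ C) (e : κ ↪ Q)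
    (U : (κ' → Bit) → Matrix.unitaryGroup (κ → Bit) ℂ) : Gate C Q :=
  ⟨Finset.univ.map d, Finset.univ.map e,
    [.unitary fun c => renameUnitary (wireEquiv e) (U fun k => c (wireEquiv d k))]⟩

lemma unitaryGate_step {d : κ' ↪ C} {e : κ ↪ Q}
    {U : (κ' → Bit) → Matrix.unitaryGroup (κ → Bit) ℂ} {c c' : C → Bit} {ψ ψ' : (Q → Bit) → ℂ}
    (h : opsStep (unitaryGate d e U).bits (unitaryGate d e U).qubits (unitaryGate d e U).ops c ψ c' ψ') :
    c' = c ∧ ψ' = actOn e (U (c ∘ d)).1 ψ := by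
  obtain ⟨c₁, ψ₁, ⟨rfl, rfl⟩, rfl, rfl⟩ := h
  exact ⟨rfl, liftOperator_rename e _ ψ⟩

variable {ι : Type} [Fintype ι] [DecidableEq ι]

/-- The `i`-th row of a family of wires. -/
def row {α β γ : Type} (e : α × β ↪ γ) (i : α) : β ↪ γ :=
  ⟨fun k => e (i, k), fun _ _ h => (Prod.ext_iff.1 (e.injective h)).2⟩

lemma disjoint_row {α β γ : Type} [Fintype β] (e : α × β ↪ γ) {i j : α} (h : i ≠ j) :
    Disjoint (Finset.univ.map (row e i)) (Finset.univ.map (row e j)) := by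
  rw [Finset.disjoint_left]
  intro x h1 h2
  obtain ⟨k, -, rfl⟩ := Finset.mem_map.1 h1
  obtain ⟨k', -, h'⟩ := Finset.mem_map.1 h2
  exact h (Prod.ext_iff.1 (e.injective h')).1.symm

/-- A step of controlled unitaries. -/
def unitaryLayer (d : ι × κ' ↪ C) (e : ι × κ ↪ Q)
    (U : ι → (κ' → Bit) → Matrix.unitaryGroup (κ → Bit) ℂ) : Layer C Q where
  gates := (Finset.univ : Finset ι).toList.map fun i => unitaryGate (row d i) (row e i) (U i)
  disjoint := by
    rw [List.pairwise_map]
    exact (Finset.nodup_toList _).imp fun {i j} hij => ⟨disjoint_row d hij, disjoint_row e hij⟩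

/-- The order of the gates in the layer is an arbitrary enumeration, so the invariant is indexed by
the set of rows already processed. -/
lemma unitaryLayer_step {d : ι × κ' ↪ C} {e : ι × κ ↪ Q}
    {U : ι → (κ' → Bit) → Matrix.unitaryGroup (κ → Bit) ℂ} {c c' : C → Bit}
    {ψ ψ' : (Q → Bit) → ℂ} (h : gatesStep (unitaryLayer d e U).gates c ψ c' ψ')
    (I : Finset ι → ((Q → Bit) → ℂ) → Prop) (h0 : I ∅ ψ)
    (hI : ∀ S i φ, i ∉ S → I S φ → I (insert i S) (actOn (row e i) (U i (c ∘ row d i)).1 φ)) :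
    c' = c ∧ I Finset.univ ψ' := by
  have key : ∀ (l : List ι) (S : Finset ι) (ψ : (Q → Bit) → ℂ), l.Nodup → (∀ i ∈ l, i ∉ S) →
      I S ψ → gatesStep (l.map fun i => unitaryGate (row d i) (row e i) (U i)) c ψ c' ψ' →
      c' = c ∧ I (S ∪ l.toFinset) ψ' := by
    intro l
    induction l with
    | nil =>
      rintro S ψ - - h ⟨rfl, rfl⟩
      simpa using h
    | cons i l ih =>
      rintro S ψ hl hS hψ ⟨c₁, ψ₁, h1, h2⟩
      obtain ⟨rfl, rfl⟩ := unitaryGate_step h1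
      obtain ⟨hil, hl⟩ := List.nodup_cons.1 hl
      have := ih (insert i S) _ hl (fun j hj => by
        rw [Finset.mem_insert, not_or]
        exact ⟨fun h => hil (h ▸ hj), hS j (List.mem_cons_of_mem _ hj)⟩)
        (hI S i ψ (hS i List.mem_cons_self) hψ) h2
      rwa [List.toFinset_cons, Finset.union_insert, ← Finset.insert_union]
  have := key _ ∅ ψ (Finset.nodup_toList _) (by simp) h0 h
  simpa using this

/-- If only one of the unitaries is nontrivial. -/
lemma unitaryLayer_single {d : ι × κ' ↪ C} {e : ι × κ ↪ Q}
    {U : ι → (κ' → Bit) → Matrix.unitaryGroup (κ → Bit) ℂ} {c c' : C → Bit}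
    {ψ ψ' : (Q → Bit) → ℂ} (h : gatesStep (unitaryLayer d e U).gates c ψ c' ψ') (i₀ : ι)
    (h1 : ∀ i, i ≠ i₀ → U i (c ∘ row d i) = 1) :
    c' = c ∧ ψ' = actOn (row e i₀) (U i₀ (c ∘ row d i₀)).1 ψ := by
  have := unitaryLayer_step h
    (fun S φ => φ = if i₀ ∈ S then actOn (row e i₀) (U i₀ (c ∘ row d i₀)).1 ψ else ψ) (by simp)
    (by
      rintro S i φ hi rfl
      by_cases h : i = i₀
      · subst h; simp [hi]
      · rw [h1 i h]
        simp only [Finset.mem_insert, Ne.symm h, false_or]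
        exact actOn_one _ _)
  simpa using this

/-- The layer has no effect if all unitaries fix the state. -/
lemma unitaryLayer_fixed {d : ι × κ' ↪ C} {e : ι × κ ↪ Q}
    {U : ι → (κ' → Bit) → Matrix.unitaryGroup (κ → Bit) ℂ} {c c' : C → Bit}
    {ψ ψ' : (Q → Bit) → ℂ} (h : gatesStep (unitaryLayer d e U).gates c ψ c' ψ')
    (h1 : ∀ i, actOn (row e i) (U i (c ∘ row d i)).1 ψ = ψ) : c' = c ∧ ψ' = ψ :=
  unitaryLayer_step h (fun _ φ => φ = ψ) rfl (by rintro S i φ - rfl; exact h1 i)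

/-! ### Pauli stabilizers of a state -/

/-- The state is an eigenvector of `pauliXZ x z`. -/
def Stab (ψ : (Q → Bit) → ℂ) (x z : Q → Bit) (g : Bit) : Prop :=
  ∀ i, ψ (i + x) = sgn (g + z ⬝ᵥ i) * ψ i

/-- The operator maps the Pauli operator `(x, z)` to `(x', z')`, with the sign `γ`. -/
def Transforms (U : Operator κ) (x z x' z' : κ → Bit) (γ : Bit) : Prop :=
  ∀ i a, U (i + x') (a + x) * sgn (z ⬝ᵥ a) = sgn (γ + z' ⬝ᵥ i) * U i a

lemma transforms_one (x z : κ → Bit) : Transforms (1 : Operator κ) x z x z 0 := by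
  intro i a
  by_cases h : i = a
  · subst h; simp
  · rw [Matrix.one_apply_ne h, Matrix.one_apply_ne (fun h' => h (add_right_cancel h'))]; simp

lemma extend_zero_dotProduct (e : κ ↪ Q) (z : Q → Bit) (a : κ → Bit) (i : Q → Bit) :
    z ⬝ᵥ Function.extend e a i = (z ∘ e) ⬝ᵥ a + Function.extend e 0 z ⬝ᵥ i := by
  have h : (z ∘ e) ⬝ᵥ a = z ⬝ᵥ Function.extend e a i + Function.extend e 0 z ⬝ᵥ i := by
    simp only [dotProduct]
    rw [← Finset.sum_add_distrib]
    refine Fintype.sum_of_injective e e.injective _ _ ?_ ?_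
    · intro q hq
      have hq : ¬ ∃ k, e k = q := hq
      rw [Function.extend_apply' _ _ _ hq, Function.extend_apply' _ _ _ hq, bit_add_self]
    · intro k
      simp [e.injective.extend_apply]
  rw [h, add_assoc, bit_add_self, add_zero]

/-- Reindexing the sum over the input string by the shift `x ∘ e` moves the row and the column of
`U` together, and `Transforms` supplies the sign on the register. Off the register the Pauli
operator is unchanged. -/
lemma Stab.actOn {ψ : (Q → Bit) → ℂ} {x z x' z' : Q → Bit} {g γ : Bit} (h : Stab ψ x z g)
    (e : κ ↪ Q) {U : Operator κ} (hU : Transforms U (x ∘ e) (z ∘ e) (x' ∘ e) (z' ∘ e) γ)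
    (hoff : ∀ q, (∀ k, e k ≠ q) → x' q = x q ∧ z' q = z q) :
    Stab (actOn e U ψ) x' z' (g + γ) := by
  intro i
  have hz : Function.extend e 0 z' = Function.extend e 0 z := by
    ext q
    by_cases hq : ∃ k, e k = q
    · obtain ⟨k, rfl⟩ := hq
      rw [e.injective.extend_apply, e.injective.extend_apply]
    · rw [Function.extend_apply' _ _ _ hq, Function.extend_apply' _ _ _ hq]
      exact (hoff q fun k hk => hq ⟨k, hk⟩).2
  have hzi : z' ⬝ᵥ i = (z' ∘ e) ⬝ᵥ (i ∘ e) + Function.extend e 0 z ⬝ᵥ i := by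
    rw [← hz, ← extend_zero_dotProduct]
    congr 1
    ext q
    by_cases hq : ∃ k, e k = q
    · obtain ⟨k, rfl⟩ := hq; rw [e.injective.extend_apply]; rfl
    · rw [Function.extend_apply' _ _ _ hq]
  simp only [MagicBCS.actOn]
  rw [← Equiv.sum_comp (Equiv.addRight (x ∘ e)), Finset.mul_sum]
  refine Finset.sum_congr rfl fun a _ => ?_
  have he : Function.extend e (a + x ∘ e) (i + x') = Function.extend e a i + x := by
    ext q
    by_cases hq : ∃ k, e k = q
    · obtain ⟨k, rfl⟩ := hq
      simp [e.injective.extend_apply]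
    · rw [Pi.add_apply, Function.extend_apply' _ _ _ hq, Function.extend_apply' _ _ _ hq,
        Pi.add_apply, (hoff q fun k hk => hq ⟨k, hk⟩).1]
  have hie : (i + x') ∘ e = i ∘ e + x' ∘ e := rfl
  simp only [Equiv.coe_addRight]
  rw [he, h, extend_zero_dotProduct, hie, hzi]
  have := hU (i ∘ e) a
  simp only [sgn_add] at this ⊢
  linear_combination sgn g * sgn (Function.extend e 0 z ⬝ᵥ i) *
    ψ (Function.extend e a i) * this

lemma Stab.unitaryLayer {d : ι × κ' ↪ C} {e : ι × κ ↪ Q}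
    {U : ι → (κ' → Bit) → Matrix.unitaryGroup (κ → Bit) ℂ} {c c' : C → Bit}
    {ψ ψ' : (Q → Bit) → ℂ} {x z : Q → Bit} {g : Bit} (hψ : Stab ψ x z g)
    (h : gatesStep (unitaryLayer d e U).gates c ψ c' ψ') (x' z' : Q → Bit) (γ : ι → Bit)
    (hU : ∀ i, Transforms (U i (c ∘ row d i)).1 (x ∘ row e i) (z ∘ row e i) (x' ∘ row e i)
      (z' ∘ row e i) (γ i))
    (hoff : ∀ q, (∀ p, e p ≠ q) → x' q = x q ∧ z' q = z q) :
    Stab ψ' x' z' (g + ∑ i, γ i) := by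
  classical
  -- In the course of the layer the rows in `S` already carry the new labels, all other qubits the
  -- old ones.
  let mix (S : Finset ι) (f f' : Q → Bit) : Q → Bit := fun q =>
    if ∃ i ∈ S, ∃ k, e (i, k) = q then f' q else f q
  have hmix : ∀ S f f' i k, mix S f f' (e (i, k)) = if i ∈ S then f' (e (i, k)) else f (e (i, k)) := by
    intro S f f' i k
    simp only [mix]
    congr 1
    rw [eq_iff_iff]
    constructor
    · rintro ⟨j, hj, k', h⟩
      have hij : j = i := (Prod.ext_iff.1 (e.injective h)).1
      exact hij ▸ hj
    · exact fun h => ⟨i, h, k, rfl⟩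
  have := (unitaryLayer_step h
    (fun S φ => Stab φ (mix S x x') (mix S z z') (g + ∑ i ∈ S, γ i)) (by simpa [mix] using hψ)
    (by
      intro S i φ hi hφ
      rw [Finset.sum_insert hi, add_comm (γ i), ← add_assoc]
      have r0 : ∀ f f', mix S f f' ∘ row e i = f ∘ row e i := by
        intro f f'
        ext k
        exact (hmix S f f' i k).trans (if_neg hi)
      have r1 : ∀ f f', mix (insert i S) f f' ∘ row e i = f' ∘ row e i := by
        intro f f'
        ext k
        exact (hmix _ f f' i k).trans (if_pos (Finset.mem_insert_self _ _))
      refine hφ.actOn (row e i) ?_ ?_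
      · rw [r0, r0, r1, r1]; exact hU i
      · intro q hq
        have : (∃ j ∈ insert i S, ∃ k, e (j, k) = q) ↔ ∃ j ∈ S, ∃ k, e (j, k) = q := by
          constructor
          · rintro ⟨j, hj, k, hk⟩
            rcases Finset.mem_insert.1 hj with rfl | hj
            · exact absurd hk (hq k)
            · exact ⟨j, hj, k, hk⟩
          · rintro ⟨j, hj, k, hk⟩
            exact ⟨j, Finset.mem_insert_of_mem hj, k, hk⟩
        simp only [mix, this, and_self])).2
  have e1 : ∀ f f' : Q → Bit, (∀ q, (∀ p, e p ≠ q) → f' q = f q) → mix Finset.univ f f' = f' := by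
    intro f f' h
    ext q
    simp only [mix, Finset.mem_univ, true_and]
    split_ifs with hq
    · rfl
    · refine (h q fun p hp => hq ⟨p.1, p.2, hp⟩).symm
  rwa [e1 _ _ fun q hq => (hoff q hq).1, e1 _ _ fun q hq => (hoff q hq).2] at this

lemma stab_ket0 (z : Q → Bit) : Stab (ket0 : (Q → Bit) → ℂ) 0 z 0 := by
  intro i
  rw [add_zero, zero_add, ket0, Pi.single_apply]
  split_ifs with h
  · subst h; simp
  · simp

lemma actOn_ket0 (e : κ ↪ Q) (M : Operator κ) (h : ∀ a, M a 0 = if a = 0 then 1 else 0) :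
    actOn e M (ket0 : (Q → Bit) → ℂ) = ket0 := by
  ext i
  rw [actOn, Finset.sum_eq_single 0]
  · rw [h, ket0, Pi.single_apply, Pi.single_apply]
    by_cases hi : i = 0
    · subst hi
      have : Function.extend e (0 : κ → Bit) (0 : Q → Bit) = 0 := by
        ext q
        by_cases hq : ∃ k, e k = q
        · obtain ⟨k, rfl⟩ := hq; rw [e.injective.extend_apply]; rfl
        · rw [Function.extend_apply' _ _ _ hq]
      simp [this]
    · rw [if_neg hi]
      by_cases hie : i ∘ e = 0
      · have hne : ¬ Function.extend e (0 : κ → Bit) i = 0 := ?_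
        rw [if_neg hne, mul_zero]
        intro h'
        apply hi
        ext q
        by_cases hq : ∃ k, e k = q
        · obtain ⟨k, rfl⟩ := hq; exact congrFun hie k
        · have := congrFun h' q
          rwa [Function.extend_apply' _ _ _ hq] at this
      · rw [if_neg hie, zero_mul]
  · intro a _ ha
    rw [ket0, Pi.single_apply, if_neg, mul_zero]
    intro h'
    apply ha
    ext k
    have := congrFun h' (e k)
    rwa [e.injective.extend_apply] at this
  · simp

/-- A step of measurements of the qubits `q i`, with outcomes in the bits `t i`. -/
def measureLayer (q : ι ↪ Q) (t : ι ↪ C) : Layer C Q where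
  gates := (Finset.univ : Finset ι).toList.map fun i =>
    ⟨{t i}, {q i}, [.measure ⟨q i, Finset.mem_singleton_self _⟩ ⟨t i, Finset.mem_singleton_self _⟩]⟩
  disjoint := by
    rw [List.pairwise_map]
    exact (Finset.nodup_toList _).imp fun {i j} hij => by simpa using hij

lemma measureLayer_step {q : ι ↪ Q} {t : ι ↪ C} {c c' : C → Bit} {ψ ψ' : (Q → Bit) → ℂ}
    (h : gatesStep (measureLayer q t).gates c ψ c' ψ') :
    (∀ s, (∀ i, s ≠ t i) → c' s = c s) ∧
      ∀ v, ψ' v = if ∀ i, v (q i) = c' (t i) then ψ v else 0 := by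
  have key : ∀ (l : List ι), l.Nodup → ∀ (c : C → Bit) (ψ : (Q → Bit) → ℂ),
      gatesStep (l.map fun i => (⟨{t i}, {q i}, [.measure ⟨q i, Finset.mem_singleton_self _⟩
        ⟨t i, Finset.mem_singleton_self _⟩]⟩ : Gate C Q)) c ψ c' ψ' →
      (∀ s, (∀ i ∈ l, s ≠ t i) → c' s = c s) ∧
      ∀ v, ψ' v = if ∀ i ∈ l, v (q i) = c' (t i) then ψ v else 0 := by
    intro l
    induction l with
    | nil =>
      rintro - c ψ ⟨rfl, rfl⟩
      simp
    | cons i l ih =>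
      rintro hl c ψ ⟨c₁, ψ₁, ⟨c₂, ψ₂, ⟨b, rfl, rfl⟩, rfl, rfl⟩, h2⟩
      obtain ⟨hil, hl⟩ := List.nodup_cons.1 hl
      obtain ⟨h3, h4⟩ := ih hl _ _ h2
      have hb : c' (t i) = b := by
        rw [h3 (t i) fun j hj h => hil (t.injective h ▸ hj)]
        simp
      refine ⟨fun s hs => ?_, fun v => ?_⟩
      · rw [h3 s fun j hj => hs j (List.mem_cons_of_mem _ hj)]
        exact Function.update_of_ne (hs i List.mem_cons_self) _ _
      · rw [h4, basisProjector_mulVec]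
        simp only [List.mem_cons, forall_eq_or_imp, hb]
        split_ifs <;> simp_all
  have := key _ (Finset.nodup_toList _) c ψ h
  simpa using this

/-- As `x` vanishes on the measured qubits, the Pauli operator commutes with the measurements. Its
`Z` factors on these qubits take the values of the outcomes and move into the sign. -/
lemma Stab.measureLayer {q : ι ↪ Q} {t : ι ↪ C} {c c' : C → Bit} {ψ ψ' : (Q → Bit) → ℂ}
    {x z : Q → Bit} {g : Bit} (hψ : Stab ψ x z g)
    (h : gatesStep (MagicBCS.measureLayer q t).gates c ψ c' ψ') (z' : Q → Bit)
    (hx : ∀ i, x (q i) = 0) (hz : ∀ i, z' (q i) = 0) (hz' : ∀ s, (∀ i, q i ≠ s) → z' s = z s) :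
    Stab ψ' x z' (g + ∑ i, z (q i) * c' (t i)) := by
  obtain ⟨-, h⟩ := measureLayer_step h
  intro v
  rw [h, h]
  by_cases hv : ∀ i, v (q i) = c' (t i)
  · rw [if_pos hv, if_pos (fun i => by rw [Pi.add_apply, hx, add_zero, hv]), hψ]
    have : ∑ i, z (q i) * c' (t i) = z ⬝ᵥ v + z' ⬝ᵥ v := by
      simp only [dotProduct]
      rw [← Finset.sum_add_distrib]
      refine Fintype.sum_of_injective q q.injective _ _ ?_ ?_
      · intro s hs
        rw [hz' s fun i hi => hs ⟨i, hi⟩, bit_add_self]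
      · intro i
        simp only [hz, hv, zero_mul, add_zero]
    rw [this, ← add_assoc, add_assoc, bit_add_self, add_zero]
  · rw [if_neg hv, if_neg, mul_zero]
    intro h'
    apply hv
    intro i
    have := h' i
    rwa [Pi.add_apply, hx, add_zero] at this

end

end
end MagicBCS

open scoped Kronecker
namespace MagicBCS
noncomputable section
set_option linter.unusedSectionVars false
set_option linter.unusedSimpArgs false

/-! ### The gates of the device -/

section
variable {κ : Type} [Fintype κ] [DecidableEq κ]

lemma norm_sq_inv_sqrt_two_pow (m : ℕ) :
    ((((Real.sqrt 2)⁻¹ ^ m : ℝ) : ℂ)) * (((Real.sqrt 2)⁻¹ ^ m : ℝ) : ℂ) * (2 : ℂ) ^ m = 1 := by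
  have : ((Real.sqrt 2)⁻¹ ^ m : ℝ) * ((Real.sqrt 2)⁻¹ ^ m : ℝ) * 2 ^ m = 1 := by
    rw [← mul_pow, ← mul_pow, ← mul_inv, Real.mul_self_sqrt (by norm_num)]
    norm_num
  exact_mod_cast this

lemma sum_sgn_dotProduct (z : κ → Bit) :
    ∑ a : κ → Bit, sgn (z ⬝ᵥ a) = if z = 0 then (2 : ℂ) ^ Fintype.card κ else 0 := by
  split_ifs with h
  · subst h; simp [ZMod.card]
  · have := pauliXZ_trace (x := (0 : κ → Bit)) (Or.inr h)
    rw [Matrix.trace] at this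
    rw [← this]
    refine Finset.sum_congr rfl fun a _ => ?_
    rw [Matrix.diag_apply, pauliXZ_apply, add_zero, if_pos rfl]

/-- The Hadamard transform of several qubits. -/
def hadamard (κ : Type) [Fintype κ] [DecidableEq κ] : Matrix.unitaryGroup (κ → Bit) ℂ :=
  ⟨Matrix.of fun i a => (((Real.sqrt 2)⁻¹ ^ Fintype.card κ : ℝ) : ℂ) * sgn (i ⬝ᵥ a), by
    rw [Matrix.mem_unitaryGroup_iff]
    ext i j
    rw [Matrix.mul_apply]
    have e : ∀ a, (((Real.sqrt 2)⁻¹ ^ Fintype.card κ : ℝ) : ℂ) * sgn (i ⬝ᵥ a) *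
        star ((((Real.sqrt 2)⁻¹ ^ Fintype.card κ : ℝ) : ℂ) * sgn (j ⬝ᵥ a)) =
        (((Real.sqrt 2)⁻¹ ^ Fintype.card κ : ℝ) : ℂ) *
        (((Real.sqrt 2)⁻¹ ^ Fintype.card κ : ℝ) : ℂ) * sgn ((i + j) ⬝ᵥ a) := by
      intro a
      rw [star_mul', add_dotProduct, sgn_add]
      have h1 : star (sgn (j ⬝ᵥ a)) = sgn (j ⬝ᵥ a) := by simp [sgn]
      have h2 : ∀ r : ℝ, star (r : ℂ) = r := Complex.conj_ofReal
      rw [h1, h2]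
      ring
    simp only [Matrix.of_apply, Matrix.star_apply, e]
    rw [← Finset.mul_sum, sum_sgn_dotProduct]
    by_cases h : i = j
    · subst h
      have : i + i = 0 := funext fun k => bit_add_self _
      rw [if_pos this, norm_sq_inv_sqrt_two_pow, Matrix.one_apply_eq]
    · rw [if_neg, Matrix.one_apply_ne h, mul_zero]
      intro h'
      apply h
      ext k
      exact CharTwo.add_eq_zero.1 (congrFun h' k)⟩

lemma hadamard_transforms (x z : κ → Bit) : Transforms (hadamard κ).1 x z z x (z ⬝ᵥ x) := by
  intro i a
  simp only [hadamard, Matrix.of_apply, add_dotProduct, dotProduct_add, sgn_add]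
  rw [dotProduct_comm i x]
  linear_combination (((Real.sqrt 2)⁻¹ ^ Fintype.card κ : ℝ) : ℂ) * sgn (i ⬝ᵥ a) * sgn (x ⬝ᵥ i) *
    sgn (z ⬝ᵥ x) * sgn_mul_self (z ⬝ᵥ a)

/-- A permutation of the basis states as a unitary. -/
def permUnitary (π : (κ → Bit) ≃+ (κ → Bit)) : Matrix.unitaryGroup (κ → Bit) ℂ :=
  ⟨Matrix.of fun i a => if i = π a then 1 else 0, by
    rw [Matrix.mem_unitaryGroup_iff]
    ext i j
    rw [Matrix.mul_apply, Finset.sum_eq_single (π.symm i)]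
    · by_cases h : i = j
      · subst h; simp
      · simp [Matrix.one_apply_ne h, Ne.symm h]
    · intro a _ ha
      have : i ≠ π a := fun h => ha (by rw [h, AddEquiv.symm_apply_apply])
      simp [this]
    · simp⟩

lemma permUnitary_transforms (π : (κ → Bit) ≃+ (κ → Bit)) {x z z' : κ → Bit}
    (hz : ∀ a, z ⬝ᵥ a = z' ⬝ᵥ π a) : Transforms (permUnitary π).1 x z (π x) z' 0 := by
  intro i a
  simp only [permUnitary, Matrix.of_apply, map_add, add_left_inj, zero_add]
  split_ifs with h
  · rw [h, hz, one_mul, mul_one]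
  · simp

lemma pauli_transforms (x₀ z₀ x z : κ → Bit) :
    Transforms (pauliXZ x₀ z₀) x z x z (z₀ ⬝ᵥ x + z ⬝ᵥ x₀) := by
  intro i a
  rw [pauliXZ_apply, pauliXZ_apply]
  by_cases h : i = a + x₀
  · rw [if_pos (by rw [h, add_right_comm]), if_pos h, h]
    simp only [dotProduct_add, sgn_add]
    linear_combination -sgn (z₀ ⬝ᵥ a) * sgn (z₀ ⬝ᵥ x) * sgn (z ⬝ᵥ a) * sgn_mul_self (z ⬝ᵥ x₀)
  · rw [if_neg h, if_neg, zero_mul, mul_zero]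
    intro h'
    exact h (add_right_cancel (h'.trans (add_right_comm a x x₀)))

/-- The Pauli operators as unitaries. -/
def pauliUnitary (x z : κ → Bit) : Matrix.unitaryGroup (κ → Bit) ℂ :=
  ⟨pauliXZ x z, (isPauli_pauliXZ x z).isClifford.1⟩

variable {μ : Type} [Fintype μ] [DecidableEq μ]

/-- The tensor product of a coefficient vector and `u`. -/
def tens {β : Type} (g : β → Bit) (u : μ → Bit) : β × μ → Bit := fun p => g p.1 * u p.2

/-- The controlled negations of the qubits `(true, l)`, controlled by the qubits `(false, l)`. -/
def cnotEquiv (μ : Type) : (Bool × μ → Bit) ≃+ (Bool × μ → Bit) where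
  toFun v p := if p.1 then v p + v (false, p.2) else v p
  invFun v p := if p.1 then v p + v (false, p.2) else v p
  left_inv v := by ext ⟨b, l⟩; cases b <;> simp [add_assoc, bit_add_self]
  right_inv v := by ext ⟨b, l⟩; cases b <;> simp [add_assoc, bit_add_self]
  map_add' v v' := by ext ⟨b, l⟩; cases b <;> simp [add_add_add_comm]

/-- The exchange of the qubits `(true, l)` and `(false, l)`. -/
def swapEquiv (μ : Type) : (Bool × μ → Bit) ≃+ (Bool × μ → Bit) where
  toFun v p := v (!p.1, p.2)
  invFun v p := v (!p.1, p.2)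
  left_inv v := by ext ⟨b, l⟩; simp
  right_inv v := by ext ⟨b, l⟩; simp
  map_add' v v' := rfl

/-- A controlled NOT copies `X` from the control `false` to the target `true`, and `Z` from the
target back to the control. -/
lemma cnot_transforms {x z x' z' : Bool → Bit} (u : μ → Bit) (h1 : x' false = x false)
    (h2 : x' true = x true + x false) (h3 : z' true = z true) (h4 : z' false = z false + z true) :
    Transforms (permUnitary (cnotEquiv μ)).1 (tens x u) (tens z u) (tens x' u) (tens z' u) 0 := by
  have hx : tens x' u = cnotEquiv μ (tens x u) := by
    ext ⟨b, l⟩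
    cases b
    · simp [tens, cnotEquiv, h1]
    · simp [tens, cnotEquiv, h2, add_mul]
  rw [hx]
  refine permUnitary_transforms _ fun a => ?_
  simp only [dotProduct, Fintype.sum_prod_type, Fintype.sum_bool, ← Finset.sum_add_distrib]
  refine Finset.sum_congr rfl fun l _ => ?_
  simp only [tens, cnotEquiv, AddEquiv.coe_mk, Equiv.coe_fn_mk, if_true, h3, h4, Bool.false_eq_true,
    if_false]
  linear_combination -(z true * u l) * bit_add_self (a (false, l))

lemma swap_transforms {x z x' z' : Bool → Bit} (u : μ → Bit) (hx : ∀ b, x' b = x !b)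
    (hz : ∀ b, z' b = z !b) :
    Transforms (permUnitary (swapEquiv μ)).1 (tens x u) (tens z u) (tens x' u) (tens z' u) 0 := by
  have hx : tens x' u = swapEquiv μ (tens x u) := by
    ext ⟨b, l⟩
    simp [tens, swapEquiv, hx]
  rw [hx]
  refine permUnitary_transforms _ fun a => ?_
  simp only [dotProduct, Fintype.sum_prod_type, Fintype.sum_bool, ← Finset.sum_add_distrib]
  refine Finset.sum_congr rfl fun l _ => ?_
  simp only [tens, swapEquiv, AddEquiv.coe_mk, Equiv.coe_fn_mk, hz, Bool.not_true, Bool.not_false]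
  ring

/-- A phase gate on one qubit that is not a Clifford gate. -/
def phaseUnitary : Matrix.unitaryGroup (Unit → Bit) ℂ :=
  ⟨Matrix.diagonal fun a => if a = 0 then 1 else (3 + 4 * Complex.I) / 5, by
    rw [Matrix.mem_unitaryGroup_iff, Matrix.star_eq_conjTranspose, Matrix.diagonal_conjTranspose,
      Matrix.diagonal_mul_diagonal, ← Matrix.diagonal_one]
    congr 1
    ext a
    by_cases h : a = 0
    · simp [h]
    · simp only [h, if_false, Pi.star_apply, RCLike.star_def, map_div₀, map_add, map_mul,
        Complex.conj_I, Complex.conj_ofNat]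
      linear_combination -(16 / 25) * Complex.I_sq⟩

lemma phaseUnitary_apply_zero (a : Unit → Bit) : phaseUnitary.1 a 0 = if a = 0 then 1 else 0 := by
  simp only [phaseUnitary, Matrix.diagonal_apply]
  split_ifs <;> simp_all

lemma IsPauli.apply_pow_four {M : Operator κ} (h : IsPauli M) (i j : κ → Bit) :
    M i j = 0 ∨ M i j ^ 4 = 1 := by
  obtain ⟨k, x, z, -, rfl⟩ := h
  rw [Matrix.smul_apply, pauliXZ_apply]
  split_ifs
  · right
    rw [smul_eq_mul, mul_pow, ← pow_mul, mul_comm k, pow_mul, Complex.I_pow_four, one_pow, one_mul]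
    linear_combination (sgn (z ⬝ᵥ j) * sgn (z ⬝ᵥ j) + 1) * sgn_mul_self (z ⬝ᵥ j)
  · simp

/-- The conjugate of `X` has the entry `(3 + 4 i) / 5`, whereas nonzero entries of Pauli operators
are fourth roots of unity. -/
lemma phaseUnitary_not_isClifford : ¬ IsClifford phaseUnitary.1 := by
  intro h
  have hP := h.2 (pauliXZ 1 0) (isPauli_pauliXZ 1 0)
  have hv : (phaseUnitary.1 * pauliXZ 1 0 * phaseUnitary.1ᴴ : Operator Unit) 1 0 = (3 + 4 * Complex.I) / 5 := by
    simp only [phaseUnitary, Matrix.diagonal_conjTranspose]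
    rw [Matrix.mul_diagonal, Matrix.diagonal_mul, pauliXZ_apply]
    simp
  rcases hP.apply_pow_four 1 0 with h0 | h0
  · rw [hv] at h0
    have := congrArg Complex.re h0
    norm_num at this
  · rw [hv] at h0
    have h1 : ((3 + 4 * Complex.I) / 5) ^ 4 = (-527 - 336 * Complex.I) / 625 := by
      have hI := Complex.I_sq
      linear_combination ((256 * Complex.I ^ 2 + 768 * Complex.I + 864 - 256) / 625) * hI
    rw [h1] at h0
    have := congrArg Complex.re h0
    norm_num at this

end

section
variable {C Q : Type} [Fintype C] [DecidableEq C] [Fintype Q] [DecidableEq Q]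
variable {κ κ' : Type} [Fintype κ] [DecidableEq κ] [Fintype κ'] [DecidableEq κ']
variable {ι : Type} [Fintype ι] [DecidableEq ι]

lemma mem_unitaryLayer {d : ι × κ' ↪ C} {e : ι × κ ↪ Q}
    {U : ι → (κ' → Bit) → Matrix.unitaryGroup (κ → Bit) ℂ} {g : Gate C Q} :
    g ∈ (unitaryLayer d e U).gates ↔ ∃ i, unitaryGate (row d i) (row e i) (U i) = g := by
  simp [unitaryLayer]

lemma fanIn_unitaryLayer {d : ι × κ' ↪ C} {e : ι × κ ↪ Q}
    {U : ι → (κ' → Bit) → Matrix.unitaryGroup (κ → Bit) ℂ} {g : Gate C Q}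
    (hg : g ∈ (unitaryLayer d e U).gates) : g.fanIn = Fintype.card κ' + Fintype.card κ := by
  obtain ⟨i, rfl⟩ := mem_unitaryLayer.1 hg
  simp [Gate.fanIn, unitaryGate, Finset.card_map]

lemma unitaryGate_not_isClifford (d : κ' ↪ C) (e : κ ↪ Q) {V : Matrix.unitaryGroup (κ → Bit) ℂ}
    (hV : ¬ IsClifford V.1) :
    ∃ U, Op.unitary U ∈ (unitaryGate d e fun _ => V).ops ∧ ∃ c, ¬ IsClifford (U c).1 := by
  refine ⟨_, List.mem_singleton_self _, 0, fun h => hV ?_⟩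
  have := relabel_isClifford (wireEquiv e) h
  convert this using 1
  ext i j
  simp only [relabel, renameUnitary, Matrix.submatrix_apply]
  refine congrArg₂ V.1 ?_ ?_ <;> ext k <;> simp [relabelEquiv]

end

end
end MagicBCS

open scoped Kronecker
namespace MagicBCS
noncomputable section
set_option linter.unusedSectionVars false
set_option linter.unusedSimpArgs false

/-! ### A device of constant depth -/

namespace Teleport

/-- The bits of a site: the input of the first round, the two syndromes, the questions, the answers
of the first and of the second round. -/
inductive LBit (w lA lB : ℕ) : Type
  | top
  | sx (l : Fin w)
  | sz (l : Fin w)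
  | qa (l : Fin lA)
  | qb (l : Fin lB)
  | syn (l : Fin w)
  | res (l : Fin w)
  deriving DecidableEq, Fintype

/-- The sites of Alice (`false`) and of Bob (`true`). -/
abbrev Site (N : ℕ) : Type := Fin N × Bool

abbrev Bits (N w lA lB : ℕ) : Type := Site N × LBit w lA lB

/-- Each site has `w` data qubits (`false`) and `w` storage qubits (`true`). -/
abbrev Qubits (N w : ℕ) : Type := Site N × (Bool × Fin w)

variable {N w lA lB : ℕ}

/-- The position of a site on the line. -/
def sitePos (s : Site N) : ℕ := 2 * s.1 + s.2.toNat

lemma sitePos_injective : Function.Injective (sitePos (N := N)) := by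
  rintro ⟨i, b⟩ ⟨i', b'⟩ h
  have h' : 2 * i.1 + b.toNat = 2 * i'.1 + b'.toNat := h
  ext1
  · ext; cases b <;> cases b' <;> simp at h' <;> omega
  · cases b <;> cases b' <;> simp at h' ⊢ <;> omega

/-- The sites of one player. -/
def side (N : ℕ) (b : Bool) : Fin N ↪ Site N := ⟨fun i => (i, b), fun _ _ h => (Prod.ext_iff.1 h).1⟩

/-- The wires of the first input. -/
def inj₁ : Fin N ⊕ Fin N ↪ Bits N w lA lB :=
  ⟨Sum.elim (fun i => ((i, false), .top)) (fun i => ((i, true), .top)), by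
    rintro (i | i) (j | j) h <;> simp_all⟩

/-- The wires of the second input. -/
def inj₂ : (Fin N × ((Fin w ⊕ Fin w) ⊕ Fin lA)) ⊕ (Fin N × Fin lB) ↪ Bits N w lA lB :=
  ⟨Sum.elim
    (fun p => ((p.1, false), Sum.elim (Sum.elim LBit.sx LBit.sz) LBit.qa p.2))
    (fun p => ((p.1, true), LBit.qb p.2)), by
    rintro (⟨i, (l | l) | l⟩ | ⟨i, l⟩) (⟨j, (l' | l') | l'⟩ | ⟨j, l'⟩) h <;> simp_all⟩

section Wires
variable {ι κ' : Type}

/-- The data qubits of pairs of sites. -/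
def pairQ (w : ℕ) (σ : ι × Bool ↪ Site N) : ι × (Bool × Fin w) ↪ Qubits N w :=
  ⟨fun p => (σ (p.1, p.2.1), (false, p.2.2)), by
    rintro ⟨i, b, l⟩ ⟨i', b', l'⟩ h
    obtain ⟨h1, h2⟩ := Prod.ext_iff.1 h
    have := σ.injective h1
    simp_all⟩

/-- The data or the storage qubits of single sites. -/
def siteQ (w : ℕ) (τ : ι ↪ Site N) (b : Bool) : ι × Fin w ↪ Qubits N w :=
  ⟨fun p => (τ p.1, (b, p.2)), by
    rintro ⟨i, l⟩ ⟨i', l'⟩ h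
    obtain ⟨h1, h2⟩ := Prod.ext_iff.1 h
    have := τ.injective h1
    simp_all⟩

/-- Some bits of single sites. -/
def siteC (τ : ι ↪ Site N) (f : κ' ↪ LBit w lA lB) : ι × κ' ↪ Bits N w lA lB :=
  ⟨fun p => (τ p.1, f p.2), by
    rintro ⟨i, l⟩ ⟨i', l'⟩ h
    obtain ⟨h1, h2⟩ := Prod.ext_iff.1 h
    have := τ.injective h1
    have := f.injective h2
    simp_all⟩

/-- No bits. -/
def noC (C : Type) : ι × Empty ↪ C := ⟨fun p => p.2.elim, fun p => p.2.elim⟩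

end Wires

/-- Neighbouring sites `B i` and `A (i + 1)`. -/
abbrev Link (N : ℕ) : Type := {p : Fin N × Fin N // p.1.1 + 1 = p.2.1}

/-- Alice's and Bob's sites with the same index. -/
def sameSite (N : ℕ) : Fin N × Bool ↪ Site N := Function.Embedding.refl _

/-- The two sites of a link. -/
def linkSite (N : ℕ) : Link N × Bool ↪ Site N :=
  ⟨fun p => (if p.2 then p.1.1.1 else p.1.1.2, p.2), by
    rintro ⟨⟨⟨a, b⟩, h⟩, x⟩ ⟨⟨⟨a', b'⟩, h'⟩, x'⟩ he
    obtain ⟨h1, h2⟩ := Prod.ext_iff.1 he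
    simp only at h1 h2 h h'
    subst h2
    have : a = a' ∧ b = b' := by
      cases x
      · simp only [Bool.false_eq_true, if_false] at h1
        subst h1
        exact ⟨Fin.ext (by omega), rfl⟩
      · simp only [if_true] at h1
        subst h1
        exact ⟨rfl, Fin.ext (by omega)⟩
    obtain ⟨rfl, rfl⟩ := this
    rfl⟩

lemma sitePos_linkSite (p : Link N × Bool) : sitePos (linkSite N p) = 2 * p.1.1.1.1 + 1 ∨
    sitePos (linkSite N p) = 2 * p.1.1.1.1 + 1 + 1 := by
  obtain ⟨⟨⟨a, b⟩, h⟩, x⟩ := p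
  have h' : a.1 + 1 = b.1 := h
  cases x
  · refine Or.inr ?_
    change 2 * b.1 + 0 = _
    simp only
    omega
  · exact Or.inl rfl

/-- The input bit of the first round. -/
def topC : Unit ↪ LBit w lA lB := ⟨fun _ => .top, fun _ _ _ => rfl⟩

/-- The two syndromes. -/
def synC : Bool × Fin w ↪ LBit w lA lB :=
  ⟨fun p => if p.1 then .sz p.2 else .sx p.2, by
    rintro ⟨b, l⟩ ⟨b', l'⟩ h
    cases b <;> cases b' <;> simp_all⟩

def qaC : Fin lA ↪ LBit w lA lB := ⟨.qa, fun _ _ h => by simpa using h⟩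

def qbC : Fin lB ↪ LBit w lA lB := ⟨.qb, fun _ _ h => by simpa using h⟩

/-- The two sites of a link, with their inputs. -/
def linkC (N w lA lB : ℕ) : Link N × Bool ↪ Bits N w lA lB :=
  ⟨fun p => (linkSite N p, .top), fun _ _ h => (linkSite N).injective (Prod.ext_iff.1 h).1⟩

/-! #### The layers -/

/-- The gates fix `|0⟩`, so this layer does nothing to the state; it guarantees a non-Clifford gate
whatever the measurement bases of the second round are. -/
def phaseLayer (N w lA lB : ℕ) : Layer (Bits N w lA lB) (Qubits N w) :=
  unitaryLayer (ι := Qubits N w) (κ := Unit) (noC _)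
    ⟨fun p => p.1, fun _ _ h => Prod.ext h rfl⟩ fun _ _ => phaseUnitary

/-- Together with `pairLayer` this prepares Bell pairs between Alice's and Bob's sites of equal
index. -/
def plusLayer (N w lA lB : ℕ) : Layer (Bits N w lA lB) (Qubits N w) :=
  unitaryLayer (noC _) (siteQ w (side N false) false) fun _ _ => hadamard _

def pairLayer (N w lA lB : ℕ) : Layer (Bits N w lA lB) (Qubits N w) :=
  unitaryLayer (noC _) (pairQ w (sameSite N)) fun _ _ => permUnitary (cnotEquiv _)

/-- First half of the Bell measurements that join neighbouring pairs: a controlled NOT from Alice's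
site `i + 1` to Bob's site `i`. The links just outside the segment, to the left of Alice's `⊤` site
and to the right of Bob's, are switched off. -/
def linkLayer (N w lA lB : ℕ) : Layer (Bits N w lA lB) (Qubits N w) :=
  unitaryLayer (linkC N w lA lB) (pairQ w (linkSite N)) fun _ c =>
    if c false = 0 ∧ c true = 0 then permUnitary (cnotEquiv _) else 1

/-- Second half of the Bell measurements: Alice's qubits are to be read in the `X` basis, except at
the end point of the segment. -/
def basisLayer (N w lA lB : ℕ) : Layer (Bits N w lA lB) (Qubits N w) :=
  unitaryLayer (siteC (side N false) topC) (siteQ w (side N false) false) fun _ c =>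
    if c () = 0 then hadamard _ else 1

/-- The two end points exchange data and storage, so that their halves of the swapped pairs survive
the reading of all data qubits. -/
def storeLayer (N w lA lB : ℕ) : Layer (Bits N w lA lB) (Qubits N w) :=
  unitaryLayer (siteC (Function.Embedding.refl (Site N)) topC) (Function.Embedding.refl _) fun _ c =>
    if c () = 0 then 1 else permUnitary (swapEquiv _)

/-- The measurement of all data or all storage qubits. -/
def readLayer (b : Bool) (f : Fin w ↪ LBit w lA lB) : Layer (Bits N w lA lB) (Qubits N w) :=
  measureLayer (siteQ w (Function.Embedding.refl (Site N)) b) (siteC (Function.Embedding.refl _) f)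

/-- The syndrome `sx` is the sign of the `X`-type stabilizers and is repaired by `Z`; the syndrome
`sz` is repaired by `X`. -/
def correctLayer (N w lA lB : ℕ) : Layer (Bits N w lA lB) (Qubits N w) :=
  unitaryLayer (siteC (side N false) synC) (siteQ w (side N false) true) fun _ c =>
    pauliUnitary (fun l => c (true, l)) (fun l => c (false, l))

/-- One player rotates the storage qubits according to the question. -/
def rotateLayer {m : ℕ} (b : Bool) (f : Fin m ↪ LBit w lA lB)
    (V : (Fin m → Bit) → Matrix.unitaryGroup (Fin w → Bit) ℂ) :
    Layer (Bits N w lA lB) (Qubits N w) :=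
  unitaryLayer (siteC (side N b) f) (siteQ w (side N b) true) fun _ c => V c

/-- The outcomes of the first round go to `syn`. Those of the second go to `res`, where the answers
later overwrite them. -/
def synRes (x : Bool) : Fin w ↪ LBit w lA lB :=
  ⟨if x then .res else .syn, fun a b h => by cases x <;> simpa using h⟩

/-- One player computes the answer from the question and the outcomes. -/
def answer {m : ℕ} (b : Bool) (f : Fin m ↪ LBit w lA lB)
    (post : (Fin m → Bit) → (Fin w → Bit) → Fin w → Bit) (c : Bits N w lA lB → Bit) :
    Bits N w lA lB → Bit
  | (s, .res l) => if s.2 = b then post (fun x => c (s, f x)) (fun l => c (s, .res l)) l else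
      c (s, .res l)
  | x => c x

def answerWires {m : ℕ} (b : Bool) (f : Fin m ↪ LBit w lA lB) (i : Fin N) :
    Finset (Bits N w lA lB) :=
  Finset.univ.map (row (siteC (side N b) f) i) ∪
    Finset.univ.map (row (siteC (side N b) (synRes true)) i)

lemma mem_answerWires {m : ℕ} {b : Bool} {f : Fin m ↪ LBit w lA lB} {i : Fin N}
    {x : Bits N w lA lB} : x ∈ answerWires b f i ↔
      x.1 = (i, b) ∧ ((∃ l, f l = x.2) ∨ ∃ l, LBit.res l = x.2) := by
  obtain ⟨s, x⟩ := x
  simp only [answerWires, Finset.mem_union, Finset.mem_map, Finset.mem_univ, true_and]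
  change ((∃ l, ((i, b), f l) = (s, x)) ∨ ∃ l, ((i, b), LBit.res l) = (s, x)) ↔ _
  simp only [Prod.mk.injEq, exists_and_left, eq_comm (a := s)]
  rw [and_or_left]

def answerLayer {m : ℕ} (b : Bool) (f : Fin m ↪ LBit w lA lB)
    (post : (Fin m → Bit) → (Fin w → Bit) → Fin w → Bit) : Layer (Bits N w lA lB) (Qubits N w) :=
  classicalLayer (answerWires b f) (fun i j hij => by
    refine Finset.disjoint_left.2 fun x h1 h2 => ?_
    have h1 := (mem_answerWires.1 h1).1
    have h2 := (mem_answerWires.1 h2).1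
    rw [h1] at h2
    exact hij (Prod.ext_iff.1 h2).1) (answer b f post)

lemma answerLayer_step {m : ℕ} {b : Bool} {f : Fin m ↪ LBit w lA lB}
    {post : (Fin m → Bit) → (Fin w → Bit) → Fin w → Bit} {c c' : Bits N w lA lB → Bit}
    {ψ ψ' : (Qubits N w → Bit) → ℂ} (h : gatesStep (answerLayer b f post).gates c ψ c' ψ') :
    c' = answer b f post c ∧ ψ' = ψ := by
  refine classicalLayer_step ?_ ?_ h
  · rintro i ⟨s, x⟩ hs c c' hc
    have hs1 : s = (i, b) := (mem_answerWires.1 hs).1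
    subst hs1
    have h1 : ∀ l, c ((i, b), f l) = c' ((i, b), f l) := fun l =>
      hc _ (mem_answerWires.2 ⟨rfl, Or.inl ⟨l, rfl⟩⟩)
    have h2 : ∀ l, c ((i, b), .res l) = c' ((i, b), .res l) := fun l =>
      hc _ (mem_answerWires.2 ⟨rfl, Or.inr ⟨l, rfl⟩⟩)
    cases x <;> simp only [answer]
    case res l => simp only [h1, h2]
    all_goals exact hc _ hs
  · rintro ⟨s, x⟩ hs c
    cases x <;> simp only [answer]
    case res l =>
      rw [if_neg]
      rintro rfl
      exact hs s.1 (mem_answerWires.2 ⟨rfl, Or.inr ⟨l, rfl⟩⟩)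

/-- The first round of the device. -/
def circuit₁ (N w lA lB : ℕ) : Circuit (Bits N w lA lB) (Qubits N w) :=
  [phaseLayer N w lA lB, plusLayer N w lA lB, pairLayer N w lA lB, linkLayer N w lA lB,
    basisLayer N w lA lB, storeLayer N w lA lB, readLayer false (synRes false)]

/-- The second round of the device. -/
def circuit₂ (N : ℕ) (VA : (Fin lA → Bit) → Matrix.unitaryGroup (Fin w → Bit) ℂ)
    (VB : (Fin lB → Bit) → Matrix.unitaryGroup (Fin w → Bit) ℂ)
    (postA : (Fin lA → Bit) → (Fin w → Bit) → Fin w → Bit)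
    (postB : (Fin lB → Bit) → (Fin w → Bit) → Fin w → Bit) :
    Circuit (Bits N w lA lB) (Qubits N w) :=
  [correctLayer N w lA lB, rotateLayer false qaC VA, rotateLayer true qbC VB,
    readLayer true (synRes true), answerLayer false qaC postA, answerLayer true qbC postB]

/-- The device; `V` are the rotations and `post` the answers of the two players. -/
def device (N : ℕ) (hw : 3 ≤ w) (VA : (Fin lA → Bit) → Matrix.unitaryGroup (Fin w → Bit) ℂ)
    (VB : (Fin lB → Bit) → Matrix.unitaryGroup (Fin w → Bit) ℂ)
    (postA : (Fin lA → Bit) → (Fin w → Bit) → Fin w → Bit)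
    (postB : (Fin lB → Bit) → (Fin w → Bit) → Fin w → Bit) : Protocol N w lA lB where
  Bits := Bits N w lA lB
  Qubits := Qubits N w
  anc := 0
  in₁ := inj₁
  in₂ := inj₂
  out₁A i l := ((i, false), .syn l)
  out₁B i l := ((i, true), .syn l)
  out₂A i l := ((i, false), .res (Fin.castLE hw l))
  out₂B i l := ((i, true), .res (Fin.castLE hw l))
  circ₁ := circuit₁ N w lA lB
  circ₂ := circuit₂ N VA VB postA postB

/-! #### Resources -/

/-- The gate is small, and acts on neighbouring sites. -/
def Fits (K : ℕ) (g : Gate (Bits N w lA lB) (Qubits N w)) : Prop :=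
  g.fanIn ≤ K ∧ ∃ m : ℕ, (∀ b ∈ g.bits, sitePos b.1 = m ∨ sitePos b.1 = m + 1) ∧
    ∀ q ∈ g.qubits, sitePos q.1 = m ∨ sitePos q.1 = m + 1

section
variable {ι κ κ' : Type} [Fintype κ] [DecidableEq κ] [Fintype κ'] [DecidableEq κ'] [Fintype ι]
  [DecidableEq ι]

lemma fits_unitaryLayer {K : ℕ} {d : ι × κ' ↪ Bits N w lA lB} {e : ι × κ ↪ Qubits N w}
    {U : ι → (κ' → Bit) → Matrix.unitaryGroup (κ → Bit) ℂ}
    (hK : Fintype.card κ' + Fintype.card κ ≤ K) (pos : ι → ℕ)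
    (hd : ∀ i x, sitePos (d (i, x)).1 = pos i ∨ sitePos (d (i, x)).1 = pos i + 1)
    (he : ∀ i x, sitePos (e (i, x)).1 = pos i ∨ sitePos (e (i, x)).1 = pos i + 1) :
    ∀ g ∈ (unitaryLayer d e U).gates, Fits K g := by
  intro g hg
  refine ⟨(fanIn_unitaryLayer hg).trans_le hK, ?_⟩
  obtain ⟨i, rfl⟩ := mem_unitaryLayer.1 hg
  refine ⟨pos i, fun b hb => ?_, fun q hq => ?_⟩
  · obtain ⟨x, -, rfl⟩ := Finset.mem_map.1 hb
    exact hd i x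
  · obtain ⟨x, -, rfl⟩ := Finset.mem_map.1 hq
    exact he i x

lemma fits_readLayer {K : ℕ} (hK : 2 ≤ K) (b : Bool) (f : Fin w ↪ LBit w lA lB) :
    ∀ g ∈ (readLayer (N := N) b f).gates, Fits K g := by
  intro g hg
  simp only [readLayer, measureLayer, List.mem_map, Finset.mem_toList, Finset.mem_univ,
    true_and] at hg
  obtain ⟨⟨s, l⟩, rfl⟩ := hg
  refine ⟨by simpa [Gate.fanIn] using hK, sitePos s, fun b hb => ?_, fun q hq => ?_⟩
  · rw [Finset.mem_singleton.1 hb]; exact Or.inl rfl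
  · rw [Finset.mem_singleton.1 hq]; exact Or.inl rfl

lemma fits_answerLayer {K m : ℕ} (hK : m + w ≤ K) (b : Bool) (f : Fin m ↪ LBit w lA lB)
    (post : (Fin m → Bit) → (Fin w → Bit) → Fin w → Bit) :
    ∀ g ∈ (answerLayer (N := N) b f post).gates, Fits K g := by
  intro g hg
  simp only [answerLayer, classicalLayer, List.mem_map, Finset.mem_toList, Finset.mem_univ,
    true_and] at hg
  obtain ⟨i, rfl⟩ := hg
  refine ⟨?_, sitePos (i, b), fun x hx => ?_, fun q hq => ?_⟩
  · simp only [Gate.fanIn, classicalGate, Finset.card_empty, add_zero]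
    refine (Finset.card_union_le _ _).trans ?_
    simpa [Finset.card_map] using hK
  · rw [(mem_answerWires.1 hx).1]; exact Or.inl rfl
  · exact absurd hq (Finset.notMem_empty _)

end

variable {hw : 3 ≤ w} {VA : (Fin lA → Bit) → Matrix.unitaryGroup (Fin w → Bit) ℂ}
  {VB : (Fin lB → Bit) → Matrix.unitaryGroup (Fin w → Bit) ℂ}
  {postA : (Fin lA → Bit) → (Fin w → Bit) → Fin w → Bit}
  {postB : (Fin lB → Bit) → (Fin w → Bit) → Fin w → Bit}

/-- Link gates use `2 * w` qubits and two bits, corrections `w` qubits and `2 * w` bits, so `4 * w +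
2` is ample for all gates that do not read a question. Rotations and answers use the question
register and `w` further wires. -/
lemma fits_device {K : ℕ} (hK : 4 * w + 2 ≤ K) (hA : lA + w ≤ K) (hB : lB + w ≤ K) :
    ∀ g ∈ Circuit.gates (circuit₁ N w lA lB) ++ Circuit.gates (circuit₂ N VA VB postA postB),
      Fits K g := by
  intro g hg
  simp only [Circuit.gates, circuit₁, circuit₂, List.flatMap_cons, List.flatMap_nil,
    List.append_nil, List.mem_append] at hg
  rcases hg with (h | h | h | h | h | h | h) | (h | h | h | h | h | h)
  · refine fits_unitaryLayer ?_ (fun q => sitePos q.1) (fun _ x => x.elim) (fun _ _ => Or.inl rfl) g h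
    simp; omega
  · refine fits_unitaryLayer ?_ (fun i => sitePos (i, false)) (fun _ x => x.elim)
      (fun _ _ => Or.inl rfl) g h
    simp; omega
  · refine fits_unitaryLayer ?_ (fun i => 2 * i.1) (fun _ x => x.elim) ?_ g h
    · simp; omega
    · rintro i ⟨b, l⟩
      cases b
      · exact Or.inl rfl
      · exact Or.inr rfl
  · refine fits_unitaryLayer ?_ (fun i => 2 * i.1.1.1 + 1) ?_ ?_ g h
    · simp; omega
    · exact fun i x => sitePos_linkSite (i, x)
    · exact fun i x => sitePos_linkSite (i, x.1)
  · refine fits_unitaryLayer ?_ (fun i => sitePos (i, false)) (fun _ _ => Or.inl rfl)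
      (fun _ _ => Or.inl rfl) g h
    simp; omega
  · refine fits_unitaryLayer ?_ (fun i => sitePos i) (fun _ _ => Or.inl rfl)
      (fun _ _ => Or.inl rfl) g h
    simp; omega
  · exact fits_readLayer (by omega) _ _ g h
  · refine fits_unitaryLayer ?_ (fun i => sitePos (i, false)) (fun _ _ => Or.inl rfl)
      (fun _ _ => Or.inl rfl) g h
    simp; omega
  · refine fits_unitaryLayer ?_ (fun i => sitePos (i, false)) (fun _ _ => Or.inl rfl)
      (fun _ _ => Or.inl rfl) g h
    simpa using hA
  · refine fits_unitaryLayer ?_ (fun i => sitePos (i, true)) (fun _ _ => Or.inl rfl)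
      (fun _ _ => Or.inl rfl) g h
    simpa using hB
  · exact fits_readLayer (by omega) _ _ g h
  · exact fits_answerLayer hA _ _ _ g h
  · exact fits_answerLayer hB _ _ _ g h

lemma circuit_usesNonClifford (hw : 3 ≤ w) (hN : 0 < N) :
    ∃ g ∈ Circuit.gates (circuit₁ N w lA lB), ∃ U, Op.unitary U ∈ g.ops ∧
      ∃ c, ¬ IsClifford (U c).1 := by
  have q : Qubits N w := ((⟨0, hN⟩, false), (false, ⟨0, by omega⟩))
  have h : unitaryGate (row (noC (Bits N w lA lB)) q)
      (row ⟨fun p : Qubits N w × Unit => p.1, fun _ _ h => Prod.ext h rfl⟩ q)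
      (fun _ => phaseUnitary) ∈ (phaseLayer N w lA lB).gates := mem_unitaryLayer.2 ⟨_, rfl⟩
  refine ⟨_, ?_, unitaryGate_not_isClifford (row (noC (Bits N w lA lB)) q)
    (row ⟨fun p : Qubits N w × Unit => p.1, fun _ _ h => Prod.ext h rfl⟩ q)
    phaseUnitary_not_isClifford⟩
  · rw [Circuit.gates, circuit₁, List.flatMap_cons]
    exact List.mem_append_left _ h

lemma device_usesNonClifford (hN : 0 < N) :
    (device N hw VA VB postA postB).UsesNonClifford := by
  obtain ⟨g, hg, h⟩ := circuit_usesNonClifford (lA := lA) (lB := lB) hw hN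
  exact ⟨g, List.mem_append_left _ hg, h⟩

lemma ncard_sitePos_le (m : ℕ) : Set.ncard {x : Bits N w lA lB ⊕ Qubits N w |
    Sum.elim (fun b => sitePos b.1) (fun q => sitePos q.1) x = m} ≤
      Fintype.card (LBit w lA lB ⊕ (Bool × Fin w)) := by
  rw [← Nat.card_eq_fintype_card, ← Set.ncard_univ]
  refine Set.ncard_le_ncard_of_injOn (Sum.map Prod.snd Prod.snd) (fun _ _ => Set.mem_univ _) ?_
    Set.finite_univ
  rintro (⟨s, x⟩ | ⟨s, x⟩) h (⟨s', x'⟩ | ⟨s', x'⟩) h' he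
  · have := sitePos_injective (h.trans h'.symm)
    simp_all
  · simp at he
  · simp at he
  · have := sitePos_injective (h.trans h'.symm)
    simp_all

lemma device_isLocal1D :
    (device N hw VA VB postA postB).IsLocal1D
      (Fintype.card (LBit w lA lB ⊕ (Bool × Fin w))) := by
  refine ⟨Sum.elim (fun b => sitePos b.1) (fun q => sitePos q.1), ?_, fun m => ?_, fun i => ?_,
    fun g hg => ?_⟩
  · have h : ∀ s : Site N, sitePos s < 2 * N := by
      rintro ⟨i, b⟩
      have := i.2
      cases b <;> simp [sitePos] <;> omega
    rintro (b | q)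
    · exact h b.1
    · exact h q.1
  · exact ncard_sitePos_le m
  · exact ⟨rfl, rfl, fun _ => rfl, fun _ => rfl, fun _ => ⟨rfl, rfl⟩, fun _ => ⟨rfl, rfl⟩⟩
  · exact (fits_device (K := max (4 * w + 2) (max (lA + w) (lB + w))) (by simp) (by simp)
      (by simp) g hg).2

end Teleport

end
end MagicBCS

open scoped Kronecker
namespace MagicBCS
noncomputable section
set_option linter.unusedSectionVars false
set_option linter.unusedSimpArgs false

namespace Teleport

variable {N w lA lB : ℕ}

/-! #### The stabilizers in the course of the first round -/

/-- The vector `u` at all sites, multiplied with the coefficients `f`. -/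
def vec (f : Site N → Bool → Bit) (u : Fin w → Bit) : Qubits N w → Bit := fun q => f q.1 q.2.1 * u q.2.2

variable {c c' : Bits N w lA lB → Bit} {ψ ψ' : (Qubits N w → Bit) → ℂ}
  {fx fz fx' fz' : Site N → Bool → Bit} {u : Fin w → Bit} {g : Bit}

lemma vec_zero : vec (fun _ _ => 0) u = (0 : Qubits N w → Bit) := by
  ext q; simp [vec]

lemma vec_eq (q : Qubits N w) (hx : fx' q.1 q.2.1 = fx q.1 q.2.1) (hz : fz' q.1 q.2.1 = fz q.1 q.2.1) :
    vec fx' u q = vec fx u q ∧ vec fz' u q = vec fz u q := by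
  simp [vec, hx, hz]

lemma phaseLayer_step (h : gatesStep (phaseLayer N w lA lB).gates c ket0 c' ψ') :
    c' = c ∧ ψ' = ket0 :=
  unitaryLayer_fixed h fun _ => actOn_ket0 _ _ phaseUnitary_apply_zero

lemma gatesStep_unitaryLayer_bits {C Q ι κ κ' : Type} [Fintype C] [DecidableEq C] [Fintype Q]
    [DecidableEq Q] [Fintype κ] [DecidableEq κ] [Fintype κ'] [DecidableEq κ'] [Fintype ι]
    [DecidableEq ι] {d : ι × κ' ↪ C} {e : ι × κ ↪ Q}
    {U : ι → (κ' → Bit) → Matrix.unitaryGroup (κ → Bit) ℂ} {c c' : C → Bit}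
    {ψ ψ' : (Q → Bit) → ℂ} (h : gatesStep (unitaryLayer d e U).gates c ψ c' ψ') : c' = c :=
  (unitaryLayer_step h (fun _ _ => True) trivial fun _ _ _ _ _ => trivial).1

/-- The condition that one of `a`, `b` vanishes excludes `Y` factors, for which the Hadamard
transform would produce a sign. -/
lemma hadamard_transforms_smul {a b a' b' : Bit} {P : Prop} [Decidable P] (hab : P → a = 0 ∨ b = 0)
    (ha : a' = if P then b else a) (hb : b' = if P then a else b) :
    Transforms (if P then hadamard (Fin w) else 1).1 (fun l => a * u l) (fun l => b * u l)
      (fun l => a' * u l) (fun l => b' * u l) 0 := by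
  subst ha hb
  by_cases hP : P
  · simp only [if_pos hP]
    have : (fun l => b * u l) ⬝ᵥ (fun l => a * u l) = 0 := by
      rcases hab hP with rfl | rfl <;> simp [dotProduct]
    rw [← this]
    exact hadamard_transforms _ _
  · simp only [if_neg hP]
    exact transforms_one _ _

lemma plusLayer_step (h : gatesStep (plusLayer N w lA lB).gates c ψ c' ψ')
    (hψ : Stab ψ (vec fx u) (vec fz u) g)
    (h0 : ∀ i, fx (i, false) false = 0 ∨ fz (i, false) false = 0)
    (hx : ∀ s b, fx' s b = if s.2 = false ∧ b = false then fz s b else fx s b)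
    (hz : ∀ s b, fz' s b = if s.2 = false ∧ b = false then fx s b else fz s b) :
    Stab ψ' (vec fx' u) (vec fz' u) g := by
  have := hψ.unitaryLayer h (vec fx' u) (vec fz' u) (fun _ => 0) (fun i => by
    have := hadamard_transforms_smul (P := True) (u := u) (a' := fx' (i, false) false)
      (b' := fz' (i, false) false) (fun _ => h0 i) (by simp [hx]) (by simp [hz])
    rw [if_pos trivial] at this
    exact this) (by
    rintro ⟨⟨i, s⟩, b, l⟩ hq
    have : ¬ (s = false ∧ b = false) := by
      rintro ⟨rfl, rfl⟩
      exact hq (i, l) rfl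
    exact vec_eq _ (by rw [hx]; exact if_neg this) (by rw [hz]; exact if_neg this))
  simpa using this

lemma basisLayer_step (h : gatesStep (basisLayer N w lA lB).gates c ψ c' ψ')
    (hψ : Stab ψ (vec fx u) (vec fz u) g)
    (h0 : ∀ i, c ((i, false), .top) = 0 → fx (i, false) false = 0 ∨ fz (i, false) false = 0)
    (hx : ∀ s b, fx' s b = if s.2 = false ∧ b = false ∧ c (s, .top) = 0 then fz s b else fx s b)
    (hz : ∀ s b, fz' s b = if s.2 = false ∧ b = false ∧ c (s, .top) = 0 then fx s b else fz s b) :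
    Stab ψ' (vec fx' u) (vec fz' u) g := by
  have := hψ.unitaryLayer h (vec fx' u) (vec fz' u) (fun _ => 0) (fun i => by
    change Transforms (if c ((i, false), .top) = 0 then hadamard (Fin w) else 1).1
      (fun l => fx (i, false) false * u l) (fun l => fz (i, false) false * u l)
      (fun l => fx' (i, false) false * u l) (fun l => fz' (i, false) false * u l) 0
    exact hadamard_transforms_smul (h0 i) (by simp [hx]) (by simp [hz])) (by
    rintro ⟨⟨i, s⟩, b, l⟩ hq
    have : ¬ (s = false ∧ b = false ∧ c ((i, s), .top) = 0) := by
      rintro ⟨rfl, rfl, -⟩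
      exact hq (i, l) rfl
    exact vec_eq _ (by rw [hx]; exact if_neg this) (by rw [hz]; exact if_neg this))
  simpa using this

lemma pairLayer_step (h : gatesStep (pairLayer N w lA lB).gates c ψ c' ψ')
    (hψ : Stab ψ (vec fx u) (vec fz u) g)
    (hx : ∀ i s b, fx' (i, s) b = fx (i, s) b + if b = false ∧ s = true then fx (i, false) b else 0)
    (hz : ∀ i s b, fz' (i, s) b = fz (i, s) b + if b = false ∧ s = false then fz (i, true) b else 0) :
    Stab ψ' (vec fx' u) (vec fz' u) g := by
  have := hψ.unitaryLayer h (vec fx' u) (vec fz' u) (fun _ => 0) (fun i =>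
    cnot_transforms (x := fun s => fx (i, s) false) (z := fun s => fz (i, s) false)
      (x' := fun s => fx' (i, s) false) (z' := fun s => fz' (i, s) false) u (by simp [hx])
      (by simp [hx]) (by simp [hz]) (by simp [hz])) (by
    rintro ⟨⟨i, s⟩, b, l⟩ hq
    have : b ≠ false := by
      rintro rfl
      exact hq (i, (s, l)) rfl
    exact vec_eq _ (by rw [hx, if_neg (fun h => this h.1), add_zero])
      (by rw [hz, if_neg (fun h => this h.1), add_zero]))
  simpa using this

lemma linkLayer_step (h : gatesStep (linkLayer N w lA lB).gates c ψ c' ψ')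
    (hψ : Stab ψ (vec fx u) (vec fz u) g)
    (h1 : ∀ i i' : Fin N, i.1 + 1 = i'.1 → fx' (i', false) false = fx (i', false) false ∧
      fz' (i, true) false = fz (i, true) false ∧
      (fx' (i, true) false = fx (i, true) false +
        if c ((i', false), .top) = 0 ∧ c ((i, true), .top) = 0 then fx (i', false) false else 0) ∧
      (fz' (i', false) false = fz (i', false) false +
        if c ((i', false), .top) = 0 ∧ c ((i, true), .top) = 0 then fz (i, true) false else 0))
    (h2 : ∀ s b, b = true ∨ (s.2 = false ∧ s.1.1 = 0) ∨ (s.2 = true ∧ s.1.1 + 1 = N) →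
      fx' s b = fx s b ∧ fz' s b = fz s b) :
    Stab ψ' (vec fx' u) (vec fz' u) g := by
  have := hψ.unitaryLayer h (vec fx' u) (vec fz' u) (fun _ => 0) (fun i => by
    obtain ⟨⟨i, i'⟩, hi⟩ := i
    obtain ⟨e1, e2, e3, e4⟩ := h1 i i' hi
    change Transforms (if c ((i', false), .top) = 0 ∧ c ((i, true), .top) = 0 then
      permUnitary (cnotEquiv (Fin w)) else 1).1 
      (tens (fun s => fx (if s then i else i', s) false) u)
      (tens (fun s => fz (if s then i else i', s) false) u)
      (tens (fun s => fx' (if s then i else i', s) false) u)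
      (tens (fun s => fz' (if s then i else i', s) false) u) 0
    by_cases hP : c ((i', false), .top) = 0 ∧ c ((i, true), .top) = 0
    · rw [if_pos hP] at e3 e4 ⊢
      exact cnot_transforms u (by simpa using e1) (by simpa using e3) (by simpa using e2)
        (by simpa using e4)
    · rw [if_neg hP] at e3 e4 ⊢
      have ex : ∀ s : Bool, fx' (if s then i else i', s) false = fx (if s then i else i', s) false := by
        intro s; cases s <;> simp [e1, e3]
      have ez : ∀ s : Bool, fz' (if s then i else i', s) false = fz (if s then i else i', s) false := by
        intro s; cases s <;> simp [e2, e4]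
      simp only [ex, ez]
      exact transforms_one _ _) (by
    rintro ⟨⟨i, s⟩, b, l⟩ hq
    have hor : b = true ∨ (s = false ∧ i.1 = 0) ∨ (s = true ∧ i.1 + 1 = N) := by
      by_contra hne
      rw [not_or, not_or, Bool.not_eq_true] at hne
      obtain ⟨rfl, n1, n2⟩ := hne
      have hi := i.2
      cases s
      · have : i.1 ≠ 0 := fun h => n1 ⟨rfl, h⟩
        exact hq (⟨(⟨i.1 - 1, by omega⟩, i), by simp only; omega⟩, (false, l)) rfl
      · have : i.1 + 1 ≠ N := fun h => n2 ⟨rfl, h⟩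
        exact hq (⟨(i, ⟨i.1 + 1, by omega⟩), rfl⟩, (true, l)) rfl
    obtain ⟨e1, e2⟩ := h2 (i, s) b hor
    exact vec_eq _ e1 e2)
  simpa using this

lemma storeLayer_step (h : gatesStep (storeLayer N w lA lB).gates c ψ c' ψ')
    (hψ : Stab ψ (vec fx u) (vec fz u) g)
    (hx : ∀ s b, fx' s b = if c (s, .top) = 0 then fx s b else fx s !b)
    (hz : ∀ s b, fz' s b = if c (s, .top) = 0 then fz s b else fz s !b) :
    Stab ψ' (vec fx' u) (vec fz' u) g := by
  have := hψ.unitaryLayer h (vec fx' u) (vec fz' u) (fun _ => 0) (fun s => by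
    change Transforms (if c (s, .top) = 0 then 1 else permUnitary (swapEquiv (Fin w))).1
      (tens (fx s) u) (tens (fz s) u) (tens (fx' s) u) (tens (fz' s) u) 0
    by_cases hP : c (s, .top) = 0
    · rw [if_pos hP, show fx' s = fx s from funext fun b => by rw [hx, if_pos hP],
        show fz' s = fz s from funext fun b => by rw [hz, if_pos hP]]
      exact transforms_one _ _
    · rw [if_neg hP]
      exact swap_transforms u (fun b => by rw [hx, if_neg hP]) (fun b => by rw [hz, if_neg hP])) (by
    rintro ⟨s, b, l⟩ hq
    exact absurd rfl (hq (s, (b, l))))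
  simpa using this

lemma readLayer_step (h : gatesStep (readLayer (lA := lA) (lB := lB) false (synRes false)).gates
      c ψ c' ψ')
    (hψ : Stab ψ (vec fx u) (vec fz u) g) (h0 : ∀ s, fx s false = 0) 
    (hz : ∀ s b, fz' s b = if b = false then 0 else fz s b) :
    Stab ψ' (vec fx u) (vec fz' u)
      (g + ∑ s, ∑ l, fz s false * u l * c' (s, .syn l)) := by
  have := hψ.measureLayer h (vec fz' u) (fun p => by
      change fx _ false * _ = 0
      rw [h0, zero_mul]) (fun p => by
      change fz' _ false * _ = 0
      rw [hz, if_pos rfl, zero_mul]) (by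
    rintro ⟨s, b, l⟩ hq
    have : b ≠ false := by
      rintro rfl
      exact hq (s, l) rfl
    simp [vec, hz, this])
  rw [Fintype.sum_prod_type] at this
  exact this

/-- The sites that receive `⊤`. -/
def IsTop (j k : ℕ) (s : Site N) : Prop := (s.2 = false ∧ s.1.1 = j) ∨ (s.2 = true ∧ s.1.1 = k)

instance (j k : ℕ) : DecidablePred (IsTop (N := N) j k) := fun s => by
  unfold IsTop; infer_instance

/-- The coefficients of the stored qubits. -/
def stored (j k : ℕ) (s : Site N) (b : Bool) : Bit := if b = true ∧ IsTop j k s then 1 else 0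

/-- Entanglement swapping, followed on two families of stabilizers only. Each is traced from a
`Z`-type stabilizer of `|0...0⟩`, chosen so that it ends as `X ⊗ X` or `Z ⊗ Z` on the stored qubits
of Alice's site `j` and Bob's site `k`, with a product of outcomes as its sign. The vector `u`
selects among the `w` parallel copies. -/
lemma circuit₁_step {j k : ℕ} (hjk : j < k) (hk : k < N)
    (htop : ∀ s, c (s, .top) = if IsTop j k s then 1 else 0)
    (h : gatesStep (Circuit.gates (circuit₁ N w lA lB)) c ket0 c' ψ') (u : Fin w → Bit) :
    Stab ψ' (vec (stored j k) u) 0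
      (∑ s : Site N, ∑ l, (if s.2 = false ∧ j < s.1.1 ∧ s.1.1 ≤ k then 1 else 0) * u l *
        c' (s, .syn l)) ∧
    Stab ψ' 0 (vec (stored j k) u)
      (∑ s : Site N, ∑ l, (if s.2 = true ∧ j ≤ s.1.1 ∧ s.1.1 < k then 1 else 0) * u l *
        c' (s, .syn l)) := by
  have hc0 : ∀ s, c (s, .top) = 0 ↔ ¬ IsTop j k s := by
    intro s; rw [htop]; split_ifs <;> simp_all
  simp only [Circuit.gates, circuit₁, List.flatMap_cons, List.flatMap_nil, List.append_nil] at h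
  obtain ⟨c₁, ψ₁, s1, r1⟩ := gatesStep_append h
  obtain ⟨rfl, rfl⟩ := phaseLayer_step s1
  obtain ⟨c₂, ψ₂, s2, r2⟩ := gatesStep_append r1
  obtain rfl := gatesStep_unitaryLayer_bits s2
  obtain ⟨c₃, ψ₃, s3, r3⟩ := gatesStep_append r2
  obtain rfl := gatesStep_unitaryLayer_bits s3
  obtain ⟨c₄, ψ₄, s4, r4⟩ := gatesStep_append r3
  obtain rfl := gatesStep_unitaryLayer_bits s4
  obtain ⟨c₅, ψ₅, s5, r5⟩ := gatesStep_append r4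
  obtain rfl := gatesStep_unitaryLayer_bits s5
  obtain ⟨c₆, ψ₆, s6, s7⟩ := gatesStep_append r5
  obtain rfl := gatesStep_unitaryLayer_bits s6
  constructor
  -- `Z` on Alice's sites from `j` to `k` becomes `X` there and then also on Bob's. The links cancel
  -- it on Bob's sites before `k`, and the change of basis turns Alice's sites after `j` into `Z`.
  -- What is measured is Alice's sites from `j + 1` to `k`.
  · have t1 : Stab (ket0 : (Qubits N w → Bit) → ℂ) (vec (fun _ _ => 0) u)
        (vec (fun s b => if b = false ∧ s.2 = false ∧ j ≤ s.1.1 ∧ s.1.1 ≤ k then 1 else 0) u) 0 := by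
      rw [vec_zero]; exact stab_ket0 _
    have t2 := plusLayer_step (fz' := fun _ _ => 0)
      (fx' := fun s b => if b = false ∧ s.2 = false ∧ j ≤ s.1.1 ∧ s.1.1 ≤ k then 1 else 0)
      s2 t1 (by simp) (by grind) (by grind)
    have t3 := pairLayer_step (fz' := fun _ _ => 0)
      (fx' := fun s b => if b = false ∧ j ≤ s.1.1 ∧ s.1.1 ≤ k then 1 else 0)
      s3 t2 (by grind) (by simp)
    have t4 := linkLayer_step (fz' := fun _ _ => 0)
      (fx' := fun s b => if b = false ∧ (if s.2 = false then j ≤ s.1.1 ∧ s.1.1 ≤ k else s.1.1 = k)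
        then 1 else 0)
      s4 t3 (by
        intro i i' hi
        simp only [hc0, IsTop]
        have := bit_add_self 1
        grind) (by
        rintro ⟨i, s⟩ b hs
        have := i.2
        grind)
    have t5 := basisLayer_step
      (fz' := fun s b => if b = false ∧ s.2 = false ∧ j < s.1.1 ∧ s.1.1 ≤ k then 1 else 0)
      (fx' := fun s b => if b = false ∧ IsTop j k s then 1 else 0)
      s5 t4 (by simp) (by simp only [hc0, IsTop]; grind) (by simp only [hc0, IsTop]; grind)
    have t6 := storeLayer_step
      (fz' := fun s b => if b = false ∧ s.2 = false ∧ j < s.1.1 ∧ s.1.1 ≤ k then 1 else 0)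
      (fx' := stored j k)
      s6 t5 (by simp only [hc0, IsTop, stored]; grind) (by simp only [hc0, IsTop]; grind)
    have t7 := readLayer_step (fz' := fun _ _ => 0) s7 t6 (by simp [stored]) (by grind)
    rw [vec_zero] at t7
    simpa using t7
  -- `Z` on Bob's sites from `j` to `k` spreads to Alice's, and the links cancel it on her sites
  -- after `j`. What is measured is Bob's sites from `j` to `k - 1`.
  · have t1 : Stab (ket0 : (Qubits N w → Bit) → ℂ) (vec (fun _ _ => 0) u)
        (vec (fun s b => if b = false ∧ s.2 = true ∧ j ≤ s.1.1 ∧ s.1.1 ≤ k then 1 else 0) u) 0 := by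
      rw [vec_zero]; exact stab_ket0 _
    have t2 := plusLayer_step (fx' := fun _ _ => 0)
      (fz' := fun s b => if b = false ∧ s.2 = true ∧ j ≤ s.1.1 ∧ s.1.1 ≤ k then 1 else 0)
      s2 t1 (by simp) (by grind) (by grind)
    have t3 := pairLayer_step (fx' := fun _ _ => 0)
      (fz' := fun s b => if b = false ∧ j ≤ s.1.1 ∧ s.1.1 ≤ k then 1 else 0)
      s3 t2 (by simp) (by grind)
    have t4 := linkLayer_step (fx' := fun _ _ => 0)
      (fz' := fun s b => if b = false ∧ (if s.2 = true then j ≤ s.1.1 ∧ s.1.1 ≤ k else s.1.1 = j)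
        then 1 else 0)
      s4 t3 (by
        intro i i' hi
        simp only [hc0, IsTop]
        have := bit_add_self 1
        grind) (by
        rintro ⟨i, s⟩ b hs
        have := i.2
        grind)
    have t5 := basisLayer_step (fx' := fun _ _ => 0)
      (fz' := fun s b => if b = false ∧ (if s.2 = true then j ≤ s.1.1 ∧ s.1.1 ≤ k else s.1.1 = j)
        then 1 else 0)
      s5 t4 (by simp) (by simp only [hc0, IsTop]; grind) (by simp only [hc0, IsTop]; grind)
    have t6 := storeLayer_step (fx' := fun _ _ => 0)
      (fz' := fun s b => if (b = true ∧ IsTop j k s) ∨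
        (b = false ∧ s.2 = true ∧ j ≤ s.1.1 ∧ s.1.1 < k) then 1 else 0)
      s6 t5 (by simp) (by simp only [hc0, IsTop]; grind)
    have t7 := readLayer_step (fz' := stored j k) s7 t6 (by simp) (by simp only [stored]; grind)
    rw [vec_zero] at t7
    simpa using t7

end Teleport

end
end MagicBCS

open scoped Kronecker
namespace MagicBCS
noncomputable section
set_option linter.unusedSectionVars false
set_option linter.unusedSimpArgs false

/-! ### The second round: local measurements of the distributed pairs -/

section
variable {Q κ : Type} [Fintype Q] [DecidableEq Q] [Fintype κ] [DecidableEq κ]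

/-- Rotations of the two halves of a maximally entangled state. -/
lemma actOn_actOn_ne_zero (eA eB : κ ↪ Q) (hd : ∀ a b, eA a ≠ eB b) (ψ : (Q → Bit) → ℂ)
    (hz : ∀ i, ψ i ≠ 0 → i ∘ eA = i ∘ eB)
    (hx : ∀ (a : κ → Bit) i, ψ (Function.extend eA a (Function.extend eB a i)) =
      ψ (Function.extend eA 0 (Function.extend eB 0 i))) (VA VB : Operator κ) (i : Q → Bit)
    (h : actOn eB VB (actOn eA VA ψ) i ≠ 0) :
    (VA * VBᵀ) (i ∘ eA) (i ∘ eB) ≠ 0 := by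
  have hA : ∀ (b : κ → Bit) i, Function.extend eB b i ∘ eA = i ∘ eA := by
    intro b i
    ext k
    rw [Function.comp_apply, Function.extend_apply']
    · rfl
    · rintro ⟨k', h⟩
      exact hd k k' h.symm
  -- On the two registers `ψ` is a multiple of the sum of all `|a, a⟩`: the hypothesis `hz` confines
  -- it to equal strings, `hx` makes the amplitudes equal. Rotating the two halves then gives the
  -- amplitudes of `VA * VBᵀ`.
  have h1 : ∀ a b, ψ (Function.extend eA a (Function.extend eB b i)) =
      if a = b then ψ (Function.extend eA 0 (Function.extend eB 0 i)) else 0 := by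
    intro a b
    split_ifs with hab
    · rw [hab, hx]
    · by_contra hne
      apply hab
      have := hz _ hne
      ext k
      have hk := congrFun this k
      rw [Function.comp_apply, Function.comp_apply, eA.injective.extend_apply,
        Function.extend_apply', eB.injective.extend_apply] at hk
      · exact hk
      · rintro ⟨k', h⟩
        exact hd k' k h
  intro h0
  apply h
  rw [actOn]
  have h2 : ∀ b, actOn eA VA ψ (Function.extend eB b i) =
      VA (i ∘ eA) b * ψ (Function.extend eA 0 (Function.extend eB 0 i)) := by
    intro b
    rw [actOn, Finset.sum_eq_single b]
    · rw [hA, h1, if_pos rfl]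
    · intro a _ hab
      rw [h1, if_neg hab, mul_zero]
    · simp
  simp only [h2]
  rw [Matrix.mul_apply] at h0
  calc ∑ b, VB (i ∘ eB) b * (VA (i ∘ eA) b * ψ (Function.extend eA 0 (Function.extend eB 0 i)))
      = (∑ b, VA (i ∘ eA) b * VBᵀ b (i ∘ eB)) *
          ψ (Function.extend eA 0 (Function.extend eB 0 i)) := by
        rw [Finset.sum_mul]
        exact Finset.sum_congr rfl fun b _ => by rw [Matrix.transpose_apply]; ring
    _ = 0 := by rw [h0, zero_mul]

end

namespace Teleport

variable {N w lA lB : ℕ}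
variable {VA : (Fin lA → Bit) → Matrix.unitaryGroup (Fin w → Bit) ℂ}
  {VB : (Fin lB → Bit) → Matrix.unitaryGroup (Fin w → Bit) ℂ}
  {postA : (Fin lA → Bit) → (Fin w → Bit) → Fin w → Bit}
  {postB : (Fin lB → Bit) → (Fin w → Bit) → Fin w → Bit}

/-- At Alice's site `j` the correction contributes a sign equal to the syndrome, which cancels. At
her other sites the stabilizers are trivial, so nothing changes there. -/
lemma correctLayer_step {j k : Fin N} {c c' : Bits N w lA lB → Bit} {ψ ψ' : (Qubits N w → Bit) → ℂ}
    {u : Fin w → Bit} (h : gatesStep (correctLayer N w lA lB).gates c ψ c' ψ')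
    (hx : Stab ψ (vec (stored j k) u) 0 (u ⬝ᵥ fun l => c ((j, false), .sx l)))
    (hz : Stab ψ 0 (vec (stored j k) u) (u ⬝ᵥ fun l => c ((j, false), .sz l))) :
    Stab ψ' (vec (stored j k) u) 0 0 ∧ Stab ψ' 0 (vec (stored j k) u) 0 := by
  have hv : ∀ i, vec (stored j k) u ∘ row (siteQ w (side N false) true) i =
      if i = j then u else 0 := by
    intro i
    ext l
    change stored j k (i, false) true * u l = _
    simp only [stored, IsTop]
    by_cases hi : i = j
    · simp [hi]
    · simp [hi, Fin.val_inj]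
  constructor
  · have := hx.unitaryLayer h (vec (stored j k) u) 0 _ (fun i => pauli_transforms _ _ _ _)
      (fun _ _ => ⟨rfl, rfl⟩)
    simp only [hv] at this
    convert this using 1
    rw [Finset.sum_eq_single j]
    · simp only [if_true]
      change _ = _ + ((fun l => c ((j, false), .sx l)) ⬝ᵥ u + (0 : Fin w → Bit) ⬝ᵥ _)
      rw [zero_dotProduct, add_zero, dotProduct_comm u, bit_add_self]
    · intro i _ hi
      rw [if_neg hi, dotProduct_zero, zero_add]
      exact zero_dotProduct _
    · simp
  · have := hz.unitaryLayer h 0 (vec (stored j k) u) _ (fun i => pauli_transforms _ _ _ _)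
      (fun _ _ => ⟨rfl, rfl⟩)
    simp only [hv] at this
    convert this using 1
    rw [Finset.sum_eq_single j]
    · simp only [if_true]
      change _ = _ + (_ ⬝ᵥ (0 : Fin w → Bit) + u ⬝ᵥ (fun l => c ((j, false), .sz l)))
      rw [dotProduct_zero, zero_add, bit_add_self]
    · intro i _ hi
      rw [if_neg hi, zero_dotProduct, add_zero]
      exact dotProduct_zero _
    · simp

lemma vec_stored_dotProduct (j k : Fin N) (u : Fin w → Bit) (i : Qubits N w → Bit) :
    vec (stored j k) u ⬝ᵥ i = u ⬝ᵥ (i ∘ row (siteQ w (side N false) true) j) +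
      u ⬝ᵥ (i ∘ row (siteQ w (side N true) true) k) := by
  simp only [dotProduct, Fintype.sum_prod_type, Fintype.sum_bool, vec, stored, IsTop]
  simp only [Fin.val_inj, Bool.false_eq_true, false_and, if_false, zero_mul, Finset.sum_const_zero,
    add_zero, true_and, false_or, or_false, Bool.true_eq_false, reduceCtorEq, Finset.sum_add_distrib]
  rw [Finset.sum_eq_single k, Finset.sum_eq_single j, add_comm]
  · simp only [if_true, one_mul]
    rfl
  · intro b _ hb; simp [hb]
  · simp
  · intro b _ hb; simp [hb]
  · simp

lemma vec_stored_of_ne {j k : Fin N} {u : Fin w → Bit} {q : Qubits N w}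
    (hA : ¬ ∃ l, row (siteQ w (side N false) true) j l = q)
    (hB : ¬ ∃ l, row (siteQ w (side N true) true) k l = q) : vec (stored j k) u q = 0 := by
  obtain ⟨⟨i, s⟩, b, l⟩ := q
  simp only [vec, stored]
  rw [if_neg, zero_mul]
  rintro ⟨rfl, ⟨h1, h2⟩ | ⟨h1, h2⟩⟩
  · obtain rfl : i = j := Fin.ext h2
    simp only at h1
    subst h1
    exact hA ⟨l, rfl⟩
  · obtain rfl : i = k := Fin.ext h2
    simp only at h1
    subst h1
    exact hB ⟨l, rfl⟩

/-- After the corrections the stored qubits at Alice's site `j` and Bob's site `k` are maximally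
entangled, and all other sites rotate trivially. Thus an outcome pair on a branch that survives must
have a nonzero entry in the product of one rotation with the transpose of the other. -/
lemma circuit₂_step {j k : Fin N} {c c' : Bits N w lA lB → Bit}
    {ψ ψ' : (Qubits N w → Bit) → ℂ} {xA : Fin lA → Bit} {xB : Fin lB → Bit}
    (hA : ∀ i, VA (fun l => c ((i, false), .qa l)) = if i = j then VA xA else 1)
    (hB : ∀ i, VB (fun l => c ((i, true), .qb l)) = if i = k then VB xB else 1)
    (hxA : ∀ l, c ((j, false), .qa l) = xA l) (hxB : ∀ l, c ((k, true), .qb l) = xB l)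
    (h : gatesStep (Circuit.gates (circuit₂ N VA VB postA postB)) c ψ c' ψ')
    (hx : ∀ u, Stab ψ (vec (stored j k) u) 0 (u ⬝ᵥ fun l => c ((j, false), .sx l)))
    (hz : ∀ u, Stab ψ 0 (vec (stored j k) u) (u ⬝ᵥ fun l => c ((j, false), .sz l)))
    (hne : ψ' ≠ 0) : ∃ vA vB, ((VA xA).1 * (VB xB).1ᵀ) vA vB ≠ 0 ∧
      (∀ l, c' ((j, false), .res l) = postA xA vA l) ∧
      (∀ l, c' ((k, true), .res l) = postB xB vB l) := by
  simp only [Circuit.gates, circuit₂, List.flatMap_cons, List.flatMap_nil, List.append_nil] at h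
  obtain ⟨c₁, ψ₁, s1, r1⟩ := gatesStep_append h
  obtain rfl := gatesStep_unitaryLayer_bits s1
  obtain ⟨c₂, ψ₂, s2, r2⟩ := gatesStep_append r1
  obtain ⟨c₃, ψ₃, s3, r3⟩ := gatesStep_append r2
  obtain ⟨c₄, ψ₄, s4, r4⟩ := gatesStep_append r3
  obtain ⟨c₅, ψ₅, s5, s6⟩ := gatesStep_append r4
  obtain ⟨rfl, hψ₂⟩ := unitaryLayer_single s2 j (fun i hi => (hA i).trans (if_neg hi))
  obtain ⟨rfl, hψ₃⟩ := unitaryLayer_single s3 k (fun i hi => (hB i).trans (if_neg hi))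
  obtain ⟨hc₄, hψ₄⟩ := measureLayer_step s4
  obtain ⟨rfl, rfl⟩ := answerLayer_step s5
  obtain ⟨rfl, rfl⟩ := answerLayer_step s6
  have hs : ∀ u, Stab ψ₁ (vec (stored j k) u) 0 0 ∧ Stab ψ₁ 0 (vec (stored j k) u) 0 :=
    fun u => correctLayer_step s1 (hx u) (hz u)
  set eA := row (siteQ w (side N false) true) j with heA
  set eB := row (siteQ w (side N true) true) k with heB
  have hd : ∀ a b, eA a ≠ eB b := by
    intro a b h
    have : false = true := congrArg (fun q : Qubits N w => q.1.2) h
    exact absurd this (by decide)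
  obtain ⟨v, hv⟩ := Function.ne_iff.1 hne
  rw [hψ₄] at hv
  have hm : ∀ p, v (siteQ w (Function.Embedding.refl (Site N)) true p) =
      c₄ (siteC (Function.Embedding.refl _) (synRes true) p) := by
    by_contra hm
    rw [if_neg hm] at hv
    exact hv rfl
  rw [if_pos hm, hψ₃, hψ₂] at hv
  have hK := actOn_actOn_ne_zero eA eB hd ψ₁ (fun i hi => by
    ext l
    have h1 := (hs (Pi.single l 1)).2 i
    rw [add_zero, zero_add, vec_stored_dotProduct, single_one_dotProduct,
      single_one_dotProduct] at h1
    rcases bit_cases (i (eA l) + i (eB l)) with h0 | h0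
    · exact CharTwo.add_eq_zero.1 h0
    · exfalso
      apply hi
      change _ = sgn (i (eA l) + i (eB l)) * _ at h1
      rw [h0, sgn_one] at h1
      linear_combination (1 / 2 : ℂ) * h1) (fun a i => by
    have h1 := (hs a).1 (Function.extend eA 0 (Function.extend eB 0 i))
    rw [zero_dotProduct, add_zero, sgn_zero, one_mul] at h1
    rw [← h1]
    congr 1
    ext q
    rw [Pi.add_apply]
    by_cases hqA : ∃ l, eA l = q
    · obtain ⟨l, rfl⟩ := hqA
      rw [eA.injective.extend_apply, eA.injective.extend_apply]
      change a l = 0 + stored j k (j, false) true * a l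
      simp [stored, IsTop]
    · rw [Function.extend_apply' _ _ _ hqA, Function.extend_apply' _ _ _ hqA]
      by_cases hqB : ∃ l, eB l = q
      · obtain ⟨l, rfl⟩ := hqB
        rw [eB.injective.extend_apply, eB.injective.extend_apply]
        change a l = 0 + stored j k (k, true) true * a l
        simp [stored, IsTop]
      · rw [Function.extend_apply' _ _ _ hqB, Function.extend_apply' _ _ _ hqB,
          vec_stored_of_ne hqA hqB, add_zero]) _ _ v hv
  have eqA : c₃ ∘ row (siteC (side N false) qaC) j = xA := funext hxA
  have eqB : c₃ ∘ row (siteC (side N true) qbC) k = xB := funext hxB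
  rw [eqA, eqB] at hK
  refine ⟨v ∘ eA, v ∘ eB, hK, fun l => ?_, fun l => ?_⟩
  · change postA (fun x => c₄ ((j, false), .qa x)) (fun l => c₄ ((j, false), .res l)) l = _
    congr 1
    · ext x
      rw [← hxA]
      refine hc₄ _ ?_
      rintro ⟨s, l⟩ h
      have h' : LBit.qa x = LBit.res l := congrArg Prod.snd h
      cases h'
    · ext l
      exact (hm ((j, false), l)).symm
  · change postB (fun x => c₄ ((k, true), .qb x)) (fun l => c₄ ((k, true), .res l)) l = _
    congr 1
    · ext x
      rw [← hxB]
      refine hc₄ _ ?_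
      rintro ⟨s, l⟩ h
      have h' : LBit.qb x = LBit.res l := congrArg Prod.snd h
      cases h'
    · ext l
      exact (hm ((k, true), l)).symm

lemma sum_sites (b : Bool) (P : Fin N → Prop) [DecidablePred P] (S : Finset (Fin N))
    (hS : ∀ m, m ∈ S ↔ P m) (u : Fin w → Bit) (f : Site N → Fin w → Bit) :
    ∑ s : Site N, ∑ l, (if s.2 = b ∧ P s.1 then 1 else 0) * u l * f s l =
      u ⬝ᵥ fun l => ∑ m ∈ S, f (m, b) l := by
  have e : S = Finset.univ.filter P := by ext m; simp [hS]
  rw [e, dotProduct, Finset.sum_comm]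
  refine Finset.sum_congr rfl fun l _ => ?_
  rw [Finset.sum_filter, Finset.mul_sum, Fintype.sum_prod_type]
  refine Finset.sum_congr rfl fun m _ => ?_
  rw [Finset.sum_eq_single b]
  · by_cases h : P m <;> simp [h]
  · intro b' _ hb; simp [hb]
  · simp

lemma device_success {n : ℕ} (hw : 3 ≤ w) (encA : Option (Constraint n) ↪ (Fin lA → Bit))
    (encB : Option (Variable n) ↪ (Fin lB → Bit)) (hA : VA (encA none) = 1)
    (hB : VB (encB none) = 1) (I : Instance n N)
    (hwin : ∀ vA vB, ((VA (encA (some I.2.1))).1 * (VB (encB (some I.2.bob))).1ᵀ) vA vB ≠ 0 →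
      I.2.Wins (fun l => postA (encA (some I.2.1)) vA (Fin.castLE hw l))
        (postB (encB (some I.2.bob)) vB (Fin.castLE hw 0))) :
    (device N hw VA VB postA postB).success encA encB I = 1 := by
  obtain ⟨⟨⟨j, k⟩, hjk⟩, q⟩ := I
  have hjk : j < k := hjk
  refine Protocol.success_eq_one _ encA encB _ (fun c ψ => ψ ≠ 0 → ∃ vA vB,
    ((VA (encA (some q.1))).1 * (VB (encB (some q.bob))).1ᵀ) vA vB ≠ 0 ∧
      (∀ l, c ((j, false), .res l) = postA (encA (some q.1)) vA l) ∧
      (∀ l, c ((k, true), .res l) = postB (encB (some q.bob)) vB l)) ?_ ?_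
  · refine Branches.circuit (I := fun c ψ =>
      (∀ i l, c ((i, false), .qa l) = encA (if i = j then some q.1 else none) l) ∧
      (∀ i l, c ((i, true), .qb l) = encB (if i = k then some q.bob else none) l) ∧
      ∀ u, Stab ψ (vec (stored j k) u) 0 (u ⬝ᵥ fun l => c ((j, false), .sx l)) ∧
        Stab ψ 0 (vec (stored j k) u) (u ⬝ᵥ fun l => c ((j, false), .sz l))) 
      (Branches.map (I := fun c ψ => ∀ u, Stab ψ (vec (stored j k) u) 0
          (u ⬝ᵥ fun l => ∑ m ∈ Finset.Ioc j k, c ((m, false), .syn l)) ∧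
        Stab ψ 0 (vec (stored j k) u)
          (u ⬝ᵥ fun l => ∑ m ∈ Finset.Ico j k, c ((m, true), .syn l)))
        (Branches.circuit (Branches.init _) _ ?_) _ ?_) _ ?_
    · rintro c ψ c' ψ' ⟨rfl, rfl⟩ h u
      have := circuit₁_step hjk k.2 ?_ h u
      · rw [sum_sites false (fun m => j.1 < m.1 ∧ m.1 ≤ k.1) (Finset.Ioc j k)
            (fun _ => Finset.mem_Ioc),
          sum_sites true (fun m => j.1 ≤ m.1 ∧ m.1 < k.1) (Finset.Ico j k)
            (fun _ => Finset.mem_Ico)] at this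
        exact this
      · rintro ⟨i, s⟩
        cases s
        · refine (inj₁.injective.extend_apply _ _ (.inl i)).trans ?_
          simp [input₁, IsTop, Fin.val_inj]
        · refine (inj₁.injective.extend_apply _ _ (.inr i)).trans ?_
          simp [input₁, IsTop, Fin.val_inj]
    · intro c ψ h
      refine ⟨fun i l => ?_, fun i l => ?_, fun u => ?_⟩
      · exact inj₂.injective.extend_apply _ _ (.inl (i, .inr l))
      · exact inj₂.injective.extend_apply _ _ (.inr (i, l))
      · convert h u using 3
        · ext l
          refine (inj₂.injective.extend_apply _ _ (.inl (j, .inl (.inl l)))).trans ?_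
          exact if_pos rfl
        · ext l
          refine (inj₂.injective.extend_apply _ _ (.inl (j, .inl (.inr l)))).trans ?_
          exact if_pos rfl
    · rintro c ψ c' ψ' ⟨h1, h2, h3⟩ h hne
      refine circuit₂_step (fun i => ?_) (fun i => ?_) (fun l => ?_) (fun l => ?_) h
        (fun u => (h3 u).1) (fun u => (h3 u).2) hne
      · rw [funext (h1 i)]
        split_ifs
        · rfl
        · exact hA
      · rw [funext (h2 i)]
        split_ifs
        · rfl
        · exact hB
      · rw [h1, if_pos rfl]
      · rw [h2, if_pos rfl]
  · intro c ψ h hlose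
    by_contra hne
    obtain ⟨vA, vB, hK, h1, h2⟩ := h hne
    apply hlose
    have := hwin vA vB hK
    simp only [← h1, ← h2] at this
    exact this

/-- The answers of the two players agree wherever the amplitude does not vanish. -/
lemma eq_of_mul_transpose_ne_zero {m : Type} [Fintype m] [DecidableEq m] {O V W : Matrix m m ℂ}
    {a b : m → Bit} (hO : Oᵀ = O) (hV : V * O = Matrix.diagonal (fun i => sgn (a i)) * V)
    (hW : W * O = Matrix.diagonal (fun i => sgn (b i)) * W) {i j : m} (h : (V * Wᵀ) i j ≠ 0) :
    a i = b j := by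
  -- Both sides are `V * O * Wᵀ`, by the symmetry of `O`. So `V * Wᵀ` intertwines the two diagonal
  -- matrices, and a nonzero entry forces equal signs.
  have e : Matrix.diagonal (fun i => sgn (a i)) * (V * Wᵀ) =
      (V * Wᵀ) * Matrix.diagonal (fun i => sgn (b i)) := by
    rw [← mul_assoc, ← hV, mul_assoc, mul_assoc]
    congr 1
    have := congrArg Matrix.transpose hW
    rwa [Matrix.transpose_mul, Matrix.transpose_mul, hO, Matrix.diagonal_transpose] at this
  have e' := congrFun (congrFun e i) j
  rw [Matrix.diagonal_mul, Matrix.mul_diagonal, mul_comm] at e'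
  have := mul_left_cancel₀ h e'
  rcases bit_cases (a i) with ha | ha <;> rcases bit_cases (b j) with hb | hb <;>
    rw [ha, hb] at this ⊢ <;> norm_num at this

end Teleport

/-- The measurement bases of the two players, and their answers. -/
lemma exists_bases {n : ℕ} (hn : 1 ≤ n) :
    ∃ (V : Constraint n → Matrix.unitaryGroup (Fin (Solution.width n) → Bit) ℂ)
      (a : Constraint n → Fin 3 → (Fin (Solution.width n) → Bit) → Bit)
      (W : Variable n → Matrix.unitaryGroup (Fin (Solution.width n) → Bit) ℂ)
      (b : Variable n → (Fin (Solution.width n) → Bit) → Bit),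
      ∀ (q : Question n) v v', ((V q.1).1 * (W q.bob).1ᵀ) v v' ≠ 0 →
        q.Wins (fun l => a q.1 l v) (b q.bob v') := by
  obtain ⟨O, hO, hO3⟩ := Solution.exists_operators hn
  have h1 : ∀ α : Constraint n, ∃ (V : Matrix.unitaryGroup (Fin (Solution.width n) → Bit) ℂ)
      (a : Fin 3 → (Fin (Solution.width n) → Bit) → Bit),
      (∀ s, V.1 * O (α.1.var s) = Matrix.diagonal (fun i => sgn (a s i)) * V.1) ∧
      ∀ v, ∑ s, a s v = α.1.rhs := by
    intro α
    obtain ⟨t0, d0, s0⟩ := hO (α.1.var 0)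
    obtain ⟨t1, d1, s1⟩ := hO (α.1.var 1)
    have e2 : O (α.1.var 2) = sgn α.1.rhs • (O (α.1.var 1) * O (α.1.var 0)) := by
      calc O (α.1.var 2) = O (α.1.var 1) * (O (α.1.var 0) * O (α.1.var 0)) * O (α.1.var 1) *
            O (α.1.var 2) := by rw [s0, mul_one, s1, one_mul]
        _ = O (α.1.var 1) * O (α.1.var 0) *
            (O (α.1.var 0) * O (α.1.var 1) * O (α.1.var 2)) := by simp only [mul_assoc]
        _ = _ := by rw [hO3, Matrix.mul_smul, mul_one]
    -- The third operator is plus or minus the product of the other two and is symmetric;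
    -- transposing reverses that product, so the two factors commute.
    have hc : O (α.1.var 0) * O (α.1.var 1) = O (α.1.var 1) * O (α.1.var 0) := by
      have t2 := (hO (α.1.var 2)).1
      rw [e2, Matrix.transpose_smul, Matrix.transpose_mul, t0, t1] at t2
      exact smul_right_injective _ (sgn_ne_zero _) t2
    obtain ⟨V, a₀, a₁, h0, h1⟩ := exists_diagonalize d0 d1 s0 s1 hc
    -- The third outcome is the one dictated by the constraint, so Alice's answers satisfy it for
    -- every basis state.
    refine ⟨V, ![a₀, a₁, fun i => α.1.rhs + a₀ i + a₁ i], fun s => ?_, fun v => ?_⟩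
    · fin_cases s
      · exact h0
      · exact h1
      · change V.1 * O (α.1.var 2) = Matrix.diagonal (fun i => sgn (α.1.rhs + a₀ i + a₁ i)) * V.1
        rw [e2, Matrix.mul_smul, ← mul_assoc, h1, mul_assoc, h0, ← mul_assoc,
          Matrix.diagonal_mul_diagonal, ← Matrix.smul_mul]
        congr 1
        ext i j
        simp only [Matrix.smul_apply, Matrix.diagonal_apply, sgn_add, smul_eq_mul]
        split_ifs <;> ring
    · rw [Fin.sum_univ_three]
      change a₀ v + a₁ v + (α.1.rhs + a₀ v + a₁ v) = _
      linear_combination bit_add_self (a₀ v) + bit_add_self (a₁ v)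
  have h2 : ∀ β : Variable n, ∃ (W : Matrix.unitaryGroup (Fin (Solution.width n) → Bit) ℂ)
      (b : (Fin (Solution.width n) → Bit) → Bit),
      W.1 * O β.1 = Matrix.diagonal (fun i => sgn (b i)) * W.1 := by
    intro β
    obtain ⟨-, d, s⟩ := hO β.1
    obtain ⟨V, a₀, -, h, -⟩ := exists_diagonalize d d s s rfl
    exact ⟨V, a₀, h⟩
  choose V a hV ha using h1
  choose W b hW using h2
  exact ⟨V, a, W, b, fun q v v' h =>
    ⟨ha _ _, Teleport.eq_of_mul_transpose_ne_zero (hO _).1 (hV q.1 q.2) (hW q.bob) h⟩⟩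

/-- A circuit of constant depth, local in one dimension, solves the relation problem. -/
theorem exists_constant_depth_device {n lA lB K : ℕ} (hn : 6 ≤ n)
    (encA : Option (Constraint n) ↪ (Fin lA → Bit)) (encB : Option (Variable n) ↪ (Fin lB → Bit))
    (hK : 4 * Solution.width n + 2 ≤ K) (hK' : max lA lB + Solution.width n ≤ K) :
    ∃ D s : ℕ, ∀ N : ℕ, 2 ≤ N → ∃ P : Protocol N (Solution.width n) lA lB,
      P.FanInLE K ∧ P.circ₁.length ≤ D ∧ P.circ₂.length ≤ D ∧ P.IsLocal1D s ∧
      P.UsesNonClifford ∧ ∀ I : Instance n N, P.success encA encB I = 1 := by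
  have hw : 3 ≤ Solution.width n := by
    unfold Solution.width; split_ifs <;> omega
  obtain ⟨V, a, W, b, h⟩ := exists_bases (n := n) (by omega)
  -- Seven layers in the first round and six in the second. Idle sites see the code of `none` and
  -- rotate by 1. Alice's answers occupy the first three of the `w` result bits; Bob writes his
  -- single answer to all of them.
  refine ⟨7, _, fun N hN => ⟨Teleport.device N hw
    (Function.extend encA (fun o => o.elim 1 V) 1) (Function.extend encB (fun o => o.elim 1 W) 1)
    (Function.extend encA (fun o => o.elim 0 fun α v l => if hl : l.1 < 3 then a α ⟨l.1, hl⟩ v else 0) 0)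
    (Function.extend encB (fun o => o.elim 0 fun β v _ => b β v) 0),
    fun g hg => (Teleport.fits_device hK (by omega) (by omega) g hg).1, le_refl 7, Nat.le_succ 6,
    Teleport.device_isLocal1D, Teleport.device_usesNonClifford (by omega), fun I => ?_⟩⟩
  refine Teleport.device_success hw encA encB ?_ ?_ I ?_
  · rw [encA.injective.extend_apply]; rfl
  · rw [encB.injective.extend_apply]; rfl
  · simp only [encA.injective.extend_apply, encB.injective.extend_apply, Option.elim_some]
    intro vA vB hne
    convert h I.2 vA vB hne using 2 with l
    simp

end
end MagicBCS

theorem theorem4 (n : ℕ) (hn : 6 ≤ n) (heven : Even n) :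
    -- the optimal winning probability of Clifford strategies is bounded away from one
    pClif n ≤ 1 - 1 / (2 * (Fintype.card (Question n) : ℝ)) ∧
    -- there is a relation problem, with `w` answer bits per site in the first round
    ∃ w : ℕ, (n = 8 → w = 3) ∧
      -- for every binary encoding of the questions
      ∀ (lA lB : ℕ) (encA : Option (Constraint n) ↪ (Fin lA → Bit))
        (encB : Option (Variable n) ↪ (Fin lB → Bit)),
      (∃ Kth : ℕ, (n = 8 → lA ≤ 11 → lB ≤ 11 → Kth ≤ 14) ∧ ∀ K : ℕ, Kth ≤ K →
        -- a constant-depth quantum circuit, local in one dimension, solves the problem perfectly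
        (∃ D s : ℕ, ∀ N : ℕ, 2 ≤ N → ∃ P : Protocol N w lA lB,
          P.FanInLE K ∧ P.circ₁.length ≤ D ∧ P.circ₂.length ≤ D ∧ P.IsLocal1D s ∧
          P.UsesNonClifford ∧ ∀ I : Instance n N, P.success encA encB I = 1) ∧
        -- a magic-free circuit of logarithmic depth solves the problem perfectly
        (∃ c : ℝ, ∀ N : ℕ, 2 ≤ N → ∃ P : Protocol N w lA lB,
          P.FanInLE K ∧ (P.circ₁.length : ℝ) ≤ c * Real.log N ∧
          (P.circ₂.length : ℝ) ≤ c * Real.log N ∧ P.MagicFree ∧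
          ∀ I : Instance n N, P.success encA encB I = 1)) ∧
      -- the success probability of probabilistic magic-free circuits
      (∀ K D N : ℕ, 1 ≤ K → 2 ≤ N → ∀ P : RandomProtocol N w lA lB,
        (∀ ω, (P.device ω).MagicFree ∧ (P.device ω).FanInLE K ∧
          (P.device ω).circ₂.length ≤ D) →
        P.avgSuccess encA encB ≤ pClif n + 48 * (K : ℝ) ^ D / N) ∧
      -- the logarithmic lower bound on the depth of probabilistic magic-free circuits
      (∀ K : ℕ, 1 ≤ K → ∃ c : ℝ, 0 < c ∧ ∃ N₀ : ℕ, ∀ N : ℕ, N₀ ≤ N → ∀ D : ℕ,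
        ∀ P : RandomProtocol N w lA lB,
        (∀ ω, (P.device ω).MagicFree ∧ (P.device ω).FanInLE K ∧
          (P.device ω).circ₂.length ≤ D) →
        (1 + pClif n) / 2 < P.avgSuccess encA encB → c * Real.log N ≤ D) := by
  have hw : 3 ≤ Solution.width n := by
    unfold Solution.width; split_ifs <;> omega
  refine ⟨pClif_le hn heven, Solution.width n, fun h => if_pos h, ?_⟩
  intro lA lB encA encB
  -- For `n = 8` and encodings of length at most 11 both arguments are at most 14. As the width is
  -- at least 3, the first one also covers the fan-in `max lA lB + 2` of the broadcasting device.
  refine ⟨⟨max (max lA lB + Solution.width n) (4 * Solution.width n + 2), ?_, fun K hK => ⟨?_, ?_⟩⟩,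
    fun K D N hK hN P hP => P.avgSuccess_le hK hN encA encB hP,
    fun K hK => exists_log_depth_lower_bound hn heven encA encB hK⟩
  · intro h8 hA hB
    have : Solution.width n = 3 := if_pos h8
    omega
  · exact exists_constant_depth_device hn encA encB (by omega) (by omega)
  · exact exists_log_depth_device hn encA encB (by omega)
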